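/- **Meshes.** A ringnet of valence $m$ is a planar (complex-valued) quadrilateral mesh with at most one extraordinary element, namely a central vertex of valence $m$ (primal ringnet, vertices $p_{ij}^l$, $i,j\ge 0$, with $p^l_{0j}=p^{l+1}_{j0}$) or a central face of valence $m$ (dual ringnet, vertices $p^l_{ij}$, $i,j\ge 1$), where $l\in\mathbb Z_m$ numbers the segments. The primal grid mesh of valence $m$ and frequency $1$ has the vertices $g^l_{ij}=i\,e^{\hat\imath 2\pi l/m}+j\,e^{\hat\imath 2\pi(l+1)/m}$; the dual one has the vertices $\frac14(g^l_{i-1,j-1}+g^l_{i,j-1}+g^l_{i-1,j}+g^l_{i,j})$. **Schemes.** The operator $A$ maps a mesh to the dual mesh formed by the face centers (averages of the corners), $R$ splits every face at its center, using the vertices, the edge midpoints and the face centers, and $V$ connects the midpoints of adjacent edges. A VAV-scheme is a product $U=U_1\cdots U_n$ with $U_i\in\{A,R,V^2,VAV,VA^2V,\dots\}$ that contains at least one $A$ or $V$ and at least one $V$ or $R$. Let $U$ map ringnets of one kind (primal or dual) to ringnets of the same kind. **Core and rings.** For a ringnet $\mathcal N$ of this kind, the core consists of all vertices that influence the central vertex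 (respectively all vertices of the central face) of $U^k\mathcal N$ for some $k\ge1$. For $\rho\ge 0$, the $c.\rho$-net consists of the core and the next $\rho$ rings of vertices around it, where the next ring around a set of vertices consists of the remaining vertices that share a face with a vertex of the set. Let $C$ and $S$ be the matrices of $U$ on the core and on $c.\rho$-nets. Let $B$ and $A$ (now matrices) be the diagonal blocks of the matrix of $U$ belonging to the first ring around the core without its convex corners, and to these convex corners (the vertices of that ring lying on exactly one face that has a core vertex). Their spectral radii are $\rho_B,\rho_A$. Let $\lambda_{2\pi/m}$ be the eigenvalue of $C$ belonging to the nonzero limit of the normalized iterates of the core of the grid mesh of frequency $1$, and let $\mu_0$ be the subdominant eigenvalue of $S$ of frequency $0$, i.e. one of largest modulus among the eigenvalues $\ne 1$ having an eigenvector invariant under $l\mapsto l+1$ ($|\mu_0|=0$ if there is none). **Lemma (a bound for $\nabla_2(\mathcal C)$).** Let $U$ be a VAV-scheme, let $\rho\ge0$, and let $m\ge 5$, or $m=3$ and $\lambda_{2\pi/3}>\max\{|\mu_0|,\rho_B,\rho_A\}$. Let $\mathcal M$ be the $c.\rho$-grid mesh of valence $m$ and frequency $1$ of the kind preserved by $U$,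 and let $\|\cdot\|$ be any norm on the real vector space of planar $c.\rho$-nets. Then the meshes $U^k\mathcal M/\|U^k\mathcal M\|$ converge as $k\to\infty$, and their limit $\mathcal C=[c_{ij}^l]$, the characteristic mesh of $U$, satisfies $$\nabla_2(\mathcal C)\subset \mathcal C\left(\tfrac{2\pi}{m},\tfrac{\pi}{2}\right).$$ Here $\nabla_2(\mathcal C)$ is the set of the $y$-edges $c^0_{i,j}-c^0_{i,j-1}$ of the $0$-th segment, with $i\ge0$, $j\ge1$ for a primal mesh; for a dual mesh $i,j\ge1$, where $c^0_{i,0}:=c^{-1}_{1,i}$, so that the edges crossing the spoke between the segments $-1$ and $0$ are included. Moreover $$\mathcal C(\alpha,\beta)=(0,\infty)\,e^{\hat\imath[\min(\alpha,\beta),\max(\alpha,\beta)]}$$ is the cone without its apex. That is, every $y$-edge of the $0$-th segment is non-zero and its direction lies between $e^{\hat\imath 2\pi/m}$ and $e^{\hat\imath\pi/2}$, these two directions included. -/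

import Mathlib

open Filter Topology

namespace MidpointSubdivision

/-! ## Ringnets

A ringnet of valence `m` is equivalent to a grid mesh: `m` quadrants (segments) glued cyclically
around a centre.  All lattices below live on one complex in *doubled* coordinates: in segment `l`
the point `(x, y)`, with `x, y ≥ 0`, stands for the grid position
`(x / 2) * e ^ (2 π i l / m) + (y / 2) * e ^ (2 π i (l + 1) / m)`.  The point `(0, y)` of segment
`l` is the point `(y, 0)` of segment `l + 1`, and all `(0, 0)` are the centre. -/

/-- The points of the complex, each written in exactly one way: the centre, or the point of
segment `l` with doubled coordinates `(a + 1, b)`. -/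
inductive Site (m : ℕ) where
  | center : Site m
  | pt (l : ZMod m) (a b : ℕ) : Site m
deriving DecidableEq

/-- The point with doubled coordinates `(x, y)` with respect to segment `l`.  Coordinates
`x < 0 < y` reach into segment `l + 1` and `y < 0 ≤ x` into segment `l - 1`.
(The remaining case `x < 0`, `y ≤ 0` is never used.) -/
def Site.mk {m : ℕ} (l : ZMod m) (x y : ℤ) : Site m :=
  if 0 < x ∧ 0 ≤ y then .pt l (x - 1).toNat y.toNat
  else if x ≤ 0 ∧ 0 < y then .pt (l + 1) (y - 1).toNat (-x).toNat
  else if 0 ≤ x ∧ y < 0 then .pt (l - 1) (-y - 1).toNat x.toNat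
  else .center

/-- Rotation of the complex by one segment. -/
def Site.rotate {m : ℕ} : Site m → Site m
  | .center => .center
  | .pt l a b => .pt (l + 1) a b

/-- The position of a point in the grid mesh of valence `m` and frequency `1`. -/
noncomputable def Site.pos {m : ℕ} : Site m → ℂ
  | .center => 0
  | .pt l a b =>
      (((a : ℂ) + 1) / 2) * Complex.exp (2 * Real.pi * Complex.I * l.val / m) +
        ((b : ℂ) / 2) * Complex.exp (2 * Real.pi * Complex.I * (l.val + 1) / m)

/-- The combinatorial type of a quadrilateral ringnet.  A `primal` net has vertices at the
positions `(2 i, 2 j)` and its extraordinary element is the central vertex; a `dual` net has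
vertices at the positions `(2 i - 1, 2 j - 1)` and an extraordinary central face.  The operator
`V` turns the lattice by 45 degrees: the `rotPrimal` net has vertices `(x, y)` with `x + y` even,
the `rotDual` net those with `x + y` odd, and edges join points that differ by `(± 1, ± 1)`. -/
inductive Kind where
  | primal | dual | rotPrimal | rotDual
deriving DecidableEq

/-- The kind of the dual mesh, whose vertices are the face centres. -/
def Kind.swap : Kind → Kind
  | .primal => .dual
  | .dual => .primal
  | .rotPrimal => .rotDual
  | .rotDual => .rotPrimal

/-- The condition on doubled coordinates for being a vertex of a mesh of the given kind. -/
def Kind.parity : Kind → ℕ → ℕ → Prop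
  | .primal, x, y => x % 2 = 0 ∧ y % 2 = 0
  | .dual, x, y => x % 2 = 1 ∧ y % 2 = 1
  | .rotPrimal, x, y => (x + y) % 2 = 0
  | .rotDual, x, y => (x + y) % 2 = 1

instance (κ : Kind) (x y : ℕ) : Decidable (κ.parity x y) := by
  cases κ <;> unfold Kind.parity <;> infer_instance

/-- `s` is a vertex of the meshes of kind `κ`.  The faces of these meshes are centred at the
vertices of kind `κ.swap`. -/
def IsVertex {m : ℕ} (κ : Kind) : Site m → Prop
  | .center => κ.parity 0 0
  | .pt _ a b => κ.parity (a + 1) b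

instance {m : ℕ} (κ : Kind) (s : Site m) : Decidable (IsVertex κ s) := by
  cases s <;> unfold IsVertex <;> infer_instance

/-- The point `s` and the points that differ from it by at most one in both doubled coordinates. -/
def nbhd {m : ℕ} [NeZero m] : Site m → Finset (Site m)
  | .center => {.center} ∪ Finset.univ.image (fun l : ZMod m => Site.mk l 1 0) ∪
      Finset.univ.image (fun l : ZMod m => Site.mk l 1 1)
  | .pt l a b => (({-1, 0, 1} : Finset ℤ) ×ˢ ({-1, 0, 1} : Finset ℤ)).image
      (fun d => Site.mk l ((a : ℤ) + 1 + d.1) ((b : ℤ) + d.2))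

/-- The vertices of kind `κ` in `nbhd s`.  If `s` is a face centre these are the corners of the
face.  For `κ` primal or dual: if `s` is an edge midpoint these are the two end points of the
edge, and if `s` is a vertex this is `{s}`. -/
def corners {m : ℕ} [NeZero m] (κ : Kind) (s : Site m) : Finset (Site m) :=
  (nbhd s).filter (IsVertex κ)

/-! ## The operators `A`, `R`, `V` -/

/-- A net assigns a complex number (a point of the plane) to every vertex; only the values at the
vertices of the relevant kind matter. -/
abbrev Net (m : ℕ) := Site m → ℂ

/-- The arithmetic mean of the values of a net over a finite set of vertices. -/
noncomputable def mean {m : ℕ} (T : Finset (Site m)) : Net m →ₗ[ℂ] ℂ :=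
  ((T.card : ℂ)⁻¹) • ∑ t ∈ T, (LinearMap.proj t : Net m →ₗ[ℂ] ℂ)

/-- The net of kind `κ'` whose value at a vertex `s` is the mean of the old net over `T s`. -/
noncomputable def meanNet {m : ℕ} (κ' : Kind) (T : Site m → Finset (Site m)) :
    Net m →ₗ[ℂ] Net m :=
  LinearMap.pi (fun s => if IsVertex κ' s then mean (T s) else 0)

/-- The averaging operator `A` on nets of kind `κ`: a new vertex at every face centre. -/
noncomputable def opA {m : ℕ} [NeZero m] (κ : Kind) : Net m →ₗ[ℂ] Net m :=
  meanNet κ.swap (corners κ)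

/-- Half of a vertex of a primal net (even doubled coordinates). -/
def half {m : ℕ} : Site m → Site m
  | .center => .center
  | .pt l a b => Site.mk l (((a + 1) / 2 : ℕ) : ℤ) ((b / 2 : ℕ) : ℤ)

/-- The refinement operator `R` on primal or dual nets: the vertices, edge midpoints and face
centres of the old net become the vertices of a primal net (on the lattice scaled by two). -/
noncomputable def opR {m : ℕ} [NeZero m] (κ : Kind) : Net m →ₗ[ℂ] Net m :=
  meanNet .primal (fun s => corners κ (half s))

/-- The mid-edge operator `V` on primal or dual nets: a new vertex at every edge midpoint. -/
noncomputable def opV {m : ℕ} [NeZero m] (κ : Kind) : Net m →ₗ[ℂ] Net m :=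
  meanNet .rotDual (corners κ)

/-- The end points of the edge of a net of a rotated kind `κ` with midpoint
`(x + 1/2, y + 1/2)`; the edge is named by the point `(2 x + 1, 2 y + 1)`. -/
def rotEdge {m : ℕ} (κ : Kind) : Site m → Finset (Site m)
  | .center => ∅
  | .pt l a b =>
      ((({0, 1} : Finset ℤ) ×ˢ ({0, 1} : Finset ℤ)).image
        (fun d => Site.mk l (((a / 2 : ℕ) : ℤ) + d.1) (((b / 2 : ℕ) : ℤ) + d.2))).filter
        (IsVertex κ)

/-- The mid-edge operator `V` on nets of a rotated kind: the edge midpoints become the vertices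
of a dual net (on the lattice scaled by two). -/
noncomputable def opVRot {m : ℕ} (κ : Kind) : Net m →ₗ[ℂ] Net m :=
  meanNet .dual (rotEdge κ)

/-! ## VAV-schemes -/

/-- The factors of a VAV-scheme: `A`, `R`, and `V A ^ l V` with `l ≥ 0`. -/
inductive Factor where
  | A : Factor
  | R : Factor
  | VAV (l : ℕ) : Factor

/-- The numbers of operators `A`, `V` and `R` in a factor. -/
def Factor.numA : Factor → ℕ
  | .A => 1
  | .R => 0
  | .VAV l => l

def Factor.numV : Factor → ℕ
  | .A => 0
  | .R => 0
  | .VAV _ => 2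

def Factor.numR : Factor → ℕ
  | .A => 0
  | .R => 1
  | .VAV _ => 0

/-- The kind of the subdivided net. -/
def Factor.out : Factor → Kind → Kind
  | .A, κ => κ.swap
  | .R, _ => .primal
  | .VAV _, _ => .dual

/-- `A ^ l` on nets of kind `κ`. -/
noncomputable def opApow {m : ℕ} [NeZero m] : ℕ → Kind → (Net m →ₗ[ℂ] Net m)
  | 0, _ => LinearMap.id
  | l + 1, κ => opApow l κ.swap ∘ₗ opA κ

/-- The action of a factor on nets of kind `κ` (primal or dual). -/
noncomputable def Factor.op {m : ℕ} [NeZero m] : Factor → Kind → (Net m →ₗ[ℂ] Net m)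
  | .A, κ => opA κ
  | .R, κ => opR κ
  | .VAV l, κ => opVRot (Kind.swap^[l] .rotDual) ∘ₗ opApow l .rotDual ∘ₗ opV κ

/-- A word `[U₁, …, Uₙ]` of factors, read as the product `U₁ ⋯ Uₙ` (so `Uₙ` acts first). -/
abbrev Word := List Factor

/-- A word is a VAV-scheme if it contains at least one `A` or `V` and at least one `V` or `R`. -/
def IsVAVScheme (U : Word) : Prop :=
  1 ≤ (U.map Factor.numA).sum + (U.map Factor.numV).sum ∧
  1 ≤ (U.map Factor.numV).sum + (U.map Factor.numR).sum

/-- The kind of `U N` for a net `N` of kind `κ`. -/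
def Word.out : Word → Kind → Kind
  | [], κ => κ
  | F :: U, κ => F.out (Word.out U κ)

/-- The operator `U` on nets of kind `κ`. -/
noncomputable def Word.op {m : ℕ} [NeZero m] : Word → Kind → Module.End ℂ (Net m)
  | [], _ => LinearMap.id
  | F :: U, κ => F.op (Word.out U κ) ∘ₗ Word.op U κ

/-! ## Core, rings, and the subdivision matrix -/

/-- The vertices of the extraordinary element of a net of kind `κ`. -/
def innermost {m : ℕ} [NeZero m] (κ : Kind) : Finset (Site m) := corners κ .center

/-- The core: all vertices that influence the extraordinary element of `U ^ k N` for some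
`k ≥ 1`. -/
def core (m : ℕ) [NeZero m] (U : Word) (κ : Kind) : Set (Site m) :=
  {s | IsVertex κ s ∧ ∃ k : ℕ, 1 ≤ k ∧
    ∀ t ∈ innermost κ, (Word.op U κ ^ k) (Pi.single s 1) t ≠ 0}

/-- A set of vertices together with the next ring of vertices: all vertices that lie on a common
face with a vertex of the set. -/
def addRing {m : ℕ} [NeZero m] (κ : Kind) (X : Set (Site m)) : Set (Site m) :=
  X ∪ {t | ∃ f : Site m, IsVertex κ.swap f ∧ t ∈ corners κ f ∧ ∃ s ∈ X, s ∈ corners κ f}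

/-- The vertices of a `c.ρ`-net: the core and the next `ρ` rings around it. -/
def coreNet (m : ℕ) [NeZero m] (U : Word) (κ : Kind) (ρ : ℕ) : Set (Site m) :=
  (addRing κ)^[ρ] (core m U κ)

/-- The convex corners of the first ring around the core: the vertices of this ring that lie on
exactly one face having a vertex in the core. -/
def convexCorners (m : ℕ) [NeZero m] (U : Word) (κ : Kind) : Set (Site m) :=
  {t | t ∈ coreNet m U κ 1 \ core m U κ ∧
    ∃! f : Site m, IsVertex κ.swap f ∧ t ∈ corners κ f ∧ ∃ s ∈ core m U κ, s ∈ corners κ f}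

/-- The other vertices of the first ring around the core. -/
def nonCorners (m : ℕ) [NeZero m] (U : Word) (κ : Kind) : Set (Site m) :=
  (coreNet m U κ 1 \ core m U κ) \ convexCorners m U κ

open Classical in
/-- Extension of a function on `X` by zero. -/
noncomputable def extendZero {m : ℕ} (X : Set (Site m)) : (X → ℂ) →ₗ[ℂ] Net m :=
  LinearMap.pi (fun s => if h : s ∈ X then LinearMap.proj (⟨s, h⟩ : X) else 0)

/-- The diagonal block, with index set `X`, of the matrix of `U`. -/
noncomputable def block {m : ℕ} [NeZero m] (U : Word) (κ : Kind) (X : Set (Site m)) :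
    Module.End ℂ (X → ℂ) :=
  LinearMap.funLeft ℂ ℂ (Subtype.val : X → Site m) ∘ₗ Word.op U κ ∘ₗ extendZero X

/-! ## The characteristic mesh -/

/-- The grid mesh of valence `m` and frequency `1`. -/
noncomputable def gridMesh (m : ℕ) : Net m := Site.pos

/-- `U ^ k M`, restricted to the vertices in `X`, where `M` is the grid mesh of frequency `1`. -/
noncomputable def gridIterate {m : ℕ} [NeZero m] (U : Word) (κ : Kind) (X : Set (Site m)) (k : ℕ) :
    X → ℂ :=
  fun s => (Word.op U κ ^ k) (gridMesh m) s

/-- The normalized meshes `U ^ k M / ‖U ^ k M‖`, restricted to the vertices in `X`, converge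
to `C`; here `‖ ‖ = ν`. -/
def IsNormalizedLimit {m : ℕ} [NeZero m] (U : Word) (κ : Kind) (X : Set (Site m))
    (ν : Seminorm ℝ (X → ℂ)) (C : X → ℂ) : Prop :=
  Tendsto (fun k : ℕ => (ν (gridIterate U κ X k))⁻¹ • gridIterate U κ X k) atTop (𝓝 C)

/-- `C` is the characteristic mesh of `U`, on the `c.ρ`-net, with respect to the norm `ν`. -/
def IsCharacteristicMesh {m : ℕ} [NeZero m] (U : Word) (κ : Kind) (ρ : ℕ)
    (ν : Seminorm ℝ (coreNet m U κ ρ → ℂ)) (C : coreNet m U κ ρ → ℂ) : Prop :=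
  IsNormalizedLimit U κ (coreNet m U κ ρ) ν C

/-- `l` is the eigenvalue `λ_{2π/m}` belonging to the limit of the normalized core meshes
(the choice of the norm has no effect on it). -/
def IsGridEigenvalue (m : ℕ) [NeZero m] (U : Word) (κ : Kind) (l : ℝ) : Prop :=
  ∃ (ν : Seminorm ℝ (core m U κ → ℂ)) (C : core m U κ → ℂ),
    (∀ x, ν x = 0 → x = 0) ∧ IsNormalizedLimit U κ (core m U κ) ν C ∧ C ≠ 0 ∧
    block U κ (core m U κ) C = (l : ℂ) • C

/-- The modulus `|μ₀|` of the subdominant eigenvalue of frequency `0` of the subdivision matrix on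
`c.ρ`-nets, the dominant one being the simple eigenvalue `1`. -/
noncomputable def absMuZero (m : ℕ) [NeZero m] (U : Word) (κ : Kind) (ρ : ℕ) : ENNReal :=
  ⨆ z ∈ {z : ℂ | z ≠ 1 ∧ ∃ x : coreNet m U κ ρ → ℂ, x ≠ 0 ∧
      (∀ s t : coreNet m U κ ρ, (t : Site m) = (s : Site m).rotate → x t = x s) ∧
      block U κ (coreNet m U κ ρ) x = z • x}, ENNReal.ofReal ‖z‖

/-- The inequality `λ_{2π/m} > max {|μ₀|, ρ_B, ρ_A}`. -/
def EigenvalueInequality (m : ℕ) [NeZero m] (U : Word) (κ : Kind) (ρ : ℕ) : Prop :=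
  ∃ l : ℝ, IsGridEigenvalue m U κ l ∧
    max (absMuZero m U κ ρ)
      (max (spectralRadius ℂ (block U κ (nonCorners m U κ)))
        (spectralRadius ℂ (block U κ (convexCorners m U κ)))) < ENNReal.ofReal l

/-! ## Edges and cones -/

/-- The unpointed cone `(0, ∞) e ^ (i [min (α, β), max (α, β)])`. -/
def cone (α β : ℝ) : Set ℂ :=
  {z | ∃ r : ℝ, 0 < r ∧ ∃ θ ∈ Set.Icc (min α β) (max α β), z = r * Complex.exp (θ * Complex.I)}

/-- The `y`-edges `c_{i,j} - c_{i,j-1}` of the `0`-th segment of a mesh of kind `κ` with vertex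
set `X`.  In a primal mesh `(x, y) = (2 i, 2 j)` with `i ≥ 0`, `j ≥ 1`; in a dual mesh
`(x, y) = (2 i - 1, 2 j - 1)` with `i, j ≥ 1`, and the edges with `j = 1` cross the spoke between
the segments `-1` and `0`. -/
def nablaTwo {m : ℕ} (κ : Kind) (X : Set (Site m)) (C : X → ℂ) : Set ℂ :=
  {z | ∃ x y : ℤ, 0 ≤ x ∧ 0 < y ∧ IsVertex κ (Site.mk (0 : ZMod m) x y) ∧
    ∃ (hp : Site.mk (0 : ZMod m) x y ∈ X) (hq : Site.mk (0 : ZMod m) x (y - 2) ∈ X),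
      z = C ⟨_, hp⟩ - C ⟨_, hq⟩}

end MidpointSubdivision

/-!
The scheme is a product of elementary steps (`Step`), each of which replaces every vertex by the
mean of old vertices. In the chart of a segment this is always the mean of the same four points
(`Step.op_mk`), and on the spokes the symmetry of the mesh turns these means into projections.
The meshes `U ^ k M` that arise from the grid mesh have the symmetries `IsSym ω` with
`ω = e ^ (2 π i / m)`: the rotation by a segment acts as multiplication by `ω`, the reflection as
complex conjugation. The proof follows edges, vertices, and the influence of the vertices outside
the core.

*Edges.* Up to the scale of the grid, a new `y`-edge is a mean of old `y`-edges, of their imaginary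
parts (at the spoke `y = 0`) and of their projections to the direction `ω` (at the other spoke).
The closed convex cone between `ω` and `i` is stable under these operations, hence it contains all
`y`-edges of all `U ^ k M`, and of any limit (`Adm`, `adm_edgeCone`, `Adm.hasEdges_run`). Nets of
frequency `0` have the symmetries `IsSym 1`; for them discs are stable, so their edges shrink like
the powers of the contraction factor `σ = totalScale` of the scheme. Nets of frequency `0` that
vanish at the centre are therefore `O(σ ^ k)`, and this applies to the net that is `0` on the core
and `1` outside (`norm_quad_run_le`, `IsCore.exists_norm_run_outer_le`).

*Vertices.* In a fundamental domain of the symmetry group, the vertices stay in a wedge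
(`Bisects.inWedge_run`), and every vertex of the core depends on every other one
(`IsCore.exists_common_reach`). So the scheme acts on the symmetric nets over the core as a positive
map whose power compresses the cone of such nets (`IsCore.positiveMap`), and the
contraction argument of Birkhoff gives a growth rate `λ` and the convergence of `λ ^ (-k) U ^ k M`
on the core to a limit inside the wedge (`PositiveMap.exists_growth`, `IsCore.exists_limit`).

*Convergence outside the core.* It remains to compare the influence of the outer vertices with
`λ ^ k`. For `m ≥ 5` the spokes `0` and `1` form an acute angle. Then a step moves the grid mesh
outwards compared to its scaled copy (`run_gridMesh_sub`), whence `σ < λ`. For `m = 3` the rate `λ`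
is the eigenvalue in the hypothesis (`eq_of_isGridEigenvalue`), and on functions of frequency `0`
that vanish on the core the eigenvalues of the subdivision matrix have modulus at most `|μ₀| < λ`
(the eigenvalue `1` is excluded since such functions decay like `σ ^ k`), so that Gelfand's formula
applies (`IsCore.decays_of_eigenvalues`). In both cases `λ ^ (-k) U ^ k M` converges on the whole
`c.ρ`-net (`Decays.exists_limit`).

*The limit.* Its edges lie in the closed cone. They are non-zero, and have positive imaginary part:
the edge next to the centre has this property because the limit of the vertex next to the centre
is inside the wedge (`exists_tendsto_centralEdge`), and every other edge depends on it after some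
repetitions of the scheme (`edgePath_eq_central`, `Adm.exists_le_edge`).
-/

/-! ### Charts, rotation and reflection of the complex -/

namespace MidpointSubdivision

variable {m : ℕ}

theorem Site.mk_of_pos (l : ZMod m) {x y : ℤ} (hx : 0 < x) (hy : 0 ≤ y) :
    Site.mk l x y = .pt l (x - 1).toNat y.toNat := by
  simp [Site.mk, hx, hy]

theorem Site.mk_of_nonpos (l : ZMod m) {x y : ℤ} (hx : x ≤ 0) (hy : 0 < y) :
    Site.mk l x y = .pt (l + 1) (y - 1).toNat (-x).toNat := by
  have h : ¬ (0 < x ∧ 0 ≤ y) := by omega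
  simp only [Site.mk, if_neg h, if_pos (And.intro hx hy)]

theorem Site.mk_of_neg (l : ZMod m) {x y : ℤ} (hx : 0 ≤ x) (hy : y < 0) :
    Site.mk l x y = .pt (l - 1) (-y - 1).toNat x.toNat := by
  have h : ¬ (0 < x ∧ 0 ≤ y) := by omega
  have h' : ¬ (x ≤ 0 ∧ 0 < y) := by omega
  simp only [Site.mk, if_neg h, if_neg h', if_pos (And.intro hx hy)]

@[simp] theorem Site.mk_zero_zero (l : ZMod m) : Site.mk l 0 0 = .center := by
  simp [Site.mk]

theorem Site.pt_eq_mk (l : ZMod m) (a b : ℕ) : Site.pt l a b = Site.mk l (a + 1) b := by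
  rw [Site.mk_of_pos l (by omega) (by omega)]
  congr 1
  omega

/-- Every point other than the centre lies in a quadrant `x ≥ 1`, `y ≥ 0`. -/
theorem Site.exists_mk (s : Site m) :
    s = .center ∨ ∃ (l : ZMod m) (x y : ℤ), 1 ≤ x ∧ 0 ≤ y ∧ s = Site.mk l x y := by
  cases s with
  | center => exact Or.inl rfl
  | pt l a b => exact Or.inr ⟨l, a + 1, b, by omega, by omega, Site.pt_eq_mk l a b⟩

theorem Site.mk_ne_center (l : ZMod m) {x y : ℤ} (h : 0 ≤ x) (h' : x ≠ 0 ∨ y ≠ 0) :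
    Site.mk l x y ≠ .center := by
  rcases lt_trichotomy y 0 with hy | hy | hy
  · rw [Site.mk_of_neg l h hy]; simp
  · rw [Site.mk_of_pos l (by omega) (by omega)]; simp
  · by_cases hx : 0 < x
    · rw [Site.mk_of_pos l hx (by omega)]; simp
    · rw [Site.mk_of_nonpos l (by omega) hy]; simp

/-- The change of charts between the two segments at a spoke: both charts cover the quadrant
`x, y ≥ 0`, and differ by a quarter turn. -/
theorem Site.mk_eq_mk_succ (l : ZMod m) {x y : ℤ} (hx : 0 ≤ x) (hy : 0 ≤ y) :
    Site.mk l x y = Site.mk (l + 1) y (-x) := by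
  rcases hx.eq_or_lt with rfl | hx
  · rcases hy.eq_or_lt with rfl | hy
    · simp
    · rw [Site.mk_of_nonpos l le_rfl hy, Site.mk_of_pos _ hy (by omega)]
  · rw [Site.mk_of_pos l hx hy, Site.mk_of_neg _ hy (by omega)]
    simp

theorem Site.mk_eq_mk_pred (l : ZMod m) {x y : ℤ} (hx : 0 ≤ x) (hy : y ≤ 0) :
    Site.mk l x y = Site.mk (l - 1) (-y) x := by
  rw [Site.mk_eq_mk_succ (l - 1) (by omega) hx]
  simp

theorem Site.rotate_mk (l : ZMod m) (x y : ℤ) :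
    (Site.mk l x y).rotate = Site.mk (l + 1) x y := by
  unfold Site.mk
  split_ifs <;> simp [Site.rotate]

/-- Reflection of the complex at the spoke between the segments `-1` and `0`, the counterpart of
complex conjugation. -/
def Site.reflect : Site m → Site m
  | .center => .center
  | .pt l a b => Site.mk (-l) ((a : ℤ) + 1) (-(b : ℤ))

theorem Site.reflect_mk (l : ZMod m) {x : ℤ} (hx : 0 ≤ x) (y : ℤ) :
    (Site.mk l x y).reflect = Site.mk (-l) x (-y) := by
  rcases lt_trichotomy y 0 with hy | rfl | hy
  · rw [Site.mk_of_neg l hx hy]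
    show Site.mk (-(l - 1)) _ _ = _
    have h1 : (((-y - 1).toNat : ℕ) : ℤ) + 1 = -y := by omega
    have h2 : -((x.toNat : ℕ) : ℤ) = -x := by omega
    rw [h1, h2, Site.mk_eq_mk_succ (-l) hx (by omega)]
    congr 1
    ring
  · rcases hx.eq_or_lt with rfl | hx
    · simp [Site.reflect]
    · rw [Site.mk_of_pos l hx le_rfl]
      show Site.mk (-l) _ _ = _
      have h1 : (((x - 1).toNat : ℕ) : ℤ) + 1 = x := by omega
      rw [h1]; simp
  · rcases hx.eq_or_lt with rfl | hx
    · rw [Site.mk_of_nonpos l le_rfl hy]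
      show Site.mk (-(l + 1)) _ _ = _
      have h1 : (((y - 1).toNat : ℕ) : ℤ) + 1 = y := by omega
      rw [h1, Site.mk_eq_mk_pred (-l) le_rfl (by omega : -y ≤ 0)]
      simp only [neg_neg, neg_zero, Int.toNat_zero, Nat.cast_zero]
      congr 1
      ring
    · rw [Site.mk_of_pos l hx hy.le]
      show Site.mk (-l) _ _ = _
      have h1 : (((x - 1).toNat : ℕ) : ℤ) + 1 = x := by omega
      have h2 : ((y.toNat : ℕ) : ℤ) = y := by omega
      rw [h1, h2]

theorem Site.reflect_mk_swap (l : ZMod m) {x y : ℤ} (hx : 0 ≤ x) (hy : 0 ≤ y) :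
    (Site.mk l x y).reflect = Site.mk (-l - 1) y x := by
  rw [Site.reflect_mk l hx, Site.mk_eq_mk_pred (-l) hx (by omega), neg_neg]

@[simp] theorem Site.reflect_reflect (s : Site m) : s.reflect.reflect = s := by
  rcases s.exists_mk with rfl | ⟨l, x, y, hx, hy, rfl⟩
  · rfl
  · rw [Site.reflect_mk l (by omega), Site.reflect_mk (-l) (by omega), neg_neg, neg_neg]

theorem Site.reflect_injective : Function.Injective (Site.reflect (m := m)) :=
  (Function.LeftInverse.injective (g := Site.reflect) Site.reflect_reflect)

theorem Site.rotate_injective : Function.Injective (Site.rotate (m := m)) := by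
  intro s t h
  cases s <;> cases t <;> simp_all [Site.rotate]

/-- The inverse of `Site.rotate`. -/
def Site.unrotate : Site m → Site m
  | .center => .center
  | .pt l a b => .pt (l - 1) a b

@[simp] theorem Site.rotate_unrotate (s : Site m) : s.unrotate.rotate = s := by
  cases s <;> simp [Site.rotate, Site.unrotate]

/-- In one half plane the coordinates determine the point; valences below `3` would identify
points on the two bounding spokes. -/
theorem Site.mk_inj (hm : 3 ≤ m) (l : ZMod m) {x y x' y' : ℤ} (hx : 0 ≤ x) (hx' : 0 ≤ x')
    (h : Site.mk l x y = Site.mk l x' y') : x = x' ∧ y = y' := by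
  have h2 : (2 : ZMod m) ≠ 0 := by
    intro h
    have h' : ((2 : ℕ) : ZMod m) = 0 := by exact_mod_cast h
    rw [ZMod.natCast_eq_zero_iff] at h'
    exact absurd (Nat.le_of_dvd (by norm_num) h') (by omega)
  have h1 : (1 : ZMod m) ≠ 0 := by
    intro h
    apply h2
    rw [← one_add_one_eq_two, h, add_zero]
  have e1 : l + 1 ≠ l := by simpa using h1
  have e2 : l - 1 ≠ l := by simpa using h1
  have e3 : l + 1 ≠ l - 1 := by
    intro h
    apply h2
    have : (l + 1) - (l - 1) = 0 := by rw [h, sub_self]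
    rw [← this]; ring
  have cases : ∀ (x y : ℤ), 0 ≤ x → (x = 0 ∧ y = 0) ∨ (0 < x ∧ 0 ≤ y) ∨ (x = 0 ∧ 0 < y) ∨
      (0 ≤ x ∧ y < 0) := by intro x y hx; omega
  rcases cases x y hx with ⟨a, b⟩ | ⟨a, b⟩ | ⟨a, b⟩ | ⟨a, b⟩ <;>
  rcases cases x' y' hx' with ⟨a', b'⟩ | ⟨a', b'⟩ | ⟨a', b'⟩ | ⟨a', b'⟩ <;>
  first
  | omega
  | (exfalso; subst a; subst b; rw [Site.mk_zero_zero] at h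
     exact Site.mk_ne_center l hx' (by omega) h.symm)
  | (exfalso; subst a'; subst b'; rw [Site.mk_zero_zero] at h
     exact Site.mk_ne_center l hx (by omega) h)
  | (first
     | rw [Site.mk_of_pos l a b] at h
     | rw [Site.mk_of_nonpos l a.le b] at h
     | rw [Site.mk_of_neg l a b] at h
     first
     | rw [Site.mk_of_pos l a' b'] at h
     | rw [Site.mk_of_nonpos l a'.le b'] at h
     | rw [Site.mk_of_neg l a' b'] at h
     simp only [Site.pt.injEq] at h
     first
     | omega
     | exact absurd h.1 e1
     | exact absurd h.1 e2
     | exact absurd h.1 e3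
     | exact absurd h.1.symm e1
     | exact absurd h.1.symm e2
     | exact absurd h.1.symm e3)

/-! ### Parity classes and neighbourhoods -/

/-- `Kind.parity` for integer coordinates. -/
def Kind.par : Kind → ℤ → ℤ → Prop
  | .primal, x, y => x % 2 = 0 ∧ y % 2 = 0
  | .dual, x, y => x % 2 = 1 ∧ y % 2 = 1
  | .rotPrimal, x, y => (x + y) % 2 = 0
  | .rotDual, x, y => (x + y) % 2 = 1

theorem isVertex_mk (κ : Kind) (l : ZMod m) {x : ℤ} (hx : 0 ≤ x) (y : ℤ) :
    IsVertex κ (Site.mk l x y) ↔ κ.par x y := by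
  rcases lt_trichotomy y 0 with hy | rfl | hy
  · rw [Site.mk_of_neg l hx hy]
    cases κ <;> simp only [IsVertex, Kind.parity, Kind.par] <;> omega
  · rcases hx.eq_or_lt with rfl | hx
    · rw [Site.mk_zero_zero]
      cases κ <;> simp [IsVertex, Kind.parity, Kind.par]
    · rw [Site.mk_of_pos l hx le_rfl]
      cases κ <;> simp only [IsVertex, Kind.parity, Kind.par] <;> omega
  · rcases hx.eq_or_lt with rfl | hx
    · rw [Site.mk_of_nonpos l le_rfl hy]
      cases κ <;> simp only [IsVertex, Kind.parity, Kind.par] <;> omega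
    · rw [Site.mk_of_pos l hx hy.le]
      cases κ <;> simp only [IsVertex, Kind.parity, Kind.par] <;> omega

theorem isVertex_rotate (κ : Kind) (s : Site m) : IsVertex κ s.rotate ↔ IsVertex κ s := by
  cases s <;> simp [IsVertex, Site.rotate]

theorem isVertex_reflect (κ : Kind) (s : Site m) : IsVertex κ s.reflect ↔ IsVertex κ s := by
  rcases s.exists_mk with rfl | ⟨l, x, y, hx, hy, rfl⟩
  · exact Iff.rfl
  · rw [Site.reflect_mk l (by omega), isVertex_mk κ _ (by omega), isVertex_mk κ _ (by omega)]
    cases κ <;> simp only [Kind.par] <;> omega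

section Nbhd

variable [NeZero m]

theorem mem_nbhd_mk (l : ZMod m) {x y : ℤ} (hx : 1 ≤ x) (hy : 0 ≤ y) (t : Site m) :
    t ∈ nbhd (Site.mk l x y) ↔ ∃ i j : ℤ, (-1 ≤ i ∧ i ≤ 1) ∧ (-1 ≤ j ∧ j ≤ 1) ∧
      t = Site.mk l (x + i) (y + j) := by
  rw [Site.mk_of_pos l (by omega) hy]
  have h1 : (((x - 1).toNat : ℕ) : ℤ) + 1 = x := by omega
  have h2 : ((y.toNat : ℕ) : ℤ) = y := by omega
  simp only [nbhd, h1, h2, Finset.mem_image, Finset.mem_product, Finset.mem_insert,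
    Finset.mem_singleton, Prod.exists]
  constructor
  · rintro ⟨i, j, ⟨hi, hj⟩, rfl⟩
    exact ⟨i, j, by omega, by omega, rfl⟩
  · rintro ⟨i, j, hi, hj, rfl⟩
    exact ⟨i, j, ⟨by omega, by omega⟩, rfl⟩

theorem mem_nbhd_center (t : Site m) :
    t ∈ nbhd (.center : Site m) ↔
      t = .center ∨ ∃ l : ZMod m, t = Site.mk l 1 0 ∨ t = Site.mk l 1 1 := by
  simp only [nbhd, Finset.mem_union, Finset.mem_singleton, Finset.mem_image, Finset.mem_univ,
    true_and]
  constructor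
  · rintro ((h | ⟨l, h⟩) | ⟨l, h⟩)
    · exact Or.inl h
    · exact Or.inr ⟨l, Or.inl h.symm⟩
    · exact Or.inr ⟨l, Or.inr h.symm⟩
  · rintro (h | ⟨l, h | h⟩)
    · exact Or.inl (Or.inl h)
    · exact Or.inl (Or.inr ⟨l, h.symm⟩)
    · exact Or.inr ⟨l, h.symm⟩

theorem mk_mem_nbhd (l : ZMod m) {x y x' y' : ℤ} (hx : 0 ≤ x) (hx' : 0 ≤ x')
    (h1 : -1 ≤ x' - x ∧ x' - x ≤ 1) (h2 : -1 ≤ y' - y ∧ y' - y ≤ 1) :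
    Site.mk l x' y' ∈ nbhd (Site.mk l x y) := by
  rcases lt_trichotomy y 0 with hy | rfl | hy
  · rw [Site.mk_eq_mk_pred l hx hy.le, Site.mk_eq_mk_pred l hx' (by omega),
      mem_nbhd_mk _ (by omega) hx]
    exact ⟨y - y', x' - x, by omega, by omega, by congr 1 <;> ring⟩
  · rcases hx.eq_or_lt with rfl | hx
    · rw [Site.mk_zero_zero, mem_nbhd_center]
      have c1 : x' = 0 ∨ x' = 1 := by omega
      have c2 : y' = -1 ∨ y' = 0 ∨ y' = 1 := by omega
      rcases c1 with rfl | rfl <;> rcases c2 with rfl | rfl | rfl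
      · exact Or.inr ⟨l - 1, Or.inl (by rw [Site.mk_eq_mk_pred l le_rfl (by omega)]; rfl)⟩
      · exact Or.inl (by simp)
      · exact Or.inr ⟨l + 1, Or.inl (by rw [Site.mk_eq_mk_succ l le_rfl (by omega)]; rfl)⟩
      · exact Or.inr ⟨l - 1, Or.inr (by rw [Site.mk_eq_mk_pred l (by omega) (by omega)]; rfl)⟩
      · exact Or.inr ⟨l, Or.inl rfl⟩
      · exact Or.inr ⟨l, Or.inr rfl⟩
    · rw [mem_nbhd_mk _ (by omega) le_rfl]
      exact ⟨x' - x, y', by omega, by omega, by congr 1 <;> ring⟩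
  · rcases hx.eq_or_lt with rfl | hx
    · rw [Site.mk_eq_mk_succ l le_rfl hy.le, Site.mk_eq_mk_succ l hx' (by omega),
        mem_nbhd_mk _ (by omega) (by omega)]
      exact ⟨y' - y, -x', by omega, by omega, by congr 1 <;> ring⟩
    · rw [mem_nbhd_mk _ (by omega) hy.le]
      exact ⟨x' - x, y' - y, by omega, by omega, by congr 1 <;> ring⟩

theorem mem_nbhd_iff (s t : Site m) :
    t ∈ nbhd s ↔ ∃ (l : ZMod m) (x y x' y' : ℤ), 0 ≤ x ∧ 0 ≤ x' ∧
      (-1 ≤ x' - x ∧ x' - x ≤ 1) ∧ (-1 ≤ y' - y ∧ y' - y ≤ 1) ∧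
      s = Site.mk l x y ∧ t = Site.mk l x' y' := by
  constructor
  · intro h
    rcases s.exists_mk with rfl | ⟨l, x, y, hx, hy, rfl⟩
    · rw [mem_nbhd_center] at h
      rcases h with rfl | ⟨l, rfl | rfl⟩
      · exact ⟨0, 0, 0, 0, 0, by simp⟩
      · exact ⟨l, 0, 0, 1, 0, by simp⟩
      · exact ⟨l, 0, 0, 1, 1, by simp⟩
    · rw [mem_nbhd_mk l hx hy] at h
      obtain ⟨i, j, hi, hj, rfl⟩ := h
      exact ⟨l, x, y, x + i, y + j, by omega, by omega, by omega, by omega, rfl, rfl⟩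
  · rintro ⟨l, x, y, x', y', hx, hx', h1, h2, rfl, rfl⟩
    exact mk_mem_nbhd l hx hx' h1 h2

theorem nbhd_symm {s t : Site m} (h : t ∈ nbhd s) : s ∈ nbhd t := by
  rw [mem_nbhd_iff] at h ⊢
  obtain ⟨l, x, y, x', y', hx, hx', h1, h2, hs, ht⟩ := h
  exact ⟨l, x', y', x, y, hx', hx, by omega, by omega, ht, hs⟩

theorem rotate_mem_nbhd {s t : Site m} (h : t ∈ nbhd s) : t.rotate ∈ nbhd s.rotate := by
  rw [mem_nbhd_iff] at h ⊢
  obtain ⟨l, x, y, x', y', hx, hx', h1, h2, rfl, rfl⟩ := h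
  exact ⟨l + 1, x, y, x', y', hx, hx', h1, h2, Site.rotate_mk .., Site.rotate_mk ..⟩

theorem unrotate_mem_nbhd {s t : Site m} (h : t.rotate ∈ nbhd s.rotate) : t ∈ nbhd s := by
  rw [mem_nbhd_iff] at h ⊢
  obtain ⟨l, x, y, x', y', hx, hx', h1, h2, hs, ht⟩ := h
  refine ⟨l - 1, x, y, x', y', hx, hx', h1, h2, Site.rotate_injective ?_,
    Site.rotate_injective ?_⟩
  · rw [hs, Site.rotate_mk]; simp
  · rw [ht, Site.rotate_mk]; simp

theorem reflect_mem_nbhd {s t : Site m} (h : t ∈ nbhd s) : t.reflect ∈ nbhd s.reflect := by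
  rw [mem_nbhd_iff] at h ⊢
  obtain ⟨l, x, y, x', y', hx, hx', h1, h2, rfl, rfl⟩ := h
  exact ⟨-l, x, -y, x', -y', hx, hx', h1, by omega, Site.reflect_mk l hx y,
    Site.reflect_mk l hx' y'⟩

theorem mem_corners {κ : Kind} {s t : Site m} :
    t ∈ corners κ s ↔ t ∈ nbhd s ∧ IsVertex κ t := by
  simp [corners]

theorem rotate_mem_corners {κ : Kind} {s t : Site m} :
    t.rotate ∈ corners κ s.rotate ↔ t ∈ corners κ s := by
  rw [mem_corners, mem_corners, isVertex_rotate]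
  exact and_congr_left fun _ => ⟨unrotate_mem_nbhd, rotate_mem_nbhd⟩

theorem reflect_mem_corners {κ : Kind} {s t : Site m} :
    t.reflect ∈ corners κ s.reflect ↔ t ∈ corners κ s := by
  rw [mem_corners, mem_corners, isVertex_reflect]
  refine and_congr_left fun _ => ⟨fun h => ?_, reflect_mem_nbhd⟩
  simpa using reflect_mem_nbhd h

end Nbhd

theorem half_mk (l : ZMod m) {x y : ℤ} (hx : 0 ≤ x) (hy : 0 ≤ y) :
    half (Site.mk l x y) = Site.mk l (x / 2) (y / 2) := by
  rcases hx.eq_or_lt with rfl | hx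
  · rcases hy.eq_or_lt with rfl | hy
    · simp [half]
    · rw [Site.mk_eq_mk_succ l le_rfl hy.le, Site.mk_of_pos _ hy (by omega),
        Site.mk_eq_mk_succ l (by omega) (by omega)]
      simp only [half]
      congr 1; omega
  · rw [Site.mk_of_pos _ hx hy]
    simp only [half]
    congr 1 <;> omega

theorem half_rotate (s : Site m) : half s.rotate = (half s).rotate := by
  rcases s.exists_mk with rfl | ⟨l, x, y, hx, hy, rfl⟩
  · rfl
  · rw [Site.rotate_mk, half_mk _ (by omega) hy, half_mk _ (by omega) hy, Site.rotate_mk]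

theorem half_reflect (s : Site m) : half s.reflect = (half s).reflect := by
  rcases s.exists_mk with rfl | ⟨l, x, y, hx, hy, rfl⟩
  · rfl
  · rw [Site.reflect_mk_swap _ (by omega) hy, half_mk _ hy (by omega), half_mk _ (by omega) hy,
      Site.reflect_mk_swap _ (by omega) (by omega)]

theorem mem_rotEdge_mk (κ : Kind) (l : ZMod m) {x y : ℤ} (hx : 1 ≤ x) (hy : 1 ≤ y)
    (px : x % 2 = 1) (t : Site m) :
    t ∈ rotEdge κ (Site.mk l x y) ↔ ∃ i j : ℤ, (0 ≤ i ∧ i ≤ 1) ∧ (0 ≤ j ∧ j ≤ 1) ∧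
      t = Site.mk l (x / 2 + i) (y / 2 + j) ∧ κ.par (x / 2 + i) (y / 2 + j) := by
  rw [Site.mk_of_pos l (by omega) (by omega)]
  have h1 : (((x - 1).toNat / 2 : ℕ) : ℤ) = x / 2 := by omega
  have h2 : ((y.toNat / 2 : ℕ) : ℤ) = y / 2 := by omega
  simp only [rotEdge, h1, h2, Finset.mem_filter, Finset.mem_image, Finset.mem_product,
    Finset.mem_insert, Finset.mem_singleton, Prod.exists]
  constructor
  · rintro ⟨⟨i, j, ⟨hi, hj⟩, rfl⟩, hv⟩
    exact ⟨i, j, by omega, by omega, rfl, (isVertex_mk κ l (by omega) _).1 hv⟩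
  · rintro ⟨i, j, hi, hj, rfl, hv⟩
    exact ⟨⟨i, j, ⟨by omega, by omega⟩, rfl⟩, (isVertex_mk κ l (by omega) _).2 hv⟩

/-- A vertex of a dual net, in the chart of its segment. -/
theorem exists_mk_of_isVertex_dual {s : Site m} (h : IsVertex .dual s) :
    ∃ (l : ZMod m) (x y : ℤ), 1 ≤ x ∧ 1 ≤ y ∧ x % 2 = 1 ∧ y % 2 = 1 ∧ s = Site.mk l x y := by
  rcases s.exists_mk with rfl | ⟨l, x, y, hx, hy, rfl⟩
  · simp [IsVertex, Kind.parity] at h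
  · rw [isVertex_mk _ _ (by omega)] at h
    simp only [Kind.par] at h
    exact ⟨l, x, y, hx, by omega, h.1, h.2, rfl⟩

theorem rotate_mem_rotEdge {κ : Kind} {s t : Site m} (hs : IsVertex .dual s)
    (h : t ∈ rotEdge κ s) : t.rotate ∈ rotEdge κ s.rotate := by
  obtain ⟨l, x, y, hx, hy, px, py, rfl⟩ := exists_mk_of_isVertex_dual hs
  rw [mem_rotEdge_mk κ l hx hy px] at h
  rw [Site.rotate_mk, mem_rotEdge_mk κ _ hx hy px]
  obtain ⟨i, j, hi, hj, rfl, hp⟩ := h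
  exact ⟨i, j, hi, hj, Site.rotate_mk .., hp⟩

theorem reflect_mem_rotEdge {κ : Kind} {s t : Site m} (hs : IsVertex .dual s)
    (h : t ∈ rotEdge κ s) : t.reflect ∈ rotEdge κ s.reflect := by
  obtain ⟨l, x, y, hx, hy, px, py, rfl⟩ := exists_mk_of_isVertex_dual hs
  rw [mem_rotEdge_mk κ l hx hy px] at h
  rw [Site.reflect_mk_swap _ (by omega) (by omega), mem_rotEdge_mk κ _ hy hx py]
  obtain ⟨i, j, hi, hj, rfl, hp⟩ := h
  refine ⟨j, i, hj, hi, Site.reflect_mk_swap _ (by omega) (by omega), ?_⟩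
  cases κ <;> simp only [Kind.par] at hp ⊢ <;> omega

/-! ### Elementary steps and their supports -/

/-- The elementary operators of which all VAV-schemes are composed, each with the kind of the nets
it is applied to: `A`, `R`, `V` on primal or dual nets, and `W`, which is `V` on nets of a rotated
kind. -/
inductive Step where
  | A (κ : Kind) : Step
  | R (κ : Kind) : Step
  | V (κ : Kind) : Step
  | W (κ : Kind) : Step

/-- The kind of the nets a step is applied to. -/
def Step.src : Step → Kind
  | .A κ => κ
  | .R κ => κ
  | .V κ => κ
  | .W κ => κ

/-- The kind of the nets a step produces. -/
def Step.tgt : Step → Kind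
  | .A κ => κ.swap
  | .R _ => .primal
  | .V _ => .rotDual
  | .W _ => .dual

/-- The kinds for which a step has its geometric meaning. -/
def Step.Valid : Step → Prop
  | .A _ => True
  | .R κ => κ = .primal ∨ κ = .dual
  | .V κ => κ = .primal ∨ κ = .dual
  | .W κ => κ = .rotPrimal ∨ κ = .rotDual

/-- The factor by which a step scales a regular grid. -/
noncomputable def Step.scale : Step → ℝ
  | .A _ => 1
  | .R _ => 1 / 2
  | .V _ => 1
  | .W _ => 1 / 2

theorem Step.scale_pos (st : Step) : 0 < st.scale := by
  cases st <;> norm_num [Step.scale]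

theorem Step.scale_le_one (st : Step) : st.scale ≤ 1 := by
  cases st <;> norm_num [Step.scale]

section Defs

variable [NeZero m]

/-- The linear operator of a step. -/
noncomputable def Step.op (st : Step) : Net m →ₗ[ℂ] Net m :=
  match st with
  | .A κ => opA κ
  | .R κ => opR κ
  | .V κ => opV κ
  | .W κ => opVRot κ

/-- The old points over which the value at `s` is averaged, if `s` is a new vertex. -/
def Step.stencil (st : Step) (s : Site m) : Finset (Site m) :=
  match st with
  | .A κ => corners κ s
  | .R κ => corners κ (half s)
  | .V κ => corners κ s
  | .W κ => rotEdge κ s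

/-- The old vertices on which the new net depends at `s`. -/
def Step.supp (st : Step) (s : Site m) : Finset (Site m) :=
  if IsVertex st.tgt s then st.stencil s else ∅

theorem Step.op_apply (st : Step) (N : Net m) (s : Site m) :
    st.op N s = ((st.supp s).card : ℂ)⁻¹ * ∑ t ∈ st.supp s, N t := by
  have h : st.op N s = meanNet st.tgt st.stencil N s := by cases st <;> rfl
  rw [h]
  simp only [meanNet, LinearMap.pi_apply, Step.supp]
  split_ifs <;> simp [mean]

/-- The composition of a list of steps; the last one acts first. -/
noncomputable def run : List Step → Module.End ℂ (Net m)
  | [] => LinearMap.id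
  | st :: l => st.op ∘ₗ run l

/-- The vertices on which the result of a list of steps depends at a given point. -/
def support : List Step → Site m → Finset (Site m)
  | [], s => {s}
  | st :: l, s => (st.supp s).biUnion (support l)

end Defs

section Averaging

variable [NeZero m]

@[simp] theorem run_nil (N : Net m) : run [] N = N := rfl

@[simp] theorem run_cons (st : Step) (l : List Step) (N : Net m) :
    run (st :: l) N = st.op (run l N) := rfl

theorem run_append (l l' : List Step) (N : Net m) : run (l ++ l') N = run l (run l' N) := by
  induction l with
  | nil => rfl
  | cons st l ih => simp [ih]

theorem support_append (l l' : List Step) (s : Site m) :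
    support (l ++ l') s = (support l s).biUnion (support l') := by
  induction l generalizing s with
  | nil => simp [support]
  | cons st l ih =>
    simp only [List.cons_append, support, Finset.biUnion_biUnion]
    exact Finset.biUnion_congr rfl fun t _ => ih t

theorem mem_support_append {l l' : List Step} {s t : Site m} :
    t ∈ support (l ++ l') s ↔ ∃ u ∈ support l s, t ∈ support l' u := by
  rw [support_append, Finset.mem_biUnion]

theorem mem_support_cons {st : Step} {l : List Step} {s t : Site m} :
    t ∈ support (st :: l) s ↔ ∃ u ∈ st.supp s, t ∈ support l u := by
  simp [support]

/-- A product of steps is an averaging operator, with positive weights on its support. -/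
theorem exists_weights (l : List Step) (s : Site m) :
    ∃ w : Site m → ℝ, (∀ t ∈ support l s, 0 < w t) ∧ (∑ t ∈ support l s, w t ≤ 1) ∧
      ∀ N : Net m, run l N s = ∑ t ∈ support l s, (w t : ℂ) * N t := by
  induction l generalizing s with
  | nil => exact ⟨fun _ => 1, by simp, by simp [support], by simp [support]⟩
  | cons st l ih =>
    choose w hpos hsum hrun using ih
    have hsub : ∀ u ∈ st.supp s, support l u ⊆ support (st :: l) s := fun u hu =>
      Finset.subset_biUnion_of_mem (support l) hu
    refine ⟨fun t => ∑ u ∈ st.supp s, ((st.supp s).card : ℝ)⁻¹ *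
      (if t ∈ support l u then w u t else 0), ?_, ?_, ?_⟩
    · intro t ht
      obtain ⟨u, hu, hut⟩ := mem_support_cons.1 ht
      have hc : (0 : ℝ) < ((st.supp s).card : ℝ)⁻¹ := by
        have := Finset.card_pos.2 ⟨u, hu⟩
        positivity
      refine Finset.sum_pos' (fun v _ => mul_nonneg hc.le ?_) ⟨u, hu, mul_pos hc ?_⟩
      · split_ifs with h
        · exact (hpos v t h).le
        · exact le_rfl
      · rw [if_pos hut]; exact hpos u t hut
    · rw [Finset.sum_comm]
      calc _ ≤ ∑ u ∈ st.supp s, ((st.supp s).card : ℝ)⁻¹ * 1 := by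
            refine Finset.sum_le_sum fun u hu => ?_
            rw [← Finset.mul_sum]
            refine mul_le_mul_of_nonneg_left ?_ (by positivity)
            rw [← Finset.sum_filter, Finset.filter_mem_eq_inter,
              Finset.inter_eq_right.2 (hsub u hu)]
            exact hsum u
        _ ≤ 1 := by
            rw [Finset.sum_const, nsmul_eq_mul, mul_one]
            exact mul_inv_le_one
    · intro N
      rw [run_cons, Step.op_apply]
      simp only [hrun, Complex.ofReal_sum, Finset.sum_mul]
      rw [Finset.sum_comm, Finset.mul_sum]
      refine Finset.sum_congr rfl fun u hu => ?_
      rw [Finset.mul_sum]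
      have : support l u = (support (st :: l) s).filter (· ∈ support l u) := by
        rw [Finset.filter_mem_eq_inter, Finset.inter_eq_right.2 (hsub u hu)]
      conv_lhs => rw [this]
      rw [Finset.sum_filter]
      refine Finset.sum_congr rfl fun t _ => ?_
      split_ifs <;> push_cast <;> ring

/-- A net matters only on the support. -/
theorem run_congr {l : List Step} {s : Site m} {N N' : Net m}
    (h : ∀ t ∈ support l s, N t = N' t) : run l N s = run l N' s := by
  obtain ⟨w, -, -, hw⟩ := exists_weights l s
  rw [hw, hw]
  exact Finset.sum_congr rfl fun t ht => by rw [h t ht]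

theorem norm_run_le {l : List Step} {s : Site m} {N : Net m} {b : ℝ} (hb : 0 ≤ b)
    (h : ∀ t ∈ support l s, ‖N t‖ ≤ b) : ‖run l N s‖ ≤ b := by
  obtain ⟨w, hpos, hsum, hw⟩ := exists_weights l s
  rw [hw]
  calc _ ≤ ∑ t ∈ support l s, w t * b := by
        refine norm_sum_le_of_le _ fun t ht => ?_
        rw [norm_mul, Complex.norm_real, Real.norm_of_nonneg (hpos t ht).le]
        exact mul_le_mul_of_nonneg_left (h t ht) (hpos t ht).le
    _ ≤ b := by
        rw [← Finset.sum_mul]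
        exact mul_le_of_le_one_left hb hsum

/-- A real-valued net, regarded as a complex-valued one. -/
def realNet (E : Site m → ℝ) : Net m := fun s => (E s : ℂ)

/-- Since the weights are positive, a pointwise bound `E` for a net is carried along by the scheme. -/
theorem norm_run_le_re {l : List Step} {s : Site m} {N : Net m} {E : Site m → ℝ}
    (h : ∀ t ∈ support l s, ‖N t‖ ≤ E t) : ‖run l N s‖ ≤ (run l (realNet E) s).re := by
  obtain ⟨w, hpos, -, hw⟩ := exists_weights l s
  rw [hw, hw]
  simp only [realNet, ← Complex.ofReal_mul, ← Complex.ofReal_sum, Complex.ofReal_re]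
  refine norm_sum_le_of_le _ fun t ht => ?_
  rw [norm_mul, Complex.norm_real, Real.norm_of_nonneg (hpos t ht).le]
  exact mul_le_mul_of_nonneg_left (h t ht) (hpos t ht).le

theorem run_single_ne_zero_iff (l : List Step) (s t : Site m) :
    run l (Pi.single t 1) s ≠ 0 ↔ t ∈ support l s := by
  obtain ⟨w, hpos, -, hw⟩ := exists_weights l s
  rw [hw]
  constructor
  · intro h
    obtain ⟨u, hu, hne⟩ := Finset.exists_ne_zero_of_sum_ne_zero h
    by_cases hut : u = t
    · exact hut ▸ hu
    · simp [hut] at hne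
  · intro h
    rw [Finset.sum_eq_single_of_mem t h (fun u _ hu => by simp [hu])]
    simpa using (hpos t h).ne'

end Averaging

/-! ### Equivariance -/

theorem rotate_mem_rotEdge_iff {κ : Kind} {s t : Site m} (hs : IsVertex .dual s) :
    t.rotate ∈ rotEdge κ s.rotate ↔ t ∈ rotEdge κ s := by
  refine ⟨fun h => ?_, rotate_mem_rotEdge hs⟩
  obtain ⟨l, x, y, hx, hy, px, py, rfl⟩ := exists_mk_of_isVertex_dual hs
  rw [Site.rotate_mk, mem_rotEdge_mk κ _ hx hy px] at h
  rw [mem_rotEdge_mk κ l hx hy px]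
  obtain ⟨i, j, hi, hj, ht, hp⟩ := h
  rw [← Site.rotate_mk] at ht
  exact ⟨i, j, hi, hj, Site.rotate_injective ht, hp⟩

section Equivariance

variable [NeZero m]

theorem Step.rotate_mem_supp {st : Step} {s t : Site m} :
    t.rotate ∈ st.supp s.rotate ↔ t ∈ st.supp s := by
  simp only [Step.supp, isVertex_rotate]
  split_ifs with h
  · cases st with
    | A κ => exact rotate_mem_corners
    | R κ => simp only [Step.stencil, half_rotate]; exact rotate_mem_corners
    | V κ => exact rotate_mem_corners
    | W κ => exact rotate_mem_rotEdge_iff h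
  · simp

theorem Step.reflect_mem_supp' {st : Step} {s t : Site m} (h : t ∈ st.supp s) :
    t.reflect ∈ st.supp s.reflect := by
  simp only [Step.supp, isVertex_reflect] at h ⊢
  split_ifs with hs
  · rw [if_pos hs] at h
    cases st with
    | A κ => exact reflect_mem_corners.2 h
    | R κ => simp only [Step.stencil, half_reflect]; exact reflect_mem_corners.2 h
    | V κ => exact reflect_mem_corners.2 h
    | W κ => exact reflect_mem_rotEdge hs h
  · rw [if_neg hs] at h; simp at h

theorem Step.reflect_mem_supp {st : Step} {s t : Site m} :
    t.reflect ∈ st.supp s.reflect ↔ t ∈ st.supp s :=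
  ⟨fun h => by simpa using reflect_mem_supp' h, reflect_mem_supp'⟩

theorem Step.supp_rotate (st : Step) (s : Site m) :
    st.supp s.rotate = (st.supp s).image Site.rotate := by
  ext t
  rw [← Site.rotate_unrotate t, Step.rotate_mem_supp,
    Site.rotate_injective.mem_finset_image]

theorem Step.supp_reflect (st : Step) (s : Site m) :
    st.supp s.reflect = (st.supp s).image Site.reflect := by
  ext t
  rw [← Site.reflect_reflect t, Step.reflect_mem_supp,
    Site.reflect_injective.mem_finset_image]

theorem rotate_mem_support {l : List Step} {s t : Site m} :
    t.rotate ∈ support l s.rotate ↔ t ∈ support l s := by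
  induction l generalizing s with
  | nil => simp [support, Site.rotate_injective.eq_iff]
  | cons st l ih =>
    rw [mem_support_cons, mem_support_cons, Step.supp_rotate]
    simp [ih]

theorem reflect_mem_support {l : List Step} {s t : Site m} :
    t.reflect ∈ support l s.reflect ↔ t ∈ support l s := by
  induction l generalizing s with
  | nil => simp [support, Site.reflect_injective.eq_iff]
  | cons st l ih =>
    rw [mem_support_cons, mem_support_cons, Step.supp_reflect]
    simp [ih]

/-- Nets on which the rotation by one segment acts as multiplication by `ω` and the reflection as
complex conjugation: `ω = e ^ (2 π i / m)` for frequency `1`, and `ω = 1` for frequency `0`. -/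
structure IsSym (ω : ℂ) (N : Net m) : Prop where
  rotate : ∀ s, N s.rotate = ω * N s
  reflect : ∀ s, N s.reflect = (starRingEnd ℂ) (N s)

theorem Step.op_rotate {ω : ℂ} {N : Net m} (h : ∀ s, N s.rotate = ω * N s) (st : Step)
    (s : Site m) : st.op N s.rotate = ω * st.op N s := by
  rw [Step.op_apply, Step.op_apply, Step.supp_rotate,
    Finset.card_image_of_injective _ Site.rotate_injective,
    Finset.sum_image Site.rotate_injective.injOn]
  simp only [h, ← Finset.mul_sum]
  ring

theorem run_rotate {ω : ℂ} {N : Net m} (h : ∀ s, N s.rotate = ω * N s) (l : List Step)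
    (s : Site m) : run l N s.rotate = ω * run l N s := by
  induction l generalizing s with
  | nil => exact h s
  | cons st l ih => exact Step.op_rotate ih st s

theorem IsSym.op {ω : ℂ} {N : Net m} (h : IsSym ω N) (st : Step) : IsSym ω (st.op N) := by
  constructor
  · exact Step.op_rotate h.rotate st
  · intro s
    rw [Step.op_apply, Step.op_apply, Step.supp_reflect,
      Finset.card_image_of_injective _ Site.reflect_injective,
      Finset.sum_image Site.reflect_injective.injOn]
    simp [h.reflect]

theorem IsSym.run {ω : ℂ} {N : Net m} (h : IsSym ω N) (l : List Step) : IsSym ω (run l N) := by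
  induction l with
  | nil => exact h
  | cons st l ih => exact ih.op st

end Equivariance

theorem IsSym.add {ω : ℂ} {N N' : Net m} (h : IsSym ω N) (h' : IsSym ω N') :
    IsSym ω (N + N') :=
  ⟨fun s => by simp [h.rotate, h'.rotate, mul_add], fun s => by simp [h.reflect, h'.reflect]⟩

theorem IsSym.smul {ω : ℂ} {N : Net m} (h : IsSym ω N) (r : ℝ) : IsSym ω (r • N) :=
  ⟨fun s => by simp [h.rotate, mul_left_comm], fun s => by simp [h.reflect]⟩

/-! ### Schemes as lists of steps -/

section Words

/-- `A ^ n` on nets of kind `κ`. -/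
def averageSteps : ℕ → Kind → List Step
  | 0, _ => []
  | n + 1, κ => averageSteps n κ.swap ++ [.A κ]

/-- The steps of a factor on nets of kind `κ`. -/
def Factor.steps : Factor → Kind → List Step
  | .A, κ => [.A κ]
  | .R, κ => [.R κ]
  | .VAV n, κ => .W (Kind.swap^[n] .rotDual) :: (averageSteps n .rotDual ++ [.V κ])

/-- The steps of a word on nets of kind `κ`. -/
def Word.steps : Word → Kind → List Step
  | [], _ => []
  | F :: U, κ => F.steps (Word.out U κ) ++ Word.steps U κ

/-- The list of steps is applicable to nets of kind `κ` and produces nets of kind `κ'`. -/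
def Chain (κ : Kind) : List Step → Kind → Prop
  | [], κ' => κ' = κ
  | st :: l, κ' => st.Valid ∧ κ' = st.tgt ∧ Chain κ l st.src

theorem Chain.append {κ κ₁ κ₂ : Kind} {l₁ l₂ : List Step} (h₂ : Chain κ l₂ κ₁)
    (h₁ : Chain κ₁ l₁ κ₂) : Chain κ (l₁ ++ l₂) κ₂ := by
  induction l₁ generalizing κ₂ with
  | nil => cases h₁; exact h₂
  | cons st l ih => exact ⟨h₁.1, h₁.2.1, ih h₁.2.2⟩

theorem chain_averageSteps (n : ℕ) (κ : Kind) :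
    Chain κ (averageSteps n κ) (Kind.swap^[n] κ) := by
  induction n generalizing κ with
  | zero => rfl
  | succ n ih => exact Chain.append ⟨trivial, rfl, rfl⟩ (ih κ.swap)

/-- The kinds of unrotated nets. -/
def Kind.Straight (κ : Kind) : Prop := κ = .primal ∨ κ = .dual

theorem Kind.Straight.swap {κ : Kind} (h : κ.Straight) : κ.swap.Straight := by
  rcases h with rfl | rfl <;> simp [Kind.Straight, Kind.swap]

theorem swap_iterate_rotDual (n : ℕ) :
    Kind.swap^[n] .rotDual = .rotPrimal ∨ Kind.swap^[n] .rotDual = .rotDual := by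
  induction n with
  | zero => right; rfl
  | succ n ih =>
    rw [Function.iterate_succ_apply']
    rcases ih with h | h <;> rw [h] <;> simp [Kind.swap]

theorem Factor.chain_steps (F : Factor) {κ : Kind} (h : κ.Straight) :
    Chain κ (F.steps κ) (F.out κ) := by
  cases F with
  | A => exact ⟨trivial, rfl, rfl⟩
  | R => exact ⟨h, rfl, rfl⟩
  | VAV n =>
    refine ⟨swap_iterate_rotDual n, rfl, Chain.append ?_ (chain_averageSteps n .rotDual)⟩
    exact ⟨h, rfl, rfl⟩

theorem Factor.straight_out (F : Factor) {κ : Kind} (h : κ.Straight) : (F.out κ).Straight := by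
  cases F with
  | A => exact h.swap
  | R => exact Or.inl rfl
  | VAV n => exact Or.inr rfl

theorem Word.straight_out (U : Word) {κ : Kind} (h : κ.Straight) : (Word.out U κ).Straight := by
  induction U with
  | nil => exact h
  | cons F U ih => exact F.straight_out ih

theorem Word.chain_steps (U : Word) {κ : Kind} (h : κ.Straight) :
    Chain κ (Word.steps U κ) (Word.out U κ) := by
  induction U with
  | nil => rfl
  | cons F U ih => exact ih.append (F.chain_steps (Word.straight_out U h))

section Run

variable [NeZero m]

theorem run_averageSteps (n : ℕ) (κ : Kind) (N : Net m) :
    run (averageSteps n κ) N = opApow n κ N := by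
  induction n generalizing κ N with
  | zero => rfl
  | succ n ih => rw [averageSteps, run_append, ih]; rfl

theorem Factor.run_steps (F : Factor) (κ : Kind) (N : Net m) : run (F.steps κ) N = F.op κ N := by
  cases F with
  | A => rfl
  | R => rfl
  | VAV n =>
    rw [Factor.steps, run_cons, run_append, run_averageSteps]
    rfl

/-- A scheme acts as the product of its elementary steps. -/
theorem Word.run_steps (U : Word) (κ : Kind) (N : Net m) :
    run (Word.steps U κ) N = Word.op U κ N := by
  induction U with
  | nil => rfl
  | cons F U ih => rw [Word.steps, run_append, ih, Factor.run_steps]; rfl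

end Run

/-- The `k`-fold repetition of a list of steps. -/
def repeatSteps (l : List Step) : ℕ → List Step
  | 0 => []
  | k + 1 => l ++ repeatSteps l k

theorem run_repeatSteps [NeZero m] (l : List Step) (k : ℕ) :
    (run (repeatSteps l k) : Module.End ℂ (Net m)) = run l ^ k := by
  induction k with
  | zero => rfl
  | succ k ih =>
    rw [pow_succ', ← ih]
    refine LinearMap.ext fun N => ?_
    rw [repeatSteps, run_append]; rfl

theorem repeatSteps_add (l : List Step) (j k : ℕ) :
    repeatSteps l (j + k) = repeatSteps l j ++ repeatSteps l k := by
  induction j with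
  | zero => simp [repeatSteps]
  | succ j ih => rw [Nat.succ_add, repeatSteps, ih, repeatSteps, List.append_assoc]

theorem Chain.repeatSteps {κ : Kind} {l : List Step} (h : Chain κ l κ) (k : ℕ) :
    Chain κ (repeatSteps l k) κ := by
  induction k with
  | zero => rfl
  | succ k ih => exact ih.append h

/-- The factor by which a list of steps scales a regular grid. -/
noncomputable def totalScale : List Step → ℝ
  | [] => 1
  | st :: l => st.scale * totalScale l

theorem totalScale_pos (l : List Step) : 0 < totalScale l := by
  induction l with
  | nil => exact one_pos
  | cons st l ih => exact mul_pos st.scale_pos ih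

theorem totalScale_append (l l' : List Step) :
    totalScale (l ++ l') = totalScale l * totalScale l' := by
  induction l with
  | nil => simp [totalScale]
  | cons st l ih => simp [totalScale, ih, mul_assoc]

theorem totalScale_repeatSteps (l : List Step) (k : ℕ) :
    totalScale (repeatSteps l k) = totalScale l ^ k := by
  induction k with
  | zero => rfl
  | succ k ih => rw [repeatSteps, totalScale_append, ih, pow_succ']

end Words

/-! ### The steps in coordinates -/

/-- The distance from `x` to the nearest coordinate of a vertex of a primal or dual net. -/
def Kind.off : Kind → ℤ → ℤ
  | .dual, x => (x + 1) % 2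
  | _, x => x % 2

theorem Kind.off_cases (κ : Kind) (x : ℤ) : κ.off x = 0 ∨ κ.off x = 1 := by
  cases κ <;> simp only [Kind.off] <;> omega

/-- The vertices of a primal or dual net that are nearest to `(x, y)`: the corners of the vertex,
edge or face with midpoint `(x, y)`, listed with multiplicities. -/
def fillPre (κ : Kind) (x y : ℤ) : Fin 4 → ℤ × ℤ :=
  ![(x + κ.off x, y + κ.off y), (x + κ.off x, y - κ.off y), (x - κ.off x, y + κ.off y),
    (x - κ.off x, y - κ.off y)]

/-- The vertices of a rotated net around the face centre `(x, y)`. -/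
def rotPre (x y : ℤ) : Fin 4 → ℤ × ℤ :=
  ![(x + 1, y), (x - 1, y), (x, y + 1), (x, y - 1)]

/-- Distinguishes the two diagonals of the unit square with lower left corner `(X, Y)`. -/
def Kind.diag : Kind → ℤ → ℤ → ℤ
  | .rotDual, X, Y => (X + Y + 1) % 2
  | _, X, Y => (X + Y) % 2

theorem Kind.diag_cases (κ : Kind) (x y : ℤ) : κ.diag x y = 0 ∨ κ.diag x y = 1 := by
  cases κ <;> simp only [Kind.diag] <;> omega

/-- The end points of the edge of a rotated net in the unit square with lower left corner
`(X, Y)`, each listed twice. -/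
def edgePre (κ : Kind) (X Y : ℤ) : Fin 4 → ℤ × ℤ :=
  ![(X + κ.diag X Y, Y), (X + 1 - κ.diag X Y, Y + 1), (X + κ.diag X Y, Y),
    (X + 1 - κ.diag X Y, Y + 1)]

/-- The coordinates of the four old vertices whose mean is the new vertex `(x, y)`. -/
def Step.pre : Step → ℤ → ℤ → Fin 4 → ℤ × ℤ
  | .A .primal, x, y => fillPre .primal x y
  | .A .dual, x, y => fillPre .dual x y
  | .A .rotPrimal, x, y => rotPre x y
  | .A .rotDual, x, y => rotPre x y
  | .R κ, x, y => fillPre κ (x / 2) (y / 2)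
  | .V κ, x, y => fillPre κ x y
  | .W κ, x, y => edgePre κ (x / 2) (y / 2)

section Means

theorem mean_fillPre (g : ℤ × ℤ → ℂ) (κ : Kind) (x y : ℤ) :
    (((Finset.univ.image (fillPre κ x y)).card : ℂ))⁻¹ *
      ∑ p ∈ Finset.univ.image (fillPre κ x y), g p =
    1 / 4 * ∑ i, g (fillPre κ x y i) := by
  have hs : Finset.univ.image (fillPre κ x y) =
      {(x + κ.off x, y + κ.off y), (x + κ.off x, y - κ.off y), (x - κ.off x, y + κ.off y),
        (x - κ.off x, y - κ.off y)} := by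
    ext p; simp [fillPre, Fin.exists_fin_succ, eq_comm]
  rw [hs]
  simp only [fillPre, Fin.sum_univ_four, Matrix.cons_val]
  rcases κ.off_cases x with h | h <;> rcases κ.off_cases y with h' | h' <;> rw [h, h']
  · simp; ring
  · have h1 : ¬ (y + 1 = y - 1) := by omega
    simp [h1]; ring
  · have h1 : ¬ (x + 1 = x - 1) := by omega
    simp [h1]; ring
  · have h1 : ¬ (y + 1 = y - 1) := by omega
    have h2 : ¬ (x + 1 = x - 1) := by omega
    rw [Finset.sum_insert (by simp [h1, h2]), Finset.sum_insert (by simp [h2]),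
      Finset.sum_pair (by simp [h1]), Finset.card_insert_of_notMem (by simp [h1, h2]),
      Finset.card_insert_of_notMem (by simp [h2]), Finset.card_pair (by simp [h1])]
    norm_num
    ring

theorem mean_rotPre (g : ℤ × ℤ → ℂ) (x y : ℤ) :
    (((Finset.univ.image (rotPre x y)).card : ℂ))⁻¹ *
      ∑ p ∈ Finset.univ.image (rotPre x y), g p =
    1 / 4 * ∑ i, g (rotPre x y i) := by
  have hs : Finset.univ.image (rotPre x y) = {(x + 1, y), (x - 1, y), (x, y + 1), (x, y - 1)} := by
    ext p; simp [rotPre, Fin.exists_fin_succ, eq_comm]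
  rw [hs]
  simp only [rotPre, Fin.sum_univ_four, Matrix.cons_val]
  have h1 : ¬ (y + 1 = y - 1) := by omega
  have h2 : ¬ (x + 1 = x - 1) := by omega
  rw [Finset.sum_insert (by simp [h2]), Finset.sum_insert (by simp),
    Finset.sum_pair (by simp [h1]), Finset.card_insert_of_notMem (by simp [h2]),
    Finset.card_insert_of_notMem (by simp), Finset.card_pair (by simp [h1])]
  norm_num
  ring

theorem mean_edgePre (g : ℤ × ℤ → ℂ) (κ : Kind) (x y : ℤ) :
    (((Finset.univ.image (edgePre κ x y)).card : ℂ))⁻¹ *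
      ∑ p ∈ Finset.univ.image (edgePre κ x y), g p =
    1 / 4 * ∑ i, g (edgePre κ x y i) := by
  have hs : Finset.univ.image (edgePre κ x y) =
      {(x + κ.diag x y, y), (x + 1 - κ.diag x y, y + 1)} := by
    ext p; simp [edgePre, Fin.exists_fin_succ, eq_comm]; tauto
  rw [hs]
  simp only [edgePre, Fin.sum_univ_four, Matrix.cons_val]
  rw [Finset.sum_pair (by simp), Finset.card_pair (by simp)]
  push_cast
  ring

theorem Step.mean_pre (g : ℤ × ℤ → ℂ) (st : Step) (x y : ℤ) :
    (((Finset.univ.image (st.pre x y)).card : ℂ))⁻¹ * ∑ p ∈ Finset.univ.image (st.pre x y), g p =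
    1 / 4 * ∑ i, g (st.pre x y i) := by
  rcases st with κ | κ | κ | κ
  · cases κ
    · exact mean_fillPre ..
    · exact mean_fillPre ..
    · exact mean_rotPre ..
    · exact mean_rotPre ..
  · exact mean_fillPre ..
  · exact mean_fillPre ..
  · exact mean_edgePre ..

end Means

theorem mem_rotEdge_edge {κ : Kind} (hκ : κ = .rotPrimal ∨ κ = .rotDual) (l : ZMod m) {x y : ℤ}
    (hx : 1 ≤ x) (hy : 1 ≤ y) (px : x % 2 = 1) (t : Site m) :
    t ∈ rotEdge κ (Site.mk l x y) ↔
      ∃ i, t = Site.mk l (edgePre κ (x / 2) (y / 2) i).1 (edgePre κ (x / 2) (y / 2) i).2 := by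
  rw [mem_rotEdge_mk κ l hx hy px]
  generalize x / 2 = X
  generalize y / 2 = Y
  constructor
  · rintro ⟨i, j, hi, hj, rfl, hv⟩
    have h : (i = κ.diag X Y ∧ j = 0) ∨ (i = 1 - κ.diag X Y ∧ j = 1) := by
      rcases hκ with rfl | rfl <;> simp only [Kind.par, Kind.diag] at * <;> omega
    rcases h with ⟨rfl, rfl⟩ | ⟨rfl, rfl⟩
    · exact ⟨0, by simp [edgePre]⟩
    · exact ⟨1, by simp [edgePre, add_sub_assoc]⟩
  · rintro ⟨i, rfl⟩
    have hd := κ.diag_cases X Y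
    have h0 : ∃ i' j' : ℤ, (0 ≤ i' ∧ i' ≤ 1) ∧ (0 ≤ j' ∧ j' ≤ 1) ∧
        Site.mk l (X + κ.diag X Y) Y = Site.mk l (X + i') (Y + j') ∧
        κ.par (X + i') (Y + j') := by
      refine ⟨κ.diag X Y, 0, by omega, by omega, by simp, ?_⟩
      rcases hκ with rfl | rfl <;> simp only [Kind.par, Kind.diag] at * <;> omega
    have h1 : ∃ i' j' : ℤ, (0 ≤ i' ∧ i' ≤ 1) ∧ (0 ≤ j' ∧ j' ≤ 1) ∧
        Site.mk l (X + 1 - κ.diag X Y) (Y + 1) = Site.mk l (X + i') (Y + j') ∧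
        κ.par (X + i') (Y + j') := by
      refine ⟨1 - κ.diag X Y, 1, by omega, by omega, by simp [add_sub_assoc], ?_⟩
      rcases hκ with rfl | rfl <;> simp only [Kind.par, Kind.diag] at * <;> omega
    fin_cases i
    · exact h0
    · exact h1
    · exact h0
    · exact h1

section Supp

variable [NeZero m]

theorem mem_corners_fill {κ : Kind} (hκ : κ.Straight) (l : ZMod m) {x y : ℤ} (hx : 1 ≤ x)
    (hy : 0 ≤ y) (t : Site m) :
    t ∈ corners κ (Site.mk l x y) ↔
      ∃ i, t = Site.mk l (fillPre κ x y i).1 (fillPre κ x y i).2 := by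
  rw [mem_corners, mem_nbhd_mk l hx hy]
  have ox := κ.off_cases x
  have oy := κ.off_cases y
  constructor
  · rintro ⟨⟨i, j, hi, hj, rfl⟩, hv⟩
    rw [isVertex_mk κ l (by omega)] at hv
    have h1 : i = κ.off x ∨ i = -κ.off x := by
      rcases hκ with rfl | rfl <;> simp only [Kind.par, Kind.off] at * <;> omega
    have h2 : j = κ.off y ∨ j = -κ.off y := by
      rcases hκ with rfl | rfl <;> simp only [Kind.par, Kind.off] at * <;> omega
    rcases h1 with h1 | h1 <;> rcases h2 with h2 | h2 <;> subst h1 <;> subst h2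
    · exact ⟨0, rfl⟩
    · exact ⟨1, rfl⟩
    · exact ⟨2, rfl⟩
    · exact ⟨3, rfl⟩
  · rintro ⟨i, rfl⟩
    have hp : ∀ (i j : ℤ), (i = κ.off x ∨ i = -κ.off x) → (j = κ.off y ∨ j = -κ.off y) →
        (∃ i' j' : ℤ, (-1 ≤ i' ∧ i' ≤ 1) ∧ (-1 ≤ j' ∧ j' ≤ 1) ∧
          Site.mk l (x + i) (y + j) = Site.mk l (x + i') (y + j')) ∧
        IsVertex κ (Site.mk l (x + i) (y + j)) := by
      intro i j h1 h2
      refine ⟨⟨i, j, by omega, by omega, rfl⟩, (isVertex_mk κ l (by omega) _).2 ?_⟩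
      rcases hκ with rfl | rfl <;> simp only [Kind.par, Kind.off] at * <;> omega
    fin_cases i
    · exact hp _ _ (Or.inl rfl) (Or.inl rfl)
    · exact hp _ _ (Or.inl rfl) (Or.inr rfl)
    · exact hp _ _ (Or.inr rfl) (Or.inl rfl)
    · exact hp _ _ (Or.inr rfl) (Or.inr rfl)

theorem mem_corners_rot {κ : Kind} (hκ : κ = .rotPrimal ∨ κ = .rotDual) (l : ZMod m) {x y : ℤ}
    (hx : 1 ≤ x) (hy : 0 ≤ y) (hp : κ.swap.par x y) (t : Site m) :
    t ∈ corners κ (Site.mk l x y) ↔ ∃ i, t = Site.mk l (rotPre x y i).1 (rotPre x y i).2 := by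
  rw [mem_corners, mem_nbhd_mk l hx hy]
  constructor
  · rintro ⟨⟨i, j, hi, hj, rfl⟩, hv⟩
    rw [isVertex_mk κ l (by omega)] at hv
    have h : (i = 1 ∧ j = 0) ∨ (i = -1 ∧ j = 0) ∨ (i = 0 ∧ j = 1) ∨ (i = 0 ∧ j = -1) := by
      rcases hκ with rfl | rfl <;> simp only [Kind.par, Kind.swap] at * <;> omega
    rcases h with ⟨rfl, rfl⟩ | ⟨rfl, rfl⟩ | ⟨rfl, rfl⟩ | ⟨rfl, rfl⟩
    · exact ⟨0, by simp [rotPre]⟩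
    · exact ⟨1, by simp [rotPre, sub_eq_add_neg]⟩
    · exact ⟨2, by simp [rotPre]⟩
    · exact ⟨3, by simp [rotPre, sub_eq_add_neg]⟩
  · rintro ⟨i, rfl⟩
    have hp' : ∀ (x' y' : ℤ), ((x' = x + 1 ∨ x' = x - 1) ∧ y' = y ∨
        x' = x ∧ (y' = y + 1 ∨ y' = y - 1)) →
        (∃ i' j' : ℤ, (-1 ≤ i' ∧ i' ≤ 1) ∧ (-1 ≤ j' ∧ j' ≤ 1) ∧
          Site.mk l x' y' = Site.mk l (x + i') (y + j')) ∧ IsVertex κ (Site.mk l x' y') := by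
      intro x' y' h
      refine ⟨⟨x' - x, y' - y, by omega, by omega, by congr 1 <;> ring⟩,
        (isVertex_mk κ l (by omega) _).2 ?_⟩
      rcases hκ with rfl | rfl <;> simp only [Kind.par, Kind.swap] at * <;> omega
    fin_cases i
    · exact hp' _ _ (Or.inl ⟨Or.inl rfl, rfl⟩)
    · exact hp' _ _ (Or.inl ⟨Or.inr rfl, rfl⟩)
    · exact hp' _ _ (Or.inr ⟨rfl, Or.inl rfl⟩)
    · exact hp' _ _ (Or.inr ⟨rfl, Or.inr rfl⟩)

theorem Step.mem_supp_mk {st : Step} (hv : st.Valid) (l : ZMod m) {x y : ℤ} (hx : 1 ≤ x)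
    (hy : 0 ≤ y) (hp : st.tgt.par x y) (t : Site m) :
    t ∈ st.supp (Site.mk l x y) ↔ ∃ i, t = Site.mk l (st.pre x y i).1 (st.pre x y i).2 := by
  rw [Step.supp, if_pos ((isVertex_mk _ l (by omega) y).2 hp)]
  rcases st with κ | κ | κ | κ
  · cases κ
    · exact mem_corners_fill (Or.inl rfl) l hx hy t
    · exact mem_corners_fill (Or.inr rfl) l hx hy t
    · exact mem_corners_rot (Or.inl rfl) l hx hy hp t
    · exact mem_corners_rot (Or.inr rfl) l hx hy hp t
  · simp only [Step.stencil, half_mk l (by omega : 0 ≤ x) hy]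
    have hx2 : x % 2 = 0 := hp.1
    exact mem_corners_fill hv l (by omega) (by omega) t
  · exact mem_corners_fill hv l hx hy t
  · have hx2 : x % 2 = 1 := hp.1
    have hy2 : y % 2 = 1 := hp.2
    exact mem_rotEdge_edge hv l hx (by omega) hx2 t

theorem Step.pre_fst_nonneg {st : Step} {x y : ℤ} (hx : 1 ≤ x)
    (hp : st.tgt.par x y) (i : Fin 4) : 0 ≤ (st.pre x y i).1 := by
  have hf : ∀ (κ : Kind) (x y : ℤ), 1 ≤ x → 0 ≤ (fillPre κ x y i).1 := by
    intro κ x y hx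
    rcases κ.off_cases x with h | h <;> fin_cases i <;> simp [fillPre, h] <;> omega
  rcases st with κ | κ | κ | κ
  · cases κ
    · exact hf _ _ _ hx
    · exact hf _ _ _ hx
    · fin_cases i <;> simp [Step.pre, rotPre] <;> omega
    · fin_cases i <;> simp [Step.pre, rotPre] <;> omega
  · have hx2 : x % 2 = 0 := hp.1
    exact hf _ _ _ (by omega)
  · exact hf _ _ _ hx
  · have := κ.diag_cases (x / 2) (y / 2)
    fin_cases i <;> simp [Step.pre, edgePre] <;> omega

/-- In the chart of a segment, the boundary `y = 0` included, every new vertex other than the centre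
is the mean of four old vertices (listed with multiplicities) with coordinates that do not depend
on the valence. -/
theorem Step.op_mk (hm : 3 ≤ m) {st : Step} (hv : st.Valid) (N : Net m) (l : ZMod m) {x y : ℤ}
    (hx : 1 ≤ x) (hy : 0 ≤ y) (hp : st.tgt.par x y) :
    st.op N (Site.mk l x y) = 1 / 4 * ∑ i, N (Site.mk l (st.pre x y i).1 (st.pre x y i).2) := by
  have hs : st.supp (Site.mk l x y) =
      (Finset.univ.image (st.pre x y)).image fun p => Site.mk l p.1 p.2 := by
    ext t
    rw [Step.mem_supp_mk hv l hx hy hp, Finset.image_image]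
    simp [eq_comm]
  have hinj : Set.InjOn (fun p : ℤ × ℤ => Site.mk l p.1 p.2)
      (Finset.univ.image (st.pre x y) : Finset (ℤ × ℤ)) := by
    intro p hp1 q hq h
    simp only [Finset.coe_image, Finset.coe_univ, Set.image_univ, Set.mem_range] at hp1 hq
    obtain ⟨i, rfl⟩ := hp1
    obtain ⟨j, rfl⟩ := hq
    have := Site.mk_inj hm l (Step.pre_fst_nonneg hx hp i) (Step.pre_fst_nonneg hx hp j) h
    exact Prod.ext this.1 this.2
  rw [Step.op_apply, hs, Finset.card_image_of_injOn hinj, Finset.sum_image hinj,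
    Step.mean_pre (fun p => N (Site.mk l p.1 p.2))]

end Supp

/-! ### Symmetric nets in the chart of a segment -/

/-- The values of a net in the chart of the segment `0`. -/
def quad (N : Net m) (x y : ℤ) : ℂ := N (Site.mk 0 x y)

section Quad

variable {ω : ℂ} {N : Net m}

theorem IsSym.mk_succ (h : IsSym ω N) (l : ZMod m) (x y : ℤ) :
    N (Site.mk (l + 1) x y) = ω * N (Site.mk l x y) := by
  rw [← Site.rotate_mk, h.rotate]

theorem IsSym.quad_neg (h : IsSym ω N) {x : ℤ} (hx : 0 ≤ x) (y : ℤ) :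
    quad N x (-y) = (starRingEnd ℂ) (quad N x y) := by
  rw [quad, quad, ← h.reflect, Site.reflect_mk 0 hx, neg_zero]

theorem IsSym.quad_rotate (h : IsSym ω N) {x y : ℤ} (hx : 0 ≤ x) (hy : 0 ≤ y) :
    quad N x y = ω * quad N y (-x) := by
  rw [quad, Site.mk_eq_mk_succ 0 hx hy, h.mk_succ, quad]

/-- The reflection of a segment at its diagonal acts as `z ↦ ω * conj z`. -/
theorem IsSym.quad_swap (h : IsSym ω N) {x y : ℤ} (hx : 0 ≤ x) (hy : 0 ≤ y) :
    quad N x y = ω * (starRingEnd ℂ) (quad N y x) := by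
  rw [h.quad_rotate hx hy, h.quad_neg hy]

theorem IsSym.quad_axis (h : IsSym ω N) {x : ℤ} (hx : 0 ≤ x) : (quad N x 0).im = 0 := by
  have := h.quad_neg hx 0
  rw [neg_zero] at this
  exact Complex.conj_eq_iff_im.1 this.symm

theorem IsSym.center (h : IsSym ω N) (hω : ω ≠ 1) : N .center = 0 := by
  have h1 : N .center = ω * N .center := h.rotate .center
  have h2 : (1 - ω) * N .center = 0 := by rw [sub_mul, one_mul, ← h1, sub_self]
  exact (mul_eq_zero.1 h2).resolve_left (sub_ne_zero.2 hω.symm)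

theorem quad_zero_zero (N : Net m) : quad N 0 0 = N .center := by simp [quad]

end Quad

/-! ### Edges of symmetric nets -/

/-- The orthogonal projection of the plane onto the real line spanned by a unit vector `ω`. -/
noncomputable def prj (ω z : ℂ) : ℂ := ω * (((starRingEnd ℂ) ω * z).re : ℂ)

theorem prj_sub (ω z w : ℂ) : prj ω (z - w) = prj ω z - prj ω w := by
  simp only [prj, mul_sub, Complex.sub_re]; push_cast; ring

theorem sub_conj_eq (z : ℂ) : z - (starRingEnd ℂ) z = 2 * (z.im * Complex.I) := by
  apply Complex.ext <;> simp; ring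

/-- The edge from `(x, y - 2)` to `(x, y)` in the segment `0`. -/
def edge (N : Net m) (x y : ℤ) : ℂ := quad N x y - quad N x (y - 2)

section Formulas

variable {ω : ℂ} {N : Net m}

theorem IsSym.edge_one (h : IsSym ω N) {x : ℤ} (hx : 0 ≤ x) :
    edge N x 1 = quad N x 1 - (starRingEnd ℂ) (quad N x 1) := by
  rw [edge, ← h.quad_neg hx]; rfl

theorem IsSym.edge_one' (h : IsSym ω N) {x : ℤ} (hx : 0 ≤ x) :
    edge N x 1 = 2 * ((quad N x 1).im * Complex.I) := by
  rw [h.edge_one hx, sub_conj_eq]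

theorem IsSym.edge_two_im (h : IsSym ω N) {x : ℤ} (hx : 0 ≤ x) :
    (edge N x 2).im = (quad N x 2).im := by
  have := h.quad_axis hx
  simp only [edge, Complex.sub_im]
  norm_num [this]

/-- Multiplying the axis of one spoke by `ω` gives the projection to the next spoke. -/
theorem IsSym.mul_re_quad (hω : ω * (starRingEnd ℂ) ω = 1) (h : IsSym ω N) {x y : ℤ}
    (hx : 0 ≤ x) (hy : 0 ≤ y) : ω * ((quad N x y).re : ℂ) = prj ω (quad N y x) := by
  rw [h.quad_swap hy hx, prj, ← mul_assoc ((starRingEnd ℂ) ω), mul_comm _ ω, hω, one_mul,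
    Complex.conj_re]

theorem IsSym.prj_center (h : IsSym ω N) : prj ω (N .center) = N .center := by
  have hr : N .center = (starRingEnd ℂ) (N .center) := h.reflect .center
  by_cases hω : ω = 1
  · subst hω
    simp [prj, Complex.conj_eq_iff_re.1 hr.symm]
  · rw [h.center hω]; simp [prj]

theorem IsSym.center_im (h : IsSym ω N) : (N .center).im = 0 :=
  Complex.conj_eq_iff_im.1 (h.reflect .center).symm

/-- The value that averaging gives to the centre: the common value of the innermost ring for
frequency `0`, zero otherwise. -/
noncomputable def cen (ω z : ℂ) : ℂ := open Classical in if ω = 1 then z else 0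

variable [NeZero m]

theorem Step.quad_op (hm : 3 ≤ m) {st : Step} (hv : st.Valid) (N : Net m) {x y : ℤ}
    (hx : 1 ≤ x) (hy : 0 ≤ y) (hp : st.tgt.par x y) :
    quad (st.op N) x y = 1 / 4 * ∑ i, quad N (st.pre x y i).1 (st.pre x y i).2 :=
  Step.op_mk hm hv N 0 hx hy hp

theorem Step.supp_center_nonempty {st : Step} (h : IsVertex st.tgt (.center : Site m)) :
    (st.supp (.center : Site m)).Nonempty := by
  have key : ∀ κ : Kind, (corners κ (.center : Site m)).Nonempty := by
    intro κ
    cases κ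
    · exact ⟨.center, mem_corners.2 ⟨(mem_nbhd_center _).2 (Or.inl rfl), by
        simp [IsVertex, Kind.parity]⟩⟩
    · exact ⟨Site.mk 0 1 1, mem_corners.2 ⟨(mem_nbhd_center _).2 (Or.inr ⟨0, Or.inr rfl⟩), by
        rw [isVertex_mk _ _ (by omega)]; simp [Kind.par]⟩⟩
    · exact ⟨.center, mem_corners.2 ⟨(mem_nbhd_center _).2 (Or.inl rfl), by
        simp [IsVertex, Kind.parity]⟩⟩
    · exact ⟨Site.mk 0 1 0, mem_corners.2 ⟨(mem_nbhd_center _).2 (Or.inr ⟨0, Or.inl rfl⟩), by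
        rw [isVertex_mk _ _ (by omega)]; simp [Kind.par]⟩⟩
  rw [Step.supp, if_pos h]
  cases st with
  | A κ => exact key κ
  | R κ => exact key κ
  | V κ => exact key κ
  | W κ => simp [Step.tgt, IsVertex, Kind.parity] at h

/-- If all vertices around the centre carry the same value, so does the new centre. -/
theorem Step.op_center_eq {st : Step} (h : IsVertex st.tgt (.center : Site m)) {N : Net m} {z : ℂ}
    (hz : ∀ t ∈ st.supp (.center : Site m), N t = z) : st.op N .center = z := by
  rw [Step.op_apply, Finset.sum_congr rfl hz, Finset.sum_const, nsmul_eq_mul, ← mul_assoc,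
    inv_mul_cancel₀, one_mul]
  exact_mod_cast (Finset.card_pos.2 (Step.supp_center_nonempty h)).ne'

theorem IsSym.mk_of_one (h : IsSym 1 N) (l : ZMod m) (x y : ℤ) :
    N (Site.mk l x y) = quad N x y := by
  have key : ∀ k : ℕ, N (Site.mk (k : ZMod m) x y) = quad N x y := by
    intro k
    induction k with
    | zero => simp [quad]
    | succ k ih => push_cast; rw [h.mk_succ, ih, one_mul]
  rw [← ZMod.natCast_zmod_val l]
  exact key _

theorem op_center_primal {st : Step} (ht : st.tgt = .primal)
    (hs : st.src = .primal) : st.op N .center = N .center := by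
  refine Step.op_center_eq (by rw [ht]; simp [IsVertex, Kind.parity]) fun t htm => ?_
  have : t ∈ corners .primal (.center : Site m) := by
    cases st with
    | A κ => cases hs; simp [Step.tgt, Kind.swap] at ht
    | R κ =>
      cases hs
      simpa [Step.supp, Step.tgt, IsVertex, Kind.parity, Step.stencil, half] using htm
    | V κ => simp [Step.tgt] at ht
    | W κ => simp [Step.tgt] at ht
  obtain ⟨hn, hv⟩ := mem_corners.1 this
  rcases (mem_nbhd_center t).1 hn with rfl | ⟨l, rfl | rfl⟩
  · rfl
  · rw [isVertex_mk _ _ (by omega)] at hv; simp [Kind.par] at hv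
  · rw [isVertex_mk _ _ (by omega)] at hv; simp [Kind.par] at hv

theorem op_center_dual (h : IsSym ω N) {st : Step} (ht : st.tgt = .primal)
    (hs : st.src = .dual) : st.op N .center = cen ω (quad N 1 1) := by
  by_cases hω : ω = 1
  · subst hω
    rw [cen, if_pos rfl]
    refine Step.op_center_eq (by rw [ht]; simp [IsVertex, Kind.parity]) fun t htm => ?_
    have : t ∈ corners .dual (.center : Site m) := by
      cases st with
      | A κ => cases hs; simpa [Step.supp, Step.tgt, IsVertex, Kind.parity, Step.stencil,
          Kind.swap] using htm
      | R κ =>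
      cases hs
      simpa [Step.supp, Step.tgt, IsVertex, Kind.parity, Step.stencil, half] using htm
      | V κ => simp [Step.tgt] at ht
      | W κ => simp [Step.tgt] at ht
    obtain ⟨hn, hv⟩ := mem_corners.1 this
    rcases (mem_nbhd_center t).1 hn with rfl | ⟨l, rfl | rfl⟩
    · simp [IsVertex, Kind.parity] at hv
    · rw [isVertex_mk _ _ (by omega)] at hv; simp [Kind.par] at hv
    · exact h.mk_of_one l 1 1
  · rw [(h.op st).center hω, cen, if_neg hω]

theorem op_center_rotDual (h : IsSym ω N) :
    (Step.A .rotDual).op N .center = cen ω (quad N 1 0) := by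
  by_cases hω : ω = 1
  · subst hω
    rw [cen, if_pos rfl]
    have hv0 : IsVertex (Step.A .rotDual).tgt (.center : Site m) := by
      simp [Step.tgt, IsVertex, Kind.parity, Kind.swap]
    refine Step.op_center_eq hv0 fun t htm => ?_
    rw [Step.supp, if_pos hv0] at htm
    obtain ⟨hn, hv⟩ := mem_corners.1 htm
    rcases (mem_nbhd_center t).1 hn with rfl | ⟨l, rfl | rfl⟩
    · simp [IsVertex, Kind.parity] at hv
    · exact h.mk_of_one l 1 0
    · rw [isVertex_mk _ _ (by omega)] at hv; simp [Kind.par] at hv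
  · rw [(h.op _).center hω, cen, if_neg hω]

/-- On the spoke between the segments `0` and `1` the mean over a set of points that is symmetric
to this spoke is a projection. -/
theorem quad_op_zero_fill (hm : 3 ≤ m) (hω : ω * (starRingEnd ℂ) ω = 1) (h : IsSym ω N)
    {st : Step} (hv : st.Valid) {κ : Kind} {y Y : ℤ} (hy : 1 ≤ y) (hY : 1 ≤ Y)
    (hp : st.tgt.par y 0) (hpre : st.pre y 0 = fillPre κ Y 0) :
    quad (st.op N) 0 y =
      1 / 2 * (prj ω (quad N (κ.off 0) (Y + κ.off Y)) +
        prj ω (quad N (κ.off 0) (Y - κ.off Y))) := by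
  have o0 := κ.off_cases 0
  have oY := κ.off_cases Y
  have hsum := Step.quad_op hm hv N hy le_rfl hp
  rw [hpre] at hsum
  simp only [fillPre, Fin.sum_univ_four, Matrix.cons_val, zero_add, zero_sub] at hsum
  rw [h.quad_neg (by omega), h.quad_neg (by omega)] at hsum
  rw [(h.op st).quad_rotate le_rfl (by omega), neg_zero, hsum,
    ← h.mul_re_quad hω (by omega) (by omega), ← h.mul_re_quad hω (by omega) (by omega),
    Complex.re_eq_add_conj, Complex.re_eq_add_conj]
  ring

theorem quad_op_zero_rot (hm : 3 ≤ m) (hω : ω * (starRingEnd ℂ) ω = 1) (h : IsSym ω N)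
    {st : Step} (hv : st.Valid) {y : ℤ} (hy : 1 ≤ y) (hp : st.tgt.par y 0)
    (hpre : st.pre y 0 = rotPre y 0) :
    quad (st.op N) 0 y =
      1 / 4 * (quad N 0 (y + 1) + quad N 0 (y - 1) + 2 * prj ω (quad N 1 y)) := by
  have hsum := Step.quad_op hm hv N hy le_rfl hp
  rw [hpre] at hsum
  simp only [rotPre, Fin.sum_univ_four, Matrix.cons_val, zero_add, zero_sub] at hsum
  rw [h.quad_neg (by omega)] at hsum
  rw [(h.op st).quad_rotate le_rfl (by omega), neg_zero, hsum,
    ← h.mul_re_quad hω (by omega) (by omega), Complex.re_eq_add_conj,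
    h.quad_rotate le_rfl (by omega : 0 ≤ y + 1), h.quad_rotate le_rfl (by omega : 0 ≤ y - 1),
    neg_zero]
  ring

end Formulas

/-! ### Admissible sets of edges -/

/-- Sets of admissible edges: convex sets `B` that are stable under the projections that occur
where a spoke is crossed, together with a functional `p ≥ 0` on `B` that decreases at most by the
factor `c` under these projections.  The two instances are a cone for nets of frequency `1`
(with the imaginary part as `p`) and a disc for nets of frequency `0` (with `p = 0`). -/
structure Adm (ω : ℂ) (B : Set ℂ) (p : ℂ →ₗ[ℝ] ℝ) (c : ℝ) : Prop where
  conv : Convex ℝ B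
  nonneg : ∀ z ∈ B, 0 ≤ p z
  pos : 0 < c
  le_one : c ≤ 1
  im : ∀ z ∈ B, (z.im * Complex.I : ℂ) ∈ B ∧ c * p z ≤ p (z.im * Complex.I)
  prj : ∀ z ∈ B, prj ω z ∈ B ∧ c * p z ≤ p (prj ω z)
  dual : ∀ z : ℂ, z = ω * (starRingEnd ℂ) z → z - (starRingEnd ℂ) z ∈ B →
    2 * (MidpointSubdivision.prj ω z - cen ω z) ∈ B ∧
      c * p (z - (starRingEnd ℂ) z) ≤ p (2 * (MidpointSubdivision.prj ω z - cen ω z))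
  rot : ∀ r : ℝ, (ω - (starRingEnd ℂ) ω) * r ∈ B →
    2 * (ω * r + MidpointSubdivision.prj ω r) - 4 * cen ω r ∈ B ∧
      c * p ((ω - (starRingEnd ℂ) ω) * r) ≤
        p (2 * (ω * r + MidpointSubdivision.prj ω r) - 4 * cen ω r)

/-- All edges of the segment `0`, and those that cross the spoke at its start, lie in `B`. -/
def HasEdges (B : Set ℂ) (κ : Kind) (N : Net m) : Prop :=
  ∀ x y : ℤ, 0 ≤ x → 1 ≤ y → κ.par x y → edge N x y ∈ B

/-- An old edge, close to the centre, on which the new edge at `(x, y)` depends. -/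
def fillPred (κ : Kind) (x y : ℤ) : ℤ × ℤ :=
  (|x - κ.off x|, if 1 ≤ y - κ.off y then y - κ.off y else y + κ.off y)

/-- An old edge, close to the centre, on which the new edge at `(x, y)` depends. -/
def Step.edgePred : Step → ℤ → ℤ → ℤ × ℤ
  | .A .primal, x, y => fillPred .primal x y
  | .A .dual, x, y => fillPred .dual x y
  | .A .rotPrimal, x, y => if 2 ≤ y then (x, y - 1) else if 1 ≤ x then (x - 1, 1) else (1, 1)
  | .A .rotDual, x, y => if 2 ≤ y then (x, y - 1) else (x - 1, 1)
  | .R κ, x, y => (|x / 2 - κ.off (x / 2)|, y / 2 + κ.off (y / 2))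
  | .V κ, x, y => fillPred κ x y
  | .W κ, x, y => (x / 2 + 1 - κ.diag (x / 2) (y / 2), y / 2 + 1)

section AdmLemmas

variable {ω : ℂ} {B : Set ℂ} {p : ℂ →ₗ[ℝ] ℝ} {c : ℝ}

theorem Adm.mid (h : Adm ω B p c) {z w : ℂ} (hz : z ∈ B) (hw : w ∈ B) :
    1 / 2 * (z + w) ∈ B ∧ 1 / 2 * p z ≤ p (1 / 2 * (z + w)) ∧
      1 / 2 * p w ≤ p (1 / 2 * (z + w)) := by
  have e : (1 / 2 * (z + w) : ℂ) = (1 / 2 : ℝ) • z + (1 / 2 : ℝ) • w := by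
    simp only [Complex.real_smul]; push_cast; ring
  rw [e]
  refine ⟨h.conv hz hw (by norm_num) (by norm_num) (by norm_num), ?_, ?_⟩
  · simp only [map_add, map_smul, smul_eq_mul]; linarith [h.nonneg w hw]
  · simp only [map_add, map_smul, smul_eq_mul]; linarith [h.nonneg z hz]

end AdmLemmas

section StepEdges

variable [NeZero m] {ω : ℂ} {B : Set ℂ} {p : ℂ →ₗ[ℝ] ℝ} {c : ℝ} {N : Net m}

/-- The new edge `e'` is `σ` times an admissible edge, at which `p` does not fall below
`c ^ 2 / 4` of its value at the old edge `e`. -/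
def EdgeBound (B : Set ℂ) (p : ℂ →ₗ[ℝ] ℝ) (c σ : ℝ) (e e' : ℂ) : Prop :=
  ∃ z ∈ B, e' = σ * z ∧ c ^ 2 / 4 * p e ≤ p z

theorem Adm.edgeBound_of_le (h : Adm ω B p c) {σ : ℝ} {e e' z : ℂ} (he : e ∈ B) (hz : z ∈ B)
    (e1 : e' = σ * z) {k : ℝ} (hk : c ^ 2 / 4 ≤ k) (hp : k * p e ≤ p z) :
    EdgeBound B p c σ e e' :=
  ⟨z, hz, e1, (mul_le_mul_of_nonneg_right hk (h.nonneg e he)).trans hp⟩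

/-- New edges of `A` and `V` on primal or dual nets. -/
theorem Adm.edge_fill (hm : 3 ≤ m) (hω : ω * (starRingEnd ℂ) ω = 1) (h : Adm ω B p c)
    (hN : IsSym ω N) {st : Step} (hv : st.Valid) {κ : Kind} (hκ : κ.Straight)
    (hsrc : st.src = κ) (hB : HasEdges B κ N)
    (hst : st = .A κ ∨ st = .V κ) {x y : ℤ} (hx : 0 ≤ x) (hy : 1 ≤ y) (hp : st.tgt.par x y) :
    EdgeBound B p c 1 (edge N (fillPred κ x y).1 (fillPred κ x y).2) (edge (st.op N) x y) := by
  have hc := h.pos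
  have hc1 := h.le_one
  have hcc : c ^ 2 ≤ c := by nlinarith
  have hpre : ∀ x y, st.pre x y = fillPre κ x y := by
    intro x y
    rcases hst with rfl | rfl
    · rcases hκ with rfl | rfl <;> rfl
    · rfl
  have ox := κ.off_cases x
  have oy := κ.off_cases y
  have oy2 : κ.off (y - 2) = κ.off y := by
    rcases hκ with rfl | rfl <;> simp only [Kind.off] <;> omega
  have hpar2 : st.tgt.par x (y - 2) := by
    rcases hst with rfl | rfl
    · rcases hκ with rfl | rfl <;> simp only [Step.tgt, Kind.swap, Kind.par] at * <;> omega
    · simp only [Step.tgt, Kind.par] at *; omega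
  have hpar : ∀ i j : ℤ, (i = x + κ.off x ∨ i = x - κ.off x ∨ i = κ.off x - x) →
      (j = y + κ.off y ∨ j = y - κ.off y) → κ.par i j := by
    intro i j hi hj
    rcases hκ with rfl | rfl <;> simp only [Kind.off, Kind.par] at * <;> omega
  -- the edges of the four quarters around the new edge
  have hE : ∀ i j : ℤ, (i = x + κ.off x ∨ i = x - κ.off x ∨ i = κ.off x - x) →
      (j = y + κ.off y ∨ j = y - κ.off y) → 0 ≤ i → 1 ≤ j → edge N i j ∈ B :=
    fun i j hi hj h0 h1 => hB i j h0 h1 (hpar i j hi hj)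
  -- The cases are: edges inside the segment, which are means of old edges; edges that cross the
  -- spoke `y = 0`, where the mean over mirror images leaves the imaginary part; edges on the other
  -- spoke, where this mean is a projection; and the edges next to the centre.
  rcases (by omega : 1 ≤ x ∧ 2 ≤ y ∨ 1 ≤ x ∧ y = 1 ∨ x = 0 ∧ 3 ≤ y ∨ x = 0 ∧ y = 1 ∨
    x = 0 ∧ y = 2) with ⟨hx1, hy2⟩ | ⟨hx1, rfl⟩ | ⟨rfl, hy3⟩ | ⟨rfl, rfl⟩ | ⟨rfl, rfl⟩
  · have e1 := h.mid (hE _ _ (Or.inl rfl) (Or.inl rfl) (by omega) (by omega))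
      (hE _ _ (Or.inr (Or.inl rfl)) (Or.inl rfl) (by omega) (by omega))
    have e2 := h.mid (hE _ _ (Or.inl rfl) (Or.inr rfl) (by omega) (by omega))
      (hE _ _ (Or.inr (Or.inl rfl)) (Or.inr rfl) (by omega) (by omega))
    have e3 := h.mid e1.1 e2.1
    have hpred : fillPred κ x y = (x - κ.off x, y - κ.off y) := by
      rw [fillPred, if_pos (by omega), abs_of_nonneg (by omega)]
    rw [hpred]
    refine h.edgeBound_of_le (hE _ _ (Or.inr (Or.inl rfl)) (Or.inr rfl) (by omega) (by omega))
      e3.1 ?_ (k := 1 / 4) (by nlinarith) (by linarith [e2.2.2, e3.2.2])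
    rw [edge, Step.quad_op hm hv N hx1 (by omega) hp,
      Step.quad_op hm hv N hx1 (by omega) hpar2, hpre, hpre]
    simp only [fillPre, Fin.sum_univ_four, Matrix.cons_val, oy2, edge]
    rw [show y - 2 + κ.off y = y + κ.off y - 2 by ring,
      show y - 2 - κ.off y = y - κ.off y - 2 by ring]
    push_cast; ring
  · rw [(hN.op st).edge_one hx, Step.quad_op hm hv N hx1 (by omega) hp, hpre]
    rcases oy with h0 | h1
    · have e1 := h.mid (hE _ _ (Or.inl rfl) (Or.inl rfl) (by omega) (by omega))
        (hE _ _ (Or.inr (Or.inl rfl)) (Or.inl rfl) (by omega) (by omega))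
      have hpred : fillPred κ x 1 = (x - κ.off x, 1) := by
        rw [fillPred, if_pos (by omega), abs_of_nonneg (by omega), h0]; simp
      rw [hpred]
      rw [h0, add_zero] at e1
      refine h.edgeBound_of_le (hB _ _ (by omega) le_rfl ?_) e1.1 ?_ (k := 1 / 2) (by nlinarith)
        (by linarith [e1.2.2])
      · exact hpar _ _ (Or.inr (Or.inl rfl)) (Or.inl (by omega))
      · rw [hN.edge_one (by omega), hN.edge_one (by omega)]
        simp only [fillPre, Fin.sum_univ_four, Matrix.cons_val, h0, add_zero, sub_zero, map_mul,
          map_add, map_div₀, map_one, map_ofNat]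
        push_cast; ring
    · have e1 := h.mid (hE _ _ (Or.inl rfl) (Or.inl rfl) (by omega) (by omega))
        (hE _ _ (Or.inr (Or.inl rfl)) (Or.inl rfl) (by omega) (by omega))
      have hpred : fillPred κ x 1 = (x - κ.off x, 2) := by
        rw [fillPred, if_neg (by omega), abs_of_nonneg (by omega), h1]; simp
      rw [hpred]
      rw [h1, show (1 : ℤ) + 1 = 2 from rfl] at e1
      have e2 := h.im _ e1.1
      refine h.edgeBound_of_le (hB _ _ (by omega) (by omega) ?_) e2.1 ?_ (k := c / 2)
        (by nlinarith) (by nlinarith [e1.2.2])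
      · exact hpar _ _ (Or.inr (Or.inl rfl)) (Or.inl (by omega))
      · have i1 := hN.quad_axis (show 0 ≤ x + κ.off x by omega)
        have i2 := hN.quad_axis (show 0 ≤ x - κ.off x by omega)
        have i3 := hN.edge_two_im (show 0 ≤ x + κ.off x by omega)
        have i4 := hN.edge_two_im (show 0 ≤ x - κ.off x by omega)
        rw [sub_conj_eq]
        simp only [fillPre, Fin.sum_univ_four, Matrix.cons_val, h1]
        norm_num [i1, i2, i3, i4]
        ring
  · have hpy : st.tgt.par y 0 := by
      rcases hst with rfl | rfl
      · rcases hκ with rfl | rfl <;> simp only [Step.tgt, Kind.swap, Kind.par] at * <;> omega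
      · simp only [Step.tgt, Kind.par] at *; omega
    have hpy2 : st.tgt.par (y - 2) 0 := by
      rcases hst with rfl | rfl
      · rcases hκ with rfl | rfl <;> simp only [Step.tgt, Kind.swap, Kind.par] at * <;> omega
      · simp only [Step.tgt, Kind.par] at *; omega
    have m1 := hE (κ.off 0) (y + κ.off y) (by omega) (Or.inl rfl) (by omega) (by omega)
    have m2 := hE (κ.off 0) (y - κ.off y) (by omega) (Or.inr rfl) (by omega) (by omega)
    have e1 := h.prj _ m1
    have e2 := h.prj _ m2
    have e3 := h.mid e1.1 e2.1
    have hpred : fillPred κ 0 y = (κ.off 0, y - κ.off y) := by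
      rw [fillPred, if_pos (by omega), abs_of_nonpos (by omega)]; simp
    rw [hpred]
    refine h.edgeBound_of_le m2 e3.1 ?_ (k := c / 2) (by nlinarith) (by nlinarith [e3.2.2])
    rw [edge, quad_op_zero_fill hm hω hN hv (by omega) (by omega) hpy (hpre y 0),
      quad_op_zero_fill hm hω hN hv (by omega) (by omega) hpy2 (hpre (y - 2) 0), oy2]
    simp only [edge, prj_sub]
    rw [show y - 2 + κ.off y = y + κ.off y - 2 by ring,
      show y - 2 - κ.off y = y - κ.off y - 2 by ring]
    push_cast; ring
  · have hpy : st.tgt.par 1 0 := by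
      rcases hst with rfl | rfl
      · rcases hκ with rfl | rfl <;> simp only [Step.tgt, Kind.swap, Kind.par] at * <;> omega
      · simp only [Step.tgt, Kind.par] at *; omega
    rw [(hN.op st).edge_one' le_rfl,
      quad_op_zero_fill hm hω hN hv le_rfl le_rfl hpy (hpre 1 0)]
    rcases hκ with rfl | rfl
    · have m1 := hB 0 2 le_rfl (by norm_num) (by simp [Kind.par])
      have e1 := h.prj _ m1
      have e2 := h.im _ e1.1
      have hpred : fillPred .primal 0 1 = (0, 2) := by simp [fillPred, Kind.off]
      rw [hpred]
      refine h.edgeBound_of_le m1 e2.1 ?_ (k := c ^ 2) (by nlinarith) (by nlinarith)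
      have ic := hN.center_im
      simp only [Kind.off, edge, prj_sub]
      norm_num [quad_zero_zero, hN.prj_center, ic]
      ring
    · have m1 := hB 1 1 (by norm_num) le_rfl (by simp [Kind.par])
      have q : quad N 1 1 = ω * (starRingEnd ℂ) (quad N 1 1) :=
        hN.quad_swap (by norm_num) (by norm_num)
      rw [hN.edge_one (by norm_num)] at m1
      have e1 := h.dual _ q m1
      have e2 := h.im _ e1.1
      have hpred : fillPred .dual 0 1 = (1, 1) := by simp [fillPred, Kind.off]
      rw [hpred, hN.edge_one (by norm_num)]
      refine h.edgeBound_of_le m1 e2.1 ?_ (k := c ^ 2) (by nlinarith) (by nlinarith)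
      have hcen : (cen ω (quad N 1 1)).im = 0 := by
        rw [cen]
        split_ifs with h1
        · rw [h1, one_mul] at q
          exact Complex.conj_eq_iff_im.1 q.symm
        · simp
      simp only [Kind.off]
      norm_num [hcen]
      ring
  · rcases hst with rfl | rfl
    · rcases hκ with rfl | rfl
      · simp only [Step.tgt, Kind.swap, Kind.par] at hp; omega
      · have m1 := hB 1 1 (by norm_num) le_rfl (by simp [Kind.par])
        have m3 := hB 1 3 (by norm_num) (by norm_num) (by simp [Kind.par])
        have q : quad N 1 1 = ω * (starRingEnd ℂ) (quad N 1 1) :=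
          hN.quad_swap (by norm_num) (by norm_num)
        rw [hN.edge_one (by norm_num)] at m1
        have e1 := h.dual _ q m1
        have e3 := h.prj _ m3
        have e4 := h.mid e1.1 e3.1
        have hpred : fillPred .dual 0 2 = (1, 1) := by simp [fillPred, Kind.off]
        rw [hpred, hN.edge_one (by norm_num)]
        refine h.edgeBound_of_le m1 e4.1 ?_ (k := c / 2) (by nlinarith) (by nlinarith [e4.2.1])
        rw [edge, show (2 : ℤ) - 2 = 0 from rfl, quad_zero_zero,
          op_center_dual hN rfl rfl, quad_op_zero_fill hm hω hN hv (by norm_num) (by norm_num)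
            (by simp [Step.tgt, Kind.swap, Kind.par]) (hpre 2 0)]
        simp only [Kind.off, edge, prj_sub]
        norm_num
        ring
    · simp only [Step.tgt, Kind.par] at hp; omega

/-- New edges of `R`. -/
theorem Adm.edge_refine (hm : 3 ≤ m) (hω : ω * (starRingEnd ℂ) ω = 1) (h : Adm ω B p c)
    (hN : IsSym ω N) {κ : Kind} (hκ : κ.Straight) (hB : HasEdges B κ N)
    {x y : ℤ} (hx : 0 ≤ x) (hy : 1 ≤ y) (hp : Kind.primal.par x y) :
    EdgeBound B p c (1 / 2) (edge N ((Step.R κ).edgePred x y).1 ((Step.R κ).edgePred x y).2)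
      (edge ((Step.R κ).op N) x y) := by
  have hc := h.pos
  have hc1 := h.le_one
  have hcc : c ^ 2 ≤ c := by nlinarith
  have hv : (Step.R κ).Valid := hκ
  obtain ⟨i, rfl⟩ : ∃ i, x = 2 * i := ⟨x / 2, by have := hp.1; omega⟩
  obtain ⟨j, rfl⟩ : ∃ j, y = 2 * j := ⟨y / 2, by have := hp.2; omega⟩
  have hi2 : 2 * i / 2 = i := by omega
  have hj2 : 2 * j / 2 = j := by omega
  have hj2' : (2 * j - 2) / 2 = j - 1 := by omega
  have oi := κ.off_cases i
  have oj := κ.off_cases j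
  have o1 : κ.off (j - 1) = 1 - κ.off j := by
    rcases hκ with rfl | rfl <;> simp only [Kind.off] <;> omega
  have hpar : ∀ i' j' : ℤ, (i' = i + κ.off i ∨ i' = i - κ.off i ∨ i' = κ.off i - i) →
      (j' = j + κ.off j) → κ.par i' j' := by
    intro i' j' hi hj
    rcases hκ with rfl | rfl <;> simp only [Kind.off, Kind.par] at * <;> omega
  have hpp : ∀ a b : ℤ, (Step.R κ).tgt.par (2 * a) (2 * b) := by
    intro a b; simp only [Step.tgt, Kind.par]; omega
  simp only [Step.edgePred, hi2, hj2]
  rcases (by omega : 1 ≤ i ∨ i = 0 ∧ 2 ≤ j ∨ i = 0 ∧ j = 1) with hi1 | ⟨rfl, hj⟩ | ⟨rfl, rfl⟩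
  · have m1 := hB (i + κ.off i) (j + κ.off j) (by omega) (by omega) (hpar _ _ (Or.inl rfl) rfl)
    have m2 := hB (i - κ.off i) (j + κ.off j) (by omega) (by omega)
      (hpar _ _ (Or.inr (Or.inl rfl)) rfl)
    have e1 := h.mid m1 m2
    rw [abs_of_nonneg (by omega)]
    refine h.edgeBound_of_le m2 e1.1 ?_ (k := 1 / 2) (by nlinarith) (by linarith [e1.2.2])
    have h2 : 2 * j - 2 = 2 * (j - 1) := by ring
    rw [edge, h2, Step.quad_op hm hv N (by omega) (by omega) (hpp _ _),
      Step.quad_op hm hv N (by omega) (by omega) (hpp _ _)]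
    simp only [Step.pre, hi2, hj2, show 2 * (j - 1) / 2 = j - 1 by omega]
    simp only [fillPre, Fin.sum_univ_four, Matrix.cons_val, o1, edge]
    rcases oj with h0 | h0 <;> rw [h0]
    · rw [show j - 1 + (1 - 0) = j by ring, show j - 1 - (1 - 0) = j - 2 by ring, add_zero,
        sub_zero]
      push_cast; ring
    · rw [show j - 1 + (1 - 1) = j - 1 by ring, show j - 1 - (1 - 1) = j - 1 by ring,
        show j + 1 - 2 = j - 1 by ring]
      push_cast; ring
  · have m1 := hB (κ.off 0) (j + κ.off j) (by omega) (by omega) (hpar _ _ (by simp) rfl)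
    have e1 := h.prj _ m1
    rw [abs_of_nonpos (by omega), zero_sub, neg_neg]
    refine h.edgeBound_of_le m1 e1.1 ?_ (k := c) (by nlinarith) e1.2
    have h2 : 2 * j - 2 = 2 * (j - 1) := by ring
    have hq : ∀ k : ℤ, (Step.R κ).pre (2 * k) 0 = fillPre κ k 0 := by
      intro k
      simp only [Step.pre, show 2 * k / 2 = k by omega]
      rfl
    have hpp0 : ∀ a : ℤ, (Step.R κ).tgt.par (2 * a) 0 := by
      intro a; simp only [Step.tgt, Kind.par]; omega
    rw [edge, h2, mul_zero,
      quad_op_zero_fill hm hω hN hv (by omega) (by omega) (hpp0 j) (hq j),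
      quad_op_zero_fill hm hω hN hv (by omega) (by omega) (hpp0 (j - 1)) (hq (j - 1)), o1]
    simp only [edge, prj_sub]
    rcases oj with h0 | h0 <;> rw [h0]
    · rw [show j - 1 + (1 - 0) = j by ring, show j - 1 - (1 - 0) = j - 2 by ring, add_zero,
        sub_zero]
      push_cast; ring
    · rw [show j - 1 + (1 - 1) = j - 1 by ring, show j - 1 - (1 - 1) = j - 1 by ring,
        show j + 1 - 2 = j - 1 by ring]
      push_cast; ring
  · have hf := quad_op_zero_fill (κ := κ) (Y := 1) hm hω hN hv (y := 2) (by norm_num) le_rfl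
      (by simp [Step.tgt, Kind.par]) rfl
    have hE : edge ((Step.R κ).op N) (2 * 0) (2 * 1) =
        quad ((Step.R κ).op N) 0 2 - (Step.R κ).op N .center := by
      rw [edge, show (2 * 1 - 2 : ℤ) = 0 from rfl, mul_zero, mul_one, quad_zero_zero]
    rw [hE, hf]
    rcases hκ with rfl | rfl
    · have m1 := hB 0 2 le_rfl (by norm_num) (by simp [Kind.par])
      have e1 := h.prj _ m1
      refine h.edgeBound_of_le m1 e1.1 ?_ (k := c) (by nlinarith) e1.2
      rw [op_center_primal rfl rfl]
      simp only [Kind.off, edge, prj_sub]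
      norm_num [quad_zero_zero, hN.prj_center]
      ring
    · have m1 := hB 1 1 (by norm_num) le_rfl (by simp [Kind.par])
      have q : quad N 1 1 = ω * (starRingEnd ℂ) (quad N 1 1) :=
        hN.quad_swap (by norm_num) (by norm_num)
      rw [hN.edge_one (by norm_num)] at m1
      have e1 := h.dual _ q m1
      have hpred : edge N |0 - Kind.dual.off 0| (1 + Kind.dual.off 1) =
          quad N 1 1 - (starRingEnd ℂ) (quad N 1 1) := by
        rw [← hN.edge_one (by norm_num)]; simp [Kind.off]
      rw [hpred]
      refine h.edgeBound_of_le m1 e1.1 ?_ (k := c) (by nlinarith) e1.2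
      rw [op_center_dual hN rfl rfl]
      simp only [Kind.off]
      norm_num
      ring

/-- New edges of `A` on rotated nets. -/
theorem Adm.edge_rot (hm : 3 ≤ m) (hω : ω * (starRingEnd ℂ) ω = 1) (h : Adm ω B p c)
    (hN : IsSym ω N) {κ : Kind} (hκ : κ = .rotPrimal ∨ κ = .rotDual) (hB : HasEdges B κ N)
    {x y : ℤ} (hx : 0 ≤ x) (hy : 1 ≤ y) (hp : κ.swap.par x y) :
    EdgeBound B p c 1 (edge N ((Step.A κ).edgePred x y).1 ((Step.A κ).edgePred x y).2)
      (edge ((Step.A κ).op N) x y) := by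
  have hc := h.pos
  have hc1 := h.le_one
  have hcc : c ^ 2 ≤ c := by nlinarith
  have hv : (Step.A κ).Valid := trivial
  have hpre : ∀ x y, (Step.A κ).pre x y = rotPre x y := by
    intro x y; rcases hκ with rfl | rfl <;> rfl
  have hpar : ∀ i j : ℤ, ((i = x + 1 ∨ i = x - 1) ∧ j = y ∨ i = x ∧ (j = y + 1 ∨ j = y - 1)) →
      κ.par i j := by
    intro i j hij
    rcases hκ with rfl | rfl <;> simp only [Kind.swap, Kind.par] at * <;> omega
  have hpar2 : (Step.A κ).tgt.par x (y - 2) := by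
    rcases hκ with rfl | rfl <;> simp only [Step.tgt, Kind.swap, Kind.par] at * <;> omega
  have hpar0 : (Step.A κ).tgt.par y x := by
    rcases hκ with rfl | rfl <;> simp only [Step.tgt, Kind.swap, Kind.par] at * <;> omega
  have hpar20 : (Step.A κ).tgt.par (y - 2) x := by
    rcases hκ with rfl | rfl <;> simp only [Step.tgt, Kind.swap, Kind.par] at * <;> omega
  rcases (by omega : 1 ≤ x ∧ 2 ≤ y ∨ 1 ≤ x ∧ y = 1 ∨ x = 0 ∧ 3 ≤ y ∨ x = 0 ∧ y = 1 ∨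
    x = 0 ∧ y = 2) with ⟨hx1, hy2⟩ | ⟨hx1, rfl⟩ | ⟨rfl, hy3⟩ | ⟨rfl, rfl⟩ | ⟨rfl, rfl⟩
  · have m1 := hB (x + 1) y (by omega) hy (hpar _ _ (by omega))
    have m2 := hB (x - 1) y (by omega) hy (hpar _ _ (by omega))
    have m3 := hB x (y + 1) (by omega) (by omega) (hpar _ _ (by omega))
    have m4 := hB x (y - 1) (by omega) (by omega) (hpar _ _ (by omega))
    have e1 := h.mid m1 m2
    have e2 := h.mid m3 m4
    have e3 := h.mid e1.1 e2.1
    have hpred : (Step.A κ).edgePred x y = (x, y - 1) := by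
      rcases hκ with rfl | rfl <;> simp only [Step.edgePred, if_pos hy2]
    rw [hpred]
    refine h.edgeBound_of_le m4 e3.1 ?_ (k := 1 / 4) (by nlinarith)
      (by linarith [e2.2.2, e3.2.2])
    rw [edge, Step.quad_op hm hv N hx1 (by omega) hp, Step.quad_op hm hv N hx1 (by omega) hpar2,
      hpre, hpre]
    simp only [rotPre, Fin.sum_univ_four, Matrix.cons_val, edge]
    rw [show y + 1 - 2 = y - 2 + 1 by ring, show y - 1 - 2 = y - 2 - 1 by ring]
    push_cast; ring
  · have m1 := hB (x + 1) 1 (by omega) le_rfl (hpar _ _ (by omega))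
    have m2 := hB (x - 1) 1 (by omega) le_rfl (hpar _ _ (by omega))
    have m3 := hB x 2 (by omega) (by omega) (hpar _ _ (by omega))
    have e1 := h.mid m1 m2
    have e2 := h.im _ m3
    have e3 := h.mid e1.1 e2.1
    have hpred : (Step.A κ).edgePred x 1 = (x - 1, 1) := by
      rcases hκ with rfl | rfl <;> simp [Step.edgePred, hx1]
    rw [hpred]
    refine h.edgeBound_of_le m2 e3.1 ?_ (k := 1 / 4) (by nlinarith)
      (by linarith [e1.2.2, e3.2.1])
    rw [(hN.op _).edge_one' hx, Step.quad_op hm hv N hx1 (by omega) hp, hpre,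
      hN.edge_one' (by omega), hN.edge_one' (by omega), hN.edge_two_im hx]
    have i1 := hN.quad_axis hx
    simp only [rotPre, Fin.sum_univ_four, Matrix.cons_val]
    norm_num [i1]
    ring
  · have m1 := hB 0 (y + 1) le_rfl (by omega) (hpar _ _ (by omega))
    have m2 := hB 0 (y - 1) le_rfl (by omega) (hpar _ _ (by omega))
    have m3 := hB 1 y (by omega) (by omega) (hpar _ _ (by omega))
    have e1 := h.mid m1 m2
    have e2 := h.prj _ m3
    have e3 := h.mid e1.1 e2.1
    have hpred : (Step.A κ).edgePred 0 y = (0, y - 1) := by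
      rcases hκ with rfl | rfl <;> simp only [Step.edgePred, if_pos (by omega : 2 ≤ y)]
    rw [hpred]
    refine h.edgeBound_of_le m2 e3.1 ?_ (k := 1 / 4) (by nlinarith)
      (by linarith [e1.2.2, e3.2.1])
    rw [edge, quad_op_zero_rot hm hω hN hv (by omega) hpar0 (hpre _ _),
      quad_op_zero_rot hm hω hN hv (by omega) hpar20 (hpre _ _)]
    simp only [edge, prj_sub]
    rw [show y + 1 - 2 = y - 2 + 1 by ring, show y - 1 - 2 = y - 2 - 1 by ring]
    push_cast; ring
  · rcases hκ with rfl | rfl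
    · have m1 := hB 1 1 (by norm_num) le_rfl (by simp [Kind.par])
      have m2 := hB 0 2 le_rfl (by norm_num) (by simp [Kind.par])
      have q : quad N 1 1 = ω * (starRingEnd ℂ) (quad N 1 1) :=
        hN.quad_swap (by norm_num) (by norm_num)
      rw [hN.edge_one (by norm_num)] at m1
      have e1 := h.dual _ q m1
      have e2 := h.mid e1.1 m2
      have e3 := h.im _ e2.1
      have hpred : (Step.A .rotPrimal).edgePred 0 1 = (1, 1) := rfl
      rw [hpred, hN.edge_one (by norm_num)]
      refine h.edgeBound_of_le m1 e3.1 ?_ (k := c ^ 2 / 2) (by nlinarith)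
        (by nlinarith [e2.2.1])
      have hcen : (cen ω (quad N 1 1)).im = 0 := by
        rw [cen]
        split_ifs with h1
        · rw [h1, one_mul] at q
          exact Complex.conj_eq_iff_im.1 q.symm
        · simp
      have ic := hN.center_im
      rw [(hN.op _).edge_one' le_rfl,
        quad_op_zero_rot hm hω hN hv (by omega) hpar0 (hpre _ _)]
      norm_num [hcen, edge, quad_zero_zero, ic]
      ring
    · simp only [Kind.swap, Kind.par] at hp; omega
  · rcases hκ with rfl | rfl
    · simp only [Kind.swap, Kind.par] at hp; omega
    · have m1 := hB 0 1 le_rfl le_rfl (by simp [Kind.par])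
      have m2 := hB 0 3 le_rfl (by norm_num) (by simp [Kind.par])
      have m3 := hB 1 2 (by norm_num) (by norm_num) (by simp [Kind.par])
      have hr : quad N 1 0 = ((quad N 1 0).re : ℂ) :=
        Complex.ext rfl (by simp [hN.quad_axis (show (0 : ℤ) ≤ 1 by norm_num)])
      have q01 : quad N 0 1 = ω * ((quad N 1 0).re : ℂ) := by
        rw [hN.quad_rotate le_rfl (by norm_num), neg_zero, ← hr]
      have q1 : edge N 0 1 = (ω - (starRingEnd ℂ) ω) * ((quad N 1 0).re : ℂ) := by
        rw [hN.edge_one le_rfl, q01, map_mul, Complex.conj_ofReal]; ring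
      rw [q1] at m1
      have e1 := h.rot _ m1
      have e2 := h.prj _ m3
      have e3 := h.mid e1.1 m2
      have e4 := h.mid e2.1 e3.1
      have hpred : (Step.A .rotDual).edgePred 0 2 = (0, 1) := rfl
      rw [hpred, q1]
      refine h.edgeBound_of_le m1 e4.1 ?_ (k := c / 4) (by nlinarith)
        (by linarith [e3.2.1, e4.2.2])
      rw [edge, show (2 : ℤ) - 2 = 0 from rfl, quad_zero_zero, op_center_rotDual hN,
        quad_op_zero_rot hm hω hN hv (by omega) hpar0 (hpre _ _)]
      simp only [edge, prj_sub]
      rw [show (2 : ℤ) - 1 = 1 from rfl, show (2 : ℤ) + 1 = 3 from rfl,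
        show (2 : ℤ) - 2 = 0 from rfl, show (3 : ℤ) - 2 = 1 from rfl, q01, ← hr]
      push_cast; ring

/-- New edges of `V` on rotated nets. -/
theorem Adm.edge_midpoint (hm : 3 ≤ m) (h : Adm ω B p c)
    (hN : IsSym ω N) {κ : Kind} (hκ : κ = .rotPrimal ∨ κ = .rotDual) (hB : HasEdges B κ N)
    {x y : ℤ} (hx : 0 ≤ x) (hy : 1 ≤ y) (hp : Kind.dual.par x y) :
    EdgeBound B p c (1 / 2) (edge N ((Step.W κ).edgePred x y).1 ((Step.W κ).edgePred x y).2)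
      (edge ((Step.W κ).op N) x y) := by
  have hc := h.pos
  have hc1 := h.le_one
  have hv : (Step.W κ).Valid := hκ
  obtain ⟨i, rfl⟩ : ∃ i, x = 2 * i + 1 := ⟨x / 2, by have := hp.1; omega⟩
  obtain ⟨j, rfl⟩ : ∃ j, y = 2 * j + 1 := ⟨y / 2, by have := hp.2; omega⟩
  have hi2 : (2 * i + 1) / 2 = i := by omega
  have hj2 : (2 * j + 1) / 2 = j := by omega
  have hj3 : (2 * j + 1 - 2) / 2 = j - 1 := by omega
  have od := κ.diag_cases i j
  have o1 : κ.diag i (j - 1) = 1 - κ.diag i j := by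
    rcases hκ with rfl | rfl <;> simp only [Kind.diag] <;> omega
  have hpar : κ.par (i + 1 - κ.diag i j) (j + 1) := by
    rcases hκ with rfl | rfl <;> simp only [Kind.diag, Kind.par] at * <;> omega
  have m1 := hB _ _ (by omega) (by omega) hpar
  simp only [Step.edgePred, hi2, hj2]
  refine h.edgeBound_of_le m1 m1 ?_ (k := 1) (by nlinarith) (by linarith)
  rcases (by omega : j = 0 ∨ 1 ≤ j) with rfl | hj
  · simp only [mul_zero, zero_add] at hp hj2 ⊢
    rw [(hN.op _).edge_one hx, Step.quad_op hm hv N (by omega) (by omega) hp]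
    simp only [Step.pre, hi2, hj2]
    simp only [edgePre, Fin.sum_univ_four, Matrix.cons_val]
    rw [hN.edge_one (by omega)]
    have ax : (starRingEnd ℂ) (quad N (i + κ.diag i 0) 0) = quad N (i + κ.diag i 0) 0 :=
      Complex.conj_eq_iff_im.2 (hN.quad_axis (by omega))
    simp only [map_mul, map_add, map_div₀, map_one, map_ofNat, ax]
    push_cast; ring
  · rw [edge, Step.quad_op hm hv N (by omega) (by omega) hp,
      Step.quad_op hm hv N (by omega) (by omega)
        (by simp only [Step.tgt, Kind.par]; omega)]
    simp only [Step.pre, hi2, hj2, hj3]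
    simp only [edgePre, Fin.sum_univ_four, Matrix.cons_val, o1, edge]
    rcases od with h0 | h0 <;> rw [h0]
    · rw [show i + (1 - 0) = i + 1 - 0 by ring, show i + 1 - (1 - 0) = i + 0 by ring,
        show j - 1 + 1 = j by ring, show j + 1 - 2 = j - 1 by ring]
      push_cast; ring
    · rw [show i + (1 - 1) = i + 1 - 1 by ring, show i + 1 - (1 - 1) = i + 1 by ring,
        show j - 1 + 1 = j by ring, show j + 1 - 2 = j - 1 by ring]
      push_cast; ring

end StepEdges

section EdgeStep

variable [NeZero m] {ω : ℂ} {B : Set ℂ} {p : ℂ →ₗ[ℝ] ℝ} {c : ℝ} {N : Net m}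

/-- The four kinds of edge masks together: admissible edges are mapped to admissible edges, up to
the scale of the step. -/
theorem Adm.edge_step (hm : 3 ≤ m) (hω : ω * (starRingEnd ℂ) ω = 1) (h : Adm ω B p c)
    (hN : IsSym ω N) {st : Step} (hv : st.Valid) (hB : HasEdges B st.src N)
    {x y : ℤ} (hx : 0 ≤ x) (hy : 1 ≤ y) (hp : st.tgt.par x y) :
    EdgeBound B p c st.scale (edge N (st.edgePred x y).1 (st.edgePred x y).2)
      (edge (st.op N) x y) := by
  rcases st with κ | κ | κ | κ
  · cases κ
    · exact h.edge_fill hm hω hN hv (Or.inl rfl) rfl hB (Or.inl rfl) hx hy hp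
    · exact h.edge_fill hm hω hN hv (Or.inr rfl) rfl hB (Or.inl rfl) hx hy hp
    · exact h.edge_rot hm hω hN (Or.inl rfl) hB hx hy hp
    · exact h.edge_rot hm hω hN (Or.inr rfl) hB hx hy hp
  · exact h.edge_refine hm hω hN hv hB hx hy hp
  · exact h.edge_fill hm hω hN hv hv rfl hB (Or.inr rfl) hx hy hp
  · exact h.edge_midpoint hm hN hv hB hx hy hp

omit [NeZero m] in
theorem edge_smul (r : ℝ) (N : Net m) (x y : ℤ) : edge (r • N) x y = r * edge N x y := by
  simp only [edge, quad, Pi.smul_apply, Complex.real_smul]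
  ring

/-- Up to the scale of the grid, admissible edges stay admissible. -/
theorem Adm.hasEdges_run (hm : 3 ≤ m) (hω : ω * (starRingEnd ℂ) ω = 1) (h : Adm ω B p c)
    (hN : IsSym ω N) {l : List Step} {κ κ' : Kind} (hl : Chain κ l κ') (hB : HasEdges B κ N) :
    HasEdges B κ' ((totalScale l)⁻¹ • run l N) := by
  induction l generalizing κ' with
  | nil =>
    obtain rfl : κ' = κ := hl
    simpa [totalScale] using hB
  | cons st l ih =>
    obtain ⟨hv, rfl, hl⟩ := hl
    have h1 := ih hl
    intro x y hx hy hp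
    obtain ⟨z, hz, e, -⟩ := h.edge_step hm hω ((hN.run l).smul _) hv h1 hx hy hp
    have hs := st.scale_pos.ne'
    have : edge ((totalScale (st :: l))⁻¹ • run (st :: l) N) x y = z := by
      have e2 : st.op ((totalScale l)⁻¹ • run l N) = (totalScale l)⁻¹ • run (st :: l) N := by
        rw [run_cons]; exact LinearMap.map_smul_of_tower _ _ _
      rw [e2, edge_smul] at e
      rw [edge_smul, totalScale, mul_inv, Complex.ofReal_mul, mul_assoc, e, Complex.ofReal_inv,
        inv_mul_cancel_left₀ (by exact_mod_cast hs)]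
    rw [this]; exact hz

/-! ### Paths of edges towards the centre -/

/-- The old edge at the end of the path of edges near the centre. -/
def edgePath : List Step → ℤ × ℤ → ℤ × ℤ
  | [], q => q
  | st :: l, q => edgePath l (st.edgePred q.1 q.2)

/-- The labels of `y`-edges of the segment `0`. -/
def Kind.IsEdge (κ : Kind) (q : ℤ × ℤ) : Prop := 0 ≤ q.1 ∧ 1 ≤ q.2 ∧ κ.par q.1 q.2

/-- A measure of the distance of an edge from the centre. It does not increase along the paths of
`edgePath`, and has the value `3` only at the edges next to the centre. -/
def edgeDist : Kind → ℤ × ℤ → ℤ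
  | .primal, (x, y) => x + y + if x = 0 then 1 else 0
  | .dual, (x, y) => x + y + if y = 1 then 1 else 0
  | .rotDual, (x, y) => x + y + 1 + (if (x, y) = (0, 1) then 1 else 0) -
      (if (x, y) = (1, 2) then 1 else 0)
  | .rotPrimal, (x, y) => if x + y = 2 then 3 else x + y

/-- The amount by which a step brings edges nearer to the centre. -/
def Step.gain : Step → ℤ
  | .A .primal => 1
  | .A .dual => 1
  | .A _ => 0
  | .V _ => 0
  | .R _ => 1
  | .W _ => 1

theorem Step.gain_nonneg (st : Step) : 0 ≤ st.gain := by
  rcases st with (_ | _ | _ | _) | _ | _ | _ <;> simp [Step.gain]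

theorem Kind.IsEdge.edgePred {st : Step} (hv : st.Valid) {x y : ℤ} (h : st.tgt.IsEdge (x, y)) :
    st.src.IsEdge (st.edgePred x y) ∧
      edgeDist st.src (st.edgePred x y) ≤ max 3 (edgeDist st.tgt (x, y) - st.gain) := by
  obtain ⟨hx, hy, hp⟩ := h
  simp only at hx hy hp
  rcases st with (_ | _ | _ | _) | κ | κ | κ
  · simp only [Step.tgt, Step.src, Kind.swap, Kind.par, Kind.IsEdge, Step.edgePred, fillPred,
      Kind.off, edgeDist, Step.gain] at *
    rw [abs_of_nonneg (by omega)]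
    split_ifs <;> omega
  · simp only [Step.tgt, Step.src, Kind.swap, Kind.par, Kind.IsEdge, Step.edgePred, fillPred,
      Kind.off, edgeDist, Step.gain] at *
    rcases abs_cases (x - (x + 1) % 2) with ⟨h, _⟩ | ⟨h, _⟩ <;> rw [h] <;>
    split_ifs <;> omega
  · simp only [Step.tgt, Step.src, Kind.swap, Kind.par, Kind.IsEdge, Step.edgePred,
      edgeDist, Step.gain, Prod.mk.injEq] at *
    split_ifs <;> simp only at * <;> omega
  · simp only [Step.tgt, Step.src, Kind.swap, Kind.par, Kind.IsEdge, Step.edgePred,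
      edgeDist, Step.gain, Prod.mk.injEq] at *
    split_ifs <;> simp only at * <;> omega
  · rcases hv with rfl | rfl
    · simp only [Step.tgt, Step.src, Kind.par, Kind.IsEdge, Step.edgePred,
        Kind.off, edgeDist, Step.gain] at *
      rw [abs_of_nonneg (by omega)]
      split_ifs <;> omega
    · simp only [Step.tgt, Step.src, Kind.par, Kind.IsEdge, Step.edgePred,
        Kind.off, edgeDist, Step.gain] at *
      rcases abs_cases (x / 2 - (x / 2 + 1) % 2) with ⟨h, _⟩ | ⟨h, _⟩ <;> rw [h] <;>
      split_ifs <;> omega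
  · rcases hv with rfl | rfl
    · simp only [Step.tgt, Step.src, Kind.par, Kind.IsEdge, Step.edgePred, fillPred,
        Kind.off, edgeDist, Step.gain, Prod.mk.injEq] at *
      rw [abs_of_nonneg (by omega)]
      split_ifs <;> omega
    · simp only [Step.tgt, Step.src, Kind.par, Kind.IsEdge, Step.edgePred, fillPred,
        Kind.off, edgeDist, Step.gain, Prod.mk.injEq] at *
      rcases abs_cases (x - (x + 1) % 2) with ⟨h, _⟩ | ⟨h, _⟩ <;> rw [h] <;>
      split_ifs <;> omega
  · rcases hv with rfl | rfl
    · simp only [Step.tgt, Step.src, Kind.par, Kind.IsEdge, Step.edgePred,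
        Kind.diag, edgeDist, Step.gain] at *
      split_ifs <;> omega
    · simp only [Step.tgt, Step.src, Kind.par, Kind.IsEdge, Step.edgePred,
        Kind.diag, edgeDist, Step.gain, Prod.mk.injEq] at *
      split_ifs <;> omega

/-- The total gain of a list of steps. -/
def totalGain (l : List Step) : ℤ := (l.map Step.gain).sum

theorem isEdge_edgePath {l : List Step} {κ κ' : Kind} (hl : Chain κ l κ') {q : ℤ × ℤ}
    (h : κ'.IsEdge q) :
    κ.IsEdge (edgePath l q) ∧ edgeDist κ (edgePath l q) ≤ max 3 (edgeDist κ' q - totalGain l) := by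
  induction l generalizing κ' q with
  | nil =>
    obtain rfl : κ' = κ := hl
    exact ⟨h, by simp [edgePath, totalGain]⟩
  | cons st l ih =>
    obtain ⟨hv, rfl, hl⟩ := hl
    obtain ⟨h1, h2⟩ := Kind.IsEdge.edgePred hv (x := q.1) (y := q.2) h
    obtain ⟨h3, h4⟩ := ih hl h1
    refine ⟨h3, h4.trans ?_⟩
    have : 0 ≤ totalGain l := by
      apply List.sum_nonneg
      intro a ha
      obtain ⟨st, -, rfl⟩ := List.mem_map.1 ha
      exact st.gain_nonneg
    have e : totalGain (st :: l) = st.gain + totalGain l := by simp [totalGain]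
    rw [e]
    simp only [Prod.mk.eta] at h2
    omega

theorem totalGain_append (l l' : List Step) :
    totalGain (l ++ l') = totalGain l + totalGain l' := by
  simp [totalGain]

theorem totalGain_repeatSteps (l : List Step) (k : ℕ) :
    totalGain (repeatSteps l k) = k * totalGain l := by
  induction k with
  | zero => simp [repeatSteps, totalGain]
  | succ k ih => rw [repeatSteps, totalGain_append, ih]; push_cast; ring

/-- An edge next to the centre. -/
def centralEdge : Kind → ℤ × ℤ
  | .dual => (1, 1)
  | _ => (0, 2)

theorem eq_centralEdge {κ : Kind} (hκ : κ.Straight) {q : ℤ × ℤ} (h : κ.IsEdge q)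
    (h3 : edgeDist κ q ≤ 3) : q = centralEdge κ := by
  obtain ⟨x, y⟩ := q
  obtain ⟨hx, hy, hp⟩ := h
  simp only at hx hy
  rcases hκ with rfl | rfl <;>
    simp only [Kind.par, edgeDist, centralEdge, Prod.mk.injEq] at * <;> split_ifs at h3 <;> omega

/-- After sufficiently many repetitions, every edge depends on the central edge. -/
theorem edgePath_eq_central {κ : Kind} (hκ : κ.Straight) {l : List Step} (hl : Chain κ l κ)
    (hg : 1 ≤ totalGain l) {q : ℤ × ℤ} (h : κ.IsEdge q) :
    ∃ n : ℕ, edgePath (repeatSteps l n) q = centralEdge κ := by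
  refine ⟨(edgeDist κ q).toNat, ?_⟩
  obtain ⟨h1, h2⟩ := isEdge_edgePath (hl.repeatSteps (edgeDist κ q).toNat) h
  refine eq_centralEdge hκ h1 (h2.trans ?_)
  rw [totalGain_repeatSteps]
  refine max_le le_rfl ?_
  have : ((edgeDist κ q).toNat : ℤ) * 1 ≤ ((edgeDist κ q).toNat : ℤ) * totalGain l :=
    mul_le_mul_of_nonneg_left hg (by omega)
  omega

/-- The functional `p` at a new edge is bounded below by its value at the old edge at the end of
the path. -/
theorem Adm.exists_le_edge (hm : 3 ≤ m) (hω : ω * (starRingEnd ℂ) ω = 1) (h : Adm ω B p c)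
    {l : List Step} {κ κ' : Kind} (hl : Chain κ l κ') {q : ℤ × ℤ} (hq : κ'.IsEdge q) :
    ∃ K : ℝ, 0 < K ∧ ∀ N : Net m, IsSym ω N → HasEdges B κ N →
      K * p (edge N (edgePath l q).1 (edgePath l q).2) ≤ p (edge (run l N) q.1 q.2) := by
  suffices h' : ∃ K : ℝ, 0 < K ∧ ∀ N : Net m, IsSym ω N → HasEdges B κ N →
      K * p (edge N (edgePath l q).1 (edgePath l q).2) ≤
        p (edge ((totalScale l)⁻¹ • run l N) q.1 q.2) by
    obtain ⟨K, hK, H⟩ := h'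
    refine ⟨totalScale l * K, mul_pos (totalScale_pos l) hK, fun N hN hB => ?_⟩
    have := mul_le_mul_of_nonneg_left (H N hN hB) (totalScale_pos l).le
    have e : p (edge ((totalScale l)⁻¹ • run l N) q.1 q.2) =
        (totalScale l)⁻¹ * p (edge (run l N) q.1 q.2) := by
      rw [edge_smul, ← Complex.real_smul, map_smul, smul_eq_mul]
    rw [e, mul_inv_cancel_left₀ (totalScale_pos l).ne'] at this
    linarith
  induction l generalizing κ' q with
  | nil =>
    refine ⟨1, one_pos, fun N hN hB => ?_⟩
    simp [edgePath, totalScale]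
  | cons st l ih =>
    obtain ⟨hv, rfl, hl⟩ := hl
    obtain ⟨h1, -⟩ := Kind.IsEdge.edgePred hv (x := q.1) (y := q.2) hq
    obtain ⟨K, hK, H⟩ := ih hl h1
    have hc := h.pos
    refine ⟨c ^ 2 / 4 * K, by positivity, fun N hN hB => ?_⟩
    obtain ⟨z, hz, e, hle⟩ := h.edge_step hm hω ((hN.run l).smul _) hv
      (h.hasEdges_run hm hω hN hl hB) hq.1 hq.2.1 hq.2.2
    have e3 : edge ((totalScale (st :: l))⁻¹ • run (st :: l) N) q.1 q.2 = z := by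
      have e2 : st.op ((totalScale l)⁻¹ • run l N) = (totalScale l)⁻¹ • run (st :: l) N := by
        rw [run_cons]; exact LinearMap.map_smul_of_tower _ _ _
      rw [e2, edge_smul] at e
      rw [edge_smul, totalScale, mul_inv, Complex.ofReal_mul, mul_assoc, e, Complex.ofReal_inv,
        inv_mul_cancel_left₀ (by exact_mod_cast st.scale_pos.ne')]
    rw [e3]
    have h5 := mul_le_mul_of_nonneg_left (H N hN hB) (show 0 ≤ c ^ 2 / 4 by positivity)
    rw [edgePath]
    linarith

end EdgeStep

/-! ### The cone and the discs of edges -/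

/-- The closed cone between the directions `ω` and `i`. -/
def edgeCone (ω : ℂ) : Set ℂ := {z | ∃ a b : ℝ, 0 ≤ a ∧ 0 ≤ b ∧ z = a * ω + b * Complex.I}

theorem edgeCone_smul {ω z : ℂ} (h : z ∈ edgeCone ω) {r : ℝ} (hr : 0 ≤ r) :
    (r : ℂ) * z ∈ edgeCone ω := by
  obtain ⟨a, b, ha, hb, rfl⟩ := h
  exact ⟨r * a, r * b, by positivity, by positivity, by push_cast; ring⟩

/-- For frequency `1`, the cone between the directions `ω` and `i` is admissible. -/
theorem adm_edgeCone {ω : ℂ} (hω : ω * (starRingEnd ℂ) ω = 1) (hS : 0 < ω.im) :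
    Adm ω (edgeCone ω) Complex.imLm (ω.im ^ 2 / 2) := by
  have h1 : ω.re ^ 2 + ω.im ^ 2 = 1 := by
    have := congrArg Complex.re hω
    simp at this; nlinarith
  have hne : ω ≠ 1 := by rintro rfl; simp at hS
  have hc1 : ω.im ^ 2 / 2 ≤ 1 + ω.re := by nlinarith [sq_nonneg (1 + ω.re)]
  have him1 : ω.im ≤ 1 := by nlinarith
  have hcen : ∀ z, cen ω z = 0 := fun z => by rw [cen, if_neg hne]
  refine ⟨?_, ?_, by positivity, by nlinarith, ?_, ?_, ?_, ?_⟩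
  · rintro _ ⟨a, b, ha, hb, rfl⟩ _ ⟨a', b', ha', hb', rfl⟩ s t hs ht -
    exact ⟨s * a + t * a', s * b + t * b', by positivity, by positivity, by
      simp only [Complex.real_smul]; push_cast; ring⟩
  · rintro _ ⟨a, b, ha, hb, rfl⟩
    simp; positivity
  · rintro _ ⟨a, b, ha, hb, rfl⟩
    have : 0 ≤ a * ω.im + b := by positivity
    refine ⟨⟨0, a * ω.im + b, le_rfl, this, by simp⟩, ?_⟩
    simp
    nlinarith
  · rintro _ ⟨a, b, ha, hb, rfl⟩
    have e : ((starRingEnd ℂ) ω * (a * ω + b * Complex.I)).re = a + b * ω.im := by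
      simp; linear_combination a * h1
    refine ⟨⟨a + b * ω.im, 0, by positivity, le_rfl, ?_⟩, ?_⟩
    · rw [prj, e]; push_cast; ring
    · rw [prj, e]
      simp
      have h2 : ω.im ^ 2 ≤ 1 := by nlinarith
      have h3 : 0 ≤ a * ω.im := by positivity
      have h4 : 0 ≤ b * ω.im ^ 2 := by positivity
      nlinarith
  · intro z hz hB
    have hy : 0 ≤ z.im := by
      obtain ⟨a, b, ha, hb, e⟩ := hB
      have := congrArg Complex.im e
      simp at this
      nlinarith [mul_nonneg ha hS.le]
    have e1 : z.im * (1 + ω.re) = ω.im * z.re := by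
      have := congrArg Complex.im hz
      simp at this; linarith
    have e2 : ((starRingEnd ℂ) ω * z).re = z.re := by
      have e3 : (starRingEnd ℂ) ω * z = (starRingEnd ℂ) z := by
        conv_lhs => rw [hz]
        rw [← mul_assoc, mul_comm ((starRingEnd ℂ) ω), hω, one_mul]
      rw [e3]; simp
    have hx : 0 ≤ z.re := by
      by_contra hneg
      have : ω.im * z.re < 0 := mul_neg_of_pos_of_neg hS (by linarith)
      nlinarith [mul_nonneg hy (show 0 ≤ 1 + ω.re by nlinarith)]
    rw [hcen, sub_zero, prj, e2]
    refine ⟨⟨2 * z.re, 0, by positivity, le_rfl, by push_cast; ring⟩, ?_⟩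
    simp
    nlinarith
  · intro r hB
    have hr : 0 ≤ r := by
      obtain ⟨a, b, ha, hb, e⟩ := hB
      have := congrArg Complex.im e
      simp at this
      nlinarith [mul_nonneg ha hS.le]
    have e2 : ((starRingEnd ℂ) ω * r).re = ω.re * r := by simp
    rw [hcen, prj, e2, mul_zero, sub_zero]
    refine ⟨⟨2 * r * (1 + ω.re), 0, by nlinarith, le_rfl, by push_cast; ring⟩, ?_⟩
    simp
    have : 0 ≤ r * ω.im := by positivity
    nlinarith

/-- For frequency `0`, discs are admissible. -/
theorem adm_closedBall (L : ℝ) : Adm 1 (Metric.closedBall 0 L) (0 : ℂ →ₗ[ℝ] ℝ) 1 := by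
  refine ⟨convex_closedBall _ _, by simp, one_pos, le_rfl, ?_, ?_, ?_, ?_⟩
  · intro z hz
    simp only [mem_closedBall_zero_iff] at hz ⊢
    refine ⟨?_, by simp⟩
    simpa using (Complex.abs_im_le_norm z).trans hz
  · intro z hz
    simp only [mem_closedBall_zero_iff] at hz ⊢
    refine ⟨?_, by simp⟩
    simpa [prj] using (Complex.abs_re_le_norm z).trans hz
  · intro z hz h
    have h1 : z.im = 0 := Complex.conj_eq_iff_im.1 (by rw [one_mul] at hz; exact hz.symm)
    have hL : 0 ≤ L := (norm_nonneg _).trans (mem_closedBall_zero_iff.1 h)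
    have h2 : (z.re : ℂ) = z := Complex.ext rfl (by simp [h1])
    simp [prj, cen, h2, hL]
  · intro r h
    have hL : 0 ≤ L := (norm_nonneg _).trans (mem_closedBall_zero_iff.1 h)
    have : (2 * ((r : ℂ) + r) - 4 * r : ℂ) = 0 := by ring
    simp [prj, cen, hL, this]

section Lipschitz

variable [NeZero m] {N : Net m}

/-- A net of frequency `0` is Lipschitz if its edges are bounded. -/
theorem IsSym.norm_quad_le (hN : IsSym 1 N) {κ : Kind} (hκ : κ.Straight) {L : ℝ}
    (hB : HasEdges (Metric.closedBall 0 L) κ N) (h0 : ∀ s ∈ innermost (m := m) κ, N s = 0)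
    {x y : ℤ} (hx : 0 ≤ x) (hy : 0 ≤ y) (hp : κ.par x y) :
    ‖quad N x y‖ ≤ (x + y) * L := by
  have hL : 0 ≤ L := by
    rcases hκ with rfl | rfl
    · exact (norm_nonneg _).trans (mem_closedBall_zero_iff.1
        (hB 0 2 le_rfl (by norm_num) (by simp [Kind.par])))
    · exact (norm_nonneg _).trans (mem_closedBall_zero_iff.1
        (hB 1 1 (by norm_num) le_rfl (by simp [Kind.par])))
  have hb : ∀ b : ℤ, (b = 0 ∨ b = 1) → κ.par b b → quad N b b = 0 := by
    intro b hb hp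
    apply h0
    rw [innermost, mem_corners]
    refine ⟨?_, (isVertex_mk _ _ (by omega) _).2 hp⟩
    have := mk_mem_nbhd (0 : ZMod m) (x := 0) (y := 0) (x' := b) (y' := b) le_rfl (by omega)
      (by omega) (by omega)
    simpa using this
  -- descend along the `y`-edges
  have key : ∀ (b x : ℤ) (n : ℕ), 0 ≤ b → 0 ≤ x → κ.par x b →
      ‖quad N x (b + 2 * n)‖ ≤ ‖quad N x b‖ + n * L := by
    intro b x n hb hx hp
    induction n with
    | zero => simp
    | succ n ih =>
      have h1 := hB x (b + 2 * (n + 1 : ℕ)) hx (by omega)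
        (by rcases hκ with rfl | rfl <;> simp only [Kind.par] at * <;> omega)
      rw [mem_closedBall_zero_iff, edge,
        show b + 2 * ((n + 1 : ℕ) : ℤ) - 2 = b + 2 * n by push_cast; ring] at h1
      have := norm_sub_norm_le (quad N x (b + 2 * (n + 1 : ℕ))) (quad N x (b + 2 * n))
      push_cast at *
      linarith
  have main : ∀ b : ℤ, (b = 0 ∨ b = 1) → x % 2 = b → y % 2 = b → κ.par b b →
      ‖quad N x y‖ ≤ (x + y) * L := by
    intro b hb' ex ey hpb
    have hpar : ∀ x y, x % 2 = b → y % 2 = b → κ.par x y := by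
      intro x y ex ey
      rcases hκ with rfl | rfl <;> simp only [Kind.par] at * <;> omega
    obtain ⟨n, rfl⟩ : ∃ n : ℕ, y = b + 2 * n := ⟨(y / 2).toNat, by omega⟩
    obtain ⟨k, rfl⟩ : ∃ k : ℕ, x = b + 2 * k := ⟨(x / 2).toNat, by omega⟩
    have h1 := key b (b + 2 * k) n (by omega) hx (hpar _ _ ex (by omega))
    have h2 := key b b k (by omega) (by omega) hpb
    rw [hN.quad_swap (y := b) hx (by omega), one_mul, RCLike.norm_conj] at h1
    rw [hb b hb' hpb, norm_zero, zero_add] at h2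
    have : (0 : ℝ) ≤ b := by exact_mod_cast (by omega : 0 ≤ b)
    push_cast
    nlinarith [mul_nonneg (Nat.cast_nonneg (α := ℝ) n) hL,
      mul_nonneg (Nat.cast_nonneg (α := ℝ) k) hL, mul_nonneg this hL]
  rcases hκ with rfl | rfl
  · exact main 0 (Or.inl rfl) hp.1 hp.2 (by simp [Kind.par])
  · exact main 1 (Or.inr rfl) hp.1 hp.2 (by simp [Kind.par])

/-- Smooth functions of frequency `0` that vanish near the centre are multiplied by the scale of
the grid. -/
theorem norm_quad_run_le (hm : 3 ≤ m) {κ : Kind} (hκ : κ.Straight) {l : List Step}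
    (hl : Chain κ l κ) (hN : IsSym 1 N) (h1 : ∀ s, ‖N s‖ ≤ 1)
    (h0 : ∀ s ∈ innermost (m := m) κ, run l N s = 0) {x y : ℤ} (hx : 0 ≤ x) (hy : 0 ≤ y)
    (hp : κ.par x y) : ‖quad (run l N) x y‖ ≤ 2 * (x + y) * totalScale l := by
  have hB : HasEdges (Metric.closedBall 0 2) κ N := by
    intro x y _ _ _
    rw [mem_closedBall_zero_iff, edge]
    exact (norm_sub_le _ _).trans ((add_le_add (h1 _) (h1 _)).trans (by norm_num))
  have h2 := (adm_closedBall 2).hasEdges_run hm (by simp) hN hl hB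
  have hs := totalScale_pos l
  have h3 := ((hN.run l).smul (totalScale l)⁻¹).norm_quad_le hκ h2
    (fun s hs => by simp [h0 s hs]) hx hy hp
  have e : quad ((totalScale l)⁻¹ • run l N) x y =
      ((totalScale l)⁻¹ : ℝ) * quad (run l N) x y := by
    simp [quad]
  rw [e, norm_mul, Complex.norm_real, Real.norm_of_nonneg (by positivity),
    inv_mul_le_iff₀ hs] at h3
  linarith

end Lipschitz

/-! ### Positions of the vertices -/

/-- The distance of a point from the line orthogonal to `ζ`. -/
noncomputable def spoke (ζ : ℂ) : ℂ →ₗ[ℝ] ℝ :=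
  Complex.reLm ∘ₗ LinearMap.mulLeft ℝ ((starRingEnd ℂ) ζ)

theorem spoke_apply (ζ z : ℂ) : spoke ζ z = ((starRingEnd ℂ) ζ * z).re := rfl

/-- The two linear forms that define the wedge `{z | 0 ≤ wedgeForm ζ 0 z ∧ 0 ≤ wedgeForm ζ 1 z}`.
The half lines in the directions `1` and `ζ` lie in its interior. -/
noncomputable def wedgeForm (ζ : ℂ) : Fin 2 → ℂ →ₗ[ℝ] ℝ :=
  ![spoke ζ - (ζ.re / 2) • Complex.reLm, Complex.reLm - (ζ.re / 2) • spoke ζ]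

theorem wedgeForm_zero_apply (ζ z : ℂ) :
    wedgeForm ζ 0 z = spoke ζ z - ζ.re / 2 * z.re := rfl

theorem wedgeForm_one_apply (ζ z : ℂ) :
    wedgeForm ζ 1 z = z.re - ζ.re / 2 * spoke ζ z := rfl

/-- `ζ` is the direction of the diagonal of the segment `0` and `ω = ζ ^ 2` that of its second
spoke. -/
structure Bisects (ζ ω : ℂ) : Prop where
  norm : ζ.re ^ 2 + ζ.im ^ 2 = 1
  sq : ω = ζ ^ 2
  half_le : 1 / 2 ≤ ζ.re
  ne_one : ω ≠ 1

section Wedge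

variable {ζ ω : ℂ} (h : Bisects ζ ω)

include h

theorem Bisects.re_le_one : ζ.re ≤ 1 := by nlinarith [h.norm, sq_nonneg ζ.im]

theorem Bisects.mul_conj : ω * (starRingEnd ℂ) ω = 1 := by
  have : ζ * (starRingEnd ℂ) ζ = 1 := by
    rw [Complex.mul_conj, Complex.normSq_apply]
    norm_cast
    linarith [h.norm]
  rw [h.sq, map_pow, ← mul_pow, this, one_pow]

theorem Bisects.spoke_swap (w : ℂ) : spoke ζ (ω * (starRingEnd ℂ) w) = spoke ζ w := by
  have h1 := h.norm
  simp only [spoke_apply, h.sq, pow_two, Complex.mul_re, Complex.mul_im, Complex.conj_re,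
    Complex.conj_im]
  linear_combination (ζ.re * w.re + ζ.im * w.im) * h1

theorem Bisects.re_swap (w : ℂ) :
    (ω * (starRingEnd ℂ) w).re = 2 * ζ.re * spoke ζ w - w.re := by
  have h1 := h.norm
  simp only [spoke_apply, h.sq, pow_two, Complex.mul_re, Complex.mul_im, Complex.conj_re,
    Complex.conj_im]
  linear_combination -w.re * h1

omit h in
/-- The bounds on two linear forms `u`, `v` that follow from the position in the wedge; `C / 2`
is the slope of its sides. -/
theorem wedge_bounds {C u v : ℝ} (c1 : 1 / 2 ≤ C) (c2 : C ≤ 1) (h0 : 0 ≤ v - C / 2 * u)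
    (h1 : 0 ≤ u - C / 2 * v) : 0 ≤ u ∧ 0 ≤ v ∧ v ≤ 4 * u ∧ u ≤ 4 * v := by
  have hC : 0 ≤ C / 2 := by linarith
  have hC2 : 0 < 1 - C / 2 * (C / 2) := by nlinarith
  have hv : 0 ≤ v := by
    have : 0 ≤ (1 - C / 2 * (C / 2)) * v := by
      have := mul_nonneg hC h1
      linarith
    exact nonneg_of_mul_nonneg_right this hC2
  have hu : 0 ≤ u := by
    have := mul_nonneg hC hv
    linarith
  have e1 : 1 / 4 * u ≤ C / 2 * u := mul_le_mul_of_nonneg_right (by linarith) hu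
  have e2 : 1 / 4 * v ≤ C / 2 * v := mul_le_mul_of_nonneg_right (by linarith) hv
  exact ⟨hu, hv, by linarith, by linarith⟩

/-- Projecting a point of the wedge to the direction `1`. -/
theorem Bisects.wedgeForm_axis {w z : ℂ} (hw : ∀ j, 0 ≤ wedgeForm ζ j w) (hz : z.im = 0)
    (hre : z.re = w.re) (j : Fin 2) : 1 / 16 * wedgeForm ζ j w ≤ wedgeForm ζ j z := by
  have c1 := h.half_le
  have c2 := h.re_le_one
  obtain ⟨hu, hv, hvu, huv⟩ := wedge_bounds c1 c2 (hw 0) (hw 1)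
  simp only [Complex.reLm_coe] at hu hvu huv
  have hs : spoke ζ z = ζ.re * w.re := by simp [spoke_apply, hz, hre]
  have e1 : 1 / 2 * w.re ≤ ζ.re * w.re := mul_le_mul_of_nonneg_right c1 hu
  have e2 : ζ.re * (ζ.re * w.re) ≤ w.re := by nlinarith [mul_le_mul_of_nonneg_right c2 hu]
  have e3 : 0 ≤ ζ.re * spoke ζ w := mul_nonneg (by linarith) hv
  match j with
  | 0 => rw [wedgeForm_zero_apply, wedgeForm_zero_apply, hs, hre]; linarith
  | 1 => rw [wedgeForm_one_apply, wedgeForm_one_apply, hs, hre]; linarith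

/-- Projecting a point of the wedge to the direction `ζ`. -/
theorem Bisects.wedgeForm_diag {w z : ℂ} (hw : ∀ j, 0 ≤ wedgeForm ζ j w)
    (hz : z = ω * (starRingEnd ℂ) z) (hre : spoke ζ z = spoke ζ w) (j : Fin 2) :
    1 / 16 * wedgeForm ζ j w ≤ wedgeForm ζ j z := by
  have c1 := h.half_le
  have c2 := h.re_le_one
  obtain ⟨hu, hv, hvu, huv⟩ := wedge_bounds c1 c2 (hw 0) (hw 1)
  simp only [Complex.reLm_coe] at hu hvu huv
  have hs : z.re = ζ.re * spoke ζ w := by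
    have := h.re_swap z
    rw [← hz, hre] at this
    linarith
  have e1 : 1 / 2 * spoke ζ w ≤ ζ.re * spoke ζ w := mul_le_mul_of_nonneg_right c1 hv
  have e2 : ζ.re * (ζ.re * spoke ζ w) ≤ spoke ζ w := by
    nlinarith [mul_le_mul_of_nonneg_right c2 hv]
  have e3 : 0 ≤ ζ.re * w.re := mul_nonneg (by linarith) hu
  match j with
  | 0 => rw [wedgeForm_zero_apply, wedgeForm_zero_apply, hs, hre]; linarith
  | 1 => rw [wedgeForm_one_apply, wedgeForm_one_apply, hs, hre]; linarith

/-- The wedge is pointed. -/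
theorem Bisects.exists_norm_le : ∃ K, 0 < K ∧ ∀ w : ℂ, (∀ j, 0 ≤ wedgeForm ζ j w) →
    ‖w‖ ≤ K * (wedgeForm ζ 0 w + wedgeForm ζ 1 w) := by
  have c1 := h.half_le
  have c2 := h.re_le_one
  have hS : 0 < |ζ.im| := by
    rw [abs_pos]
    intro h0
    have h1 : ζ.re = 1 := by nlinarith [h.norm]
    apply h.ne_one
    rw [h.sq, show ζ = 1 from Complex.ext h1 h0, one_pow]
  refine ⟨2 * (1 + |ζ.im|⁻¹), by positivity, fun w hw => ?_⟩
  obtain ⟨hu, hv, -, -⟩ := wedge_bounds c1 c2 (hw 0) (hw 1)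
  simp only [Complex.reLm_coe] at hu
  have hsp : spoke ζ w = ζ.re * w.re + ζ.im * w.im := by
    simp [spoke_apply]
  have hu1 : ζ.re * w.re ≤ w.re := by nlinarith
  have hv1 : ζ.re * spoke ζ w ≤ spoke ζ w := by nlinarith
  have hu0 : 0 ≤ ζ.re * w.re := mul_nonneg (by linarith) hu
  have him : |w.im| ≤ |ζ.im|⁻¹ * (w.re + spoke ζ w) := by
    rw [← div_eq_inv_mul, le_div_iff₀ hS, ← abs_mul, mul_comm, abs_le]
    constructor <;> linarith
  have h1 := Complex.norm_le_abs_re_add_abs_im w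
  rw [abs_of_nonneg hu] at h1
  have h2 : w.re + spoke ζ w ≤ 2 * (wedgeForm ζ 0 w + wedgeForm ζ 1 w) := by
    rw [wedgeForm_zero_apply, wedgeForm_one_apply]; linarith
  have h3 : 0 ≤ 1 + |ζ.im|⁻¹ := by positivity
  have h4 := mul_le_mul_of_nonneg_left h2 h3
  calc ‖w‖ ≤ (1 + |ζ.im|⁻¹) * (w.re + spoke ζ w) := by linarith
    _ ≤ _ := by linarith

end Wedge

/-! ### Representatives of the vertices in a fundamental domain -/

/-- The representative of a point under the reflections at the axis and the diagonal. -/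
def fold (p : ℤ × ℤ) : ℤ × ℤ := (max |p.1| |p.2|, min |p.1| |p.2|)

theorem fold_of_le {x y : ℤ} (hy : 0 ≤ y) (h : y ≤ x) : fold (x, y) = (x, y) := by
  simp [fold, abs_of_nonneg hy, abs_of_nonneg (hy.trans h), h]

/-- The labels of the vertices in the fundamental domain of the symmetry group. -/
def Kind.IsRep (κ : Kind) (q : ℤ × ℤ) : Prop := 1 ≤ q.1 ∧ 0 ≤ q.2 ∧ q.2 ≤ q.1 ∧ κ.par q.1 q.2

/-- A vertex next to the centre. -/
def centralRep : Kind → ℤ × ℤ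
  | .primal => (2, 0)
  | .dual => (1, 1)
  | .rotDual => (1, 0)
  | .rotPrimal => (1, 1)

theorem isRep_centralRep (κ : Kind) : κ.IsRep (centralRep κ) := by
  cases κ <;> simp [Kind.IsRep, centralRep, Kind.par]

theorem Kind.par_fold {κ : Kind} {x y : ℤ} (h : κ.par x y) :
    κ.par (fold (x, y)).1 (fold (x, y)).2 := by
  rcases abs_cases x with ⟨hx, _⟩ | ⟨hx, _⟩ <;> rcases abs_cases y with ⟨hy, _⟩ | ⟨hy, _⟩ <;>
  cases κ <;> simp only [Kind.par, fold, hx, hy] at * <;> omega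

theorem Kind.isRep_fold {κ : Kind} {x y : ℤ} (h : κ.par x y) (h0 : fold (x, y) ≠ (0, 0)) :
    κ.IsRep (fold (x, y)) := by
  refine ⟨?_, ?_, ?_, Kind.par_fold h⟩
  · simp only [fold, ne_eq, Prod.mk.injEq] at h0 ⊢
    have := abs_nonneg x
    have := abs_nonneg y
    omega
  · simp [fold]
  · simp [fold]

theorem Step.par_pre {st : Step} (hv : st.Valid) {x y : ℤ} (hp : st.tgt.par x y) (i : Fin 4) :
    st.src.par (st.pre x y i).1 (st.pre x y i).2 := by
  rcases st with (_ | _ | _ | _) | κ | κ | κ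
  · fin_cases i <;>
      simp [Step.tgt, Step.src, Kind.swap, Kind.par, Step.pre, fillPre, Kind.off] at * <;> omega
  · fin_cases i <;>
      simp [Step.tgt, Step.src, Kind.swap, Kind.par, Step.pre, fillPre, Kind.off] at * <;> omega
  · fin_cases i <;> simp [Step.tgt, Step.src, Kind.swap, Kind.par, Step.pre, rotPre] at * <;> omega
  · fin_cases i <;> simp [Step.tgt, Step.src, Kind.swap, Kind.par, Step.pre, rotPre] at * <;> omega
  · rcases hv with rfl | rfl <;>
    fin_cases i <;> simp [Step.tgt, Step.src, Kind.par, Step.pre, fillPre, Kind.off] at * <;> omega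
  · rcases hv with rfl | rfl <;>
    fin_cases i <;> simp [Step.tgt, Step.src, Kind.par, Step.pre, fillPre, Kind.off] at * <;> omega
  · rcases hv with rfl | rfl <;>
    fin_cases i <;> simp [Step.tgt, Step.src, Kind.par, Step.pre, edgePre, Kind.diag] at * <;> omega

/-- Old vertices leave the fundamental domain only where the new vertex is on its boundary. -/
theorem Step.pre_position {st : Step} (hv : st.Valid) {x y : ℤ} (h : st.tgt.IsRep (x, y))
    (i : Fin 4) : 0 ≤ (st.pre x y i).1 ∧ (0 < y → 0 ≤ (st.pre x y i).2) ∧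
      (y < x → |(st.pre x y i).2| ≤ (st.pre x y i).1) := by
  obtain ⟨h1, h2, h3, hp⟩ := h
  simp only at h1 h2 h3 hp
  refine ⟨Step.pre_fst_nonneg h1 hp i, ?_⟩
  rw [abs_le]
  rcases st with (_ | _ | _ | _) | κ | κ | κ
  · fin_cases i <;> simp [Step.tgt, Kind.swap, Kind.par, Step.pre, fillPre, Kind.off] at * <;> omega
  · fin_cases i <;> simp [Step.tgt, Kind.swap, Kind.par, Step.pre, fillPre, Kind.off] at * <;> omega
  · fin_cases i <;> simp [Step.tgt, Kind.swap, Kind.par, Step.pre, rotPre] at * <;> omega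
  · fin_cases i <;> simp [Step.tgt, Kind.swap, Kind.par, Step.pre, rotPre] at * <;> omega
  · rcases hv with rfl | rfl <;>
    fin_cases i <;> simp [Step.tgt, Kind.par, Step.pre, fillPre, Kind.off] at * <;> omega
  · rcases hv with rfl | rfl <;>
    fin_cases i <;> simp [Step.tgt, Kind.par, Step.pre, fillPre, Kind.off] at * <;> omega
  · rcases hv with rfl | rfl <;>
    fin_cases i <;> simp [Step.tgt, Kind.par, Step.pre, edgePre, Kind.diag] at * <;> omega

section StepWedge

variable [NeZero m] {ζ ω : ℂ} {N : Net m}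

/-- All vertices of the fundamental domain lie in the wedge. -/
def InWedge (ζ : ℂ) (κ : Kind) (N : Net m) : Prop :=
  ∀ q, κ.IsRep q → ∀ j, 0 ≤ wedgeForm ζ j (quad N q.1 q.2)

omit [NeZero m] in
theorem Bisects.wedgeForm_fold_nonneg (h : Bisects ζ ω) (hN : IsSym ω N) {κ : Kind}
    (hW : InWedge ζ κ N) {x y : ℤ} (hp : κ.par x y) (j : Fin 2) :
    0 ≤ wedgeForm ζ j (quad N (fold (x, y)).1 (fold (x, y)).2) := by
  by_cases h0 : fold (x, y) = (0, 0)
  · rw [h0, quad_zero_zero, hN.center h.ne_one, map_zero]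
  · exact hW _ (Kind.isRep_fold hp h0) j

/-- A new vertex is the projection of the mean of the representatives of old vertices. -/
theorem Bisects.exists_wedge_mean (hm : 3 ≤ m) (h : Bisects ζ ω) (hN : IsSym ω N) {st : Step}
    (hv : st.Valid) {x y : ℤ} (hq : st.tgt.IsRep (x, y)) :
    let w := 1 / 4 * ∑ i, quad N (fold (st.pre x y i)).1 (fold (st.pre x y i)).2
    let z := quad (st.op N) x y
    z = w ∨ (y = 0 ∧ z.im = 0 ∧ z.re = w.re) ∨
      (y = x ∧ z = ω * (starRingEnd ℂ) z ∧ spoke ζ z = spoke ζ w) := by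
  intro w z
  obtain ⟨h1, h2, h3, hp⟩ := id hq
  simp only at h1 h2 h3 hp
  have hz : z = 1 / 4 * ∑ i, quad N (st.pre x y i).1 (st.pre x y i).2 :=
    Step.quad_op hm hv N h1 h2 hp
  have pos := Step.pre_position hv hq
  rcases h2.eq_or_lt with rfl | hy
  · refine Or.inr (Or.inl ⟨rfl, (hN.op st).quad_axis (by omega), ?_⟩)
    have e : ∀ i, (quad N (st.pre x 0 i).1 (st.pre x 0 i).2).re =
        (quad N (fold (st.pre x 0 i)).1 (fold (st.pre x 0 i)).2).re := by
      intro i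
      obtain ⟨p1, -, p3⟩ := pos i
      have p3 := p3 (by omega)
      rw [fold, abs_of_nonneg p1, max_eq_left p3, min_eq_right p3]
      rcases abs_cases (st.pre x 0 i).2 with ⟨e, _⟩ | ⟨e, _⟩
      · rw [e]
      · rw [e, hN.quad_neg p1, Complex.conj_re]
    have e4 : ∀ z : ℂ, (1 / 4 * z : ℂ).re = 1 / 4 * z.re := fun z => by
      rw [show (1 / 4 : ℂ) = ((1 / 4 : ℝ) : ℂ) by push_cast; rfl, Complex.re_ofReal_mul]
    rw [hz, e4, e4, Complex.re_sum, Complex.re_sum]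
    simp only [e]
  rcases h3.eq_or_lt with rfl | hlt
  · have hsw : z = ω * (starRingEnd ℂ) z := (hN.op st).quad_swap (by omega) (by omega)
    refine Or.inr (Or.inr ⟨rfl, hsw, ?_⟩)
    have e : ∀ i, spoke ζ (quad N (st.pre y y i).1 (st.pre y y i).2) =
        spoke ζ (quad N (fold (st.pre y y i)).1 (fold (st.pre y y i)).2) := by
      intro i
      obtain ⟨p1, p2, -⟩ := pos i
      have p2 := p2 hy
      rw [fold, abs_of_nonneg p1, abs_of_nonneg p2]
      rcases le_total (st.pre y y i).2 (st.pre y y i).1 with hle | hle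
      · rw [max_eq_left hle, min_eq_right hle]
      · rw [max_eq_right hle, min_eq_left hle, hN.quad_swap p2 p1, h.spoke_swap]
    have e4 : ∀ z : ℂ, spoke ζ (1 / 4 * z : ℂ) = 1 / 4 * spoke ζ z := fun z => by
      rw [show (1 / 4 * z : ℂ) = (1 / 4 : ℝ) • z by rw [Complex.real_smul]; push_cast; rfl,
        map_smul, smul_eq_mul]
    rw [hz, e4, e4, map_sum, map_sum]
    simp only [e]
  · left
    rw [hz]
    congr 1
    refine Finset.sum_congr rfl fun i _ => ?_
    obtain ⟨-, p2, p3⟩ := pos i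
    have p3 := p3 hlt
    have p2 := p2 hy
    rw [abs_of_nonneg p2] at p3
    rw [show st.pre x y i = ((st.pre x y i).1, (st.pre x y i).2) from rfl, fold_of_le p2 p3]

/-- Steps preserve the wedge, and a new vertex is inside of it if one of the representatives of
the old vertices is. -/
theorem Bisects.wedge_step (hm : 3 ≤ m) (h : Bisects ζ ω) (hN : IsSym ω N) {st : Step}
    (hv : st.Valid) (hW : InWedge ζ st.src N) {q : ℤ × ℤ} (hq : st.tgt.IsRep q) (i : Fin 4)
    (j : Fin 2) :
    1 / 64 * wedgeForm ζ j (quad N (fold (st.pre q.1 q.2 i)).1 (fold (st.pre q.1 q.2 i)).2) ≤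
      wedgeForm ζ j (quad (st.op N) q.1 q.2) := by
  have hnn : ∀ i j, 0 ≤ wedgeForm ζ j
      (quad N (fold (st.pre q.1 q.2 i)).1 (fold (st.pre q.1 q.2 i)).2) := fun i j =>
    h.wedgeForm_fold_nonneg hN hW (Step.par_pre hv hq.2.2.2 i) j
  have e4 : ∀ j (z : ℂ), wedgeForm ζ j (1 / 4 * z : ℂ) = 1 / 4 * wedgeForm ζ j z := fun j z => by
    rw [show (1 / 4 * z : ℂ) = (1 / 4 : ℝ) • z by rw [Complex.real_smul]; push_cast; rfl,
      map_smul, smul_eq_mul]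
  have hmean := h.exists_wedge_mean hm hN hv (x := q.1) (y := q.2) hq
  simp only at hmean
  generalize hw : (1 / 4 * ∑ i, quad N (fold (st.pre q.1 q.2 i)).1
    (fold (st.pre q.1 q.2 i)).2 : ℂ) = w at hmean
  have hw4 : ∀ j, wedgeForm ζ j w = 1 / 4 * ∑ i, wedgeForm ζ j
      (quad N (fold (st.pre q.1 q.2 i)).1 (fold (st.pre q.1 q.2 i)).2) := by
    intro j; rw [← hw, e4, map_sum]
  have hw0 : ∀ j, 0 ≤ wedgeForm ζ j w := fun j => by
    rw [hw4]; exact mul_nonneg (by norm_num) (Finset.sum_nonneg fun i _ => hnn i j)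
  have hle : 1 / 4 * wedgeForm ζ j (quad N (fold (st.pre q.1 q.2 i)).1
      (fold (st.pre q.1 q.2 i)).2) ≤ wedgeForm ζ j w := by
    rw [hw4]
    exact mul_le_mul_of_nonneg_left
      (Finset.single_le_sum (f := fun i => wedgeForm ζ j (quad N (fold (st.pre q.1 q.2 i)).1
        (fold (st.pre q.1 q.2 i)).2)) (fun i _ => hnn i j) (Finset.mem_univ i)) (by norm_num)
  have h16 : 1 / 16 * wedgeForm ζ j w ≤ wedgeForm ζ j (quad (st.op N) q.1 q.2) := by
    rcases hmean with e | ⟨-, e1, e2⟩ | ⟨-, e1, e2⟩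
    · rw [e]; linarith [hw0 j]
    · exact h.wedgeForm_axis hw0 e1 e2 j
    · exact h.wedgeForm_diag hw0 e1 e2 j
  linarith

theorem Bisects.inWedge_op (hm : 3 ≤ m) (h : Bisects ζ ω) (hN : IsSym ω N) {st : Step}
    (hv : st.Valid) (hW : InWedge ζ st.src N) : InWedge ζ st.tgt (st.op N) := by
  intro q hq j
  have h1 := h.wedge_step hm hN hv hW hq 0 j
  have h2 := h.wedgeForm_fold_nonneg hN hW (Step.par_pre hv hq.2.2.2 0) j
  linarith

/-- Symmetric nets whose vertices lie in the wedge keep this property under all steps. -/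
theorem Bisects.inWedge_run (hm : 3 ≤ m) (h : Bisects ζ ω) (hN : IsSym ω N) {l : List Step}
    {κ κ' : Kind} (hl : Chain κ l κ') (hW : InWedge ζ κ N) : InWedge ζ κ' (run l N) := by
  induction l generalizing κ' with
  | nil => obtain rfl : κ' = κ := hl; exact hW
  | cons st l ih =>
    obtain ⟨hv, rfl, hl⟩ := hl
    exact h.inWedge_op hm (hN.run l) hv (ih hl)

end StepWedge

/-! ### Dependence of vertices -/

/-- The representative `q` of a new vertex depends on the representative `q'` of an old vertex. -/
def Step.Dep (st : Step) (q q' : ℤ × ℤ) : Prop := ∃ i, fold (st.pre q.1 q.2 i) = q'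

theorem Step.dep_centralRep {st : Step} (hv : st.Valid) :
    st.Dep (centralRep st.tgt) (centralRep st.src) := by
  rcases st with (_ | _ | _ | _) | κ | κ | κ
  · exact ⟨1, by
      simp [Step.tgt, Step.src, Kind.swap, centralRep, Step.pre, fillPre, Kind.off, fold]⟩
  · exact ⟨2, by
      simp [Step.tgt, Step.src, Kind.swap, centralRep, Step.pre, fillPre, Kind.off, fold]⟩
  · exact ⟨2, by simp [Step.tgt, Step.src, Kind.swap, centralRep, Step.pre, rotPre, fold]⟩
  · exact ⟨3, by simp [Step.tgt, Step.src, Kind.swap, centralRep, Step.pre, rotPre, fold]⟩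
  · rcases hv with rfl | rfl <;>
    exact ⟨0, by simp [Step.tgt, Step.src, centralRep, Step.pre, fillPre, Kind.off, fold]⟩
  · rcases hv with rfl | rfl <;>
    exact ⟨0, by simp [Step.tgt, Step.src, centralRep, Step.pre, fillPre, Kind.off, fold]⟩
  · rcases hv with rfl | rfl
    · exact ⟨1, by simp [Step.tgt, Step.src, centralRep, Step.pre, edgePre, Kind.diag, fold]⟩
    · exact ⟨0, by simp [Step.tgt, Step.src, centralRep, Step.pre, edgePre, Kind.diag, fold]⟩

/-- Vertices that depend on the centre also depend on the vertices next to it. -/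
theorem Step.dep_centralRep_of_center {st : Step} (hv : st.Valid) {x y : ℤ}
    (hq : st.tgt.IsRep (x, y)) (h0 : st.Dep (x, y) (0, 0)) :
    st.Dep (x, y) (centralRep st.src) := by
  obtain ⟨h1, h2, h3, hp⟩ := hq
  simp only at h1 h2 h3 hp
  obtain ⟨i, hi⟩ := h0
  have hi1 : (st.pre x y i).1 = 0 ∧ (st.pre x y i).2 = 0 := by
    simp only [fold, Prod.mk.injEq] at hi
    have a1 := abs_nonneg (st.pre x y i).1
    have a2 := abs_nonneg (st.pre x y i).2
    constructor <;> apply abs_eq_zero.1 <;> omega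
  rcases st with (_ | _ | _ | _) | κ | κ | κ
  · obtain ⟨rfl, rfl⟩ : x = 1 ∧ y = 1 := by
      fin_cases i <;>
        simp [Step.tgt, Kind.swap, Kind.par, Step.pre, fillPre, Kind.off] at * <;> omega
    exact Step.dep_centralRep hv
  · exfalso
    fin_cases i <;> simp [Step.tgt, Kind.swap, Kind.par, Step.pre, fillPre, Kind.off] at * <;> omega
  · obtain ⟨rfl, rfl⟩ : x = 1 ∧ y = 0 := by
      fin_cases i <;> simp [Step.tgt, Kind.swap, Kind.par, Step.pre, rotPre] at * <;> omega
    exact Step.dep_centralRep hv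
  · exfalso
    fin_cases i <;> simp [Step.tgt, Kind.swap, Kind.par, Step.pre, rotPre] at * <;> omega
  · rcases hv with rfl | rfl
    · obtain ⟨rfl, rfl⟩ | ⟨rfl, rfl⟩ : x = 2 ∧ y = 0 ∨ x = 2 ∧ y = 2 := by
        fin_cases i <;> simp [Step.tgt, Kind.par, Step.pre, fillPre, Kind.off] at * <;> omega
      · exact Step.dep_centralRep (st := .R .primal) (Or.inl rfl)
      · exact ⟨1, by simp [Step.src, centralRep, Step.pre, fillPre, Kind.off, fold]⟩
    · exfalso
      fin_cases i <;> simp [Step.tgt, Kind.par, Step.pre, fillPre, Kind.off] at * <;> omega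
  · rcases hv with rfl | rfl
    · obtain ⟨rfl, rfl⟩ : x = 1 ∧ y = 0 := by
        fin_cases i <;> simp [Step.tgt, Kind.par, Step.pre, fillPre, Kind.off] at * <;> omega
      exact Step.dep_centralRep (st := .V .primal) (Or.inl rfl)
    · exfalso
      fin_cases i <;> simp [Step.tgt, Kind.par, Step.pre, fillPre, Kind.off] at * <;> omega
  · rcases hv with rfl | rfl
    · obtain ⟨rfl, rfl⟩ : x = 1 ∧ y = 1 := by
        fin_cases i <;> simp [Step.tgt, Kind.par, Step.pre, edgePre, Kind.diag] at * <;> omega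
      exact Step.dep_centralRep (st := .W .rotPrimal) (Or.inl rfl)
    · exfalso
      fin_cases i <;> simp [Step.tgt, Kind.par, Step.pre, edgePre, Kind.diag] at * <;> omega

/-- The representative of a vertex under the symmetry group; the centre, where nets of frequency
`1` vanish, is represented by a vertex next to it. -/
def Site.rep (κ : Kind) : Site m → ℤ × ℤ
  | .center => centralRep κ
  | .pt _ a b => fold ((a : ℤ) + 1, (b : ℤ))

theorem fold_swap (x y : ℤ) : fold (y, x) = fold (x, y) := by
  simp [fold, max_comm, min_comm]

theorem fold_neg (x y : ℤ) : fold (x, -y) = fold (x, y) := by simp [fold]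

theorem Site.rep_mk (κ : Kind) (l : ZMod m) {x y : ℤ} (hx : 0 ≤ x) (h : x ≠ 0 ∨ y ≠ 0) :
    (Site.mk l x y).rep κ = fold (x, y) := by
  rcases lt_trichotomy y 0 with hy | rfl | hy
  · rw [Site.mk_of_neg l hx hy, Site.rep, ← fold_neg x y, ← fold_swap x (-y)]
    congr 2 <;> omega
  · rw [Site.mk_of_pos l (by omega) le_rfl, Site.rep]
    congr 2; omega
  · rcases hx.eq_or_lt with rfl | hx
    · rw [Site.mk_of_nonpos l le_rfl hy, Site.rep, ← fold_swap 0 y]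
      congr 2; omega
    · rw [Site.mk_of_pos l hx hy.le, Site.rep]
      congr 2 <;> omega

theorem Site.rep_reflect (κ : Kind) (s : Site m) : s.reflect.rep κ = s.rep κ := by
  cases s with
  | center => rfl
  | pt l a b =>
    rw [Site.pt_eq_mk, Site.reflect_mk _ (by omega), Site.rep_mk _ _ (by omega) (by omega),
      Site.rep_mk _ _ (by omega) (by omega), fold_neg]

theorem Site.isRep_rep {κ : Kind} {s : Site m} (h : IsVertex κ s) : κ.IsRep (s.rep κ) := by
  rcases s.exists_mk with rfl | ⟨l, x, y, hx, hy, rfl⟩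
  · exact isRep_centralRep κ
  · rw [Site.rep_mk _ _ (by omega) (by omega)]
    refine Kind.isRep_fold ((isVertex_mk _ _ (by omega) _).1 h) fun h => ?_
    simp only [fold, Prod.mk.injEq, abs_of_nonneg hy, abs_of_nonneg (by omega : 0 ≤ x)] at h
    omega

theorem Site.rep_center (κ : Kind) : (Site.center : Site m).rep κ = centralRep κ := rfl

section Dep

variable [NeZero m]

theorem Step.isVertex_of_mem_supp {st : Step} {s t : Site m} (h : t ∈ st.supp s) :
    IsVertex st.tgt s := by
  by_contra hs
  rw [Step.supp, if_neg hs] at h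
  simp at h

theorem Step.rep_of_mem_supp_center {st : Step} (hv : st.Valid) {t : Site m}
    (h : t ∈ st.supp .center) : t.rep st.src = centralRep st.src := by
  have hc := Step.isVertex_of_mem_supp h
  rw [Step.supp, if_pos hc] at h
  have key : ∀ κ : Kind, κ ≠ .rotPrimal → t ∈ corners κ .center → t.rep κ = centralRep κ := by
    intro κ hκ ht
    rw [mem_corners, mem_nbhd_center] at ht
    obtain ⟨rfl | ⟨l, rfl | rfl⟩, hp⟩ := ht
    · rfl
    · rw [isVertex_mk _ _ (by norm_num)] at hp
      rw [Site.rep_mk _ _ (by norm_num) (by norm_num)]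
      cases κ <;> simp [Kind.par, fold, centralRep] at *
    · rw [isVertex_mk _ _ (by norm_num)] at hp
      rw [Site.rep_mk _ _ (by norm_num) (by norm_num)]
      cases κ <;> simp [Kind.par, fold, centralRep] at *
  rcases st with κ | κ | κ | κ
  · refine key κ ?_ h
    rintro rfl
    simp [Step.tgt, Kind.swap, IsVertex, Kind.parity] at hc
  · refine key κ ?_ h
    rcases hv with rfl | rfl <;> simp
  · simp [Step.tgt, IsVertex, Kind.parity] at hc
  · simp [Step.tgt, IsVertex, Kind.parity] at hc

/-- If a new vertex depends on an old one, so do their representatives. -/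
theorem Step.dep_rep {st : Step} (hv : st.Valid) {s t : Site m} (h : t ∈ st.supp s) :
    st.Dep (s.rep st.tgt) (t.rep st.src) := by
  have main : ∀ (l : ZMod m) (x y : ℤ) (t : Site m), 1 ≤ x → 0 ≤ y → y ≤ x →
      t ∈ st.supp (Site.mk l x y) → st.Dep ((Site.mk l x y).rep st.tgt) (t.rep st.src) := by
    intro l x y t hx hy hyx ht
    have hs := Step.isVertex_of_mem_supp ht
    have hr := Site.isRep_rep hs
    have hp := (isVertex_mk _ l (by omega) y).1 hs
    rw [Step.mem_supp_mk hv l hx hy hp] at ht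
    obtain ⟨i, rfl⟩ := ht
    rw [Site.rep_mk _ _ (by omega) (by omega), fold_of_le hy hyx] at hr ⊢
    have h0 := Step.pre_fst_nonneg hx hp i
    by_cases hz : (st.pre x y i).1 ≠ 0 ∨ (st.pre x y i).2 ≠ 0
    · rw [Site.rep_mk _ _ h0 hz]
      exact ⟨i, rfl⟩
    · push Not at hz
      rw [hz.1, hz.2, Site.mk_zero_zero, Site.rep_center]
      refine Step.dep_centralRep_of_center hv hr ⟨i, ?_⟩
      simp [fold, hz]
  rcases s.exists_mk with rfl | ⟨l, x, y, hx, hy, rfl⟩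
  · rw [Step.rep_of_mem_supp_center hv h]
    exact Step.dep_centralRep hv
  · rcases le_total y x with hle | hle
    · exact main l x y t hx hy hle h
    · have h' := Step.reflect_mem_supp.2 h
      rw [Site.reflect_mk_swap _ (by omega) hy] at h'
      have := main _ y x _ (by omega) (by omega) hle h'
      rwa [← Site.reflect_mk_swap l (by omega) hy, Site.rep_reflect, Site.rep_reflect] at this

/-- A measure of the distance of a vertex from the centre. -/
def vertexDist : Kind → ℤ × ℤ → ℤ
  | .primal, (x, y) => x + y + if y = 0 then 1 else 0
  | .dual, (x, y) => x + y + if x + y = 2 then 1 else 0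
  | .rotDual, (x, y) => x + y + 1 + if x + y = 1 then 1 else 0
  | .rotPrimal, (x, y) => x + y + if x + y = 2 then 1 else 0

theorem eq_centralRep {κ : Kind} (hκ : κ.Straight) {q : ℤ × ℤ} (h : κ.IsRep q)
    (h3 : vertexDist κ q ≤ 3) : q = centralRep κ := by
  obtain ⟨x, y⟩ := q
  obtain ⟨h1, h2, h4, hp⟩ := h
  simp only at h1 h2 h4
  rcases hκ with rfl | rfl <;>
    simp only [Kind.par, vertexDist, centralRep, Prod.mk.injEq] at * <;> split_ifs at h3 <;> omega

/-- Every vertex depends on a vertex that is nearer to the centre. -/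
theorem Step.exists_dep {st : Step} (hv : st.Valid) {x y : ℤ} (hq : st.tgt.IsRep (x, y)) :
    ∃ q', st.src.IsRep q' ∧ st.Dep (x, y) q' ∧
      vertexDist st.src q' ≤ max 3 (vertexDist st.tgt (x, y) - st.gain) := by
  obtain ⟨h1, h2, h3, hp⟩ := id hq
  simp only at h1 h2 h3 hp
  -- it suffices to choose one of the old vertices
  have key : ∀ i : Fin 4, 0 ≤ (st.pre x y i).2 → (st.pre x y i).2 ≤ (st.pre x y i).1 →
      1 ≤ (st.pre x y i).1 →
      vertexDist st.src (st.pre x y i) ≤ max 3 (vertexDist st.tgt (x, y) - st.gain) →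
      ∃ q', st.src.IsRep q' ∧ st.Dep (x, y) q' ∧
        vertexDist st.src q' ≤ max 3 (vertexDist st.tgt (x, y) - st.gain) :=
    fun i a b c d => ⟨st.pre x y i, ⟨c, a, b, Step.par_pre hv hp i⟩, ⟨i, fold_of_le a b⟩, d⟩
  have hcen : (x, y) = centralRep st.tgt → vertexDist st.src (centralRep st.src) ≤ 3 →
      ∃ q', st.src.IsRep q' ∧ st.Dep (x, y) q' ∧
        vertexDist st.src q' ≤ max 3 (vertexDist st.tgt (x, y) - st.gain) := by
    intro h h3
    exact ⟨centralRep st.src, isRep_centralRep _, by rw [h]; exact Step.dep_centralRep hv,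
      h3.trans (le_max_left _ _)⟩
  rcases st with (_ | _ | _ | _) | κ | κ | κ
  · simp only [Step.tgt, Step.src, Kind.swap, Kind.par, vertexDist, Step.pre, fillPre, Kind.off,
      Step.gain] at *
    by_cases h : x = 1
    · exact hcen (by simp [centralRep]; omega) (by simp [centralRep])
    · refine key 3 ?_ ?_ ?_ ?_ <;> simp <;> omega
  · simp only [Step.tgt, Step.src, Kind.swap, Kind.par, vertexDist, Step.pre, fillPre, Kind.off,
      Step.gain] at *
    by_cases h : y = 0
    · refine key 2 ?_ ?_ ?_ ?_ <;> simp <;> omega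
    · refine key 3 ?_ ?_ ?_ ?_ <;> simp <;> omega
  · simp only [Step.tgt, Step.src, Kind.swap, Kind.par, vertexDist, Step.pre, rotPre,
      Step.gain] at *
    by_cases h : x = 1
    · exact hcen (by simp [centralRep]; omega) (by simp [centralRep])
    · by_cases hy : y = 0
      · refine key 1 ?_ ?_ ?_ ?_ <;> simp <;> omega
      · refine key 3 ?_ ?_ ?_ ?_ <;> simp <;> omega
  · simp only [Step.tgt, Step.src, Kind.swap, Kind.par, vertexDist, Step.pre, rotPre,
      Step.gain] at *
    by_cases hy : y = 0
    · refine key 1 ?_ ?_ ?_ ?_ <;> simp <;> omega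
    · refine key 3 ?_ ?_ ?_ ?_ <;> simp <;> omega
  · rcases hv with rfl | rfl
    · simp only [Step.tgt, Step.src, Kind.par, vertexDist, Step.pre, fillPre, Kind.off,
        Step.gain] at *
      by_cases h : x / 2 = 1
      · by_cases hy : y = 0
        · exact hcen (by simp [centralRep]; omega) (by simp [centralRep])
        · refine key 1 ?_ ?_ ?_ ?_ <;> simp <;> omega
      · refine key 3 ?_ ?_ ?_ ?_ <;> simp <;> omega
    · simp only [Step.tgt, Step.src, Kind.par, vertexDist, Step.pre, fillPre, Kind.off,
        Step.gain] at *
      by_cases h : y = 0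
      · refine key 2 ?_ ?_ ?_ ?_ <;> simp <;> omega
      · refine key 3 ?_ ?_ ?_ ?_ <;> simp <;> omega
  · rcases hv with rfl | rfl
    · simp only [Step.tgt, Step.src, Kind.par, vertexDist, Step.pre, fillPre, Kind.off,
        Step.gain] at *
      by_cases h : x = 1
      · exact hcen (by simp [centralRep]; omega) (by simp [centralRep])
      · refine key 3 ?_ ?_ ?_ ?_ <;> simp <;> omega
    · simp only [Step.tgt, Step.src, Kind.par, vertexDist, Step.pre, fillPre, Kind.off,
        Step.gain] at *
      by_cases h : y = 0
      · refine key 2 ?_ ?_ ?_ ?_ <;> simp <;> omega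
      · refine key 3 ?_ ?_ ?_ ?_ <;> simp <;> omega
  · rcases hv with rfl | rfl
    · simp only [Step.tgt, Step.src, Kind.par, vertexDist, Step.pre, edgePre, Kind.diag,
        Step.gain] at *
      by_cases h : x = 1
      · exact hcen (by simp [centralRep]; omega) (by simp [centralRep])
      · refine key 0 ?_ ?_ ?_ ?_ <;> simp <;> omega
    · simp only [Step.tgt, Step.src, Kind.par, vertexDist, Step.pre, edgePre, Kind.diag,
        Step.gain] at *
      refine key 0 ?_ ?_ ?_ ?_ <;> simp <;> omega

/-- `q` depends on `q'` through a list of steps. -/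
def Reach : List Step → ℤ × ℤ → ℤ × ℤ → Prop
  | [], q, q' => q = q'
  | st :: l, q, q' => ∃ q₁, st.src.IsRep q₁ ∧ st.Dep q q₁ ∧ Reach l q₁ q'

theorem reach_rep {l : List Step} {κ κ' : Kind} (hl : Chain κ l κ') {s t : Site m}
    (ht : IsVertex κ t) (h : t ∈ support l s) :
    Reach l (s.rep κ') (t.rep κ) ∧ IsVertex κ' s := by
  induction l generalizing κ' s with
  | nil =>
    obtain rfl : κ' = κ := hl
    obtain rfl : t = s := by simpa [support] using h
    exact ⟨rfl, ht⟩
  | cons st l ih =>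
    obtain ⟨hv, rfl, hl⟩ := hl
    obtain ⟨s₁, h1, h2⟩ := mem_support_cons.1 h
    obtain ⟨h3, h4⟩ := ih hl h2
    exact ⟨⟨_, Site.isRep_rep h4, Step.dep_rep hv h1, h3⟩, Step.isVertex_of_mem_supp h1⟩

theorem exists_reach {l : List Step} {κ κ' : Kind} (hl : Chain κ l κ') {q : ℤ × ℤ}
    (hq : κ'.IsRep q) :
    ∃ q', κ.IsRep q' ∧ Reach l q q' ∧
      vertexDist κ q' ≤ max 3 (vertexDist κ' q - totalGain l) := by
  induction l generalizing κ' q with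
  | nil =>
    obtain rfl : κ' = κ := hl
    exact ⟨q, hq, rfl, by simp [totalGain]⟩
  | cons st l ih =>
    obtain ⟨hv, rfl, hl⟩ := hl
    obtain ⟨q₁, h1, h2, h3⟩ := Step.exists_dep hv (x := q.1) (y := q.2) hq
    obtain ⟨q', h4, h5, h6⟩ := ih hl h1
    refine ⟨q', h4, ⟨q₁, h1, h2, h5⟩, h6.trans ?_⟩
    have : 0 ≤ totalGain l := by
      apply List.sum_nonneg
      intro a ha
      obtain ⟨st, -, rfl⟩ := List.mem_map.1 ha
      exact st.gain_nonneg
    have e : totalGain (st :: l) = st.gain + totalGain l := by simp [totalGain]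
    rw [e]
    simp only [Prod.mk.eta] at h3
    omega

/-- After sufficiently many repetitions, every vertex depends on those next to the centre. -/
theorem reach_central {κ : Kind} (hκ : κ.Straight) {l : List Step} (hl : Chain κ l κ)
    (hg : 1 ≤ totalGain l) {q : ℤ × ℤ} (h : κ.IsRep q) {n : ℕ} (hn : vertexDist κ q ≤ n) :
    Reach (repeatSteps l n) q (centralRep κ) := by
  obtain ⟨q', h1, h2, h3⟩ := exists_reach (hl.repeatSteps n) h
  rw [totalGain_repeatSteps] at h3
  have : (n : ℤ) * 1 ≤ (n : ℤ) * totalGain l := mul_le_mul_of_nonneg_left hg (by omega)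
  rw [eq_centralRep hκ h1 (by omega)] at h2
  exact h2

theorem reach_centralRep {l : List Step} {κ κ' : Kind} (hl : Chain κ l κ') :
    Reach l (centralRep κ') (centralRep κ) := by
  induction l generalizing κ' with
  | nil => obtain rfl : κ' = κ := hl; rfl
  | cons st l ih =>
    obtain ⟨hv, rfl, hl⟩ := hl
    exact ⟨_, isRep_centralRep _, Step.dep_centralRep hv, ih hl⟩

theorem Reach.append {l l' : List Step} {q q₁ q₂ : ℤ × ℤ} (h : Reach l q q₁) (h' : Reach l' q₁ q₂) :
    Reach (l ++ l') q q₂ := by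
  induction l generalizing q with
  | nil => obtain rfl : q = q₁ := h; exact h'
  | cons st l ih =>
    obtain ⟨a, b, c, d⟩ := h
    exact ⟨a, b, c, ih d⟩

/-- If `q` depends on `q'`, then `q` lies at least as deep inside the wedge as `q'`, up to a
factor. -/
theorem Bisects.exists_le_wedgeForm {ζ ω : ℂ} (hm : 3 ≤ m) (h : Bisects ζ ω) {l : List Step}
    {κ κ' : Kind} (hl : Chain κ l κ') {q q' : ℤ × ℤ} (hq : κ'.IsRep q) (hr : Reach l q q') :
    ∃ K : ℝ, 0 < K ∧ ∀ N : Net m, IsSym ω N → InWedge ζ κ N → ∀ j,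
      K * wedgeForm ζ j (quad N q'.1 q'.2) ≤ wedgeForm ζ j (quad (run l N) q.1 q.2) := by
  induction l generalizing κ' q with
  | nil =>
    obtain rfl : q = q' := hr
    exact ⟨1, one_pos, fun N _ _ j => by simp⟩
  | cons st l ih =>
    obtain ⟨hv, rfl, hl⟩ := hl
    obtain ⟨q₁, h1, ⟨i, h2⟩, h3⟩ := hr
    obtain ⟨K, hK, H⟩ := ih hl h1 h3
    refine ⟨1 / 64 * K, by positivity, fun N hN hW j => ?_⟩
    have h4 := h.wedge_step hm (hN.run l) hv (h.inWedge_run hm hN hl hW) hq i j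
    rw [h2] at h4
    have h5 := H N hN hW j
    rw [run_cons]
    linarith

end Dep

section Values

variable {ω : ℂ} {N : Net m}

theorem IsSym.natCast_mk (h : IsSym ω N) (n : ℕ) (x y : ℤ) :
    N (Site.mk (n : ZMod m) x y) = ω ^ n * quad N x y := by
  induction n with
  | zero => simp [quad]
  | succ n ih => rw [Nat.cast_succ, h.mk_succ, ih, pow_succ']; ring

/-- The values of symmetric nets are determined by those on the fundamental domain. -/
theorem exists_value_eq [NeZero m] (ω : ℂ) (κ : Kind) (s : Site m) (hs : s ≠ .center) :
    ∃ T : ℂ →ₗ[ℝ] ℂ, ∀ N : Net m, IsSym ω N → N s = T (quad N (s.rep κ).1 (s.rep κ).2) := by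
  rcases s.exists_mk with rfl | ⟨l, x, y, hx, hy, rfl⟩
  · exact absurd rfl hs
  · rw [Site.rep_mk _ _ (by omega) (by omega)]
    rcases le_total y x with hle | hle
    · refine ⟨LinearMap.mulLeft ℝ (ω ^ l.val), fun N hN => ?_⟩
      rw [fold_of_le hy hle]
      simpa using hN.natCast_mk l.val x y
    · refine ⟨LinearMap.mulLeft ℝ (ω ^ l.val * ω) ∘ₗ Complex.conjLIE.toLinearEquiv.toLinearMap,
        fun N hN => ?_⟩
      rw [← fold_swap, fold_of_le (by omega) hle]
      have := hN.natCast_mk l.val x y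
      rw [hN.quad_swap (by omega) hy] at this
      simpa [mul_assoc] using this

end Values

/-! ### The grid mesh of frequency `1` -/

/-- The direction of the second spoke of the segment `0`. -/
noncomputable def spokeDir (m : ℕ) : ℂ := Complex.exp ((2 * Real.pi / m : ℝ) * Complex.I)

/-- The direction of the diagonal of the segment `0`. -/
noncomputable def diagDir (m : ℕ) : ℂ := Complex.exp ((Real.pi / m : ℝ) * Complex.I)

theorem spokeDir_re (m : ℕ) : (spokeDir m).re = Real.cos (2 * Real.pi / m) :=
  Complex.exp_ofReal_mul_I_re _

theorem spokeDir_im (m : ℕ) : (spokeDir m).im = Real.sin (2 * Real.pi / m) :=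
  Complex.exp_ofReal_mul_I_im _

theorem spokeDir_im_pos (hm : 3 ≤ m) : 0 < (spokeDir m).im := by
  rw [spokeDir_im]
  have : (3 : ℝ) ≤ m := by exact_mod_cast hm
  have hpi := Real.pi_pos
  apply Real.sin_pos_of_pos_of_lt_pi (by positivity)
  rw [div_lt_iff₀ (by positivity)]
  nlinarith

theorem spokeDir_re_pos (hm : 5 ≤ m) : 0 < (spokeDir m).re := by
  rw [spokeDir_re]
  have : (5 : ℝ) ≤ m := by exact_mod_cast hm
  have hpi := Real.pi_pos
  apply Real.cos_pos_of_mem_Ioo ⟨lt_of_lt_of_le (by linarith)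
    (by positivity : 0 ≤ 2 * Real.pi / m), ?_⟩
  rw [div_lt_iff₀ (by positivity)]
  nlinarith

theorem bisects (hm : 3 ≤ m) : Bisects (diagDir m) (spokeDir m) := by
  have h3 : (3 : ℝ) ≤ m := by exact_mod_cast hm
  have hpi := Real.pi_pos
  have hre : (diagDir m).re = Real.cos (Real.pi / m) := Complex.exp_ofReal_mul_I_re _
  have him : (diagDir m).im = Real.sin (Real.pi / m) := Complex.exp_ofReal_mul_I_im _
  refine ⟨by rw [hre, him]; exact Real.cos_sq_add_sin_sq _, ?_, ?_, ?_⟩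
  · rw [diagDir, spokeDir, ← Complex.exp_nat_mul]
    congr 1
    push_cast; ring
  · rw [hre, ← Real.cos_pi_div_three]
    refine Real.cos_le_cos_of_nonneg_of_le_pi (by positivity) (by linarith) ?_
    exact div_le_div_of_nonneg_left hpi.le (by norm_num) h3
  · intro h
    have := spokeDir_im_pos hm
    rw [h] at this
    simp at this

section Grid

variable [NeZero m]

/-- The direction of the first spoke of a segment. -/
noncomputable def segDir (l : ZMod m) : ℂ := spokeDir m ^ l.val

theorem spokeDir_pow_self : spokeDir m ^ m = 1 := by
  rw [spokeDir, ← Complex.exp_nat_mul, Complex.exp_eq_one_iff]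
  refine ⟨1, ?_⟩
  have : (m : ℂ) ≠ 0 := by exact_mod_cast NeZero.ne m
  push_cast
  field_simp

theorem segDir_add (k l : ZMod m) : segDir (k + l) = segDir k * segDir l := by
  rw [segDir, segDir, segDir, ZMod.val_add, ← pow_eq_pow_mod _ spokeDir_pow_self, pow_add]

omit [NeZero m] in
theorem segDir_zero : segDir (0 : ZMod m) = 1 := by simp [segDir]

theorem segDir_one : segDir (1 : ZMod m) = spokeDir m := by
  rw [segDir, ZMod.val_one_eq_one_mod, ← pow_eq_pow_mod _ spokeDir_pow_self, pow_one]

theorem segDir_neg (hm : 3 ≤ m) (l : ZMod m) : segDir (-l) = (starRingEnd ℂ) (segDir l) := by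
  have h1 : segDir l * segDir (-l) = 1 := by
    rw [← segDir_add, add_neg_cancel, segDir_zero]
  have h2 : segDir l * (starRingEnd ℂ) (segDir l) = 1 := by
    rw [segDir, map_pow, ← mul_pow, (bisects hm).mul_conj, one_pow]
  exact mul_left_cancel₀ (left_ne_zero_of_mul_eq_one h1) (h1.trans h2.symm)

theorem pos_mk (l : ZMod m) {x y : ℤ} (hx : 0 ≤ x) (hy : 0 ≤ y) :
    (Site.mk l x y).pos = segDir l * (x / 2 + y / 2 * spokeDir m) := by
  have hpt : ∀ (l : ZMod m) (a b : ℕ), (Site.pt l a b).pos =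
      segDir l * ((a + 1) / 2 + b / 2 * spokeDir m) := by
    intro l a b
    have h1 : Complex.exp (2 * Real.pi * Complex.I * l.val / m) = segDir l := by
      rw [segDir, spokeDir, ← Complex.exp_nat_mul]
      congr 1
      push_cast; ring
    have h2 : Complex.exp (2 * Real.pi * Complex.I * (l.val + 1) / m) =
        segDir l * spokeDir m := by
      rw [← h1, spokeDir, ← Complex.exp_add]
      congr 1
      push_cast; ring
    rw [Site.pos, h1, h2]; ring
  rcases hx.eq_or_lt with rfl | hx
  · rcases hy.eq_or_lt with rfl | hy
    · simp [Site.pos]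
    · rw [Site.mk_of_nonpos l le_rfl hy, hpt, segDir_add, segDir_one]
      obtain ⟨n, rfl⟩ : ∃ n : ℕ, y = n + 1 := ⟨(y - 1).toNat, by omega⟩
      simp
      ring
  · rw [Site.mk_of_pos l hx hy, hpt]
    obtain ⟨n, rfl⟩ : ∃ n : ℕ, x = n + 1 := ⟨(x - 1).toNat, by omega⟩
    obtain ⟨k, rfl⟩ : ∃ k : ℕ, y = k := ⟨y.toNat, by omega⟩
    simp

theorem isSym_gridMesh (hm : 3 ≤ m) : IsSym (spokeDir m) (gridMesh m) := by
  constructor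
  · intro s
    rcases s.exists_mk with rfl | ⟨l, x, y, hx, hy, rfl⟩
    · simp [gridMesh, Site.rotate, Site.pos]
    · rw [Site.rotate_mk, gridMesh, pos_mk _ (by omega) hy, pos_mk _ (by omega) hy, segDir_add,
        segDir_one]
      ring
  · intro s
    rcases s.exists_mk with rfl | ⟨l, x, y, hx, hy, rfl⟩
    · simp [gridMesh, Site.reflect, Site.pos]
    · have h1 := (bisects hm).mul_conj
      rw [Site.reflect_mk_swap _ (by omega) hy, gridMesh, pos_mk _ hy (by omega),
        pos_mk _ (by omega) hy, sub_eq_add_neg, segDir_add, segDir_neg hm, segDir_neg hm,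
        segDir_one]
      simp only [map_mul, map_add, map_div₀, map_intCast, map_ofNat]
      linear_combination (starRingEnd ℂ) (segDir l) * (x / 2) * h1

theorem quad_gridMesh {x y : ℤ} (hx : 0 ≤ x) (hy : 0 ≤ y) :
    quad (gridMesh m) x y = x / 2 + y / 2 * spokeDir m := by
  rw [quad, gridMesh, pos_mk _ hx hy, segDir_zero, one_mul]

theorem hasEdges_gridMesh (hm : 3 ≤ m) (κ : Kind) :
    HasEdges (edgeCone (spokeDir m)) κ (gridMesh m) := by
  intro x y hx hy _
  rcases hy.eq_or_lt with rfl | hy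
  · refine ⟨0, (spokeDir m).im, le_rfl, (spokeDir_im_pos hm).le, ?_⟩
    rw [(isSym_gridMesh hm).edge_one' hx, quad_gridMesh hx (by norm_num)]
    apply Complex.ext <;> simp
  · refine ⟨1, 0, zero_le_one, le_rfl, ?_⟩
    rw [edge, quad_gridMesh hx (by omega), quad_gridMesh hx (by omega)]
    push_cast; ring

theorem Bisects.wedgeForm_ofReal_pos {ζ ω : ℂ} (h : Bisects ζ ω) {z : ℂ} (hz : z.im = 0)
    (hre : 0 < z.re) (j : Fin 2) : 0 < wedgeForm ζ j z := by
  have c1 := h.half_le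
  have c2 := h.re_le_one
  have hs : spoke ζ z = ζ.re * z.re := by simp [spoke_apply, hz]
  match j with
  | 0 => rw [wedgeForm_zero_apply, hs]; nlinarith
  | 1 =>
    rw [wedgeForm_one_apply, hs]
    have : 0 < (1 - ζ.re * ζ.re / 2) * z.re := mul_pos (by nlinarith) hre
    linarith

theorem wedgeForm_gridMesh_pos (hm : 3 ≤ m) {κ : Kind} {q : ℤ × ℤ} (hq : κ.IsRep q) (j : Fin 2) :
    0 < wedgeForm (diagDir m) j (quad (gridMesh m) q.1 q.2) := by
  have h := bisects hm
  obtain ⟨x, y⟩ := q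
  obtain ⟨h1, h2, h3, -⟩ := hq
  simp only at h1 h2 h3
  have c1 := h.half_le
  have c2 := h.re_le_one
  have hx : (1 : ℝ) ≤ x := by exact_mod_cast h1
  have hy : (0 : ℝ) ≤ y := by exact_mod_cast h2
  have hxy : (y : ℝ) ≤ x := by exact_mod_cast h3
  rw [quad_gridMesh (by omega) h2]
  -- the position is a combination of the directions of the axis and the diagonal
  have e : ((x : ℂ) / 2 + y / 2 * spokeDir m) =
      ((x - y) / 2 : ℝ) • (1 : ℂ) + (y / 2 : ℝ) • (1 + spokeDir m) := by
    simp only [Complex.real_smul]; push_cast; ring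
  have a1 : spoke (diagDir m) 1 = (diagDir m).re := by simp [spoke_apply]
  have a2 : spoke (diagDir m) (1 + spokeDir m) = 2 * (diagDir m).re := by
    have := h.spoke_swap 1
    rw [map_one, mul_one, a1] at this
    rw [map_add, a1, this]; ring
  have a3 : (1 + spokeDir m).re = 2 * (diagDir m).re * (diagDir m).re := by
    have := h.re_swap 1
    rw [map_one, mul_one, a1, Complex.one_re] at this
    rw [Complex.add_re, this, Complex.one_re]; ring
  rw [e, map_add, map_smul, map_smul, smul_eq_mul, smul_eq_mul]
  have p1 : 0 < wedgeForm (diagDir m) j 1 := h.wedgeForm_ofReal_pos (by simp) (by simp) j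
  have p2 : 0 < wedgeForm (diagDir m) j (1 + spokeDir m) := by
    match j with
    | 0 =>
      rw [wedgeForm_zero_apply, a2, a3]
      have hc : 0 < (diagDir m).re := by linarith
      nlinarith [mul_pos hc hc]
    | 1 =>
      rw [wedgeForm_one_apply, a2, a3]
      have hc : 0 < (diagDir m).re := by linarith
      nlinarith [mul_pos hc hc]
  rcases hy.eq_or_lt with h0 | h0
  · rw [← h0]
    have : 0 < ((x - 0) / 2 : ℝ) * wedgeForm (diagDir m) j 1 := mul_pos (by linarith) p1
    linarith
  · have : 0 < (y / 2 : ℝ) * wedgeForm (diagDir m) j (1 + spokeDir m) := mul_pos (by linarith) p2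
    have : 0 ≤ ((x - y) / 2 : ℝ) * wedgeForm (diagDir m) j 1 := mul_nonneg (by linarith) p1.le
    linarith

theorem inWedge_gridMesh (hm : 3 ≤ m) (κ : Kind) : InWedge (diagDir m) κ (gridMesh m) :=
  fun _ hq j => (wedgeForm_gridMesh_pos hm hq j).le

/-! ### Expansion of the grid mesh for valence at least `5` -/

/-- In the chart of a segment, every step reproduces linear functions, up to scaling. -/
theorem Step.sum_pre {st : Step} {x y : ℤ} (hp : st.tgt.par x y) :
    (∑ i, ((st.pre x y i).1 : ℝ) = 4 * st.scale * x) ∧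
      (∑ i, ((st.pre x y i).2 : ℝ) = 4 * st.scale * y) := by
  rcases st with (_ | _ | _ | _) | κ | κ | κ
  · simp [Step.pre, fillPre, Fin.sum_univ_four, Step.scale]; constructor <;> ring
  · simp [Step.pre, fillPre, Fin.sum_univ_four, Step.scale]; constructor <;> ring
  · simp [Step.pre, rotPre, Fin.sum_univ_four, Step.scale]; constructor <;> ring
  · simp [Step.pre, rotPre, Fin.sum_univ_four, Step.scale]; constructor <;> ring
  · obtain ⟨i, rfl⟩ : ∃ i, x = 2 * i := ⟨x / 2, by have := hp.1; omega⟩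
    obtain ⟨j, rfl⟩ : ∃ j, y = 2 * j := ⟨y / 2, by have := hp.2; omega⟩
    simp [Step.pre, fillPre, Fin.sum_univ_four, Step.scale]; constructor <;> ring
  · simp [Step.pre, fillPre, Fin.sum_univ_four, Step.scale]; constructor <;> ring
  · obtain ⟨i, rfl⟩ : ∃ i, x = 2 * i + 1 := ⟨x / 2, by have := hp.1; omega⟩
    obtain ⟨j, rfl⟩ : ∃ j, y = 2 * j + 1 := ⟨y / 2, by have := hp.2; omega⟩
    have e1 : (2 * i + 1) / 2 = i := by omega
    have e2 : (2 * j + 1) / 2 = j := by omega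
    simp [Step.pre, edgePre, Fin.sum_univ_four, Step.scale, e1, e2]; constructor <;> ring

omit [NeZero m] in
theorem IsSym.sub {ω : ℂ} {N N' : Net m} (h : IsSym ω N) (h' : IsSym ω N') : IsSym ω (N - N') :=
  ⟨fun s => by simp [h.rotate, h'.rotate, mul_sub], fun s => by simp [h.reflect, h'.reflect]⟩

/-- A step moves the grid mesh outwards along the spokes, and does not change its other vertices,
up to scaling. -/
theorem op_gridMesh_sub (hm : 3 ≤ m) (hre : 0 < (spokeDir m).re) {st : Step} (hv : st.Valid) :
    InWedge (diagDir m) st.tgt (st.op (gridMesh m) - st.scale • gridMesh m) ∧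
      (st.src = .dual → ∀ j, 0 < wedgeForm (diagDir m) j
        (quad (st.op (gridMesh m) - st.scale • gridMesh m) (centralRep st.tgt).1
          (centralRep st.tgt).2)) := by
  have hM := isSym_gridMesh hm
  have h := bisects hm
  have hD : IsSym (spokeDir m) (st.op (gridMesh m) - st.scale • gridMesh m) :=
    (hM.op st).sub (hM.smul _)
  have hval : ∀ x y, 1 ≤ x → 0 ≤ y → st.tgt.par x y →
      quad (st.op (gridMesh m) - st.scale • gridMesh m) x y =
        1 / 4 * ∑ i, quad (gridMesh m) (st.pre x y i).1 (st.pre x y i).2 -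
          st.scale * (x / 2 + y / 2 * spokeDir m) := by
    intro x y hx hy hp
    rw [← Step.quad_op hm hv _ hx hy hp, ← quad_gridMesh (by omega) hy]
    simp [quad]
  -- the shift along the spokes
  have hax : ∀ x, 1 ≤ x → st.tgt.par x 0 →
      (quad (st.op (gridMesh m) - st.scale • gridMesh m) x 0).re =
        (spokeDir m).re / 8 * ∑ i, |((st.pre x 0 i).2 : ℝ)| := by
    intro x hx hp
    rw [hval x 0 hx le_rfl hp]
    have e : ∀ i, (quad (gridMesh m) (st.pre x 0 i).1 (st.pre x 0 i).2).re =
        ((st.pre x 0 i).1 : ℝ) / 2 + (spokeDir m).re / 2 * |((st.pre x 0 i).2 : ℝ)| := by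
      intro i
      have p1 := Step.pre_fst_nonneg hx hp i
      have key : ∀ a b : ℤ, 0 ≤ a → 0 ≤ b → (quad (gridMesh m) a b).re =
          (a : ℝ) / 2 + (spokeDir m).re / 2 * b := by
        intro a b ha hb
        rw [quad_gridMesh ha hb]
        simp
        ring
      rcases le_total 0 (st.pre x 0 i).2 with h0 | h0
      · rw [key _ _ p1 h0, abs_of_nonneg (by exact_mod_cast h0)]
      · rw [← neg_neg (st.pre x 0 i).2, hM.quad_neg p1, Complex.conj_re, key _ _ p1 (by omega)]
        push_cast
        rw [neg_neg, abs_of_nonpos (by exact_mod_cast h0)]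
    have e4 : ∀ z : ℂ, (1 / 4 * z : ℂ).re = 1 / 4 * z.re := fun z => by
      rw [show (1 / 4 : ℂ) = ((1 / 4 : ℝ) : ℂ) by push_cast; rfl, Complex.re_ofReal_mul]
    rw [Complex.sub_re, e4, Complex.re_sum, Complex.re_ofReal_mul]
    simp only [e]
    rw [Finset.sum_add_distrib, ← Finset.sum_div, (Step.sum_pre hp).1, ← Finset.mul_sum]
    simp
    ring
  constructor
  · rintro ⟨x, y⟩ hq j
    obtain ⟨h1, h2, h3, hp⟩ := id hq
    simp only at h1 h2 h3 hp
    rcases h2.eq_or_lt with rfl | hy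
    · have hre' := hax x h1 hp
      have hnn : 0 ≤ (quad (st.op (gridMesh m) - st.scale • gridMesh m) x 0).re := by
        rw [hre']
        have : 0 ≤ ∑ i, |((st.pre x 0 i).2 : ℝ)| := Finset.sum_nonneg fun _ _ => abs_nonneg _
        positivity
      have him := hD.quad_axis (x := x) (by omega)
      rcases hnn.eq_or_lt with h0 | h0
      · rw [show quad (st.op (gridMesh m) - st.scale • gridMesh m) x 0 = 0 from
          Complex.ext h0.symm him, map_zero]
      · exact (h.wedgeForm_ofReal_pos him h0 j).le
    · have e : quad (st.op (gridMesh m) - st.scale • gridMesh m) x y = 0 := by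
        rw [hval x y h1 h2 hp]
        have e : ∀ i, quad (gridMesh m) (st.pre x y i).1 (st.pre x y i).2 =
            (((st.pre x y i).1 : ℝ) : ℂ) / 2 + (((st.pre x y i).2 : ℝ) : ℂ) / 2 * spokeDir m := by
          intro i
          obtain ⟨p1, p2, -⟩ := Step.pre_position hv hq i
          rw [quad_gridMesh p1 (p2 hy)]
          push_cast; rfl
        simp only [e]
        rw [Finset.sum_add_distrib, ← Finset.sum_div, ← Finset.sum_mul, ← Finset.sum_div,
          ← Complex.ofReal_sum, ← Complex.ofReal_sum, (Step.sum_pre hp).1, (Step.sum_pre hp).2]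
        push_cast; ring
      rw [e, map_zero]
  · intro hs j
    have hq := isRep_centralRep st.tgt
    have hne : (centralRep st.tgt).2 = 0 ∧
        (st.pre (centralRep st.tgt).1 0 0).2 ≠ 0 := by
      rcases st with κ | κ | κ | κ <;> simp only [Step.src] at hs <;> subst hs
      · simp [Step.tgt, Kind.swap, centralRep, Step.pre, fillPre, Kind.off]
      · simp [Step.tgt, centralRep, Step.pre, fillPre, Kind.off]
      · simp [Step.tgt, centralRep, Step.pre, fillPre, Kind.off]
      · rcases hv with h | h <;> simp at h
    rw [hne.1]
    have hp := hq.2.2.2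
    rw [hne.1] at hp
    refine h.wedgeForm_ofReal_pos (hD.quad_axis (by have := hq.1; omega)) ?_ j
    rw [hax _ hq.1 hp]
    refine mul_pos (by positivity) (lt_of_lt_of_le ?_ (Finset.single_le_sum
      (f := fun i => |((st.pre (centralRep st.tgt).1 0 i).2 : ℝ)|)
      (fun i _ => abs_nonneg _) (Finset.mem_univ 0)))
    exact abs_pos.2 (by exact_mod_cast hne.2)

/-- The subdivided grid mesh is larger than the scaled grid mesh, in the sense of the wedge. -/
theorem run_gridMesh_sub (hm : 3 ≤ m) (hre : 0 < (spokeDir m).re) {l : List Step} {κ κ' : Kind}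
    (hl : Chain κ l κ') :
    InWedge (diagDir m) κ' (run l (gridMesh m) - totalScale l • gridMesh m) ∧
      ((∃ st ∈ l, st.src = .dual) → ∀ j, 0 < wedgeForm (diagDir m) j
        (quad (run l (gridMesh m) - totalScale l • gridMesh m) (centralRep κ').1
          (centralRep κ').2)) := by
  have hM := isSym_gridMesh hm
  have h := bisects hm
  induction l generalizing κ' with
  | nil =>
    refine ⟨fun q _ j => ?_, by simp⟩
    simp [totalScale, quad]
  | cons st l ih =>
    obtain ⟨hv, rfl, hl⟩ := hl
    obtain ⟨ih1, ih2⟩ := ih hl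
    obtain ⟨s1, s2⟩ := op_gridMesh_sub hm hre hv
    have hD : IsSym (spokeDir m) (run l (gridMesh m) - totalScale l • gridMesh m) :=
      (hM.run l).sub (hM.smul _)
    have hpos := totalScale_pos l
    have hsplit : run (st :: l) (gridMesh m) - totalScale (st :: l) • gridMesh m =
        st.op (run l (gridMesh m) - totalScale l • gridMesh m) +
          totalScale l • (st.op (gridMesh m) - st.scale • gridMesh m) := by
      rw [map_sub, LinearMap.map_smul_of_tower, run_cons, totalScale, smul_sub, smul_smul,
        mul_comm st.scale]
      abel
    have hform : ∀ (q : ℤ × ℤ) j, wedgeForm (diagDir m) j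
        (quad (run (st :: l) (gridMesh m) - totalScale (st :: l) • gridMesh m) q.1 q.2) =
          wedgeForm (diagDir m) j
            (quad (st.op (run l (gridMesh m) - totalScale l • gridMesh m)) q.1 q.2) +
          totalScale l * wedgeForm (diagDir m) j
            (quad (st.op (gridMesh m) - st.scale • gridMesh m) q.1 q.2) := by
      intro q j
      rw [hsplit, show ∀ (A B : Net m), quad (A + B) q.1 q.2 = quad A q.1 q.2 + quad B q.1 q.2
        from fun _ _ => rfl, map_add, show ∀ (r : ℝ) (A : Net m), quad (r • A) q.1 q.2 =
        r • quad A q.1 q.2 from fun _ _ => rfl, map_smul, smul_eq_mul]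
    have t1 := h.inWedge_op hm hD hv ih1
    refine ⟨fun q hq j => ?_, ?_⟩
    · rw [hform]
      exact add_nonneg (t1 q hq j) (mul_nonneg hpos.le (s1 q hq j))
    · rintro ⟨st', hmem, hd⟩ j
      rw [hform]
      have hc := isRep_centralRep st.tgt
      rcases List.mem_cons.1 hmem with rfl | hmem
      · exact add_pos_of_nonneg_of_pos (t1 _ hc j) (mul_pos hpos (s2 hd j))
      · refine add_pos_of_pos_of_nonneg ?_ (mul_nonneg hpos.le (s1 _ hc j))
        obtain ⟨i, hi⟩ := Step.dep_centralRep hv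
        have h4 := h.wedge_step hm hD hv ih1 hc i j
        rw [hi] at h4
        have h5 := ih2 ⟨st', hmem, hd⟩ j
        linarith

end Grid

/-! ### Combinatorics of schemes -/

theorem straight_out_of_scheme (U : Word) (κ : Kind)
    (h : 1 ≤ (U.map Factor.numV).sum + (U.map Factor.numR).sum) : (Word.out U κ).Straight := by
  induction U with
  | nil => simp at h
  | cons F U ih =>
    cases F with
    | A =>
      exact Kind.Straight.swap (ih (by simpa [Factor.numV, Factor.numR] using h))
    | R => exact Or.inl rfl
    | VAV n => exact Or.inr rfl

theorem totalGain_nonneg (l : List Step) : 0 ≤ totalGain l := by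
  apply List.sum_nonneg
  intro a ha
  obtain ⟨st, -, rfl⟩ := List.mem_map.1 ha
  exact st.gain_nonneg

theorem one_le_totalGain (U : Word) (κ : Kind)
    (h : 1 ≤ (U.map Factor.numV).sum + (U.map Factor.numR).sum) :
    1 ≤ totalGain (Word.steps U κ) := by
  induction U with
  | nil => simp at h
  | cons F U ih =>
    rw [Word.steps, totalGain_append]
    have h1 := totalGain_nonneg (F.steps (Word.out U κ))
    have h2 := totalGain_nonneg (Word.steps U κ)
    cases F with
    | A =>
      have := ih (by simpa [Factor.numV, Factor.numR] using h)
      omega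
    | R =>
      have : totalGain (Factor.R.steps (Word.out U κ)) = 1 := rfl
      omega
    | VAV n =>
      have h3 := totalGain_nonneg (averageSteps n .rotDual ++ [.V (Word.out U κ)])
      have : totalGain ((Factor.VAV n).steps (Word.out U κ)) =
          1 + totalGain (averageSteps n .rotDual ++ [.V (Word.out U κ)]) := rfl
      omega

theorem totalScale_le_one (l : List Step) : totalScale l ≤ 1 := by
  induction l with
  | nil => exact le_rfl
  | cons st l ih =>
    exact mul_le_one₀ st.scale_le_one (totalScale_pos l).le ih

theorem totalScale_lt_one (U : Word) (κ : Kind)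
    (h : 1 ≤ (U.map Factor.numV).sum + (U.map Factor.numR).sum) :
    totalScale (Word.steps U κ) < 1 := by
  induction U with
  | nil => simp at h
  | cons F U ih =>
    rw [Word.steps, totalScale_append]
    have h1 := totalScale_le_one (F.steps (Word.out U κ))
    have h2 := totalScale_le_one (Word.steps U κ)
    have h3 := totalScale_pos (F.steps (Word.out U κ))
    have h4 := totalScale_pos (Word.steps U κ)
    cases F with
    | A =>
      have := ih (by simpa [Factor.numV, Factor.numR] using h)
      nlinarith
    | R =>
      have : totalScale (Factor.R.steps (Word.out U κ)) = 1 / 2 := by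
        simp [Factor.steps, totalScale, Step.scale]
      nlinarith
    | VAV n =>
      have h3 := totalScale_le_one (averageSteps n .rotDual ++ [.V (Word.out U κ)])
      have : totalScale ((Factor.VAV n).steps (Word.out U κ)) =
          1 / 2 * totalScale (averageSteps n .rotDual ++ [.V (Word.out U κ)]) := rfl
      nlinarith

/-- Nets that are primal again after a step other than `R` have been dual in between. -/
theorem Chain.exists_dual {l : List Step} {κ' : Kind} (hl : Chain .primal l κ')
    (hd : ∀ st ∈ l, st.src ≠ .dual) (h : κ' = .primal) : ∀ st ∈ l, st = .R .primal := by
  induction l generalizing κ' with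
  | nil => simp
  | cons st l ih =>
    obtain ⟨hv, rfl, hl⟩ := hl
    have hs := hd st (by simp)
    have hst : st = .R .primal := by
      rcases st with κ | κ | κ | κ
      · cases κ <;> simp [Step.src, Step.tgt, Kind.swap] at *
      · rcases hv with rfl | rfl
        · rfl
        · exact absurd rfl hs
      · simp [Step.tgt] at h
      · simp [Step.tgt] at h
    subst hst
    intro st hmem
    rcases List.mem_cons.1 hmem with rfl | hmem
    · rfl
    · exact ih hl (fun st h => hd st (by simp [h])) rfl st hmem

theorem exists_dual_step {U : Word} {κ : Kind} (hκ : κ.Straight) (hout : Word.out U κ = κ)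
    (h : 1 ≤ (U.map Factor.numA).sum + (U.map Factor.numV).sum) :
    ∃ st ∈ Word.steps U κ, st.src = .dual := by
  have hchain := Word.chain_steps U hκ
  rw [hout] at hchain
  -- the scheme contains a step other than `R`
  have hne : ∃ st ∈ Word.steps U κ, st ≠ .R .primal := by
    clear hchain hout
    induction U with
    | nil => simp at h
    | cons F U ih =>
      cases F with
      | A => exact ⟨.A (Word.out U κ), by simp [Word.steps, Factor.steps], by simp⟩
      | R =>
        obtain ⟨st, h1, h2⟩ := ih (by simpa [Factor.numA, Factor.numV] using h)
        exact ⟨st, by simp [Word.steps, h1], h2⟩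
      | VAV n =>
        exact ⟨.W (Kind.swap^[n] .rotDual), by simp [Word.steps, Factor.steps], by simp⟩
  obtain ⟨st, hst, hst'⟩ := hne
  rcases hκ with rfl | rfl
  · by_contra hcon
    push Not at hcon
    exact hst' (hchain.exists_dual hcon rfl st hst)
  · have : ∀ l : List Step, ∀ κ', Chain .dual l κ' → l ≠ [] → ∃ st ∈ l, st.src = .dual := by
      intro l
      induction l with
      | nil => simp
      | cons st l ih =>
        intro κ' hl _
        obtain ⟨hv, rfl, hl⟩ := hl
        rcases eq_or_ne l [] with rfl | hne
        · exact ⟨st, by simp, hl⟩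
        · obtain ⟨st', h1, h2⟩ := ih _ hl hne
          exact ⟨st', by simp [h1], h2⟩
    exact this _ _ hchain (List.ne_nil_of_mem hst)

theorem Chain.split {l₁ l₂ : List Step} {κ κ' : Kind} (h : Chain κ (l₁ ++ l₂) κ') :
    ∃ κ₁, Chain κ l₂ κ₁ ∧ Chain κ₁ l₁ κ' := by
  induction l₁ generalizing κ' with
  | nil => exact ⟨κ', h, rfl⟩
  | cons st l ih =>
    obtain ⟨hv, rfl, h⟩ := h
    obtain ⟨κ₁, h1, h2⟩ := ih h
    exact ⟨κ₁, h1, hv, rfl, h2⟩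

/-! ### Supports and faces -/

section Faces

variable [NeZero m]

theorem Step.isVertex_src_of_mem_supp {st : Step} {s t : Site m} (h : t ∈ st.supp s) :
    IsVertex st.src t := by
  rw [Step.supp, if_pos (Step.isVertex_of_mem_supp h)] at h
  rcases st with κ | κ | κ | κ
  · exact (mem_corners.1 h).2
  · exact (mem_corners.1 h).2
  · exact (mem_corners.1 h).2
  · cases s with
    | center => simp [Step.stencil, rotEdge] at h
    | pt l a b => exact (Finset.mem_filter.1 h).2

theorem isVertex_of_mem_support {l : List Step} {κ κ' : Kind} (hl : Chain κ l κ') {s t : Site m}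
    (hs : IsVertex κ' s) (h : t ∈ support l s) : IsVertex κ t := by
  induction l generalizing κ' s with
  | nil =>
    obtain rfl : κ' = κ := hl
    obtain rfl : t = s := by simpa [support] using h
    exact hs
  | cons st l ih =>
    obtain ⟨hv, rfl, hl⟩ := hl
    obtain ⟨s₁, h1, h2⟩ := mem_support_cons.1 h
    exact ih hl (Step.isVertex_src_of_mem_supp h1) h2

theorem Step.supp_nonempty {st : Step} (hv : st.Valid) {s : Site m} (hs : IsVertex st.tgt s) :
    (st.supp s).Nonempty := by
  rcases s.exists_mk with rfl | ⟨l, x, y, hx, hy, rfl⟩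
  · exact Step.supp_center_nonempty hs
  · exact ⟨_, (Step.mem_supp_mk hv l hx hy ((isVertex_mk _ l (by omega) y).1 hs) _).2 ⟨0, rfl⟩⟩

/-- Two vertices share a face. -/
def Share (κ : Kind) (s t : Site m) : Prop :=
  ∃ f, IsVertex κ.swap f ∧ s ∈ corners κ f ∧ t ∈ corners κ f

theorem Kind.swap_swap (κ : Kind) : κ.swap.swap = κ := by cases κ <;> rfl

/-- The end points of the edges of a face, and the corners of the faces next to a corner, are
corners. -/
theorem corners_subset_nbhd {κ : Kind} (hκ : κ.Straight) {g h t : Site m}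
    (hg : IsVertex κ.swap g) (hh : h ∈ nbhd g) (ht : t ∈ corners κ h) : t ∈ nbhd g := by
  rw [mem_corners] at ht
  obtain ⟨ht, hp⟩ := ht
  rcases g.exists_mk with rfl | ⟨l, x, y, hx, hy, rfl⟩
  · obtain rfl : κ = .dual := by
      rcases hκ with rfl | rfl
      · simp [Kind.swap, IsVertex, Kind.parity] at hg
      · rfl
    rw [mem_nbhd_center] at hh ⊢
    rcases hh with rfl | ⟨l, rfl | rfl⟩
    · exact (mem_nbhd_center t).1 ht
    · rw [mem_nbhd_mk l le_rfl le_rfl] at ht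
      obtain ⟨i, j, hi, hj, rfl⟩ := ht
      rw [isVertex_mk _ _ (by omega)] at hp
      simp only [Kind.par] at hp
      right
      obtain rfl : i = 0 := by omega
      rcases (by omega : j = 1 ∨ j = -1) with rfl | rfl
      · exact ⟨l, Or.inr rfl⟩
      · exact ⟨l - 1, Or.inr (Site.mk_eq_mk_pred l (by norm_num) (by norm_num))⟩
    · rw [mem_nbhd_mk l le_rfl (by norm_num)] at ht
      obtain ⟨i, j, hi, hj, rfl⟩ := ht
      rw [isVertex_mk _ _ (by omega)] at hp
      simp only [Kind.par] at hp
      obtain rfl : i = 0 := by omega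
      obtain rfl : j = 0 := by omega
      exact Or.inr ⟨l, Or.inr rfl⟩
  · rw [isVertex_mk _ _ (by omega)] at hg
    rw [mem_nbhd_mk l hx hy] at hh
    obtain ⟨i, j, hi, hj, rfl⟩ := hh
    have hpar : ∀ a b : ℤ, κ.par a b → (a - x) % 2 = 1 ∧ (b - y) % 2 = 1 := by
      intro a b hab
      rcases hκ with rfl | rfl <;> simp only [Kind.swap, Kind.par] at * <;> omega
    have hpar' : ∀ a b : ℤ, κ.par a b → (b - x) % 2 = 1 ∧ (a - y) % 2 = 1 := by
      intro a b hab
      rcases hκ with rfl | rfl <;> simp only [Kind.swap, Kind.par] at * <;> omega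
    rw [mem_nbhd_mk l hx hy]
    have fin : ∀ a b : ℤ, a = x + 1 ∨ a = x - 1 → b = y + 1 ∨ b = y - 1 → t = Site.mk l a b →
        ∃ i j : ℤ, (-1 ≤ i ∧ i ≤ 1) ∧ (-1 ≤ j ∧ j ≤ 1) ∧ t = Site.mk l (x + i) (y + j) := by
      intro a b ha hb e
      refine ⟨a - x, b - y, by omega, by omega, ?_⟩
      rw [e]; congr 1 <;> omega
    have hgp : x % 2 = y % 2 := by
      rcases hκ with rfl | rfl <;> simp only [Kind.swap, Kind.par] at * <;> omega
    rcases (by omega : 1 ≤ x + i ∧ 0 ≤ y + j ∨ 1 ≤ x + i ∧ y + j = -1 ∨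
      x + i = 0 ∧ 1 ≤ y + j ∨ x + i = 0 ∧ y + j = 0 ∨ x + i = 0 ∧ y + j = -1) with
      ⟨a1, a2⟩ | ⟨a1, a2⟩ | ⟨a1, a2⟩ | ⟨a1, a2⟩ | ⟨a1, a2⟩
    · rw [mem_nbhd_mk l a1 a2] at ht
      obtain ⟨i', j', hi', hj', rfl⟩ := ht
      rw [isVertex_mk _ _ (by omega)] at hp
      have := hpar _ _ hp
      exact fin _ _ (by omega) (by omega) rfl
    · rw [a2, Site.mk_eq_mk_pred l (by omega) (by norm_num), neg_neg,
        mem_nbhd_mk _ le_rfl (by omega)] at ht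
      obtain ⟨i', j', hi', hj', rfl⟩ := ht
      rw [isVertex_mk _ _ (by omega)] at hp
      have := hpar' _ _ hp
      refine fin (x + i + j') (-(1 + i')) (by omega) (by omega) ?_
      rw [Site.mk_eq_mk_succ (l - 1) (by omega) (by omega), sub_add_cancel]
    · rw [a1, Site.mk_eq_mk_succ l le_rfl (by omega), neg_zero,
        mem_nbhd_mk _ a2 le_rfl] at ht
      obtain ⟨i', j', hi', hj', rfl⟩ := ht
      rw [isVertex_mk _ _ (by omega)] at hp
      have := hpar' _ _ hp
      refine fin (-(0 + j')) (y + j + i') (by omega) (by omega) ?_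
      rw [Site.mk_eq_mk_pred (l + 1) (by omega) (by omega), add_sub_cancel_right]
    · rw [a1, a2, Site.mk_zero_zero, mem_nbhd_center] at ht
      rcases ht with rfl | ⟨l', rfl | rfl⟩
      · exact fin 0 0 (by omega) (by omega) (by simp)
      · rw [isVertex_mk _ _ (by norm_num)] at hp
        have := hpar _ _ hp; have := hpar' _ _ hp
        omega
      · rw [isVertex_mk _ _ (by norm_num)] at hp
        have := hpar _ _ hp
        omega
    · omega

/-- A vertex of a primal net that lies on a face, in a common chart. -/
theorem exists_chart {f s : Site m} (hf : IsVertex .dual f) (hs : IsVertex .primal s)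
    (h : s ∈ nbhd f) : ∀ (l : ZMod m) (A B : ℤ), 0 ≤ A → 0 ≤ B →
      f = Site.mk l (2 * A + 1) (2 * B + 1) →
      ∃ X Y : ℤ, (X = A ∨ X = A + 1) ∧ (Y = B ∨ Y = B + 1) ∧ s = Site.mk l (2 * X) (2 * Y) := by
  rintro l A B hA hB rfl
  rw [mem_nbhd_mk l (by omega) (by omega)] at h
  obtain ⟨i, j, hi, hj, rfl⟩ := h
  rw [isVertex_mk _ _ (by omega)] at hs
  simp only [Kind.par] at hs
  refine ⟨(2 * A + 1 + i) / 2, (2 * B + 1 + j) / 2, by omega, by omega, ?_⟩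
  congr 1 <;> omega

omit [NeZero m] in
theorem exists_dual_chart {f : Site m} (hf : IsVertex .dual f) :
    ∃ (l : ZMod m) (A B : ℤ), 0 ≤ A ∧ 0 ≤ B ∧ f = Site.mk l (2 * A + 1) (2 * B + 1) := by
  obtain ⟨l, x, y, hx, hy, px, py, rfl⟩ := exists_mk_of_isVertex_dual hf
  exact ⟨l, x / 2, y / 2, by omega, by omega, by congr 1 <;> omega⟩

/-- The relation of sharing a face is carried over to the old vertices. -/
theorem Share.step {st : Step} (hv : st.Valid) {s t t' : Site m} (h : Share st.tgt s t)
    (ht' : t' ∈ st.supp t) : ∃ s' ∈ st.supp s, Share st.src s' t' := by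
  obtain ⟨f, hf, hs, ht⟩ := h
  obtain ⟨hsf, hsv⟩ := mem_corners.1 hs
  obtain ⟨htf, htv⟩ := mem_corners.1 ht
  have hvt' := Step.isVertex_src_of_mem_supp ht'
  obtain ⟨s₀, hs₀⟩ := Step.supp_nonempty hv hsv
  have hvs₀ := Step.isVertex_src_of_mem_supp hs₀
  have es : st.supp s = st.stencil s := if_pos hsv
  have et : st.supp t = st.stencil t := if_pos htv
  rw [es] at hs₀ ⊢
  rw [et] at ht'
  rcases st with κ | κ | κ | κ
  · -- the common face becomes the common vertex
    simp only [Step.tgt, Step.src, Kind.swap_swap] at *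
    exact ⟨f, mem_corners.2 ⟨nbhd_symm hsf, hf⟩, t, htv, mem_corners.2 ⟨nbhd_symm htf, hf⟩, ht'⟩
  · simp only [Step.tgt, Step.src, Step.stencil] at *
    replace hf : IsVertex .dual f := hf
    obtain ⟨l, A, B, hA, hB, rfl⟩ := exists_dual_chart hf
    obtain ⟨X, Y, hX, hY, rfl⟩ := exists_chart hf hsv hsf l A B hA hB rfl
    obtain ⟨X', Y', hX', hY', rfl⟩ := exists_chart hf htv htf l A B hA hB rfl
    rw [half_mk l (by omega) (by omega), show 2 * X / 2 = X by omega,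
      show 2 * Y / 2 = Y by omega] at hs₀ ⊢
    rw [half_mk l (by omega) (by omega), show 2 * X' / 2 = X' by omega,
      show 2 * Y' / 2 = Y' by omega] at ht'
    -- the face of the old net in the unit square
    obtain ⟨a, b, ha, hb, hg⟩ : ∃ a b : ℤ, (a = A ∨ a = A + 1) ∧ (b = B ∨ b = B + 1) ∧
        κ.swap.par a b := by
      rcases hv with rfl | rfl
      · exact ⟨A + (A + 1) % 2, B + (B + 1) % 2, by omega, by omega, by
          simp only [Kind.swap, Kind.par]; omega⟩
      · exact ⟨A + A % 2, B + B % 2, by omega, by omega, by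
          simp only [Kind.swap, Kind.par]; omega⟩
    have hgv := (isVertex_mk κ.swap l (show 0 ≤ a by omega) b).2 hg
    have n1 : Site.mk l X Y ∈ nbhd (Site.mk l a b) :=
      mk_mem_nbhd l (by omega) (by omega) (by omega) (by omega)
    have n2 : Site.mk l X' Y' ∈ nbhd (Site.mk l a b) :=
      mk_mem_nbhd l (by omega) (by omega) (by omega) (by omega)
    exact ⟨s₀, hs₀, _, hgv, mem_corners.2 ⟨corners_subset_nbhd hv hgv n1 hs₀, hvs₀⟩,
      mem_corners.2 ⟨corners_subset_nbhd hv hgv n2 ht', hvt'⟩⟩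
  · simp only [Step.tgt, Step.src, Step.stencil] at *
    have hcase : IsVertex κ f ∨ IsVertex κ.swap f := by
      rcases f.exists_mk with rfl | ⟨l, x, y, hx, hy, rfl⟩
      · rcases hv with rfl | rfl <;> simp [Kind.swap, IsVertex, Kind.parity]
      · rw [isVertex_mk _ _ (by omega)] at hf ⊢
        rw [isVertex_mk _ _ (by omega)]
        rcases hv with rfl | rfl <;> simp only [Kind.swap, Kind.par] at * <;> omega
    rcases hcase with hf' | hf'
    · -- the two edges have the end point `f` in common; `g` is a face next to the edge of `t`
      obtain ⟨g, hg, hgt⟩ : ∃ g, IsVertex κ.swap g ∧ t ∈ nbhd g := by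
        rcases t.exists_mk with rfl | ⟨l, x, y, hx, hy, rfl⟩
        · simp [IsVertex, Kind.parity] at htv
        · rw [isVertex_mk _ _ (by omega)] at htv
          obtain ⟨a, b, ha, hb, hg⟩ : ∃ a b : ℤ, (a = x ∨ a = x + 1) ∧ (b = y ∨ b = y + 1) ∧
              κ.swap.par a b := by
            rcases hv with rfl | rfl
            · exact ⟨x + (x + 1) % 2, y + (y + 1) % 2, by omega, by omega, by
                simp only [Kind.swap, Kind.par] at *; omega⟩
            · exact ⟨x + x % 2, y + y % 2, by omega, by omega, by
                simp only [Kind.swap, Kind.par] at *; omega⟩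
          exact ⟨Site.mk l a b, (isVertex_mk _ _ (by omega) _).2 hg,
            mk_mem_nbhd l (by omega) (by omega) (by omega) (by omega)⟩
      exact ⟨f, mem_corners.2 ⟨nbhd_symm hsf, hf'⟩, g, hg,
        mem_corners.2 ⟨corners_subset_nbhd hv hg hgt
          (mem_corners.2 ⟨nbhd_symm htf, hf'⟩), hf'⟩,
        mem_corners.2 ⟨corners_subset_nbhd hv hg hgt ht', hvt'⟩⟩
    · exact ⟨s₀, hs₀, f, hf', mem_corners.2 ⟨corners_subset_nbhd hv hf' hsf hs₀, hvs₀⟩,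
        mem_corners.2 ⟨corners_subset_nbhd hv hf' htf ht', hvt'⟩⟩
  · simp only [Step.tgt, Step.src, Step.stencil] at *
    replace hf : IsVertex .primal f := hf
    -- the edges of `s` and `t` lie in unit squares with the common corner `half f`
    have key : ∀ s, IsVertex .dual s → s ∈ nbhd f → ∃ (l : ZMod m) (A B X Y : ℤ), 0 ≤ A ∧ 0 ≤ B ∧
        (X = A ∨ X = A + 1) ∧ (Y = B ∨ Y = B + 1) ∧ half f = Site.mk l X Y ∧
        ∀ u, u ∈ rotEdge κ s ↔ ∃ i j : ℤ, (0 ≤ i ∧ i ≤ 1) ∧ (0 ≤ j ∧ j ≤ 1) ∧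
          u = Site.mk l (A + i) (B + j) ∧ κ.par (A + i) (B + j) := by
      intro s hs hsf
      obtain ⟨l, A, B, hA, hB, rfl⟩ := exists_dual_chart hs
      obtain ⟨X, Y, hX, hY, rfl⟩ := exists_chart hs hf (nbhd_symm hsf) l A B hA hB rfl
      refine ⟨l, A, B, X, Y, hA, hB, hX, hY, ?_, fun u => ?_⟩
      · rw [half_mk l (by omega) (by omega)]; congr 1 <;> omega
      · rw [mem_rotEdge_mk κ l (by omega) (by omega) (by omega),
          show (2 * A + 1) / 2 = A by omega, show (2 * B + 1) / 2 = B by omega]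
    obtain ⟨l, A, B, X, Y, hA, hB, hX, hY, ef, hu⟩ := key s hsv hsf
    obtain ⟨l', A', B', X', Y', hA', hB', hX', hY', ef', hu'⟩ := key t htv htf
    obtain ⟨i', j', hi', hj', rfl, hp'⟩ := (hu' _).1 ht'
    by_cases hP : IsVertex κ (half f)
    · refine ⟨half f, (hu _).2 ⟨X - A, Y - B, by omega, by omega, ?_, ?_⟩,
        Site.mk l' (A' + 1 - i') (B' + j'), ?_, ?_, ?_⟩
      · rw [ef]; congr 1 <;> omega
      · rw [ef, isVertex_mk _ _ (by omega)] at hP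
        rwa [add_sub_cancel, add_sub_cancel]
      · rw [isVertex_mk _ _ (by omega)]
        rcases hv with rfl | rfl <;> simp only [Kind.swap, Kind.par] at * <;> omega
      · refine mem_corners.2 ⟨?_, hP⟩
        rw [ef']
        exact mk_mem_nbhd l' (by omega) (by omega) (by omega) (by omega)
      · exact mem_corners.2 ⟨mk_mem_nbhd l' (by omega) (by omega) (by omega) (by omega), hvt'⟩
    · obtain ⟨i, j, hi, hj, rfl, hp⟩ := (hu _).1 hs₀
      refine ⟨_, hs₀, half f, ?_, mem_corners.2 ⟨?_, hvs₀⟩, mem_corners.2 ⟨?_, hvt'⟩⟩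
      · rw [ef, isVertex_mk _ _ (by omega)] at hP ⊢
        rcases hv with rfl | rfl <;> simp only [Kind.swap, Kind.par] at * <;> omega
      · rw [ef]
        exact mk_mem_nbhd l (by omega) (by omega) (by omega) (by omega)
      · rw [ef']
        exact mk_mem_nbhd l' (by omega) (by omega) (by omega) (by omega)

theorem Share.run {l : List Step} {κ κ' : Kind} (hl : Chain κ l κ') {s t t' : Site m}
    (h : Share κ' s t) (ht' : t' ∈ support l t) : ∃ s' ∈ support l s, Share κ s' t' := by
  induction l generalizing κ' s t with
  | nil =>
    obtain rfl : κ' = κ := hl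
    obtain rfl : t' = t := by simpa [support] using ht'
    exact ⟨s, by simp [support], h⟩
  | cons st l ih =>
    obtain ⟨hv, rfl, hl⟩ := hl
    obtain ⟨t₁, h1, h2⟩ := mem_support_cons.1 ht'
    obtain ⟨s₁, h3, h4⟩ := h.step hv h1
    obtain ⟨s', h5, h6⟩ := ih hl h4 h2
    exact ⟨s', mem_support_cons.2 ⟨s₁, h3, h5⟩, h6⟩

end Faces

/-! ### Finiteness of the core -/

/-- The distance of a point from the centre, in the maximum norm. -/
def Site.size : Site m → ℕ
  | .center => 0
  | .pt _ a b => max (a + 1) b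

theorem Site.size_mk (l : ZMod m) {x : ℤ} (hx : 0 ≤ x) (y : ℤ) :
    (Site.mk l x y).size = max x.natAbs y.natAbs := by
  rcases lt_trichotomy y 0 with hy | rfl | hy
  · rw [Site.mk_of_neg l hx hy, Site.size]; omega
  · rcases hx.eq_or_lt with rfl | hx
    · simp [Site.size]
    · rw [Site.mk_of_pos l hx le_rfl, Site.size]; omega
  · rcases hx.eq_or_lt with rfl | hx
    · rw [Site.mk_of_nonpos l le_rfl hy, Site.size]; omega
    · rw [Site.mk_of_pos l hx hy.le, Site.size]; omega

section Core

variable [NeZero m]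

theorem finite_size_le (n : ℕ) : {s : Site m | s.size ≤ n}.Finite := by
  refine ((Set.finite_singleton .center).union (((Set.finite_univ (α := ZMod m)).prod
    ((Set.finite_Iic n).prod (Set.finite_Iic n))).image
      (fun q => Site.pt q.1 q.2.1 q.2.2))).subset ?_
  intro s hs
  cases s with
  | center => exact Or.inl rfl
  | pt l a b =>
    simp only [Set.mem_ofPred_eq, Site.size] at hs
    refine Or.inr ⟨(l, a, b), ⟨Set.mem_univ _, ?_, ?_⟩, rfl⟩ <;> simp <;> omega

theorem size_le_of_mem_nbhd {s t : Site m} (h : t ∈ nbhd s) : t.size ≤ s.size + 1 := by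
  rw [mem_nbhd_iff] at h
  obtain ⟨l, x, y, x', y', hx, hx', h1, h2, rfl, rfl⟩ := h
  rw [Site.size_mk l hx, Site.size_mk l hx']
  omega

omit [NeZero m] in
theorem size_half_le (s : Site m) : 2 * (half s).size ≤ s.size := by
  rcases s.exists_mk with rfl | ⟨l, x, y, hx, hy, rfl⟩
  · simp [half, Site.size]
  · rw [half_mk l (by omega) hy, Site.size_mk l (by omega), Site.size_mk l (by omega)]
    omega

theorem Step.size_le {st : Step} {s t : Site m} (h : t ∈ st.supp s) :
    t.size ≤ s.size + 1 ∧ (st.scale ≠ 1 → 2 * t.size ≤ s.size + 2) := by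
  have hs := Step.isVertex_of_mem_supp h
  rw [Step.supp, if_pos hs] at h
  rcases st with κ | κ | κ | κ
  · exact ⟨size_le_of_mem_nbhd (mem_corners.1 h).1, fun h => absurd rfl h⟩
  · have := size_le_of_mem_nbhd (mem_corners.1 h).1
    have := size_half_le s
    exact ⟨by omega, fun _ => by omega⟩
  · exact ⟨size_le_of_mem_nbhd (mem_corners.1 h).1, fun h => absurd rfl h⟩
  · obtain ⟨l, x, y, hx, hy, px, py, rfl⟩ := exists_mk_of_isVertex_dual hs
    simp only [Step.stencil] at h
    rw [mem_rotEdge_mk κ l hx hy px] at h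
    obtain ⟨i, j, hi, hj, rfl, -⟩ := h
    rw [Site.size_mk l (by omega), Site.size_mk l (by omega)]
    exact ⟨by omega, fun _ => by omega⟩

theorem size_le_of_mem_support {l : List Step} {s t : Site m} (h : t ∈ support l s) :
    t.size ≤ s.size + l.length ∧
      ((∃ st ∈ l, st.scale ≠ 1) → 2 * t.size ≤ s.size + 2 * l.length) := by
  induction l generalizing s with
  | nil =>
    obtain rfl : t = s := by simpa [support] using h
    simp
  | cons st l ih =>
    obtain ⟨s₁, h1, h2⟩ := mem_support_cons.1 h
    obtain ⟨a1, a2⟩ := Step.size_le h1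
    obtain ⟨b1, b2⟩ := ih h2
    rw [List.length_cons]
    refine ⟨by omega, ?_⟩
    rintro ⟨st', hmem, hs⟩
    rcases List.mem_cons.1 hmem with rfl | hmem
    · have := a2 hs; omega
    · have := b2 ⟨st', hmem, hs⟩; omega

theorem size_le_of_mem_support_repeat {l : List Step} (hl : ∃ st ∈ l, st.scale ≠ 1) {k : ℕ}
    {s t : Site m} (h : t ∈ support (repeatSteps l k) s) : t.size ≤ max s.size (2 * l.length) := by
  induction k generalizing s with
  | zero =>
    obtain rfl : t = s := by simpa [support, repeatSteps] using h
    exact le_max_left _ _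
  | succ k ih =>
    rw [repeatSteps, mem_support_append] at h
    obtain ⟨s₁, h1, h2⟩ := h
    have := (size_le_of_mem_support h1).2 hl
    have := ih h2
    omega

theorem exists_scale_ne_one {l : List Step} (h : totalScale l < 1) :
    ∃ st ∈ l, st.scale ≠ 1 := by
  by_contra hcon
  push Not at hcon
  have : totalScale l = 1 := by
    clear h
    induction l with
    | nil => rfl
    | cons st l ih =>
      rw [totalScale, hcon st (by simp), ih fun st h => hcon st (by simp [h]), one_mul]
  linarith

/-! ### Properties of the core and its rings -/

/-- Sets that contain, together with a vertex, all old vertices on which it depends. -/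
def DepClosed (l : List Step) (X : Set (Site m)) : Prop :=
  ∀ t ∈ X, ∀ s ∈ support l t, s ∈ X

variable {U : Word} {κ : Kind}

theorem Word.op_pow (U : Word) (κ : Kind) (k : ℕ) :
    (Word.op U κ ^ k : Module.End ℂ (Net m)) = run (repeatSteps (Word.steps U κ) k) := by
  rw [run_repeatSteps]
  congr 1
  exact LinearMap.ext fun N => (Word.run_steps U κ N).symm

theorem mem_core_iff {s : Site m} :
    s ∈ core m U κ ↔ IsVertex κ s ∧ ∃ k : ℕ, 1 ≤ k ∧
      ∀ t ∈ innermost κ, s ∈ support (repeatSteps (Word.steps U κ) k) t := by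
  simp only [core, Set.mem_ofPred_eq, Word.op_pow, run_single_ne_zero_iff]

/-- The core depends only on itself. -/
theorem depClosed_core (hκ : κ.Straight) (hout : Word.out U κ = κ) :
    DepClosed (Word.steps U κ) (core m U κ) := by
  have hchain := Word.chain_steps U hκ
  rw [hout] at hchain
  intro t ht s hs
  rw [mem_core_iff] at ht ⊢
  obtain ⟨hv, k, hk, h⟩ := ht
  refine ⟨isVertex_of_mem_support hchain hv hs, k + 1, by omega, fun u hu => ?_⟩
  rw [repeatSteps_add, mem_support_append]
  refine ⟨t, h u hu, ?_⟩
  simpa [repeatSteps] using hs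

theorem mem_innermost {s : Site m} :
    s ∈ innermost κ ↔
      IsVertex κ s ∧ (s = .center ∨ ∃ l, s = Site.mk l 1 0 ∨ s = Site.mk l 1 1) := by
  rw [innermost, mem_corners, mem_nbhd_center, and_comm]

theorem mem_innermost_primal {s : Site m} : s ∈ innermost .primal ↔ s = .center := by
  rw [mem_innermost]
  constructor
  · rintro ⟨hv, rfl | ⟨l, rfl | rfl⟩⟩
    · rfl
    · rw [isVertex_mk _ _ (by norm_num)] at hv; simp [Kind.par] at hv
    · rw [isVertex_mk _ _ (by norm_num)] at hv; simp [Kind.par] at hv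
  · rintro rfl
    exact ⟨by simp [IsVertex, Kind.parity], Or.inl rfl⟩

theorem mem_innermost_dual {s : Site m} : s ∈ innermost .dual ↔ ∃ l, s = Site.mk l 1 1 := by
  rw [mem_innermost]
  constructor
  · rintro ⟨hv, rfl | ⟨l, rfl | rfl⟩⟩
    · simp [IsVertex, Kind.parity] at hv
    · rw [isVertex_mk _ _ (by norm_num)] at hv; simp [Kind.par] at hv
    · exact ⟨l, rfl⟩
  · rintro ⟨l, rfl⟩
    exact ⟨by rw [isVertex_mk _ _ (by norm_num)]; simp [Kind.par], Or.inr ⟨l, Or.inr rfl⟩⟩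

theorem exists_mem_innermost (hκ : κ.Straight) : ∃ s : Site m, s ∈ innermost κ := by
  rcases hκ with rfl | rfl
  · exact ⟨.center, mem_innermost_primal.2 rfl⟩
  · exact ⟨Site.mk 0 1 1, mem_innermost_dual.2 ⟨0, rfl⟩⟩

theorem finite_core (hκ : κ.Straight) (hs : totalScale (Word.steps U κ) < 1) :
    (core m U κ).Finite := by
  refine (finite_size_le (max 1 (2 * (Word.steps U κ).length))).subset ?_
  intro s h
  obtain ⟨-, k, -, h⟩ := mem_core_iff.1 h
  obtain ⟨t, ht⟩ := exists_mem_innermost (m := m) hκ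
  have h1 := size_le_of_mem_support_repeat (exists_scale_ne_one hs) (h t ht)
  have h2 := size_le_of_mem_nbhd (mem_corners.1 ht).1
  have h0 : (Site.center : Site m).size = 0 := rfl
  rw [h0] at h2
  simp only [Set.mem_ofPred_eq]
  omega

theorem unrotate_mem_innermost {s : Site m} (h : s ∈ innermost κ) :
    s.unrotate ∈ innermost κ := by
  rw [innermost] at *
  rw [← rotate_mem_corners, Site.rotate_unrotate]
  exact h

theorem rotate_mem_innermost {s : Site m} (h : s ∈ innermost κ) : s.rotate ∈ innermost κ := by
  rw [innermost] at *
  exact rotate_mem_corners (s := .center).2 h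

theorem reflect_mem_innermost {s : Site m} (h : s ∈ innermost κ) : s.reflect ∈ innermost κ := by
  rw [innermost] at *
  exact reflect_mem_corners (s := .center).2 h

/-- Sets that are invariant under the symmetries of the complex. -/
structure SymSet (X : Set (Site m)) : Prop where
  rotate : ∀ s, s.rotate ∈ X ↔ s ∈ X
  reflect : ∀ s, s.reflect ∈ X ↔ s ∈ X

theorem symSet_core : SymSet (core m U κ) := by
  have key : ∀ s, s ∈ core m U κ → s.reflect ∈ core m U κ := by
    intro s h
    rw [mem_core_iff] at *
    obtain ⟨hv, k, hk, h⟩ := h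
    refine ⟨(isVertex_reflect κ s).2 hv, k, hk, fun t ht => ?_⟩
    rw [← Site.reflect_reflect t, reflect_mem_support]
    exact h _ (reflect_mem_innermost ht)
  refine ⟨fun s => ⟨fun h => ?_, fun h => ?_⟩, fun s => ⟨fun h => ?_, key s⟩⟩
  · rw [mem_core_iff] at *
    obtain ⟨hv, k, hk, h⟩ := h
    refine ⟨(isVertex_rotate κ s).1 hv, k, hk, fun t ht => ?_⟩
    rw [← rotate_mem_support]
    exact h _ (rotate_mem_innermost ht)
  · rw [mem_core_iff] at *
    obtain ⟨hv, k, hk, h⟩ := h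
    refine ⟨(isVertex_rotate κ s).2 hv, k, hk, fun t ht => ?_⟩
    rw [← Site.rotate_unrotate t, rotate_mem_support]
    exact h _ (unrotate_mem_innermost ht)
  · simpa using key _ h

theorem addRing_eq (X : Set (Site m)) :
    addRing κ X = X ∪ {t | ∃ s ∈ X, Share κ s t} := by
  ext t
  simp only [addRing, Share, Set.mem_union, Set.mem_ofPred_eq]
  constructor
  · rintro (h | ⟨f, hf, ht, s, hs, hsf⟩)
    · exact Or.inl h
    · exact Or.inr ⟨s, hs, f, hf, hsf, ht⟩
  · rintro (h | ⟨s, hs, f, hf, hsf, ht⟩)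
    · exact Or.inl h
    · exact Or.inr ⟨f, hf, ht, s, hs, hsf⟩

theorem Share.rotate {s t : Site m} (h : Share κ s t) : Share κ s.rotate t.rotate := by
  obtain ⟨f, hf, h1, h2⟩ := h
  exact ⟨f.rotate, (isVertex_rotate _ _).2 hf, rotate_mem_corners.2 h1, rotate_mem_corners.2 h2⟩

theorem Share.reflect {s t : Site m} (h : Share κ s t) : Share κ s.reflect t.reflect := by
  obtain ⟨f, hf, h1, h2⟩ := h
  exact ⟨f.reflect, (isVertex_reflect _ _).2 hf, reflect_mem_corners.2 h1,
    reflect_mem_corners.2 h2⟩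

theorem Share.of_rotate {s t : Site m} (h : Share κ s t.rotate) : Share κ s.unrotate t := by
  obtain ⟨f, hf, h1, h2⟩ := h
  refine ⟨f.unrotate, ?_, ?_, ?_⟩
  · rwa [← isVertex_rotate, Site.rotate_unrotate]
  · rwa [← rotate_mem_corners, Site.rotate_unrotate, Site.rotate_unrotate]
  · rwa [← rotate_mem_corners, Site.rotate_unrotate]

theorem SymSet.addRing {X : Set (Site m)} (h : SymSet X) : SymSet (addRing κ X) := by
  rw [addRing_eq]
  have key : ∀ s, s ∈ X ∪ {t | ∃ s ∈ X, Share κ s t} →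
      s.reflect ∈ X ∪ {t | ∃ s ∈ X, Share κ s t} := by
    rintro s (hs | ⟨t, ht, hst⟩)
    · exact Or.inl ((h.reflect s).2 hs)
    · exact Or.inr ⟨t.reflect, (h.reflect t).2 ht, hst.reflect⟩
  refine ⟨fun s => ⟨?_, ?_⟩, fun s => ⟨fun hs => ?_, key s⟩⟩
  · rintro (hs | ⟨t, ht, hst⟩)
    · exact Or.inl ((h.rotate s).1 hs)
    · exact Or.inr ⟨t.unrotate, by rwa [← h.rotate, Site.rotate_unrotate], hst.of_rotate⟩
  · rintro (hs | ⟨t, ht, hst⟩)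
    · exact Or.inl ((h.rotate s).2 hs)
    · exact Or.inr ⟨t.rotate, (h.rotate t).2 ht, hst.rotate⟩
  · simpa using key _ hs

theorem finite_addRing {X : Set (Site m)} (h : X.Finite) : (addRing κ X).Finite := by
  rw [addRing_eq]
  refine h.union ((h.biUnion fun s _ => ((nbhd s).finite_toSet.biUnion fun f _ =>
    (corners κ f).finite_toSet)).subset ?_)
  rintro t ⟨s, hs, f, hf, h1, h2⟩
  simp only [Set.mem_iUnion]
  exact ⟨s, hs, f, nbhd_symm (mem_corners.1 h1).1, h2⟩

theorem DepClosed.addRing {l : List Step} (hl : Chain κ l κ) {X : Set (Site m)}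
    (h : DepClosed l X) : DepClosed l (addRing κ X) := by
  rw [addRing_eq]
  rintro t (ht | ⟨s, hs, hst⟩) t' ht'
  · exact Or.inl (h t ht t' ht')
  · obtain ⟨s', h1, h2⟩ := hst.run hl ht'
    exact Or.inr ⟨s', h s hs s' h1, h2⟩

theorem coreNet_induction {P : Set (Site m) → Prop} (h0 : P (core m U κ))
    (h1 : ∀ X, P X → P (addRing κ X)) (ρ : ℕ) : P (coreNet m U κ ρ) := by
  rw [coreNet]
  induction ρ with
  | zero => exact h0
  | succ n ih => rw [Function.iterate_succ_apply']; exact h1 _ ih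

theorem core_subset_coreNet (ρ : ℕ) : core m U κ ⊆ coreNet m U κ ρ :=
  coreNet_induction (P := fun X => core m U κ ⊆ X) subset_rfl
    (fun _ h => h.trans Set.subset_union_left) ρ

theorem isVertex_coreNet {ρ : ℕ} {s : Site m} (h : s ∈ coreNet m U κ ρ) : IsVertex κ s := by
  refine coreNet_induction (P := fun X => ∀ s ∈ X, IsVertex κ s)
    (fun s h => (mem_core_iff.1 h).1) (fun X hX s hs => ?_) ρ s h
  rw [addRing_eq] at hs
  rcases hs with hs | ⟨t, -, f, -, -, hs⟩
  · exact hX s hs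
  · exact (mem_corners.1 hs).2

/-! ### The centre belongs to the core -/

-- Without this attribute, the unifier evaluates supports of explicit vertices.
attribute [local irreducible] support

theorem innermost_step {st : Step} (hv : st.Valid) {t : Site m} (ht : t ∈ innermost st.tgt) :
    ∃ t' ∈ innermost st.src, t' ∈ st.supp t := by
  obtain ⟨hvt, h⟩ := mem_innermost.1 ht
  rcases h with rfl | ⟨l, h⟩
  · obtain ⟨t', h'⟩ := Step.supp_nonempty hv hvt
    refine ⟨t', ?_, h'⟩
    rw [Step.supp, if_pos hvt] at h'
    rcases st with κ | κ | κ | κ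
    · exact h'
    · exact h'
    · exact h'
    · simp [Step.stencil, rotEdge] at h'
  · obtain ⟨i, y, hy, hin⟩ : ∃ (i : Fin 4) (y : ℤ), (t = Site.mk l 1 y ∧ 0 ≤ y) ∧
        Site.mk l (st.pre 1 y i).1 (st.pre 1 y i).2 ∈ innermost st.src := by
      rcases st with (_ | _ | _ | _) | κ | κ | κ
      · rcases h with rfl | rfl
        · rw [isVertex_mk _ _ (by norm_num)] at hvt
          simp [Step.tgt, Kind.swap, Kind.par] at hvt
        · exact ⟨3, 1, ⟨rfl, by norm_num⟩, by
            simp [Step.pre, fillPre, Kind.off, Step.src, mem_innermost_primal]⟩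
      · rcases h with rfl | rfl
        · rw [isVertex_mk _ _ (by norm_num)] at hvt
          simp [Step.tgt, Kind.swap, Kind.par] at hvt
        · rw [isVertex_mk _ _ (by norm_num)] at hvt
          simp [Step.tgt, Kind.swap, Kind.par] at hvt
      · rcases h with rfl | rfl
        · exact ⟨1, 0, ⟨rfl, by norm_num⟩, by
            simp [Step.pre, rotPre, Step.src, mem_innermost, IsVertex, Kind.parity]⟩
        · rw [isVertex_mk _ _ (by norm_num)] at hvt
          simp [Step.tgt, Kind.swap, Kind.par] at hvt
      · rcases h with rfl | rfl
        · rw [isVertex_mk _ _ (by norm_num)] at hvt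
          simp [Step.tgt, Kind.swap, Kind.par] at hvt
        · refine ⟨3, 1, ⟨rfl, by norm_num⟩, mem_innermost.2 ⟨?_, Or.inr ⟨l, Or.inl rfl⟩⟩⟩
          rw [isVertex_mk _ _ (by simp [Step.pre, rotPre])]
          simp [Step.pre, rotPre, Step.src, Kind.par]
      · rcases h with rfl | rfl <;>
        · rw [isVertex_mk _ _ (by norm_num)] at hvt
          simp [Step.tgt, Kind.par] at hvt
      · rcases h with rfl | rfl
        · rcases hv with rfl | rfl
          · exact ⟨3, 0, ⟨rfl, by norm_num⟩, by
              simp [Step.pre, fillPre, Kind.off, Step.src, mem_innermost_primal]⟩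
          · exact ⟨0, 0, ⟨rfl, by norm_num⟩, mem_innermost_dual.2
              ⟨l, by simp [Step.pre, fillPre, Kind.off]⟩⟩
        · rw [isVertex_mk _ _ (by norm_num)] at hvt
          simp [Step.tgt, Kind.par] at hvt
      · rcases h with rfl | rfl
        · rw [isVertex_mk _ _ (by norm_num)] at hvt
          simp [Step.tgt, Kind.par] at hvt
        · rcases hv with rfl | rfl
          · exact ⟨0, 1, ⟨rfl, by norm_num⟩, by
              simp [Step.pre, edgePre, Kind.diag, Step.src, mem_innermost, IsVertex, Kind.parity]⟩
          · refine ⟨0, 1, ⟨rfl, by norm_num⟩, mem_innermost.2 ⟨?_, Or.inr ⟨l, Or.inl ?_⟩⟩⟩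
            · rw [isVertex_mk _ _ (by simp [Step.pre, edgePre, Kind.diag])]
              simp [Step.pre, edgePre, Kind.diag, Step.src, Kind.par]
            · simp [Step.pre, edgePre, Kind.diag]
    obtain ⟨rfl, hy⟩ := hy
    exact ⟨_, hin, (Step.mem_supp_mk hv l le_rfl hy ((isVertex_mk _ l (by norm_num) y).1 hvt) _).2
      ⟨i, rfl⟩⟩

/-- Innermost vertices depend on innermost vertices. -/
theorem innermost_run {l : List Step} {κ κ' : Kind} (hl : Chain κ l κ') {t : Site m}
    (ht : t ∈ innermost κ') : ∃ t' ∈ innermost κ, t' ∈ support l t := by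
  induction l generalizing κ' t with
  | nil => obtain rfl : κ' = κ := hl; exact ⟨t, ht, by simp [support]⟩
  | cons st l ih =>
    obtain ⟨hv, rfl, hl⟩ := hl
    obtain ⟨t₁, h1, h2⟩ := innermost_step hv ht
    obtain ⟨t', h3, h4⟩ := ih hl h1
    exact ⟨t', h3, mem_support_cons.2 ⟨t₁, h2, h4⟩⟩

theorem Step.centralSite_mem_supp {st : Step} (hv : st.Valid) (l : ZMod m) :
    Site.mk l (centralRep st.src).1 (centralRep st.src).2 ∈
      st.supp (Site.mk l (centralRep st.tgt).1 (centralRep st.tgt).2) := by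
  obtain ⟨h1, h2, h3, hp⟩ := isRep_centralRep st.tgt
  refine (Step.mem_supp_mk hv l h1 h2 hp _).2 ?_
  rcases st with (_ | _ | _ | _) | κ | κ | κ
  · exact ⟨1, by simp [Step.tgt, Step.src, Kind.swap, centralRep, Step.pre, fillPre, Kind.off]⟩
  · exact ⟨2, by simp [Step.tgt, Step.src, Kind.swap, centralRep, Step.pre, fillPre, Kind.off]⟩
  · exact ⟨2, by simp [Step.tgt, Step.src, Kind.swap, centralRep, Step.pre, rotPre]⟩
  · exact ⟨3, by simp [Step.tgt, Step.src, Kind.swap, centralRep, Step.pre, rotPre]⟩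
  · rcases hv with rfl | rfl <;>
    exact ⟨0, by simp [Step.tgt, Step.src, centralRep, Step.pre, fillPre, Kind.off]⟩
  · rcases hv with rfl | rfl <;>
    exact ⟨0, by simp [Step.tgt, Step.src, centralRep, Step.pre, fillPre, Kind.off]⟩
  · rcases hv with rfl | rfl
    · exact ⟨1, by simp [Step.tgt, Step.src, centralRep, Step.pre, edgePre, Kind.diag]⟩
    · exact ⟨0, by simp [Step.tgt, Step.src, centralRep, Step.pre, edgePre, Kind.diag]⟩

theorem centralSite_mem_support {l : List Step} {κ κ' : Kind} (hl : Chain κ l κ') (j : ZMod m) :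
    Site.mk j (centralRep κ).1 (centralRep κ).2 ∈
      support l (Site.mk j (centralRep κ').1 (centralRep κ').2) := by
  induction l generalizing κ' with
  | nil => obtain rfl : κ' = κ := hl; simp [support]
  | cons st l ih =>
    obtain ⟨hv, rfl, hl⟩ := hl
    exact mem_support_cons.2 ⟨_, Step.centralSite_mem_supp hv j, ih hl⟩

/-- A vertex next to the centre, for a dual net at the start, depends on that of its own segment
and on that of the previous one; the centre depends on all of them. -/
def SpreadsTo (l : List Step) : Kind → Prop
  | .primal => ∀ j : ZMod m, Site.mk j 1 1 ∈ support l .center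
  | .rotPrimal => ∀ j : ZMod m, Site.mk j 1 1 ∈ support l .center
  | .dual => ∀ j : ZMod m, Site.mk j 1 1 ∈ support l (Site.mk j 1 1) ∧
      (l ≠ [] → Site.mk (j - 1) 1 1 ∈ support l (Site.mk j 1 1))
  | .rotDual => ∀ j : ZMod m, Site.mk j 1 1 ∈ support l (Site.mk j 1 0) ∧
      Site.mk (j - 1) 1 1 ∈ support l (Site.mk j 1 0)

theorem mem_support_of_pre (st : Step) (hv : st.Valid) {l : List Step} (j : ZMod m) (x y : ℤ)
    (hx : 1 ≤ x) (hy : 0 ≤ y) (hp : st.tgt.par x y) (i : Fin 4) {t : Site m}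
    (h : t ∈ support l (Site.mk j (st.pre x y i).1 (st.pre x y i).2)) :
    t ∈ support (st :: l) (Site.mk j x y) :=
  mem_support_cons.2 ⟨_, (Step.mem_supp_mk hv j hx hy hp _).2 ⟨i, rfl⟩, h⟩

theorem mem_support_center {st : Step} {l : List Step} {s t : Site m}
    (hst : (∃ κ, st = .A κ ∨ st = .R κ)) (hv : IsVertex st.tgt (.center : Site m))
    (hs : s ∈ innermost st.src) (h : t ∈ support l s) : t ∈ support (st :: l) .center := by
  refine mem_support_cons.2 ⟨s, ?_, h⟩
  rw [Step.supp, if_pos hv]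
  obtain ⟨κ, rfl | rfl⟩ := hst <;> exact hs

/-- Repeated steps carry the influence of an innermost vertex of a dual net around the centre. -/
theorem Chain.spreadsTo {l : List Step} {κ' : Kind} (hl : Chain .dual l κ') :
    SpreadsTo (m := m) l κ' := by
  induction l generalizing κ' with
  | nil => obtain rfl : κ' = .dual := hl; intro j; simp [support]
  | cons st l ih =>
    obtain ⟨hv, rfl, hl⟩ := hl
    have IH := ih hl
    rcases st with (_ | _ | _ | _) | κ | κ | κ
    · replace IH : ∀ j : ZMod m, Site.mk j 1 1 ∈ support l .center := IH
      change ∀ j : ZMod m, Site.mk j 1 1 ∈ support (.A .primal :: l) (Site.mk j 1 1) ∧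
        (.A .primal :: l ≠ [] → Site.mk (j - 1) 1 1 ∈ support (.A .primal :: l) (Site.mk j 1 1))
      intro j
      have h : ∀ j' : ZMod m, Site.mk j' 1 1 ∈ support (.A .primal :: l) (Site.mk j 1 1) :=
        fun j' => mem_support_of_pre (.A .primal) hv j 1 1 le_rfl (by norm_num)
          (by simp [Step.tgt, Kind.swap, Kind.par]) 3
          (by simpa [Step.pre, fillPre, Kind.off] using IH j')
      exact ⟨h j, fun _ => h (j - 1)⟩
    · replace IH : ∀ j : ZMod m, Site.mk j 1 1 ∈ support l (Site.mk j 1 1) ∧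
        (l ≠ [] → Site.mk (j - 1) 1 1 ∈ support l (Site.mk j 1 1)) := IH
      change ∀ j : ZMod m, Site.mk j 1 1 ∈ support (.A .dual :: l) .center
      intro j
      refine mem_support_center (s := Site.mk j 1 1) ⟨_, Or.inl rfl⟩ ?_
        (mem_innermost_dual.2 ⟨j, rfl⟩) (IH j).1
      simp [Step.tgt, Kind.swap, IsVertex, Kind.parity]
    · replace IH : ∀ j : ZMod m, Site.mk j 1 1 ∈ support l .center := IH
      change ∀ j : ZMod m, Site.mk j 1 1 ∈ support (.A .rotPrimal :: l) (Site.mk j 1 0) ∧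
        Site.mk (j - 1) 1 1 ∈ support (.A .rotPrimal :: l) (Site.mk j 1 0)
      intro j
      have h : ∀ j' : ZMod m, Site.mk j' 1 1 ∈ support (.A .rotPrimal :: l) (Site.mk j 1 0) :=
        fun j' => mem_support_of_pre (.A .rotPrimal) hv j 1 0 le_rfl (by norm_num)
          (by simp [Step.tgt, Kind.swap, Kind.par]) 1 (by simpa [Step.pre, rotPre] using IH j')
      exact ⟨h j, h (j - 1)⟩
    · replace IH : ∀ j : ZMod m, Site.mk j 1 1 ∈ support l (Site.mk j 1 0) ∧
        Site.mk (j - 1) 1 1 ∈ support l (Site.mk j 1 0) := IH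
      change ∀ j : ZMod m, Site.mk j 1 1 ∈ support (.A .rotDual :: l) .center
      intro j
      refine mem_support_center (s := Site.mk j 1 0) ⟨_, Or.inl rfl⟩ ?_
        (mem_innermost.2 ⟨?_, Or.inr ⟨j, Or.inl rfl⟩⟩) (IH j).1
      · simp [Step.tgt, Kind.swap, IsVertex, Kind.parity]
      · rw [isVertex_mk _ _ (by norm_num)]; simp [Step.src, Kind.par]
    · rcases hv with rfl | rfl
      · replace IH : ∀ j : ZMod m, Site.mk j 1 1 ∈ support l .center := IH
        change ∀ j : ZMod m, Site.mk j 1 1 ∈ support (.R .primal :: l) .center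
        intro j
        refine mem_support_center (s := .center) ⟨_, Or.inr rfl⟩ ?_
          (mem_innermost_primal.2 rfl) (IH j)
        simp [Step.tgt, IsVertex, Kind.parity]
      · replace IH : ∀ j : ZMod m, Site.mk j 1 1 ∈ support l (Site.mk j 1 1) ∧
          (l ≠ [] → Site.mk (j - 1) 1 1 ∈ support l (Site.mk j 1 1)) := IH
        change ∀ j : ZMod m, Site.mk j 1 1 ∈ support (.R .dual :: l) .center
        intro j
        refine mem_support_center (s := Site.mk j 1 1) ⟨_, Or.inr rfl⟩ ?_
          (mem_innermost_dual.2 ⟨j, rfl⟩) (IH j).1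
        simp [Step.tgt, IsVertex, Kind.parity]
    · rcases hv with rfl | rfl
      · replace IH : ∀ j : ZMod m, Site.mk j 1 1 ∈ support l .center := IH
        change ∀ j : ZMod m, Site.mk j 1 1 ∈ support (.V .primal :: l) (Site.mk j 1 0) ∧
          Site.mk (j - 1) 1 1 ∈ support (.V .primal :: l) (Site.mk j 1 0)
        intro j
        have h : ∀ j' : ZMod m, Site.mk j' 1 1 ∈ support (.V .primal :: l) (Site.mk j 1 0) :=
          fun j' => mem_support_of_pre (.V .primal) (Or.inl rfl) j 1 0 le_rfl (by norm_num)
            (by simp [Step.tgt, Kind.par]) 3 (by simpa [Step.pre, fillPre, Kind.off] using IH j')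
        exact ⟨h j, h (j - 1)⟩
      · replace IH : ∀ j : ZMod m, Site.mk j 1 1 ∈ support l (Site.mk j 1 1) ∧
          (l ≠ [] → Site.mk (j - 1) 1 1 ∈ support l (Site.mk j 1 1)) := IH
        change ∀ j : ZMod m, Site.mk j 1 1 ∈ support (.V .dual :: l) (Site.mk j 1 0) ∧
          Site.mk (j - 1) 1 1 ∈ support (.V .dual :: l) (Site.mk j 1 0)
        intro j
        have h1 := (IH j).1
        have h2 := (IH (j - 1)).1
        refine ⟨mem_support_of_pre (.V .dual) (Or.inr rfl) j 1 0 le_rfl (by norm_num)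
            (by simp [Step.tgt, Kind.par]) 0 (by simpa [Step.pre, fillPre, Kind.off] using h1),
          mem_support_of_pre (.V .dual) (Or.inr rfl) j 1 0 le_rfl (by norm_num)
            (by simp [Step.tgt, Kind.par]) 1 ?_⟩
        have e : Site.mk j 1 (-1) = Site.mk (j - 1) 1 1 :=
          Site.mk_eq_mk_pred j (by norm_num) (by norm_num)
        simpa [Step.pre, fillPre, Kind.off, e] using h2
    · rcases hv with rfl | rfl
      · replace IH : ∀ j : ZMod m, Site.mk j 1 1 ∈ support l .center := IH
        change ∀ j : ZMod m, Site.mk j 1 1 ∈ support (.W .rotPrimal :: l) (Site.mk j 1 1) ∧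
          (.W .rotPrimal :: l ≠ [] →
            Site.mk (j - 1) 1 1 ∈ support (.W .rotPrimal :: l) (Site.mk j 1 1))
        intro j
        have h : ∀ j' : ZMod m, Site.mk j' 1 1 ∈ support (.W .rotPrimal :: l) (Site.mk j 1 1) :=
          fun j' => mem_support_of_pre (.W .rotPrimal) (Or.inl rfl) j 1 1 le_rfl (by norm_num)
            (by simp [Step.tgt, Kind.par]) 0 (by simpa [Step.pre, edgePre, Kind.diag] using IH j')
        exact ⟨h j, fun _ => h (j - 1)⟩
      · replace IH : ∀ j : ZMod m, Site.mk j 1 1 ∈ support l (Site.mk j 1 0) ∧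
          Site.mk (j - 1) 1 1 ∈ support l (Site.mk j 1 0) := IH
        change ∀ j : ZMod m, Site.mk j 1 1 ∈ support (.W .rotDual :: l) (Site.mk j 1 1) ∧
          (.W .rotDual :: l ≠ [] →
            Site.mk (j - 1) 1 1 ∈ support (.W .rotDual :: l) (Site.mk j 1 1))
        intro j
        have h : ∀ t, t ∈ support l (Site.mk j 1 0) →
            t ∈ support (.W .rotDual :: l) (Site.mk j 1 1) :=
          fun t ht => mem_support_of_pre (.W .rotDual) (Or.inr rfl) j 1 1 le_rfl (by norm_num)
            (by simp [Step.tgt, Kind.par]) 0 (by simpa [Step.pre, edgePre, Kind.diag] using ht)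
        exact ⟨h _ (IH j).1, fun _ => h _ (IH j).2⟩

/-- The centre, or all vertices of the central face, belong to the core. -/
theorem innermost_subset_core (hκ : κ.Straight) (hout : Word.out U κ = κ)
    (hne : Word.steps U κ ≠ []) {s : Site m} (hs : s ∈ innermost κ) : s ∈ core m U κ := by
  have hchain := Word.chain_steps U hκ
  rw [hout] at hchain
  rw [mem_core_iff]
  refine ⟨(mem_innermost.1 hs).1, ?_⟩
  rcases hκ with rfl | rfl
  · refine ⟨1, le_rfl, fun t ht => ?_⟩
    obtain ⟨t', h1, h2⟩ := innermost_run (hchain.repeatSteps 1) ht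
    rw [mem_innermost_primal] at h1 hs
    rw [hs, ← h1]; exact h2
  · have hsp : ∀ j : ZMod m, Site.mk j 1 1 ∈ support (Word.steps U .dual) (Site.mk j 1 1) ∧
        (Word.steps U .dual ≠ [] → Site.mk (j - 1) 1 1 ∈
          support (Word.steps U .dual) (Site.mk j 1 1)) := hchain.spreadsTo (m := m)
    have key : ∀ n i : ℕ, i ≤ n → ∀ j : ZMod m,
        Site.mk (j - (i : ZMod m)) 1 1 ∈
          support (repeatSteps (Word.steps U .dual) n) (Site.mk j 1 1) := by
      intro n
      induction n with
      | zero =>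
        intro i hi j
        obtain rfl : i = 0 := by omega
        simp [repeatSteps, support]
      | succ n ih =>
        intro i hi j
        rw [repeatSteps, mem_support_append]
        rcases i with _ | i
        · exact ⟨_, (hsp j).1, ih 0 (by omega) j⟩
        · refine ⟨_, (hsp j).2 hne, ?_⟩
          have := ih i (by omega) (j - 1)
          rwa [show j - 1 - (i : ZMod m) = j - ((i + 1 : ℕ) : ZMod m) by push_cast; ring] at this
    refine ⟨m, NeZero.one_le, fun t ht => ?_⟩
    obtain ⟨j, rfl⟩ := mem_innermost_dual.1 ht
    obtain ⟨j', rfl⟩ := mem_innermost_dual.1 hs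
    have := key m (j - j').val (ZMod.val_lt _).le j
    rwa [ZMod.natCast_zmod_val, sub_sub_cancel] at this

theorem centralSite_mem_core (hκ : κ.Straight) (hout : Word.out U κ = κ)
    (hd : ∃ st ∈ Word.steps U κ, st.src = .dual) :
    Site.mk (0 : ZMod m) (centralRep κ).1 (centralRep κ).2 ∈ core m U κ := by
  have hchain := Word.chain_steps U hκ
  rw [hout] at hchain
  rcases hκ with rfl | rfl
  · rw [mem_core_iff]
    refine ⟨?_, 1, le_rfl, fun t ht => ?_⟩
    · rw [isVertex_mk _ _ (by simp [centralRep])]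
      simp [centralRep, Kind.par]
    · rw [mem_innermost_primal] at ht
      subst ht
      obtain ⟨st, hst, hsd⟩ := hd
      obtain ⟨l₁, l₂, e⟩ := List.append_of_mem hst
      rw [repeatSteps, repeatSteps, List.append_nil, e, List.append_cons]
      rw [e, List.append_cons] at hchain
      obtain ⟨κ₁, h1, h2⟩ := hchain.split
      have hκ₁ : κ₁ = .dual := by
        obtain ⟨κ₂, h3, -⟩ := h2.split
        obtain ⟨-, -, h3⟩ := h3
        rw [← hsd]; exact (show st.src = κ₁ from h3).symm
      subst hκ₁
      rw [mem_support_append]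
      exact ⟨Site.mk 0 1 1, h2.spreadsTo 0, centralSite_mem_support h1 0⟩
  · exact innermost_subset_core (Or.inr rfl) hout
      (List.ne_nil_of_mem hd.choose_spec.1) (mem_innermost_dual.2 ⟨0, rfl⟩)

end Core

/-! ### Positive linear maps with comparable values -/

section PositiveMaps

/-- A positive sequence whose relative increments decay geometrically has a positive limit. -/
theorem exists_tendsto_pos {u : ℕ → ℝ} (hu : ∀ k, 0 < u k) {D θ : ℝ} (hθ : 0 < θ) (hθ1 : θ < 1)
    (h : ∀ k, |u (k + 1) - u k| ≤ D * θ ^ k * u k) : ∃ a, 0 < a ∧ Tendsto u atTop (𝓝 a) := by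
  have hD : 0 ≤ D := by
    have := (abs_nonneg _).trans (h 0)
    rw [pow_zero, mul_one] at this
    exact nonneg_of_mul_nonneg_left this (hu 0)
  have hlim : Tendsto (fun k : ℕ => D * θ ^ k) atTop (𝓝 0) := by
    simpa using (tendsto_pow_atTop_nhds_zero_of_lt_one hθ.le hθ1).const_mul D
  obtain ⟨k₀, hk₀⟩ := eventually_atTop.1
    (hlim.eventually_le_const (show (0 : ℝ) < 1 / 2 by norm_num))
  have hlog : ∀ k, k₀ ≤ k → |Real.log (u (k + 1)) - Real.log (u k)| ≤ 2 * D * θ ^ k := by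
    intro k hk
    have h1 := hk₀ k hk
    have h2 := abs_le.1 (h k)
    have p0 := hu k
    have p1 := hu (k + 1)
    have hd : 0 ≤ D * θ ^ k := by positivity
    have hle : u k ≤ 2 * u (k + 1) := by nlinarith
    rw [← Real.log_div p1.ne' p0.ne', abs_le]
    constructor
    · have h3 := Real.log_le_sub_one_of_pos (div_pos p0 p1)
      have h4 : Real.log (u (k + 1) / u k) = - Real.log (u k / u (k + 1)) := by
        rw [← Real.log_inv, inv_div]
      have h5 : u k / u (k + 1) - 1 ≤ 2 * D * θ ^ k := by
        rw [sub_le_iff_le_add, div_le_iff₀ p1]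
        nlinarith
      linarith
    · have h3 := Real.log_le_sub_one_of_pos (div_pos p1 p0)
      have h5 : u (k + 1) / u k - 1 ≤ 2 * D * θ ^ k := by
        rw [sub_le_iff_le_add, div_le_iff₀ p0]
        nlinarith
      linarith
  have hC : CauchySeq fun k => Real.log (u (k + k₀)) := by
    refine cauchySeq_of_le_geometric θ (2 * D * θ ^ k₀) hθ1 fun k => ?_
    rw [dist_comm, Real.dist_eq, show k + 1 + k₀ = k + k₀ + 1 by ring]
    refine (hlog (k + k₀) (by omega)).trans (le_of_eq ?_)
    rw [pow_add]; ring
  obtain ⟨w, hw⟩ := cauchySeq_tendsto_of_complete hC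
  refine ⟨Real.exp w, Real.exp_pos w, ?_⟩
  rw [← tendsto_add_atTop_iff_nat k₀]
  have := (Real.continuous_exp.tendsto w).comp hw
  refine this.congr fun k => ?_
  simp [Real.exp_log (hu _)]

variable {V : Type*} [AddCommGroup V] [Module ℝ V] {J : Type*}

/-- The cone of the vectors of `W` at which all functionals `f j` are non-negative is mapped into
itself by `T`, and into a much smaller cone by `T ^ n`. -/
structure PositiveMap (W : Submodule ℝ V) (T : Module.End ℝ V) (f : J → V →ₗ[ℝ] ℝ) (n : ℕ)
    (K : ℝ) : Prop where
  maps : ∀ x ∈ W, T x ∈ W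
  pos : ∀ x ∈ W, (∀ j, 0 ≤ f j x) → ∀ j, 0 ≤ f j (T x)
  comp : ∀ x ∈ W, (∀ j, 0 ≤ f j x) → ∀ i j, f i ((T ^ n) x) ≤ K * f j ((T ^ n) x)

namespace PositiveMap

variable {W : Submodule ℝ V} {T : Module.End ℝ V} {f : J → V →ₗ[ℝ] ℝ} {n : ℕ} {K : ℝ}
  (h : PositiveMap W T f n K)

include h

theorem maps_pow {x : V} (hx : x ∈ W) (k : ℕ) : (T ^ k) x ∈ W := by
  induction k with
  | zero => exact hx
  | succ k ih => rw [pow_succ']; exact h.maps _ ih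

theorem pos_pow {x : V} (hx : x ∈ W) (hf : ∀ j, 0 ≤ f j x) (k : ℕ) (j : J) :
    0 ≤ f j ((T ^ k) x) := by
  induction k generalizing j with
  | zero => exact hf j
  | succ k ih => rw [pow_succ']; exact h.pos _ (h.maps_pow hx k) ih j

/-- Lower bounds for the quotients of successive iterates persist. -/
theorem lower_mono {x : V} (hx : x ∈ W) {a : ℝ} {k i : ℕ} (hki : k ≤ i)
    (ha : ∀ j, a * f j ((T ^ k) x) ≤ f j ((T ^ (k + 1)) x)) (j : J) :
    a * f j ((T ^ i) x) ≤ f j ((T ^ (i + 1)) x) := by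
  obtain ⟨d, rfl⟩ := Nat.exists_eq_add_of_le hki
  have h1 := h.pos_pow (W.sub_mem (h.maps_pow hx (k + 1)) (W.smul_mem a (h.maps_pow hx k)))
    (fun j => by simpa using ha j) d j
  rw [map_sub, map_smul, ← Module.End.mul_apply, ← Module.End.mul_apply, ← pow_add, ← pow_add,
    map_sub, map_smul, smul_eq_mul, add_comm d k, show d + (k + 1) = k + d + 1 by ring] at h1
  linarith

/-- Upper bounds for the quotients of successive iterates persist. -/
theorem upper_mono {x : V} (hx : x ∈ W) {b : ℝ} {k i : ℕ} (hki : k ≤ i)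
    (hb : ∀ j, f j ((T ^ (k + 1)) x) ≤ b * f j ((T ^ k) x)) (j : J) :
    f j ((T ^ (i + 1)) x) ≤ b * f j ((T ^ i) x) := by
  obtain ⟨d, rfl⟩ := Nat.exists_eq_add_of_le hki
  have h1 := h.pos_pow (W.sub_mem (W.smul_mem b (h.maps_pow hx k)) (h.maps_pow hx (k + 1)))
    (fun j => by simpa using hb j) d j
  rw [map_sub, map_smul, ← Module.End.mul_apply, ← Module.End.mul_apply, ← pow_add, ← pow_add,
    map_sub, map_smul, smul_eq_mul, add_comm d k, show d + (k + 1) = k + d + 1 by ring] at h1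
  linarith

/-- If a combination is non-negative, and large at one functional, it is large at all of them after
`n` steps. -/
theorem lower_of_half (hK : 1 ≤ K) {x y : V} (hx : x ∈ W) (hy : y ∈ W) (hx0 : ∀ j, 0 ≤ f j x)
    (hy0 : ∀ j, 0 ≤ f j y) {c : ℝ} (hc : 0 ≤ c) (i : J)
    (hi : c * f i ((T ^ n) x) ≤ f i ((T ^ n) y)) (j : J) :
    c / K ^ 2 * f j ((T ^ n) x) ≤ f j ((T ^ n) y) := by
  have h1 := h.comp y hy hy0 i j
  have h2 := h.comp x hx hx0 j i
  have hK0 : 0 < K := by linarith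
  rw [div_mul_eq_mul_div, div_le_iff₀ (by positivity)]
  calc c * f j ((T ^ n) x) ≤ c * (K * f i ((T ^ n) x)) := mul_le_mul_of_nonneg_left h2 hc
    _ = K * (c * f i ((T ^ n) x)) := by ring
    _ ≤ K * (K * f j ((T ^ n) y)) := mul_le_mul_of_nonneg_left (hi.trans h1) hK0.le
    _ = f j ((T ^ n) y) * K ^ 2 := by ring

/-- The bounds for the quotients of successive iterates get closer by a fixed factor. -/
theorem contract [Nonempty J] (hK : 1 ≤ K) {x : V} (hx : x ∈ W) (hpos : ∀ k j, 0 < f j ((T ^ k) x))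
    {a b : ℝ} {k : ℕ} (ha : ∀ j, a * f j ((T ^ k) x) ≤ f j ((T ^ (k + 1)) x))
    (hb : ∀ j, f j ((T ^ (k + 1)) x) ≤ b * f j ((T ^ k) x)) :
    ∃ a' b', b' - a' ≤ (1 - 1 / (2 * K ^ 2)) * (b - a) ∧
      (∀ j, a' * f j ((T ^ (k + n)) x) ≤ f j ((T ^ (k + n + 1)) x)) ∧
      ∀ j, f j ((T ^ (k + n + 1)) x) ≤ b' * f j ((T ^ (k + n)) x) := by
  have hab : a ≤ b := by
    obtain ⟨j⟩ := ‹Nonempty J›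
    exact le_of_mul_le_mul_right ((ha j).trans (hb j)) (hpos k j)
  have e : ∀ d, (T ^ n) ((T ^ d) x) = (T ^ (d + n)) x := fun d => by
    rw [← Module.End.mul_apply, ← pow_add, add_comm]
  have e' : (T ^ (k + 1 + n)) x = (T ^ (k + n + 1)) x := by
    rw [show k + 1 + n = k + n + 1 by ring]
  have hxk := h.maps_pow hx k
  have hxk1 := h.maps_pow hx (k + 1)
  have hf0 : ∀ j, 0 ≤ f j ((T ^ k) x) := fun j => (hpos k j).le
  obtain ⟨i⟩ := ‹Nonempty J›
  rcases le_total ((b - a) / 2 * f i ((T ^ (k + n)) x) + a * f i ((T ^ (k + n)) x))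
    (f i ((T ^ (k + n + 1)) x)) with hi | hi
  · refine ⟨a + (b - a) / 2 / K ^ 2, b, ?_, fun j => ?_, h.upper_mono hx (by omega) hb⟩
    · apply le_of_eq; field_simp; ring
    · have := h.lower_of_half hK hxk (W.sub_mem hxk1 (W.smul_mem a hxk)) hf0
        (fun j => by simpa using ha j) (c := (b - a) / 2) (by linarith) i
        (by simp only [map_sub, map_smul, smul_eq_mul, e, e']; linarith) j
      simp only [map_sub, map_smul, smul_eq_mul, e, e'] at this
      linarith
  · refine ⟨a, b - (b - a) / 2 / K ^ 2, ?_, h.lower_mono hx (by omega) ha, fun j => ?_⟩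
    · apply le_of_eq; field_simp; ring
    · have := h.lower_of_half hK hxk (W.sub_mem (W.smul_mem b hxk) hxk1) hf0
        (fun j => by simpa using hb j) (c := (b - a) / 2) (by linarith) i
        (by simp only [map_sub, map_smul, smul_eq_mul, e, e']; linarith) j
      simp only [map_sub, map_smul, smul_eq_mul, e, e'] at this
      linarith

/-- The iterates of a positive map grow like the powers of a number. -/
theorem exists_growth [Finite J] [Nonempty J] (hn : 1 ≤ n) (hK : 1 ≤ K) {x : V} (hx : x ∈ W)
    (hpos : ∀ k j, 0 < f j ((T ^ k) x)) :
    ∃ lam : ℝ, 0 < lam ∧ ∃ a : J → ℝ, (∀ j, 0 < a j) ∧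
      ∀ j, Tendsto (fun k => f j ((T ^ k) x) / lam ^ k) atTop (𝓝 (a j)) := by
  have hK2 : 0 < 2 * K ^ 2 := by positivity
  set q : ℝ := 1 - 1 / (2 * K ^ 2) with hq
  have hq1 : q < 1 := by
    have : 0 < 1 / (2 * K ^ 2) := by positivity
    linarith
  have hq0 : 0 < q := by
    have : 1 / (2 * K ^ 2) ≤ 1 / 2 := by
      apply div_le_div_of_nonneg_left <;> nlinarith
    linarith
  -- the initial bounds
  obtain ⟨j₀, hj₀⟩ := Finite.exists_min fun j => f j ((T ^ 1) x) / f j ((T ^ 0) x)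
  obtain ⟨j₁, hj₁⟩ := Finite.exists_max fun j => f j ((T ^ 1) x) / f j ((T ^ 0) x)
  set a₀ := f j₀ ((T ^ 1) x) / f j₀ ((T ^ 0) x)
  set b₀ := f j₁ ((T ^ 1) x) / f j₁ ((T ^ 0) x)
  have ha₀ : 0 < a₀ := div_pos (hpos 1 j₀) (hpos 0 j₀)
  have hla : ∀ j, a₀ * f j ((T ^ 0) x) ≤ f j ((T ^ (0 + 1)) x) := fun j =>
    (le_div_iff₀ (hpos 0 j)).1 (hj₀ j)
  have hub : ∀ j, f j ((T ^ (0 + 1)) x) ≤ b₀ * f j ((T ^ 0) x) := fun j =>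
    (div_le_iff₀ (hpos 0 j)).1 (hj₁ j)
  have hab₀ : a₀ ≤ b₀ := hj₀ j₁
  have hseq : ∀ i : ℕ, ∃ a b, b - a ≤ q ^ i * (b₀ - a₀) ∧
      (∀ j, a * f j ((T ^ (i * n)) x) ≤ f j ((T ^ (i * n + 1)) x)) ∧
      ∀ j, f j ((T ^ (i * n + 1)) x) ≤ b * f j ((T ^ (i * n)) x) := by
    intro i
    induction i with
    | zero => exact ⟨a₀, b₀, by simp, by simpa using hla, by simpa using hub⟩
    | succ i ih =>
      obtain ⟨a, b, h1, h2, h3⟩ := ih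
      obtain ⟨a', b', h4, h5, h6⟩ := h.contract hK hx hpos h2 h3
      refine ⟨a', b', h4.trans ?_, ?_, ?_⟩
      · rw [pow_succ' q i, mul_assoc]
        exact mul_le_mul_of_nonneg_left h1 hq0.le
      · simpa [Nat.succ_mul] using h5
      · simpa [Nat.succ_mul] using h6
  -- all lower bounds are below all upper bounds
  set A : Set ℝ := {a | ∃ k, ∀ j, a * f j ((T ^ k) x) ≤ f j ((T ^ (k + 1)) x)} with hA
  have hAB : ∀ a ∈ A, ∀ k b, (∀ j, f j ((T ^ (k + 1)) x) ≤ b * f j ((T ^ k) x)) → a ≤ b := by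
    rintro a ⟨i, hi⟩ k b hb
    have h1 := h.lower_mono hx (le_max_left i k) hi j₀
    have h2 := h.upper_mono hx (le_max_right i k) hb j₀
    exact le_of_mul_le_mul_right (h1.trans h2) (hpos _ _)
  have hbdd : BddAbove A := ⟨b₀, fun a ha => hAB a ha 0 b₀ hub⟩
  have hne : A.Nonempty := ⟨a₀, 0, hla⟩
  set lam := sSup A with hlam
  have hlam0 : 0 < lam := ha₀.trans_le (le_csSup hbdd ⟨0, hla⟩)
  -- the rate
  set θ : ℝ := q ^ ((n : ℝ)⁻¹) with hθ
  have hθn : θ ^ n = q := Real.rpow_inv_natCast_pow hq0.le (by omega)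
  have hθ0 : 0 < θ := Real.rpow_pos_of_pos hq0 _
  have hθ1 : θ < 1 := Real.rpow_lt_one hq0.le hq1 (by positivity)
  have hrate : ∀ k, q ^ (k / n) ≤ q⁻¹ * θ ^ k := by
    intro k
    rw [← div_eq_inv_mul, le_div_iff₀ hq0, ← pow_succ]
    conv_lhs => rw [← hθn]
    rw [← pow_mul]
    apply pow_le_pow_of_le_one hθ0.le hθ1.le
    rw [Nat.mul_add, Nat.mul_one]
    have h1 := Nat.div_add_mod k n
    have h2 := Nat.mod_lt k (show n > 0 by omega)
    omega
  have hdiff : ∀ k j, |f j ((T ^ (k + 1)) x) - lam * f j ((T ^ k) x)| ≤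
      (q⁻¹ * (b₀ - a₀)) * θ ^ k * f j ((T ^ k) x) := by
    intro k j
    obtain ⟨a, b, h1, h2, h3⟩ := hseq (k / n)
    have hal : a ≤ lam := le_csSup hbdd ⟨_, h2⟩
    have hlb : lam ≤ b := csSup_le hne fun a' ha' => hAB a' ha' _ _ h3
    have h4 := h.lower_mono hx (Nat.div_mul_le_self k n) h2 j
    have h5 := h.upper_mono hx (Nat.div_mul_le_self k n) h3 j
    have h6 : b - a ≤ (q⁻¹ * (b₀ - a₀)) * θ ^ k := by
      have := mul_le_mul_of_nonneg_right (hrate k) (sub_nonneg.2 hab₀)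
      linarith
    have hp := hpos k j
    refine le_trans ?_ (mul_le_mul_of_nonneg_right h6 hp.le)
    rw [abs_le]
    constructor <;> nlinarith
  have hconv : ∀ j, ∃ a, 0 < a ∧ Tendsto (fun k => f j ((T ^ k) x) / lam ^ k) atTop (𝓝 a) := by
    intro j
    refine exists_tendsto_pos (D := lam⁻¹ * (q⁻¹ * (b₀ - a₀))) (fun k => div_pos (hpos k j)
      (pow_pos hlam0 k)) hθ0 hθ1 fun k => ?_
    have e1 : f j ((T ^ (k + 1)) x) / lam ^ (k + 1) - f j ((T ^ k) x) / lam ^ k =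
        (lam ^ (k + 1))⁻¹ * (f j ((T ^ (k + 1)) x) - lam * f j ((T ^ k) x)) := by
      rw [pow_succ]; field_simp [hlam0.ne']; try ring
    rw [e1, abs_mul, abs_of_pos (by positivity)]
    refine (mul_le_mul_of_nonneg_left (hdiff k j) (by positivity)).trans (le_of_eq ?_)
    rw [pow_succ]; field_simp
  choose a ha hlim using hconv
  exact ⟨lam, hlam0, a, ha, hlim⟩

/-- A lower bound for the quotients of successive iterates is one for the growth rate. -/
theorem le_of_lower {x : V} (hx : x ∈ W) {lam a : ℝ} (hlam : 0 < lam) (ha : 0 < a) {j : J}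
    (hlim : Tendsto (fun k => f j ((T ^ k) x) / lam ^ k) atTop (𝓝 a)) {c : ℝ} {k : ℕ}
    (hc : ∀ j, c * f j ((T ^ k) x) ≤ f j ((T ^ (k + 1)) x)) : c ≤ lam := by
  refine le_of_mul_le_mul_right (le_of_tendsto_of_tendsto (hlim.const_mul c)
    (((tendsto_add_atTop_iff_nat 1).2 hlim).const_mul lam) ?_) ha
  filter_upwards [eventually_ge_atTop k] with i hi
  have h1 := h.lower_mono hx hi hc j
  have e : lam * (f j ((T ^ (i + 1)) x) / lam ^ (i + 1)) = f j ((T ^ (i + 1)) x) / lam ^ i := by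
    rw [pow_succ lam, mul_div_assoc', mul_comm lam, mul_div_mul_right _ _ hlam.ne']
  rw [e, ← mul_div_assoc]
  exact div_le_div_of_nonneg_right h1 (by positivity)

end PositiveMap

end PositiveMaps

/-! ### Growth on the core -/

section Cut

variable {X : Set (Site m)} {ω : ℂ} {N : Net m}

open Classical in
/-- The net with the values of `N` on `X`, and zero elsewhere. -/
noncomputable def cut (X : Set (Site m)) (N : Net m) : Net m := fun s => if s ∈ X then N s else 0

theorem cut_of_mem {s : Site m} (h : s ∈ X) : cut X N s = N s := if_pos h

theorem cut_of_notMem {s : Site m} (h : s ∉ X) : cut X N s = 0 := if_neg h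

theorem IsSym.cut (hN : IsSym ω N) (hX : SymSet X) : IsSym ω (cut X N) := by
  constructor
  · intro s
    by_cases h : s ∈ X
    · rw [cut_of_mem h, cut_of_mem ((hX.rotate s).2 h), hN.rotate]
    · rw [cut_of_notMem h, cut_of_notMem (mt (hX.rotate s).1 h), mul_zero]
  · intro s
    by_cases h : s ∈ X
    · rw [cut_of_mem h, cut_of_mem ((hX.reflect s).2 h), hN.reflect]
    · rw [cut_of_notMem h, cut_of_notMem (mt (hX.reflect s).1 h), map_zero]

theorem SymSet.mk_natCast (hX : SymSet X) (n : ℕ) (x y : ℤ) :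
    Site.mk (n : ZMod m) x y ∈ X ↔ Site.mk 0 x y ∈ X := by
  induction n with
  | zero => simp
  | succ n ih => rw [Nat.cast_succ, ← Site.rotate_mk, hX.rotate, ih]

theorem SymSet.rep_mem [NeZero m] (hX : SymSet X) {κ : Kind}
    (hc : Site.mk 0 (centralRep κ).1 (centralRep κ).2 ∈ X) {s : Site m} (hs : s ∈ X) :
    Site.mk 0 (s.rep κ).1 (s.rep κ).2 ∈ X := by
  rcases s.exists_mk with rfl | ⟨l, x, y, hx, hy, rfl⟩
  · exact hc
  · rw [Site.rep_mk _ _ (by omega) (by omega)]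
    rw [← ZMod.natCast_zmod_val l, hX.mk_natCast] at hs
    rcases le_total y x with hle | hle
    · rwa [fold_of_le hy hle]
    · rw [← fold_swap, fold_of_le (by omega) hle]
      rw [Site.mk_eq_mk_succ 0 (by omega) hy, ← Site.rotate_mk, hX.rotate, ← hX.reflect,
        Site.reflect_mk 0 hy, neg_zero, neg_neg] at hs
      exact hs

end Cut

/-- In a finite family, bounds that may be increased can be chosen independently of the index. -/
theorem exists_uniform {ι : Type*} [Finite ι] {P : ι → ℝ → Prop}
    (hP : ∀ i a b, a ≤ b → P i a → P i b) (h : ∀ i, ∃ a, P i a) : ∃ a, ∀ i, P i a := by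
  choose a ha using h
  obtain ⟨b, hb⟩ := Finite.exists_le a
  exact ⟨b, fun i => hP i _ _ (hb i) (ha i)⟩

section Forms

variable {ζ ω : ℂ} (h : Bisects ζ ω)

theorem exists_wedgeForm_le (ζ : ℂ) : ∃ D, 0 < D ∧ ∀ j z, wedgeForm ζ j z ≤ D * ‖z‖ := by
  obtain ⟨D, hD⟩ := exists_uniform (ι := Fin 2) (P := fun j D => ∀ z, wedgeForm ζ j z ≤ D * ‖z‖)
    (fun j a b hab H z => (H z).trans (mul_le_mul_of_nonneg_right hab (norm_nonneg z)))
    fun j => ⟨_, fun z => (le_abs_self _).trans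
      ((LinearMap.toContinuousLinearMap (wedgeForm ζ j)).le_opNorm z)⟩
  exact ⟨max D 1, by positivity, fun j z => (hD j z).trans
    (mul_le_mul_of_nonneg_right (le_max_left _ _) (norm_nonneg z))⟩

include h in
/-- A point of the plane can be recovered from its position relative to the two sides of the
wedge. -/
theorem Bisects.exists_eq_wedgeForm :
    ∃ G : (Fin 2 → ℝ) →ₗ[ℝ] ℂ, ∀ z, G (fun j => wedgeForm ζ j z) = z := by
  obtain ⟨K, hK, H⟩ := h.exists_norm_le
  have hker : LinearMap.ker (LinearMap.pi (wedgeForm ζ)) = ⊥ := by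
    rw [LinearMap.ker_eq_bot']
    intro z hz
    have h0 : ∀ j, wedgeForm ζ j z = 0 := fun j => congrFun hz j
    have := H z fun j => (h0 j).ge
    rw [h0, h0, add_zero, mul_zero] at this
    exact norm_le_zero_iff.1 this
  obtain ⟨G, hG⟩ := LinearMap.exists_leftInverse_of_injective _ hker
  exact ⟨G, fun z => LinearMap.congr_fun hG z⟩

include h in
/-- Next to the centre, the distances from the two sides of the wedge are comparable. -/
theorem Bisects.wedgeForm_central_le [NeZero m] {N : Net m} (hN : IsSym ω N) {κ : Kind}
    (hκ : κ.Straight) (hW : InWedge ζ κ N) (i j : Fin 2) :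
    wedgeForm ζ i (quad N (centralRep κ).1 (centralRep κ).2) ≤
      4 * wedgeForm ζ j (quad N (centralRep κ).1 (centralRep κ).2) := by
  have c1 := h.half_le
  have c2 := h.re_le_one
  have hw := hW _ (isRep_centralRep κ)
  set z := quad N (centralRep κ).1 (centralRep κ).2 with hz
  obtain ⟨hu, hv, -, -⟩ := wedge_bounds c1 c2 (hw 0) (hw 1)
  simp only [Complex.reLm_coe] at hu
  have key : spoke ζ z = ζ.re * z.re ∨ z.re = ζ.re * spoke ζ z := by
    rcases hκ with rfl | rfl
    · left
      have h0 : z.im = 0 := hN.quad_axis (by norm_num [centralRep])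
      simp [spoke_apply, h0]
    · right
      have h1 : z = ω * (starRingEnd ℂ) z := hN.quad_swap (by norm_num [centralRep])
        (by norm_num [centralRep])
      have := h.re_swap z
      rw [← h1] at this
      linarith
  rcases key with e | e
  · rw [e] at hv
    have a1 : 1 / 2 * z.re ≤ ζ.re * z.re := mul_le_mul_of_nonneg_right c1 hu
    have a2 : ζ.re * z.re ≤ 1 * z.re := mul_le_mul_of_nonneg_right c2 hu
    have a3 : ζ.re * (ζ.re * z.re) ≤ 1 * (ζ.re * z.re) := mul_le_mul_of_nonneg_right c2 hv
    have a4 : 1 / 2 * (ζ.re * z.re) ≤ ζ.re * (ζ.re * z.re) := mul_le_mul_of_nonneg_right c1 hv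
    fin_cases i <;> fin_cases j <;>
      simp only [Fin.zero_eta, Fin.mk_one, wedgeForm_zero_apply, wedgeForm_one_apply, e] <;>
      linarith
  · set v := spoke ζ z
    rw [e] at hu
    have a1 : 1 / 2 * v ≤ ζ.re * v := mul_le_mul_of_nonneg_right c1 hv
    have a2 : ζ.re * v ≤ 1 * v := mul_le_mul_of_nonneg_right c2 hv
    have a3 : ζ.re * (ζ.re * v) ≤ 1 * (ζ.re * v) := mul_le_mul_of_nonneg_right c2 hu
    have a4 : 1 / 2 * (ζ.re * v) ≤ ζ.re * (ζ.re * v) := mul_le_mul_of_nonneg_right c1 hu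
    fin_cases i <;> fin_cases j <;>
      simp only [Fin.zero_eta, Fin.mk_one, wedgeForm_zero_apply, wedgeForm_one_apply] <;>
      change _ ≤ _ <;> rw [e] <;> linarith

end Forms

/-- The properties of the core `X` on which the growth of the grid mesh depends. -/
structure IsCore [NeZero m] (κ : Kind) (l : List Step) (X : Set (Site m)) : Prop where
  straight : κ.Straight
  chain : Chain κ l κ
  gain : 1 ≤ totalGain l
  dual : ∃ st ∈ l, st.src = .dual
  finite : X.Finite
  vertex : ∀ s ∈ X, IsVertex κ s
  depClosed : DepClosed l X
  sym : SymSet X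
  central : Site.mk 0 (centralRep κ).1 (centralRep κ).2 ∈ X
  innermost_mem : ∀ s ∈ innermost κ, s ∈ X
  reach : ∀ s ∈ X, ∃ k, Reach (repeatSteps l k) (centralRep κ) (s.rep κ)

section Growth

variable [NeZero m] {κ : Kind} {l : List Step} {X : Set (Site m)} {ζ ω : ℂ}

theorem isCore_core {U : Word} (hU : IsVAVScheme U) (hout : Word.out U κ = κ) :
    IsCore κ (Word.steps U κ) (core m U κ) := by
  have hκ : κ.Straight := hout ▸ straight_out_of_scheme U κ hU.2
  have hchain : Chain κ (Word.steps U κ) κ := by simpa [hout] using Word.chain_steps U hκ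
  have hd := exists_dual_step hκ hout hU.1
  refine ⟨hκ, hchain, one_le_totalGain U κ hU.2, hd, finite_core hκ (totalScale_lt_one U κ hU.2),
    fun s hs => (mem_core_iff.1 hs).1, depClosed_core hκ hout, symSet_core,
    centralSite_mem_core hκ hout hd, fun s hs => ?_, fun s hs => ?_⟩
  · refine innermost_subset_core hκ hout ?_ hs
    rintro h0
    simp [h0] at hd
  · obtain ⟨hv, k, -, h⟩ := mem_core_iff.1 hs
    obtain ⟨t, ht⟩ := exists_mem_innermost (m := m) hκ
    refine ⟨k, ?_⟩
    have h1 := (reach_rep (hchain.repeatSteps k) hv (h t ht)).1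
    convert h1 using 1
    rcases hκ with rfl | rfl
    · rw [mem_innermost_primal.1 ht]; rfl
    · obtain ⟨j, rfl⟩ := mem_innermost_dual.1 ht
      rw [Site.rep_mk _ _ (by norm_num) (by norm_num)]
      rfl

/-- The nets of frequency `1` (for `ω = e ^ (2 π i / m)`) as a real vector space. -/
def symNets (m : ℕ) (ω : ℂ) : Submodule ℝ (Net m) where
  carrier := {N | IsSym ω N}
  add_mem' := IsSym.add
  zero_mem' := ⟨fun s => by simp, fun s => by simp⟩
  smul_mem' r _ h := h.smul r

/-- The positions of the vertices in `X`, moved into the fundamental domain, relative to the sides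
of the wedge. -/
noncomputable def vertexForm (ζ : ℂ) (κ : Kind) (X : Set (Site m)) (p : X × Fin 2) :
    Net m →ₗ[ℝ] ℝ :=
  wedgeForm ζ p.2 ∘ₗ LinearMap.proj (Site.mk 0 ((p.1 : Site m).rep κ).1 ((p.1 : Site m).rep κ).2)

omit [NeZero m] in
theorem vertexForm_apply (ζ : ℂ) (κ : Kind) (s : X) (j : Fin 2) (N : Net m) :
    vertexForm ζ κ X (s, j) N =
      wedgeForm ζ j (quad N ((s : Site m).rep κ).1 ((s : Site m).rep κ).2) := rfl

theorem restrictScalars_pow (l : List Step) (k : ℕ) (N : Net m) :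
    (((run l).restrictScalars ℝ : Module.End ℝ (Net m)) ^ k) N = run (repeatSteps l k) N := by
  induction k with
  | zero => rfl
  | succ k ih => rw [pow_succ', repeatSteps, run_append, ← ih]; rfl

theorem DepClosed.support_repeatSteps (h : DepClosed l X) (k : ℕ) :
    DepClosed (repeatSteps l k) X := by
  induction k with
  | zero =>
    intro t ht s hs
    obtain rfl : s = t := by simpa [repeatSteps, support] using hs
    exact ht
  | succ k ih =>
    intro t ht s hs
    obtain ⟨u, hu, hs⟩ := mem_support_append.1 hs
    exact ih u (h t ht u hu) s hs

theorem DepClosed.run_cut (h : DepClosed l X) {N : Net m} {s : Site m} (hs : s ∈ X) :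
    run l (cut X N) s = run l N s :=
  run_congr fun t ht => cut_of_mem (h s hs t ht)

namespace IsCore

variable (hX : IsCore κ l X)

omit [NeZero m] in
theorem _root_.MidpointSubdivision.inWedge_cut {N : Net m} (hN : ∀ p, 0 ≤ vertexForm ζ κ X p N) :
    InWedge ζ κ (cut X N) := by
  intro q hq j
  by_cases hs : Site.mk 0 q.1 q.2 ∈ X
  · have h1 := hN (⟨_, hs⟩, j)
    rw [vertexForm_apply, Site.rep_mk κ 0 (by have := hq.1; omega) (by have := hq.1; omega),
      fold_of_le hq.2.1 hq.2.2.1] at h1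
    rwa [quad, cut_of_mem hs]
  · rw [quad, cut_of_notMem hs, map_zero]

include hX in
theorem vertexForm_run_cut (N : Net m) (k : ℕ) (p : X × Fin 2) :
    vertexForm ζ κ X p (run (repeatSteps l k) (cut X N)) =
      vertexForm ζ κ X p (run (repeatSteps l k) N) := by
  obtain ⟨s, j⟩ := p
  rw [vertexForm_apply, vertexForm_apply, quad, quad,
    (hX.depClosed.support_repeatSteps k).run_cut (hX.sym.rep_mem hX.central s.2)]

include hX in
/-- A common number of repetitions after which every vertex of the core depends on the central
vertex, and the central vertex on every vertex of the core. -/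
theorem exists_common_reach : ∃ n₁ n₂ : ℕ, 1 ≤ n₁ ∧ ∀ s ∈ X,
    Reach (repeatSteps l n₁) (s.rep κ) (centralRep κ) ∧
    Reach (repeatSteps l n₂) (centralRep κ) (s.rep κ) := by
  have := hX.finite.to_subtype
  obtain ⟨n₁, h₁⟩ := Finite.exists_le fun s : X => (vertexDist κ ((s : Site m).rep κ)).toNat
  choose! k hk using hX.reach
  obtain ⟨n₂, h₂⟩ := Finite.exists_le fun s : X => k s
  refine ⟨n₁ + 1, n₂, by omega, fun s hs => ⟨?_, ?_⟩⟩
  · refine reach_central hX.straight hX.chain hX.gain (Site.isRep_rep (hX.vertex s hs)) ?_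
    have := h₁ ⟨s, hs⟩
    simp only at this
    omega
  · obtain ⟨d, hd⟩ := Nat.exists_eq_add_of_le' (h₂ ⟨s, hs⟩)
    simp only at hd
    rw [hd, repeatSteps_add]
    exact (reach_centralRep (hX.chain.repeatSteps d)).append (hk s hs)

include hX in
/-- The scheme acts on the nets of frequency `1` over the core as a positive map. -/
theorem positiveMap (hm : 3 ≤ m) (h : Bisects ζ ω) : ∃ n K, 1 ≤ n ∧ 1 ≤ K ∧
    PositiveMap (symNets m ω) ((run l).restrictScalars ℝ) (vertexForm ζ κ X) n K := by
  have := hX.finite.to_subtype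
  obtain ⟨n₁, n₂, hn₁, hr⟩ := hX.exists_common_reach
  set n := n₁ + n₂ with hn
  have hpos : ∀ (k : ℕ) (N : Net m), IsSym ω N → (∀ p, 0 ≤ vertexForm ζ κ X p N) →
      ∀ p, 0 ≤ vertexForm ζ κ X p (run (repeatSteps l k) N) := by
    intro k N hN hf p
    rw [← hX.vertexForm_run_cut]
    obtain ⟨s, j⟩ := p
    exact h.inWedge_run hm (hN.cut hX.sym) (hX.chain.repeatSteps k) (inWedge_cut hf) _
      (Site.isRep_rep (hX.vertex s s.2)) j
  -- after `n` repetitions, every form dominates every form of the initial net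
  have hdom : ∃ K, ∀ pp' : (X × Fin 2) × (X × Fin 2), ∀ N : Net m, IsSym ω N →
      (∀ p, 0 ≤ vertexForm ζ κ X p N) →
      vertexForm ζ κ X pp'.1 N ≤ K * vertexForm ζ κ X pp'.2 (run (repeatSteps l n) N) := by
    refine exists_uniform (fun pp' a b hab H N hN hf => (H N hN hf).trans
      (mul_le_mul_of_nonneg_right hab (hpos n N hN hf _))) ?_
    rintro ⟨⟨s, i⟩, ⟨t, j⟩⟩
    obtain ⟨K₁, hK₁, H₁⟩ := h.exists_le_wedgeForm hm (hX.chain.repeatSteps n₁)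
      (Site.isRep_rep (hX.vertex t t.2)) (hr t t.2).1
    obtain ⟨K₂, hK₂, H₂⟩ := h.exists_le_wedgeForm hm (hX.chain.repeatSteps n₂)
      (isRep_centralRep κ) (hr s s.2).2
    refine ⟨4 / (K₁ * K₂), fun N hN hf => ?_⟩
    have hN' := hN.cut hX.sym
    have hW := inWedge_cut hf
    have hW₂ := h.inWedge_run hm hN' (hX.chain.repeatSteps n₂) hW
    have a1 := H₁ _ (hN'.run _) hW₂ j
    have a2 := h.wedgeForm_central_le (hN'.run _) hX.straight hW₂ i j
    have a3 := H₂ _ hN' hW i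
    rw [← hX.vertexForm_run_cut, hn, repeatSteps_add, run_append]
    change vertexForm ζ κ X (s, i) N ≤ _ * wedgeForm ζ j
      (quad _ ((t : Site m).rep κ).1 ((t : Site m).rep κ).2)
    have e : vertexForm ζ κ X (s, i) N =
        wedgeForm ζ i (quad (cut X N) ((s : Site m).rep κ).1 ((s : Site m).rep κ).2) := by
      rw [vertexForm_apply, quad, quad, cut_of_mem (hX.sym.rep_mem hX.central s.2)]
    rw [e, div_mul_eq_mul_div, le_div_iff₀ (by positivity)]
    have a4 := mul_le_mul_of_nonneg_left (a3.trans a2) hK₁.le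
    have a5 := mul_le_mul_of_nonneg_left a1 (show (0 : ℝ) ≤ 4 by norm_num)
    refine le_trans (le_of_eq ?_) (a4.trans (le_trans (le_of_eq ?_) a5)) <;> ring
  obtain ⟨K, hK⟩ := hdom
  obtain ⟨D, hD, hD'⟩ := exists_wedgeForm_le ζ
  obtain ⟨B, hB, hB'⟩ := h.exists_norm_le
  -- the values on the core are controlled by those at the representatives
  have hval : ∃ A, ∀ s : X, ∀ N : Net m, IsSym ω N →
      ‖N s‖ ≤ A * ‖quad N ((s : Site m).rep κ).1 ((s : Site m).rep κ).2‖ := by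
    refine exists_uniform (fun s a b hab H N hN => (H N hN).trans
      (mul_le_mul_of_nonneg_right hab (norm_nonneg _))) fun s => ?_
    by_cases hs : (s : Site m) = .center
    · exact ⟨0, fun N hN => by rw [hs, hN.center h.ne_one]; simp⟩
    · obtain ⟨G, hG⟩ := exists_value_eq ω κ (s : Site m) hs
      refine ⟨‖LinearMap.toContinuousLinearMap G‖, fun N hN => ?_⟩
      rw [hG N hN]
      exact (LinearMap.toContinuousLinearMap G).le_opNorm _
  obtain ⟨A, hA⟩ := hval
  set A' := max A 0
  set K' := max K 0
  refine ⟨n, max 1 (D * (A' * (B * (2 * K')))), by omega, le_max_left _ _, fun N hN => hN.run l,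
    fun N hN hf p => by simpa [repeatSteps] using hpos 1 N hN hf p, fun N hN hf p p' => ?_⟩
  rw [restrictScalars_pow]
  set b := vertexForm ζ κ X p' (run (repeatSteps l n) N) with hb
  have hb0 : 0 ≤ b := hpos n N hN hf p'
  have h1 : ∀ q, vertexForm ζ κ X q N ≤ K' * b := fun q =>
    (hK (q, p') N hN hf).trans (mul_le_mul_of_nonneg_right (le_max_left _ _) hb0)
  have h2 : ∀ s, ‖cut X N s‖ ≤ A' * (B * (2 * K')) * b := by
    intro s
    by_cases hs : s ∈ X
    · rw [cut_of_mem hs]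
      have h3 := hB' (quad N (s.rep κ).1 (s.rep κ).2) fun j => hf (⟨s, hs⟩, j)
      have h4 := h1 (⟨s, hs⟩, 0)
      have h5 := h1 (⟨s, hs⟩, 1)
      rw [vertexForm_apply] at h4 h5
      have h6 : ‖quad N (s.rep κ).1 (s.rep κ).2‖ ≤ B * (2 * K' * b) :=
        h3.trans (mul_le_mul_of_nonneg_left (by linarith) hB.le)
      calc ‖N s‖ ≤ A * ‖quad N (s.rep κ).1 (s.rep κ).2‖ := hA ⟨s, hs⟩ N hN
        _ ≤ A' * ‖quad N (s.rep κ).1 (s.rep κ).2‖ :=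
          mul_le_mul_of_nonneg_right (le_max_left _ _) (norm_nonneg _)
        _ ≤ A' * (B * (2 * K' * b)) := mul_le_mul_of_nonneg_left h6 (le_max_right _ _)
        _ = _ := by ring
    · rw [cut_of_notMem hs, norm_zero]; positivity
  rw [← hX.vertexForm_run_cut]
  calc vertexForm ζ κ X p (run (repeatSteps l n) (cut X N))
      ≤ D * ‖run (repeatSteps l n) (cut X N) (Site.mk 0 ((p.1 : Site m).rep κ).1
          ((p.1 : Site m).rep κ).2)‖ := hD' _ _
    _ ≤ D * (A' * (B * (2 * K')) * b) :=
        mul_le_mul_of_nonneg_left (norm_run_le (by positivity) fun t _ => h2 t) hD.le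
    _ = D * (A' * (B * (2 * K'))) * b := by ring
    _ ≤ _ := mul_le_mul_of_nonneg_right (le_max_right _ _) hb0

end IsCore

end Growth

section Growth

variable [NeZero m] {κ : Kind} {l : List Step} {X : Set (Site m)}

/-- The iterates of the grid mesh have a limit on the core, up to the powers of a number `lam`.
This number exceeds the contraction factor of the scheme, if the spokes `0` and `1` form an acute
angle. -/
theorem IsCore.exists_limit (hX : IsCore κ l X) (hm : 3 ≤ m) :
    ∃ lam : ℝ, 0 < lam ∧ ∃ a : Site m → ℂ,
      (∀ s ∈ X, Tendsto (fun k => ((lam ^ k)⁻¹ • run (repeatSteps l k) (gridMesh m)) s) atTop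
        (𝓝 (a s))) ∧
      (∀ j, 0 < wedgeForm (diagDir m) j (a (Site.mk 0 (centralRep κ).1 (centralRep κ).2))) ∧
      (0 < (spokeDir m).re → totalScale l < lam) := by
  have h := bisects hm
  have hM := isSym_gridMesh hm
  have := hX.finite.to_subtype
  set s₀ : X := ⟨_, hX.central⟩ with hs₀
  have : Nonempty (X × Fin 2) := ⟨(s₀, 0)⟩
  obtain ⟨n, K, hn, hK, hP⟩ := hX.positiveMap hm h
  have hrep₀ : (s₀ : Site m).rep κ = centralRep κ := by
    obtain ⟨h1, h2, h3, -⟩ := isRep_centralRep κ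
    rw [hs₀, Site.rep_mk κ 0 (by omega) (by omega), fold_of_le h2 h3]
  have hpos : ∀ k p, 0 < vertexForm (diagDir m) κ X p
      ((((run l).restrictScalars ℝ : Module.End ℝ (Net m)) ^ k) (gridMesh m)) := by
    rintro k ⟨s, j⟩
    rw [restrictScalars_pow, vertexForm_apply]
    have hq := Site.isRep_rep (hX.vertex s s.2)
    obtain ⟨q', hq', hr, -⟩ := exists_reach (hX.chain.repeatSteps k) hq
    obtain ⟨c, hc, H⟩ := h.exists_le_wedgeForm hm (hX.chain.repeatSteps k) hq hr
    exact (mul_pos hc (wedgeForm_gridMesh_pos hm hq' j)).trans_le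
      (H _ hM (inWedge_gridMesh hm κ) j)
  obtain ⟨lam, hlam, b, hb, hlim⟩ := hP.exists_growth hn hK hM hpos
  obtain ⟨G, hG⟩ := h.exists_eq_wedgeForm
  -- the positions of the representatives converge, since the wedge forms are coordinates
  have hrep : ∀ s : X, Tendsto (fun k => quad ((lam ^ k)⁻¹ • run (repeatSteps l k) (gridMesh m))
      ((s : Site m).rep κ).1 ((s : Site m).rep κ).2) atTop (𝓝 (G fun j => b (s, j))) := by
    intro s
    have h1 : Tendsto (fun k => fun j : Fin 2 => vertexForm (diagDir m) κ X (s, j)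
        ((((run l).restrictScalars ℝ : Module.End ℝ (Net m)) ^ k) (gridMesh m)) / lam ^ k) atTop
        (𝓝 fun j => b (s, j)) := tendsto_pi_nhds.2 fun j => hlim (s, j)
    refine ((G.continuous_of_finiteDimensional.tendsto _).comp h1).congr fun k => ?_
    rw [← hG (quad _ _ _)]
    refine congrArg G (funext fun j => ?_)
    beta_reduce
    rw [restrictScalars_pow, div_eq_inv_mul, ← smul_eq_mul, ← map_smul]
    rfl
  have hall : ∀ s : X, ∃ z, Tendsto
      (fun k => ((lam ^ k)⁻¹ • run (repeatSteps l k) (gridMesh m)) (s : Site m)) atTop (𝓝 z) := by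
    intro s
    by_cases hs : (s : Site m) = .center
    · refine ⟨0, tendsto_const_nhds.congr fun k => ?_⟩
      rw [hs, ((hM.run _).smul _).center h.ne_one]
    · obtain ⟨F, hF⟩ := exists_value_eq (spokeDir m) κ (s : Site m) hs
      refine ⟨_, ((F.continuous_of_finiteDimensional.tendsto _).comp (hrep s)).congr fun k => ?_⟩
      exact (hF _ ((hM.run _).smul _)).symm
  choose! a ha using fun s (hs : s ∈ X) => hall ⟨s, hs⟩
  refine ⟨lam, hlam, a, ha, fun j => ?_, fun hre => ?_⟩
  · have h1 := hrep s₀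
    rw [hrep₀] at h1
    have h2 : a (Site.mk 0 (centralRep κ).1 (centralRep κ).2) = G fun j => b (s₀, j) :=
      tendsto_nhds_unique (ha _ hX.central) h1
    have h3 : Tendsto (fun k => wedgeForm (diagDir m) j
        (((lam ^ k)⁻¹ • run (repeatSteps l k) (gridMesh m))
          (Site.mk 0 (centralRep κ).1 (centralRep κ).2))) atTop (𝓝 (b (s₀, j))) := by
      refine (hlim (s₀, j)).congr fun k => ?_
      rw [restrictScalars_pow, div_eq_inv_mul, ← smul_eq_mul, ← map_smul, vertexForm_apply, hrep₀]
      rfl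
    have h4 := tendsto_nhds_unique h3
      (((wedgeForm (diagDir m) j).continuous_of_finiteDimensional.tendsto _).comp
        (ha _ hX.central))
    rw [← h4]
    exact hb _
  · -- the difference `y` of the refined and the scaled grid mesh lies inside the wedge
    obtain ⟨hW, hy⟩ := run_gridMesh_sub hm hre hX.chain
    have hy := hy hX.dual
    set y := run l (gridMesh m) - totalScale l • gridMesh m with hydef
    have hyS : IsSym (spokeDir m) y := (hM.run l).sub (hM.smul _)
    have hy0 : ∀ p, 0 ≤ vertexForm (diagDir m) κ X p y := fun p =>
      hW _ (Site.isRep_rep (hX.vertex p.1 p.1.2)) p.2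
    obtain ⟨c, hc, H⟩ := h.exists_le_wedgeForm hm (hX.chain.repeatSteps n)
      (isRep_centralRep κ) (reach_centralRep (hX.chain.repeatSteps n))
    have hypos : ∀ p, 0 < vertexForm (diagDir m) κ X p
        ((((run l).restrictScalars ℝ : Module.End ℝ (Net m)) ^ n) y) := by
      intro p
      have h1 : 0 < vertexForm (diagDir m) κ X (s₀, 0)
          ((((run l).restrictScalars ℝ : Module.End ℝ (Net m)) ^ n) y) := by
        rw [restrictScalars_pow, vertexForm_apply, hrep₀]
        exact (mul_pos hc (hy 0)).trans_le (H y hyS hW 0)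
      exact pos_of_mul_pos_right (h1.trans_le (hP.comp y hyS hy0 (s₀, 0) p)) (by linarith)
    set T := ((run l).restrictScalars ℝ : Module.End ℝ (Net m)) with hT
    have hTy : (T ^ n) y = (T ^ (n + 1)) (gridMesh m) - totalScale l • (T ^ n) (gridMesh m) := by
      rw [hydef, map_sub, map_smul, pow_succ]; rfl
    -- after `n` repetitions the difference exceeds the multiple `ε` of the grid mesh
    obtain ⟨p₀, hp₀⟩ := Finite.exists_min fun p => vertexForm (diagDir m) κ X p ((T ^ n) y) /
      vertexForm (diagDir m) κ X p ((T ^ n) (gridMesh m))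
    set ε := vertexForm (diagDir m) κ X p₀ ((T ^ n) y) /
      vertexForm (diagDir m) κ X p₀ ((T ^ n) (gridMesh m)) with hε
    have hε0 : 0 < ε := div_pos (hypos p₀) (hpos n p₀)
    have h1 : totalScale l + ε ≤ lam := by
      refine hP.le_of_lower hM hlam (hb (s₀, 0)) (hlim (s₀, 0)) (k := n) fun p => ?_
      have h2 := (le_div_iff₀ (hpos n p)).1 (hp₀ p)
      rw [hTy, map_sub, map_smul, smul_eq_mul] at h2
      linarith
    linarith

end Growth

/-! ### Decay of the influence of the vertices outside the core -/

/-- The powers of a linear map on a finite-dimensional space grow more slowly than those of a bound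
for its eigenvalues. -/
theorem tendsto_norm_pow_div {E : Type*} [NormedAddCommGroup E] [NormedSpace ℂ E]
    [FiniteDimensional ℂ E] (T : Module.End ℂ E) {r : ℝ} (hr : 0 < r)
    (h : ∀ z, T.HasEigenvalue z → ‖z‖ < r) (x : E) :
    Tendsto (fun k : ℕ => ‖(T ^ k) x‖ / r ^ k) atTop (𝓝 0) := by
  rcases subsingleton_or_nontrivial E with hE | hE
  · simp [Subsingleton.elim _ (0 : E)]
  have := FiniteDimensional.complete ℂ E
  set e := Module.End.toContinuousLinearMap (𝕜 := ℂ) E with he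
  lift r to NNReal using hr.le
  have hrad : spectralRadius ℂ (e T) < r := by
    refine spectrum.spectralRadius_lt_of_forall_lt _ fun z hz => ?_
    rw [AlgEquiv.spectrum_eq, ← Module.End.hasEigenvalue_iff_mem_spectrum] at hz
    exact_mod_cast h z hz
  obtain ⟨q, hq, hqr⟩ := ENNReal.lt_iff_exists_nnreal_btwn.1 hrad
  have hqr : (q : ℝ) < r := by exact_mod_cast hqr
  have hG := (spectrum.pow_nnnorm_pow_one_div_tendsto_nhds_spectralRadius (e T)).eventually
    (gt_mem_nhds hq)
  have hlim : Tendsto (fun k : ℕ => ‖x‖ * ((q : ℝ) / r) ^ k) atTop (𝓝 0) := by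
    simpa using (tendsto_pow_atTop_nhds_zero_of_lt_one (by positivity)
      ((div_lt_one hr).2 hqr)).const_mul ‖x‖
  refine squeeze_zero' (Eventually.of_forall fun k => by positivity) ?_ hlim
  filter_upwards [hG, eventually_ge_atTop 1] with k hk hk1
  have hk0 : (0 : ℝ) < k := by exact_mod_cast hk1
  have h1 : (‖(e T) ^ k‖₊ : ENNReal) ≤ (q : ENNReal) ^ (k : ℝ) :=
    (ENNReal.rpow_inv_le_iff hk0).1 (by simpa using hk.le)
  have h2 : ‖(e T) ^ k‖ ≤ (q : ℝ) ^ k := by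
    rw [ENNReal.rpow_natCast] at h1
    exact_mod_cast h1
  have h3 : ‖(T ^ k) x‖ ≤ ‖(e T) ^ k‖ * ‖x‖ := by
    have : (T ^ k) x = ((e T) ^ k) x := by rw [← map_pow]; rfl
    rw [this]
    exact ContinuousLinearMap.le_opNorm _ _
  rw [div_pow, ← mul_div_assoc]
  refine div_le_div_of_nonneg_right ?_ (by positivity)
  rw [mul_comm]
  exact h3.trans (mul_le_mul_of_nonneg_right h2 (norm_nonneg x))

section Outer

variable [NeZero m] {κ : Kind} {l : List Step} {X Y : Set (Site m)}

/-- The net that is `0` on `Y` and `1` elsewhere. -/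
noncomputable def outer (Y : Set (Site m)) : Net m := realNet (Yᶜ.indicator 1)

omit [NeZero m] in
theorem outer_of_mem {s : Site m} (h : s ∈ Y) : outer Y s = 0 := by simp [outer, realNet, h]

omit [NeZero m] in
theorem outer_of_notMem {s : Site m} (h : s ∉ Y) : outer Y s = 1 := by simp [outer, realNet, h]

omit [NeZero m] in
theorem norm_outer_le (Y : Set (Site m)) (s : Site m) : ‖outer Y s‖ ≤ 1 := by
  by_cases h : s ∈ Y
  · simp [outer_of_mem h]
  · simp [outer_of_notMem h]

omit [NeZero m] in
theorem isSym_outer (hY : SymSet Y) : IsSym 1 (outer Y) := by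
  constructor
  · intro s
    by_cases h : s ∈ Y
    · rw [outer_of_mem h, outer_of_mem ((hY.rotate s).2 h), mul_zero]
    · rw [outer_of_notMem h, outer_of_notMem (mt (hY.rotate s).1 h), mul_one]
  · intro s
    by_cases h : s ∈ Y
    · rw [outer_of_mem h, outer_of_mem ((hY.reflect s).2 h), map_zero]
    · rw [outer_of_notMem h, outer_of_notMem (mt (hY.reflect s).1 h), map_one]

theorem run_eq_zero_of_mem {N : Net m} (hY : DepClosed l Y) (hN : ∀ s ∈ Y, N s = 0) {s : Site m}
    (hs : s ∈ Y) : run l N s = 0 := by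
  rw [run_congr (N' := 0) fun t ht => hN t (hY s hs t ht), map_zero]
  rfl

/-- A net is bounded by its bound on the core, plus the influence of the vertices outside the
core. -/
theorem norm_run_le_add {N : Net m} (hX : DepClosed l X) {a b : ℝ} (ha : 0 ≤ a) (hb : 0 ≤ b)
    (hNY : ∀ s ∈ Y, ‖N s‖ ≤ a) (hNX : ∀ s ∈ X, ‖N s‖ ≤ b) {s : Site m} (hs : s ∈ X) :
    ‖run l N s‖ ≤ a + b * ‖run l (outer Y) s‖ := by
  have e : N = cut Y N + (N - cut Y N) := by abel
  have h1 : ‖run l (cut Y N) s‖ ≤ a := norm_run_le ha fun t _ => by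
    by_cases h : t ∈ Y
    · rw [cut_of_mem h]; exact hNY t h
    · rw [cut_of_notMem h, norm_zero]; exact ha
  have h2 : ‖run l (N - cut Y N) s‖ ≤ b * ‖run l (outer Y) s‖ := by
    have h3 : ‖run l (N - cut Y N) s‖ ≤ (run l (realNet fun t => b * Yᶜ.indicator 1 t) s).re := by
      refine norm_run_le_re fun t ht => ?_
      by_cases h : t ∈ Y
      · simp [cut_of_mem h, h]
      · simpa [cut_of_notMem h, h] using hNX t (hX s hs t ht)
    have h4 : (realNet fun t => b * Yᶜ.indicator 1 t : Net m) = (b : ℂ) • outer Y := by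
      funext t
      simp [realNet, outer]
    rw [h4, map_smul] at h3
    refine h3.trans ((Complex.re_le_norm _).trans (le_of_eq ?_))
    rw [Pi.smul_apply, norm_smul, Complex.norm_real, Real.norm_eq_abs, abs_of_nonneg hb]
  calc ‖run l N s‖ = ‖run l (cut Y N) s + run l (N - cut Y N) s‖ := by
        conv_lhs => rw [e]
        rw [map_add, Pi.add_apply]
    _ ≤ _ := (norm_add_le _ _).trans (add_le_add h1 h2)

/-- Every vertex is attracted by the core at the rate of the contraction factor of the grid. -/
theorem IsCore.exists_norm_run_outer_le (hY : IsCore κ l Y) (hm : 3 ≤ m) (hX : X.Finite)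
    (hv : ∀ s ∈ X, IsVertex κ s) :
    ∃ C, ∀ s ∈ X, ∀ k, ‖run (repeatSteps l k) (outer Y) s‖ ≤ C * totalScale l ^ k := by
  have := hX.to_subtype
  have key : ∃ C, ∀ s : X, ∀ k, ‖run (repeatSteps l k) (outer Y) s‖ ≤ C * totalScale l ^ k := by
    refine exists_uniform (fun s a b hab H k => (H k).trans
      (mul_le_mul_of_nonneg_right hab (pow_pos (totalScale_pos l) k).le)) fun s => ?_
    have h0 : ∀ k, ∀ s ∈ innermost (m := m) κ, run (repeatSteps l k) (outer Y) s = 0 :=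
      fun k s hs => run_eq_zero_of_mem (hY.depClosed.support_repeatSteps k)
        (fun _ h => outer_of_mem h) (hY.innermost_mem s hs)
    have hN := isSym_outer hY.sym
    obtain ⟨s, hs⟩ := s
    have hsv := hv s hs
    rcases s.exists_mk with rfl | ⟨j, x, y, hx, hy, rfl⟩
    · refine ⟨0, fun k => ?_⟩
      rcases hY.straight with rfl | rfl
      · rw [h0 k _ (mem_innermost_primal.2 rfl)]; simp
      · simp [IsVertex, Kind.parity] at hsv
    · refine ⟨2 * (x + y), fun k => ?_⟩
      have h1 := norm_quad_run_le hm hY.straight (hY.chain.repeatSteps k) hN (norm_outer_le Y)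
        (h0 k) (by omega) hy ((isVertex_mk κ j (by omega) y).1 hsv)
      rw [totalScale_repeatSteps] at h1
      have h2 := (hN.run (repeatSteps l k)).natCast_mk j.val x y
      rw [one_pow, one_mul, ZMod.natCast_zmod_val] at h2
      simpa only [h2] using h1
  obtain ⟨C, hC⟩ := key
  exact ⟨C, fun s hs => hC ⟨s, hs⟩⟩

/-- The influence of the vertices outside the core decays faster than the powers of `lam`. -/
def Decays (l : List Step) (X Y : Set (Site m)) (lam : ℝ) : Prop :=
  ∀ s ∈ X, Tendsto (fun k => ‖run (repeatSteps l k) (outer Y) s‖ / lam ^ k) atTop (𝓝 0)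

theorem IsCore.decays_of_totalScale_lt (hY : IsCore κ l Y) (hm : 3 ≤ m) (hX : X.Finite)
    (hv : ∀ s ∈ X, IsVertex κ s) {lam : ℝ} (hlam : totalScale l < lam) : Decays l X Y lam := by
  obtain ⟨C, hC⟩ := hY.exists_norm_run_outer_le hm hX hv
  intro s hs
  have h0 := totalScale_pos l
  have hlam0 := h0.trans hlam
  have hlim : Tendsto (fun k : ℕ => C * (totalScale l / lam) ^ k) atTop (𝓝 0) := by
    simpa using (tendsto_pow_atTop_nhds_zero_of_lt_one (by positivity)
      ((div_lt_one hlam0).2 hlam)).const_mul C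
  refine squeeze_zero (fun k => by positivity) (fun k => ?_) hlim
  rw [div_pow, ← mul_div_assoc]
  exact div_le_div_of_nonneg_right (hC s hs k) (by positivity)

end Outer

/-! ### Subdivision matrices -/

section Block

variable [NeZero m] {U : Word} {κ : Kind} {X Y : Set (Site m)}

/-- The values of a net on `X`. -/
def restrictTo (X : Set (Site m)) (N : Net m) : X → ℂ := fun s => N s

theorem block_restrictTo (hX : DepClosed (Word.steps U κ) X) (N : Net m) :
    block U κ X (restrictTo X N) = restrictTo X (run (Word.steps U κ) N) := by
  funext s
  have e : block U κ X (restrictTo X N) s =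
      Word.op U κ (extendZero X (restrictTo X N)) s := rfl
  rw [e, ← Word.run_steps]
  refine run_congr fun t ht => ?_
  have := hX s s.2 t ht
  simp [extendZero, this, restrictTo]

/-- On sets that depend only on themselves, powers of the subdivision matrix belong to iterates of
the scheme. -/
theorem block_pow_restrictTo (hX : DepClosed (Word.steps U κ) X) (N : Net m) (k : ℕ) :
    (block U κ X ^ k) (restrictTo X N) =
      restrictTo X (run (repeatSteps (Word.steps U κ) k) N) := by
  induction k with
  | zero => rfl
  | succ k ih =>
    rw [pow_succ', Module.End.mul_apply, ih, block_restrictTo hX, repeatSteps, run_append]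

omit [NeZero m] in
theorem restrictTo_extendZero (x : X → ℂ) : restrictTo X (extendZero X x) = x := by
  funext s
  simp [restrictTo, extendZero]

theorem gridIterate_eq (X : Set (Site m)) (k : ℕ) :
    gridIterate U κ X k =
      restrictTo X (run (repeatSteps (Word.steps U κ) k) (gridMesh m)) := by
  funext s
  rw [gridIterate, Word.op_pow, restrictTo]

/-- The functions of frequency `0` on `X` that vanish on `Y`. -/
def zeroFreq (X Y : Set (Site m)) : Submodule ℂ (X → ℂ) where
  carrier := {x | (∀ s t : X, (t : Site m) = (s : Site m).rotate → x t = x s) ∧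
    ∀ s : X, (s : Site m) ∈ Y → x s = 0}
  add_mem' := by
    rintro x y ⟨h1, h2⟩ ⟨h3, h4⟩
    exact ⟨fun s t h => by simp [h1 s t h, h3 s t h], fun s h => by simp [h2 s h, h4 s h]⟩
  zero_mem' := ⟨fun _ _ _ => rfl, fun _ _ => rfl⟩
  smul_mem' := by
    rintro c x ⟨h1, h2⟩
    exact ⟨fun s t h => by simp [h1 s t h], fun s h => by simp [h2 s h]⟩

theorem block_mem_zeroFreq (hX : DepClosed (Word.steps U κ) X) (hXs : SymSet X)
    (hY : DepClosed (Word.steps U κ) Y) {x : X → ℂ} (hx : x ∈ zeroFreq X Y) :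
    block U κ X x ∈ zeroFreq X Y := by
  have hrot : ∀ s, extendZero X x s.rotate = 1 * extendZero X x s := by
    intro s
    by_cases h : s ∈ X
    · simpa [extendZero, h, (hXs.rotate s).2 h] using hx.1 ⟨s, h⟩ ⟨_, (hXs.rotate s).2 h⟩ rfl
    · simp [extendZero, h, mt (hXs.rotate s).1 h]
  have h0 : ∀ s ∈ Y, extendZero X x s = 0 := by
    intro s hs
    by_cases h : s ∈ X
    · simpa [extendZero, h] using hx.2 ⟨s, h⟩ hs
    · simp [extendZero, h]
  rw [← restrictTo_extendZero x, block_restrictTo hX]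
  refine ⟨fun s t h => ?_, fun s hs => run_eq_zero_of_mem hY h0 hs⟩
  rw [restrictTo, restrictTo, h, run_rotate hrot, one_mul]

/-- The influence of the vertices outside the core decays faster than the powers of `lam` if the
eigenvalues of frequency `0`, apart from `1`, are smaller than `lam`. -/
theorem IsCore.decays_of_eigenvalues (hY : IsCore κ (Word.steps U κ) Y) (hm : 3 ≤ m)
    (hσ : totalScale (Word.steps U κ) < 1) (hX : X.Finite) (hv : ∀ s ∈ X, IsVertex κ s)
    (hXd : DepClosed (Word.steps U κ) X) (hXs : SymSet X) {lam : ℝ} (hlam : 0 < lam)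
    (hμ : ∀ z : ℂ, z ≠ 1 → (∃ x : X → ℂ, x ≠ 0 ∧
      (∀ s t : X, (t : Site m) = (s : Site m).rotate → x t = x s) ∧
      block U κ X x = z • x) → ‖z‖ < lam) :
    Decays (Word.steps U κ) X Y lam := by
  have := hX.fintype
  obtain ⟨C, hC⟩ := hY.exists_norm_run_outer_le hm hX hv
  set T : Module.End ℂ (zeroFreq X Y) := (block U κ X).restrict
    fun x hx => block_mem_zeroFreq hXd hXs hY.depClosed hx with hT
  have heig : ∀ z, T.HasEigenvalue z → ‖z‖ < lam := by
    intro z hz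
    obtain ⟨x, hx⟩ := hz.exists_hasEigenvector
    have hx0 : (x : X → ℂ) ≠ 0 := fun h => hx.2 (Subtype.ext h)
    have hxz : block U κ X x = z • (x : X → ℂ) := congrArg Subtype.val hx.apply_eq_smul
    by_cases hz1 : z = 1
    · -- functions with eigenvalue `1` would not be attracted by the core
      exfalso
      apply hx0
      have hpow : ∀ k, (block U κ X ^ k) (x : X → ℂ) = x := by
        intro k
        induction k with
        | zero => rfl
        | succ k ih => rw [pow_succ', Module.End.mul_apply, ih, hxz, hz1, one_smul]
      set N := extendZero X (x : X → ℂ) with hN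
      have hNX : ∀ s : X, N s = (x : X → ℂ) s := fun s => congrFun (restrictTo_extendZero _) s
      funext s
      have hle : ∀ k, ‖(x : X → ℂ) s‖ ≤
          ‖(x : X → ℂ)‖ * C * totalScale (Word.steps U κ) ^ k := by
        intro k
        have h1 : (x : X → ℂ) s = run (repeatSteps (Word.steps U κ) k) N s := by
          conv_lhs => rw [← hpow k, ← restrictTo_extendZero (x : X → ℂ),
            block_pow_restrictTo hXd]
          rfl
        rw [h1]
        refine (norm_run_le_add (Y := Y) (hXd.support_repeatSteps k) le_rfl
          (norm_nonneg (x : X → ℂ)) (fun t ht => ?_) (fun t ht => ?_) s.2).trans ?_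
        · by_cases h : t ∈ X
          · rw [hNX ⟨t, h⟩, x.2.2 ⟨t, h⟩ ht, norm_zero]
          · simp [hN, extendZero, h]
        · rw [hNX ⟨t, ht⟩]; exact norm_le_pi_norm _ _
        · rw [zero_add, mul_assoc]
          exact mul_le_mul_of_nonneg_left (hC s s.2 k) (norm_nonneg _)
      have hlim : Tendsto (fun k => ‖(x : X → ℂ)‖ * C * totalScale (Word.steps U κ) ^ k) atTop
          (𝓝 0) := by
        simpa using (tendsto_pow_atTop_nhds_zero_of_lt_one (totalScale_pos _).le hσ).const_mul
          (‖(x : X → ℂ)‖ * C)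
      exact norm_le_zero_iff.1 (ge_of_tendsto' hlim hle)
    · exact hμ z hz1 ⟨x, hx0, x.2.1, hxz⟩
  have hχ : restrictTo X (outer Y) ∈ zeroFreq X Y := by
    refine ⟨fun s t h => ?_, fun s hs => outer_of_mem hs⟩
    rw [restrictTo, restrictTo, h, (isSym_outer hY.sym).rotate, one_mul]
  have hlim := tendsto_norm_pow_div T hlam heig ⟨_, hχ⟩
  intro s hs
  refine squeeze_zero (fun k => by positivity) (fun k => ?_) hlim
  refine div_le_div_of_nonneg_right ?_ (by positivity)
  have hk : ((T ^ k) ⟨_, hχ⟩ : zeroFreq X Y).1 = (block U κ X ^ k) (restrictTo X (outer Y)) := by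
    induction k with
    | zero => rfl
    | succ k ih => rw [pow_succ', pow_succ', Module.End.mul_apply, Module.End.mul_apply, ← ih]; rfl
  have h1 : run (repeatSteps (Word.steps U κ) k) (outer Y) s =
      ((T ^ k) ⟨_, hχ⟩ : zeroFreq X Y).1 ⟨s, hs⟩ := by
    rw [hk, block_pow_restrictTo hXd]; rfl
  rw [h1]
  exact norm_le_pi_norm _ _

end Block

/-! ### Normalized limits -/

/-- Normalization turns convergence up to positive factors into convergence. -/
theorem tendsto_normalize {E : Type*} [NormedAddCommGroup E] [NormedSpace ℝ E]
    [FiniteDimensional ℝ E] (ν : Seminorm ℝ E) (hν : ∀ x, ν x = 0 → x = 0) {g : ℕ → E}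
    {c : ℕ → ℝ} (hc : ∀ k, 0 < c k) {v : E} (hv : v ≠ 0)
    (h : Tendsto (fun k => (c k)⁻¹ • g k) atTop (𝓝 v)) :
    Tendsto (fun k => (ν (g k))⁻¹ • g k) atTop (𝓝 ((ν v)⁻¹ • v)) := by
  have hcont : Continuous ν := continuousOn_univ.1
    (ν.convexOn.continuousOn isOpen_univ)
  have h1 := ((hcont.tendsto v).comp h).inv₀ (mt (hν v) hv)
  refine (h1.smul h).congr fun k => ?_
  have hk := hc k
  rw [Function.comp_apply, map_smul_eq_mul, Real.norm_eq_abs, abs_of_pos (inv_pos.2 hk), smul_smul]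
  congr 1
  rw [mul_inv, inv_inv, mul_right_comm, mul_inv_cancel₀ hk.ne', one_mul]

section GridEigenvalue

variable [NeZero m] {U : Word} {κ : Kind} {Y : Set (Site m)}

/-- The growth rate on the core is the eigenvalue belonging to the limit of the normalized core
meshes. -/
theorem eq_of_isGridEigenvalue (hY : IsCore κ (Word.steps U κ) (core m U κ)) {lam : ℝ}
    (hlam : 0 < lam) {a : Site m → ℂ}
    (ha : ∀ s ∈ core m U κ, Tendsto (fun k => ((lam ^ k)⁻¹ •
      run (repeatSteps (Word.steps U κ) k) (gridMesh m)) s) atTop (𝓝 (a s)))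
    (ha0 : restrictTo (core m U κ) a ≠ 0) {r : ℝ} (hr : IsGridEigenvalue m U κ r) : r = lam := by
  have := hY.finite.fintype
  obtain ⟨ν, C, hν, hlim, hC0, hC⟩ := hr
  rw [IsNormalizedLimit] at hlim
  set g : ℕ → core m U κ → ℂ := fun k =>
    restrictTo (core m U κ) (run (repeatSteps (Word.steps U κ) k) (gridMesh m)) with hg
  have h1 : Tendsto (fun k => (lam ^ k)⁻¹ • g k) atTop (𝓝 (restrictTo (core m U κ) a)) :=
    tendsto_pi_nhds.2 fun s => ha s s.2
  have h2 : C = (ν (restrictTo (core m U κ) a))⁻¹ • restrictTo (core m U κ) a := by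
    refine tendsto_nhds_unique hlim ?_
    simp only [gridIterate_eq]
    exact tendsto_normalize ν hν (fun k => pow_pos hlam k) ha0 h1
  have hcont : Continuous (block U κ (core m U κ)) := LinearMap.continuous_of_finiteDimensional _
  have h3 : block U κ (core m U κ) (restrictTo (core m U κ) a) =
      (lam : ℂ) • restrictTo (core m U κ) a := by
    refine tendsto_nhds_unique ((hcont.tendsto _).comp h1) ?_
    refine (((tendsto_add_atTop_iff_nat 1).2 h1).const_smul (lam : ℂ)).congr fun k => ?_
    have e : block U κ (core m U κ) (g k) = g (k + 1) := by
      change block U κ (core m U κ) (restrictTo (core m U κ) _) =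
        restrictTo (core m U κ) (run (_ ++ _) _)
      rw [block_restrictTo hY.depClosed, run_append]
    funext s
    have e' := congrFun e s
    simp only [Function.comp_apply, Pi.smul_apply, Complex.real_smul, smul_eq_mul]
    have e2 : block U κ (core m U κ) ((lam ^ k)⁻¹ • g k) s =
        ((lam ^ k)⁻¹ : ℝ) * block U κ (core m U κ) (g k) s := by
      have : ((lam ^ k)⁻¹ • g k) = (((lam ^ k)⁻¹ : ℝ) : ℂ) • g k := by
        funext t; simp
      rw [this, map_smul]; rfl
    rw [e2, e', pow_succ]
    have hl : (lam : ℂ) ≠ 0 := by exact_mod_cast hlam.ne'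
    push_cast
    field_simp
  have h4 : block U κ (core m U κ) C = (lam : ℂ) • C := by
    have e : C = (((ν (restrictTo (core m U κ) a))⁻¹ : ℝ) : ℂ) • restrictTo (core m U κ) a := by
      rw [h2]; funext t; simp
    rw [e, map_smul, h3, smul_comm]
  have h5 : ((r : ℂ) - lam) • C = 0 := by rw [sub_smul, ← hC, ← h4, sub_self]
  have h6 := (smul_eq_zero.1 h5).resolve_right hC0
  exact_mod_cast sub_eq_zero.1 h6

end GridEigenvalue

/-! ### Convergence outside the core -/

section Convergence

variable [NeZero m] {κ : Kind} {l : List Step} {X Y : Set (Site m)}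

/-- The iterates of a net, divided by the powers of `lam`. -/
noncomputable def scaled (l : List Step) (lam : ℝ) (N : Net m) (k : ℕ) : Net m :=
  (lam ^ k)⁻¹ • run (repeatSteps l k) N

theorem run_scaled (l : List Step) (lam : ℝ) (N : Net m) (i k : ℕ) :
    (lam ^ k)⁻¹ • run (repeatSteps l k) (scaled l lam N i) = scaled l lam N (i + k) := by
  have h1 : ∀ (l' : List Step) (r : ℝ) (N : Net m), run l' (r • N) = r • run l' N :=
    fun l' r N => ((run l').restrictScalars ℝ).map_smul r N
  rw [scaled, scaled, h1, smul_smul, ← run_append, ← repeatSteps_add, pow_add, mul_inv,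
    add_comm k i, mul_comm]

/-- If the iterates converge on the core, up to the powers of `lam`, and the influence of the other
vertices decays faster, then they converge on every finite net around the core. -/
theorem Decays.exists_limit {lam : ℝ} (hD : Decays l X Y lam) (hlam : 0 < lam) (hX : X.Finite)
    (hYX : Y ⊆ X) (hXd : DepClosed l X) {N : Net m} {a : Site m → ℂ}
    (ha : ∀ s ∈ Y, Tendsto (fun k => scaled l lam N k s) atTop (𝓝 (a s))) :
    ∃ v : Site m → ℂ, ∀ s ∈ X, Tendsto (fun k => scaled l lam N k s) atTop (𝓝 (v s)) := by
  have := hX.to_subtype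
  have hY := hX.subset hYX
  have := hY.to_subtype
  have hdec : ∀ ε : ℝ, 0 < ε → ∃ k : ℕ, ∀ s ∈ X,
      ‖run (repeatSteps l k) (outer Y) s‖ / lam ^ k < ε := fun ε hε =>
    ((hX.eventually_all).2 fun s hs => (hD s hs).eventually_lt_const hε).exists
  -- a bound for `k` further steps
  have hstep : ∀ (k : ℕ) (N : Net m) {A b ε : ℝ}, 0 ≤ A → 0 ≤ b → (∀ s ∈ Y, ‖N s‖ ≤ A) →
      (∀ s ∈ X, ‖N s‖ ≤ b) →
      (∀ s ∈ X, ‖run (repeatSteps l k) (outer Y) s‖ / lam ^ k < ε) →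
      ∀ s ∈ X, ‖((lam ^ k)⁻¹ • run (repeatSteps l k) N) s‖ ≤ (lam ^ k)⁻¹ * A + b * ε := by
    intro k N A b ε hA hb hNY hNX hk s hs
    have hp : 0 < lam ^ k := pow_pos hlam k
    have h1 := norm_run_le_add (hXd.support_repeatSteps k) hA hb hNY hNX hs
    have h2 := mul_le_mul_of_nonneg_left (hk s hs).le hb
    rw [Pi.smul_apply, norm_smul, Real.norm_eq_abs, abs_of_pos (inv_pos.2 hp)]
    calc (lam ^ k)⁻¹ * ‖run (repeatSteps l k) N s‖
        ≤ (lam ^ k)⁻¹ * (A + b * ‖run (repeatSteps l k) (outer Y) s‖) :=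
          mul_le_mul_of_nonneg_left h1 (inv_pos.2 hp).le
      _ = (lam ^ k)⁻¹ * A + b * (‖run (repeatSteps l k) (outer Y) s‖ / lam ^ k) := by
          rw [div_eq_inv_mul]; ring
      _ ≤ _ := by linarith
  obtain ⟨A, hA⟩ : ∃ A, ∀ s : Y, ∀ i, ‖scaled l lam N i s‖ ≤ A := by
    refine exists_uniform (fun s a b hab H i => (H i).trans hab) fun s => ?_
    obtain ⟨A, hA⟩ := (ha s s.2).norm.bddAbove_range
    exact ⟨A, fun i => hA ⟨i, rfl⟩⟩
  -- the scaled iterates are bounded: `k` steps halve the part that comes from outside the core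
  obtain ⟨B, hB0, hB⟩ : ∃ B, 0 < B ∧ ∀ i, ∀ s ∈ X, ‖scaled l lam N i s‖ ≤ B := by
    obtain ⟨k, hk⟩ := hdec (1 / 2) (by norm_num)
    obtain ⟨B₀, hB₀⟩ := Finite.exists_le fun p : Fin k × X => ‖scaled l lam N p.1 p.2‖
    set A' := max A 0
    set B := max B₀ (max (2 * ((lam ^ k)⁻¹ * A')) 1)
    have hB1 : 0 < B := lt_max_of_lt_right (lt_max_of_lt_right one_pos)
    refine ⟨B, hB1, fun i => ?_⟩
    induction i using Nat.strong_induction_on with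
    | _ i ih =>
      intro s hs
      rcases lt_or_ge i k with hi | hi
      · exact (hB₀ (⟨i, hi⟩, ⟨s, hs⟩)).trans (le_max_left _ _)
      · obtain ⟨j, rfl⟩ := Nat.exists_eq_add_of_le' hi
        have hb2 : 2 * ((lam ^ k)⁻¹ * A') ≤ B := (le_max_left _ _).trans (le_max_right _ _)
        rcases Nat.eq_zero_or_pos k with rfl | hk0
        · -- every vertex belongs to the core
          have hsY : s ∈ Y := by
            by_contra hsY
            have := hk s hs
            simp [repeatSteps, outer_of_notMem hsY] at this
            norm_num at this
          have h1 := hA ⟨s, hsY⟩ (j + 0)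
          have h2 : A ≤ A' := le_max_left _ _
          have h3 : 0 ≤ A' := le_max_right _ _
          simp only [pow_zero, inv_one, one_mul] at hb2
          simp only at h1
          linarith
        · rw [← run_scaled]
          refine (hstep k _ (le_max_right A 0) hB1.le
            (fun t ht => (hA ⟨t, ht⟩ j).trans (le_max_left _ _)) (ih j (by omega)) hk s hs).trans ?_
          linarith
  -- Cauchy's criterion: after `k` further steps, differences depend on the core only, up to `ε / 4`
  have hlim : ∀ s : X, ∃ z, Tendsto (fun k => scaled l lam N k s) atTop (𝓝 z) := by
    intro s
    refine cauchySeq_tendsto_of_complete (Metric.cauchySeq_iff'.2 fun ε hε => ?_)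
    obtain ⟨k, hk⟩ := hdec (ε / (8 * B)) (by positivity)
    have hp : 0 < lam ^ k := pow_pos hlam k
    obtain ⟨i, hi⟩ := eventually_atTop.1 ((hY.eventually_all).2 fun s hs =>
      (ha s hs).eventually (Metric.ball_mem_nhds (a s) (show 0 < lam ^ k * ε / 8 by positivity)))
    refine ⟨i + k, fun n hn => ?_⟩
    obtain ⟨p, rfl⟩ := Nat.exists_eq_add_of_le hn
    rw [dist_eq_norm, show i + k + p = i + p + k by ring,
      ← run_scaled l lam N (i + p) k, ← run_scaled l lam N i k]
    have h1 := hstep k (scaled l lam N (i + p) - scaled l lam N i) (A := lam ^ k * ε / 4)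
      (b := 2 * B) (by positivity) (by positivity) (fun t ht => ?_) (fun t ht => ?_) hk s s.2
    · have e : ((lam ^ k)⁻¹ • run (repeatSteps l k) (scaled l lam N (i + p) - scaled l lam N i)) s =
          ((lam ^ k)⁻¹ • run (repeatSteps l k) (scaled l lam N (i + p))) s -
          ((lam ^ k)⁻¹ • run (repeatSteps l k) (scaled l lam N i)) s := by
        rw [map_sub, smul_sub, Pi.sub_apply]
      rw [e] at h1
      refine h1.trans_lt ?_
      have e1 : (lam ^ k)⁻¹ * (lam ^ k * ε / 4) = ε / 4 := by field_simp
      have e2 : 2 * B * (ε / (8 * B)) = ε / 4 := by field_simp; norm_num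
      rw [e1, e2]
      linarith
    · have h2 := hi (i + p) (by omega) t ht
      have h3 := hi i le_rfl t ht
      rw [Pi.sub_apply, ← dist_eq_norm]
      have := dist_triangle_right (scaled l lam N (i + p) t) (scaled l lam N i t) (a t)
      linarith
    · rw [Pi.sub_apply]
      have := norm_sub_le (scaled l lam N (i + p) t) (scaled l lam N i t)
      have := hB (i + p) t ht
      have := hB i t ht
      linarith
  choose! v hv using fun s (hs : s ∈ X) => hlim ⟨s, hs⟩
  exact ⟨v, hv⟩

end Convergence

/-! ### The edges of the limit -/

theorem isClosed_edgeCone {ω : ℂ} (hω : ω.re ≠ 0) : IsClosed (edgeCone ω) := by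
  have e : edgeCone ω = {z | 0 ≤ z.re / ω.re ∧ 0 ≤ z.im - z.re / ω.re * ω.im} := by
    ext z
    constructor
    · rintro ⟨a, b, ha, hb, rfl⟩
      have : ((a : ℂ) * ω + b * Complex.I).re / ω.re = a := by simp [hω]
      rw [Set.mem_ofPred_eq, this]
      simpa using ⟨ha, hb⟩
    · rintro ⟨ha, hb⟩
      refine ⟨_, _, ha, hb, Complex.ext ?_ ?_⟩
      · simp [hω]
      · simp
  rw [e]
  have h1 : Continuous fun z : ℂ => z.re / ω.re := Complex.continuous_re.div_const _
  exact (isClosed_le continuous_const h1).inter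
    (isClosed_le continuous_const (Complex.continuous_im.sub (h1.mul_const _)))

/-- The points of the closed cone between the directions `e ^ (i φ)` and `i` that lie in the upper
half-plane have a direction between `φ` and `π / 2`. -/
theorem mem_cone_of_mem_edgeCone {φ : ℝ} (h0 : 0 < φ) (hφ : φ < Real.pi)
    (hc : Real.cos φ ≠ 0) {ω z : ℂ} (hre : ω.re = Real.cos φ) (him : ω.im = Real.sin φ)
    (hz : z ∈ edgeCone ω) (hz0 : 0 < z.im) : z ∈ cone φ (Real.pi / 2) := by
  obtain ⟨a, b, ha, hb, hab⟩ := hz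
  have hne : z ≠ 0 := by rintro rfl; simp at hz0
  have hr : 0 < ‖z‖ := norm_pos_iff.2 hne
  have hθ0 : 0 < Complex.arg z := by
    rcases (Complex.arg_nonneg_iff.2 hz0.le).eq_or_lt with h | h
    · exact absurd (Complex.arg_eq_zero_iff.1 h.symm).2 hz0.ne'
    · exact h
  have hθπ : Complex.arg z < Real.pi :=
    Complex.arg_lt_pi_iff.2 (Or.inr hz0.ne')
  have hcos : ‖z‖ * Real.cos (Complex.arg z) = a * Real.cos φ := by
    rw [Complex.norm_mul_cos_arg, hab, ← hre]; simp
  have hsin : ‖z‖ * Real.sin (Complex.arg z - φ) = b * Real.cos φ := by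
    rw [Real.sin_sub, mul_sub, ← mul_assoc, ← mul_assoc, hcos, Complex.norm_mul_sin_arg, hab]
    simp only [Complex.add_im, Complex.mul_im, Complex.ofReal_re, Complex.ofReal_im,
      Complex.I_im, Complex.I_re, him]
    ring
  refine ⟨‖z‖, hr, Complex.arg z, ?_, (Complex.norm_mul_exp_arg_mul_I z).symm⟩
  rcases hc.lt_or_gt with hc | hc
  · have h1 : Real.pi / 2 < φ := by
      by_contra h
      exact absurd hc (not_lt.2 (Real.cos_nonneg_of_neg_pi_div_two_le_of_le (by linarith)
        (not_lt.1 h)))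
    rw [min_eq_right h1.le, max_eq_left h1.le]
    constructor
    · by_contra h
      have h2 := Real.cos_pos_of_mem_Ioo (x := Complex.arg z) ⟨by linarith, not_le.1 h⟩
      nlinarith [mul_pos hr h2]
    · by_contra h
      have h2 := Real.sin_pos_of_pos_of_lt_pi (x := Complex.arg z - φ)
        (by linarith [not_le.1 h]) (by linarith)
      nlinarith [mul_pos hr h2]
  · have h1 : φ < Real.pi / 2 := by
      by_contra h
      exact absurd hc (not_lt.2 (Real.cos_nonpos_of_pi_div_two_le_of_le (not_lt.1 h)
        (by linarith)))
    rw [min_eq_left h1.le, max_eq_right h1.le]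
    constructor
    · by_contra h
      have h2 := Real.sin_neg_of_neg_of_neg_pi_lt (x := Complex.arg z - φ)
        (by linarith [not_le.1 h]) (by linarith)
      nlinarith [mul_neg_of_pos_of_neg hr h2, mul_nonneg hb hc.le]
    · by_contra h
      have h2 := Real.cos_neg_of_pi_div_two_lt_of_lt (x := Complex.arg z) (not_le.1 h)
        (by linarith)
      nlinarith [mul_neg_of_pos_of_neg hr h2, mul_nonneg ha hc.le]

section Limit

variable [NeZero m] {κ : Kind} {l : List Step} {X Y : Set (Site m)}

omit [NeZero m] in
/-- The edge next to the centre is non-zero in the limit. -/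
theorem exists_tendsto_centralEdge (hm : 3 ≤ m) (hκ : κ.Straight) {η : ℕ → Net m}
    (hη : ∀ k, IsSym (spokeDir m) (η k)) {z : ℂ}
    (hz : Tendsto (fun k => quad (η k) (centralRep κ).1 (centralRep κ).2) atTop (𝓝 z))
    (hpos : ∀ j, 0 < wedgeForm (diagDir m) j z) :
    ∃ e : ℂ, 0 < e.im ∧
      Tendsto (fun k => edge (η k) (centralEdge κ).1 (centralEdge κ).2) atTop (𝓝 e) := by
  have h := bisects hm
  have hconj : Continuous (starRingEnd ℂ) := Complex.continuous_conj
  obtain ⟨hu, hv, -, -⟩ := wedge_bounds h.half_le h.re_le_one (hpos 0).le (hpos 1).le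
  simp only [Complex.reLm_coe] at hu
  have hg0 := hpos 0
  have hg1 := hpos 1
  rw [wedgeForm_zero_apply] at hg0
  rw [wedgeForm_one_apply] at hg1
  have c1 := h.half_le
  rcases hκ with rfl | rfl
  · refine ⟨spokeDir m * (starRingEnd ℂ) z, ?_, ?_⟩
    · have him : z.im = 0 := tendsto_nhds_unique ((Complex.continuous_im.tendsto _).comp hz)
        (tendsto_const_nhds.congr fun k => ((hη k).quad_axis (by norm_num [centralRep])).symm)
      have hre : 0 < z.re := by nlinarith
      have := mul_pos (spokeDir_im_pos hm) hre
      simpa [him] using this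
    · refine (((hconj.tendsto z).comp hz).const_mul (spokeDir m)).congr fun k => ?_
      have h2 : edge (η k) 0 2 = quad (η k) 0 2 := by
        rw [edge, sub_self, quad_zero_zero, (hη k).center h.ne_one, sub_zero]
      rw [centralEdge, h2, (hη k).quad_swap le_rfl (by norm_num)]
      · rfl
      · simp
  · refine ⟨z - (starRingEnd ℂ) z, ?_, ?_⟩
    · have hsym : z = spokeDir m * (starRingEnd ℂ) z := by
        refine tendsto_nhds_unique hz ((((hconj.tendsto z).comp hz).const_mul (spokeDir m)).congr
          fun k => ?_)
        exact ((hη k).quad_swap (by norm_num [centralRep]) (by norm_num [centralRep])).symm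
      have hre := h.re_swap z
      rw [← hsym] at hre
      have hsp : spoke (diagDir m) z = (diagDir m).re * z.re + (diagDir m).im * z.im := by
        simp [spoke_apply]
      have hS : 0 < (diagDir m).im := by
        rw [diagDir, Complex.exp_ofReal_mul_I_im]
        have hm0 : (1 : ℝ) < m := by exact_mod_cast (by omega : 1 < m)
        exact Real.sin_pos_of_pos_of_lt_pi (by positivity)
          (div_lt_self Real.pi_pos hm0)
      have hv0 : 0 < spoke (diagDir m) z := by nlinarith
      have hnorm := h.norm
      -- the component orthogonal to the spoke has the sign of that along the diagonal
      have him : (diagDir m).im * z.im = (diagDir m).im ^ 2 * spoke (diagDir m) z := by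
        nlinarith
      have him' : 0 < z.im := by
        refine pos_of_mul_pos_right (b := z.im) ?_ hS.le
        rw [him]; positivity
      simpa using him'
    · exact (hz.sub ((hconj.tendsto z).comp hz)).congr fun k =>
        ((hη k).edge_one zero_le_one).symm

/-- All edges of the limit are non-zero and lie in the cone. -/
theorem IsCore.edge_limit_mem_cone (hY : IsCore κ l Y) (hm : 3 ≤ m)
    (hcos : Real.cos (2 * Real.pi / m) ≠ 0) {lam : ℝ} (hlam : 0 < lam) {z : ℂ}
    (hz : Tendsto (fun k => quad (scaled l lam (gridMesh m) k) (centralRep κ).1 (centralRep κ).2)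
      atTop (𝓝 z)) (hpos : ∀ j, 0 < wedgeForm (diagDir m) j z) {q : ℤ × ℤ} (hq : κ.IsEdge q)
    {w : ℂ} (hw : Tendsto (fun k => edge (scaled l lam (gridMesh m) k) q.1 q.2) atTop (𝓝 w)) :
    w ∈ cone (2 * Real.pi / m) (Real.pi / 2) := by
  have h := bisects hm
  have hM := isSym_gridMesh hm
  have hη : ∀ k, IsSym (spokeDir m) (scaled l lam (gridMesh m) k) := fun k => (hM.run _).smul _
  have hadm := adm_edgeCone h.mul_conj (spokeDir_im_pos hm)
  have hedges : ∀ k, HasEdges (edgeCone (spokeDir m)) κ (scaled l lam (gridMesh m) k) := by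
    intro k x y hx hy hp
    have h1 := hadm.hasEdges_run hm h.mul_conj hM (hY.chain.repeatSteps k)
      (hasEdges_gridMesh hm κ) x y hx hy hp
    have hs := totalScale_pos (repeatSteps l k)
    have h2 := edgeCone_smul h1 (r := (lam ^ k)⁻¹ * totalScale (repeatSteps l k)) (by positivity)
    rw [edge_smul, ← mul_assoc, ← Complex.ofReal_mul, mul_assoc, mul_inv_cancel₀ hs.ne',
      mul_one] at h2
    rwa [scaled, edge_smul]
  obtain ⟨e, he, hlim⟩ := exists_tendsto_centralEdge hm hY.straight hη hz hpos
  obtain ⟨n, hn⟩ := edgePath_eq_central hY.straight hY.chain hY.gain hq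
  obtain ⟨K, hK, H⟩ := hadm.exists_le_edge hm h.mul_conj (hY.chain.repeatSteps n) hq
  -- the edge `q` of the iterate `k + n` depends on the central edge of the iterate `k`
  have hle : (lam ^ n)⁻¹ * (K * e.im) ≤ w.im := by
    refine le_of_tendsto_of_tendsto'
      ((((Complex.continuous_im.tendsto _).comp hlim).const_mul K).const_mul (lam ^ n)⁻¹)
      ((tendsto_add_atTop_iff_nat n).2 ((Complex.continuous_im.tendsto _).comp hw)) fun k => ?_
    have h1 := H _ (hη k) (hedges k)
    rw [hn] at h1
    have h2 := mul_le_mul_of_nonneg_left h1 (inv_pos.2 (pow_pos hlam n)).le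
    refine h2.trans (le_of_eq ?_)
    simp only [Function.comp_apply]
    rw [← run_scaled, edge_smul, Complex.im_ofReal_mul]
    rfl
  have hw0 : 0 < w.im := lt_of_lt_of_le (by positivity) hle
  have hmem : w ∈ edgeCone (spokeDir m) :=
    (isClosed_edgeCone (by rwa [spokeDir_re])).mem_of_tendsto hw
      (Eventually.of_forall fun k => hedges k _ _ hq.1 hq.2.1 hq.2.2)
  have hm0 : (3 : ℝ) ≤ m := by exact_mod_cast hm
  refine mem_cone_of_mem_edgeCone (by positivity) ?_ hcos (spokeDir_re m) (spokeDir_im m) hmem hw0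
  rw [div_lt_iff₀ (by linarith)]
  nlinarith [Real.pi_pos]

end Limit

section Scheme

variable [NeZero m] {U : Word} {κ : Kind}

/-- The two directions that bound the cone differ: only for valence `4` is the second spoke
vertical. -/
theorem cos_ne_zero_of_valence (hm : 5 ≤ m ∨ m = 3) : Real.cos (2 * Real.pi / m) ≠ 0 := by
  rcases hm with h5 | rfl
  · rw [← spokeDir_re]
    exact (spokeDir_re_pos h5).ne'
  · have e : 2 * Real.pi / ((3 : ℕ) : ℝ) = Real.pi - Real.pi / 3 := by push_cast; ring
    rw [e, Real.cos_pi_sub, Real.cos_pi_div_three]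
    norm_num

/-- On `c.ρ`-nets, the iterates of the grid mesh converge up to the powers of a number. -/
theorem exists_limit_coreNet (hU : IsVAVScheme U) (hout : Word.out U κ = κ) (ρ : ℕ)
    (hm : 5 ≤ m ∨ (m = 3 ∧ EigenvalueInequality m U κ ρ)) :
    ∃ lam : ℝ, 0 < lam ∧ ∃ v : Site m → ℂ,
      (∀ s ∈ coreNet m U κ ρ, Tendsto
        (fun k => scaled (Word.steps U κ) lam (gridMesh m) k s) atTop (𝓝 (v s))) ∧
      ∀ j, 0 < wedgeForm (diagDir m) j (v (Site.mk 0 (centralRep κ).1 (centralRep κ).2)) := by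
  have hm3 : 3 ≤ m := by omega
  have hY := isCore_core (m := m) hU hout
  have hσ := totalScale_lt_one U κ hU.2
  have hX : (coreNet m U κ ρ).Finite :=
    coreNet_induction hY.finite (fun X => finite_addRing) ρ
  have hXd : DepClosed (Word.steps U κ) (coreNet m U κ ρ) :=
    coreNet_induction hY.depClosed (fun X => DepClosed.addRing hY.chain) ρ
  have hXs : SymSet (coreNet m U κ ρ) := coreNet_induction hY.sym (fun X => SymSet.addRing) ρ
  have hv : ∀ s ∈ coreNet m U κ ρ, IsVertex κ s := fun s => isVertex_coreNet
  obtain ⟨lam, hlam, a, ha, hpos, hlt⟩ := hY.exists_limit hm3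
  have hD : Decays (Word.steps U κ) (coreNet m U κ ρ) (core m U κ) lam := by
    rcases hm with h5 | ⟨-, r, hr, hmax⟩
    · exact hY.decays_of_totalScale_lt hm3 hX hv (hlt (spokeDir_re_pos h5))
    · have ha0 : restrictTo (core m U κ) a ≠ 0 := by
        intro h
        have h1 := congrFun h ⟨_, hY.central⟩
        have h2 := hpos 0
        rw [restrictTo] at h1
        simp only at h1
        rw [h1] at h2
        simp at h2
      rw [eq_of_isGridEigenvalue hY hlam ha ha0 hr] at hmax
      refine hY.decays_of_eigenvalues hm3 hσ hX hv hXd hXs hlam fun z hz1 hz => ?_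
      have h1 : ENNReal.ofReal ‖z‖ ≤ absMuZero m U κ ρ :=
        le_iSup₂ (f := fun (z : ℂ) _ => ENNReal.ofReal ‖z‖) z ⟨hz1, hz⟩
      exact (ENNReal.ofReal_lt_ofReal_iff hlam).1 ((h1.trans (le_max_left _ _)).trans_lt hmax)
  obtain ⟨v, hlim⟩ := hD.exists_limit hlam hX (core_subset_coreNet ρ) hXd ha
  refine ⟨lam, hlam, v, hlim, fun j => ?_⟩
  rw [tendsto_nhds_unique (hlim _ (core_subset_coreNet ρ hY.central)) (ha _ hY.central)]
  exact hpos j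

theorem smul_mem_cone {α β r : ℝ} (hr : 0 < r) {z : ℂ} (h : z ∈ cone α β) :
    (r : ℂ) * z ∈ cone α β := by
  obtain ⟨q, hq, θ, hθ, rfl⟩ := h
  exact ⟨r * q, mul_pos hr hq, θ, hθ, by push_cast; ring⟩

end Scheme

end MidpointSubdivision

theorem mainTheorem7 (m : ℕ) [NeZero m] (U : MidpointSubdivision.Word)
    (hU : MidpointSubdivision.IsVAVScheme U)
    (κ : MidpointSubdivision.Kind) (hκ : MidpointSubdivision.Word.out U κ = κ) (ρ : ℕ)
    (hm : 5 ≤ m ∨ (m = 3 ∧ MidpointSubdivision.EigenvalueInequality m U κ ρ))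
    (ν : Seminorm ℝ (MidpointSubdivision.coreNet m U κ ρ → ℂ))
    (hν : ∀ x, ν x = 0 → x = 0) :
    ∃ C : MidpointSubdivision.coreNet m U κ ρ → ℂ,
      MidpointSubdivision.IsCharacteristicMesh U κ ρ ν C ∧
      MidpointSubdivision.nablaTwo κ (MidpointSubdivision.coreNet m U κ ρ) C ⊆
        MidpointSubdivision.cone (2 * Real.pi / m) (Real.pi / 2) := by
  have hY := MidpointSubdivision.isCore_core (m := m) hU hκ
  have hfin : (MidpointSubdivision.coreNet m U κ ρ).Finite :=
    MidpointSubdivision.coreNet_induction hY.finite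
      (fun X => MidpointSubdivision.finite_addRing) ρ
  have := hfin.fintype
  have hc := MidpointSubdivision.core_subset_coreNet ρ hY.central
  obtain ⟨lam, hlam, v, hlim, hpos⟩ := MidpointSubdivision.exists_limit_coreNet hU hκ ρ hm
  set w := MidpointSubdivision.restrictTo (MidpointSubdivision.coreNet m U κ ρ) v with hw
  have hw0 : w ≠ 0 := by
    intro h
    have h1 : v _ = 0 := congrFun h ⟨_, hc⟩
    simpa [h1] using hpos 0
  have hν0 : 0 < ν w := lt_of_le_of_ne (apply_nonneg ν w) fun h => hw0 (hν w h.symm)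
  refine ⟨(ν w)⁻¹ • w, ?_, ?_⟩
  · rw [MidpointSubdivision.IsCharacteristicMesh, MidpointSubdivision.IsNormalizedLimit]
    simp only [MidpointSubdivision.gridIterate_eq]
    exact MidpointSubdivision.tendsto_normalize ν hν (fun k => pow_pos hlam k) hw0
      (tendsto_pi_nhds.2 fun s => hlim s s.2)
  · rintro z ⟨x, y, hx, hy, hvert, hp, hq, rfl⟩
    have hedge : v (MidpointSubdivision.Site.mk 0 x y) - v (MidpointSubdivision.Site.mk 0 x (y - 2))
        ∈ MidpointSubdivision.cone (2 * Real.pi / m) (Real.pi / 2) :=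
      hY.edge_limit_mem_cone (by omega)
        (MidpointSubdivision.cos_ne_zero_of_valence (hm.imp_right And.left)) hlam (hlim _ hc) hpos
        (q := (x, y)) ⟨hx, hy, (MidpointSubdivision.isVertex_mk κ 0 hx y).1 hvert⟩
        ((hlim _ hp).sub (hlim _ hq))
    have := MidpointSubdivision.smul_mem_cone (inv_pos.2 hν0) hedge
    rw [mul_sub] at this
    simpa [hw, MidpointSubdivision.restrictTo] using this
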